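/- **Notation.** Let $K$ be a number field with adele ring $\mathbb A$, let $\psi=\otimes_v\psi_v$ be a nontrivial continuous unitary character of $K\backslash\mathbb A$, and for each place $v$ let $|\cdot|_v$ be the normalized absolute value of $K_v$. Let $G$ be the split group of type $G_2$, realized as the automorphism group of the split octonions, with simple roots $\alpha$ (short) and $\beta$ (long) and root subgroups $x_\gamma$. Let $H=\mathrm{Spin}_8$, realized as the group of triples $(t_1,t_2,t_3)$ of isometries of the octonion norm with $t_1(xy)=t_2(x)t_3(y)$, with simple roots $\alpha_1,\dots,\alpha_4$, $\alpha_2$ being the central node of the Dynkin diagram, and root subgroups $x_{\pm\alpha_i}$. The group $G\subset H$ (embedded by $g\mapsto(g,g,g)$) is the centralizer of the triality automorphisms. Let $P_H\subset H$ be the Heisenberg maximal parabolic subgroup (the stabilizer of an isotropic plane in the $8$-dimensional vector representation); its modulus character is $\delta_{P_H}=|\det|^5$, where $\det$ is the determinant of the action on this plane. Let $P=P_H\cap G$, let $U$ be the unipotent radical of $P$, with elements $u(r_1,\dots,r_5)=x_\beta(r_1)x_{\alpha+\beta}(r_2)x_{2\alpha+\beta}(r_3)x_{3\alpha+\beta}(r_4)x_{3\alpha+2\beta}(r_5)$,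 and let $\Psi(u(r_1,\dots,r_5))=\psi(r_2+r_3)$ be the split character of $U(K)\backslash U(\mathbb A)$; $\Psi_v$ denotes the same character of $U(K_v)$ built from $\psi_v$. Let $\mu=w_2w_3x_{-\alpha_1}(1)\in H$, where $w_i=x_{\alpha_i}(1)x_{-\alpha_i}(-1)x_{\alpha_i}(1)$, and let $U^\mu=U\cap\mu^{-1}P_H\mu$. A smooth cusp form is a left $G(K)$-invariant function on $G(\mathbb A)$ which is smooth (at the archimedean places, and right invariant under an open subgroup at the finite places), of uniformly moderate growth, and whose constant terms along the unipotent radicals of the two maximal parabolic subgroups vanish. Let $\pi$ be an irreducible cuspidal representation of $G(\mathbb A)$, realized on the space of smooth vectors: a nonzero space of smooth cusp forms which is stable under right translation and closed for the $L^2$-norm of $G(K)\backslash G(\mathbb A)$ (among smooth cusp forms), and minimal among the nonzero spaces of this kind. For $\varphi\in\pi$ put $$L_\Psi(\varphi)(g)=\int_{U(K)\backslash U(\mathbb A)}\varphi(ug)\overline{\Psi(u)}\,du ,$$ and assume that $\pi$ supports the split Fourier coefficient: $L_\Psi(\varphi)\not\equiv0$ for some $\varphi\in\pi$. For a finite set $S$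 of places containing the archimedean ones let $K_S=\prod_{v\in S}K_v$, $G_S=\prod_{v\in S}G(K_v)\subset G(\mathbb A)$ and $U_S=\prod_{v\in S}U(K_v)$, and let $\psi_S=\prod_{v\in S}\psi_v$. Say that $\varphi$ is *spherical outside* $S$ if it is right $G(\mathcal O_v)$-invariant for all $v\notin S$ (jointly). Let $\zeta_v(s)$ be the local zeta factor: $(1-q_v^{-s})^{-1}$ at finite $v$, $\Gamma_{\mathbb R}(s)=\pi^{-s/2}\Gamma(s/2)$ at real $v$, and $\Gamma_{\mathbb C}(s)=2(2\pi)^{-s}\Gamma(s)$ at complex $v$. Put $j_v(s)=\zeta_v(5s)\zeta_v(5s-1)^2\zeta_v(10s-4)$ and $j_S=\prod_{v\in S}j_v$. A *section* at $v\in S$ is a family $f_v(\cdot,s)$, $s\in\mathbb C$, of smooth functions on $H(K_v)$ with $f_v(ph,s)=\delta_{P_H}(p)^sf_v(h,s)$ for $p\in P_H(K_v)$, such that: if $v$ is finite, it is a standard section, i.e. its restriction to $H(\mathcal O_v)$ does not depend on $s$; if $v$ is archimedean, for each $h$ there are $c\in\mathbb C$ and $b\in\mathbb R$ such that $f_v(h,s)=c\,e^{bs}$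 for all $s$. For sections $f_S=(f_v)_{v\in S}$ and $g=(g_v)\in G_S$ put $f_S(\mu g,s)=\prod_{v\in S}f_v(\mu g_v,s)$, $$F^*(g,s)=j_S(s)\int_{K_S}f_S(\mu x_{\alpha+\beta}(r)g,s)\,\psi_S(r)\,dr,\qquad d_S(s,\varphi,f_S)=\int_{U_S\backslash G_S}L_\Psi(\varphi)(g)\,F^*(g,s)\,dg .$$ All quotient measures are nonzero invariant Radon measures, and $dr$ is a Haar measure. **Theorem (Ramified Computation).** (i) There is a finite set $S_0$ of places, containing the archimedean ones, such that for every finite set of places $S\supseteq S_0$ there is $\varphi\in\pi$, spherical outside $S$, with $L_\Psi(\varphi)\not\equiv0$ on $G_S$. (ii) Let $S$ be any finite set of places containing the archimedean ones, and let $\varphi_0\in\pi$ be spherical outside $S$ with $L_\Psi(\varphi_0)\not\equiv0$ on $G_S$. Then for every $s_0\in\mathbb C$ there exist, for each $v\in S$, a finite linear combination $a_v$ of elements of $G(K_v)$ and a section $f_v$ such that for $\varphi=(\otimes_{v\in S}a_v)\varphi_0$ (action by right translation): $\varphi$ belongs to $\pi$ and is spherical outside $S$; the integrals over $K_S$ in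 $F^*(g,s)$ converge absolutely for all $g\in G_S$ and $s\in\mathbb C$; the integral defining $d_S(s,\varphi,f_S)$ converges absolutely for all $s\in\mathbb C$ (the value of $F^*$ at a pole of $j_S$ being irrelevant); and $d_S(s,\varphi,f_S)$ is holomorphic and nonvanishing in a neighbourhood of $s_0$, i.e. on a punctured neighbourhood of $s_0$ it equals a function $D$ that is analytic at $s_0$ with $D(s_0)\neq0$. (iii) Let $v$ be a finite place, let $(\rho,E)$ be a smooth complex representation of $G(K_v)$ and fix a nonzero invariant Radon measure on $U^\mu(K_v)\backslash G(K_v)$. For each $x_0\in E$ there exist $x\in E$ and a standard section $f$ at $v$ such that for every $l\in\mathrm{Hom}_{U(K_v)}(\rho,\mathbb C_{\Psi_v})$ one has $l(x)=l(x_0)$ and, for every $s\in\mathbb C$, $$\int_{U^\mu(K_v)\backslash G(K_v)}l(\rho(g)x)\,f(\mu g,s)\,dg=l(x),$$ the integral converging absolutely. -/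

import Mathlib

open scoped Matrix
open NumberField IsDedekindDomain MeasureTheory Topology

noncomputable section

namespace G2Zeta

/-! ## Split octonions, the split group of type `G₂` and the group `Spin₈` -/

/-- The multiplication of the split octonions (Zorn vector matrices) in coordinates
`(a, u₁, u₂, u₃, v₁, v₂, v₃, b)`:
`(a,u,v,b)(a',u',v',b') = (aa' + u·v', au' + b'u - v×v', a'v + bv' + u×u', bb' + v·u')`. -/
def octMul {R : Type*} [CommRing R] (x y : Fin 8 → R) : Fin 8 → R :=
  ![x 0 * y 0 + (x 1 * y 4 + x 2 * y 5 + x 3 * y 6),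
    x 0 * y 1 + y 7 * x 1 - (x 5 * y 6 - x 6 * y 5),
    x 0 * y 2 + y 7 * x 2 - (x 6 * y 4 - x 4 * y 6),
    x 0 * y 3 + y 7 * x 3 - (x 4 * y 5 - x 5 * y 4),
    y 0 * x 4 + x 7 * y 4 + (x 2 * y 3 - x 3 * y 2),
    y 0 * x 5 + x 7 * y 5 + (x 3 * y 1 - x 1 * y 3),
    y 0 * x 6 + x 7 * y 6 + (x 1 * y 2 - x 2 * y 1),
    x 7 * y 7 + (x 4 * y 1 + x 5 * y 2 + x 6 * y 3)]

/-- The norm form `ab - u·v` of the split octonions. -/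
def octNorm {R : Type*} [CommRing R] (x : Fin 8 → R) : R :=
  x 0 * x 7 - x 1 * x 4 - x 2 * x 5 - x 3 * x 6

theorem octNorm_octMul {R : Type*} [CommRing R] (x y : Fin 8 → R) :
    octNorm (octMul x y) = octNorm x * octNorm y := by
  simp [octNorm, octMul]; ring

/-- The Gram matrix of the polar form of the norm. -/
def octGram (R : Type*) [CommRing R] : Matrix (Fin 8) (Fin 8) R :=
  !![0, 0, 0, 0, 0, 0, 0, 1;
     0, 0, 0, 0, -1, 0, 0, 0;
     0, 0, 0, 0, 0, -1, 0, 0;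
     0, 0, 0, 0, 0, 0, -1, 0;
     0, -1, 0, 0, 0, 0, 0, 0;
     0, 0, -1, 0, 0, 0, 0, 0;
     0, 0, 0, -1, 0, 0, 0, 0;
     1, 0, 0, 0, 0, 0, 0, 0]

theorem octGram_polar {R : Type*} [CommRing R] (x y : Fin 8 → R) :
    x ⬝ᵥ (octGram R *ᵥ y) = octNorm (x + y) - octNorm x - octNorm y := by
  simp [octNorm, octGram, dotProduct, Matrix.mulVec, Fin.sum_univ_succ]; ring

theorem octGram_mul_self (R : Type*) [CommRing R] : octGram R * octGram R = 1 := by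
  ext i j
  fin_cases i <;> fin_cases j <;>
    simp [octGram, Matrix.mul_apply, Fin.sum_univ_succ]

theorem octGram_map {R R' : Type*} [CommRing R] [CommRing R'] (φ : R →+* R') :
    (octGram R).map φ = octGram R' := by
  ext i j
  fin_cases i <;> fin_cases j <;> simp [octGram]

/-- `A(xy) = B(x) C(y)` for all octonions `x`, `y`. -/
def IsRelated {R : Type*} [CommRing R] (A B C : Matrix (Fin 8) (Fin 8) R) : Prop :=
  ∀ x y : Fin 8 → R, A *ᵥ octMul x y = octMul (B *ᵥ x) (C *ᵥ y)

/-- The octonion multiplication as a bilinear map. -/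
def octBilin (R : Type*) [CommRing R] : (Fin 8 → R) →ₗ[R] (Fin 8 → R) →ₗ[R] (Fin 8 → R) :=
  LinearMap.mk₂ R octMul
    (by intro x x' y; ext i; fin_cases i <;> simp [octMul] <;> ring)
    (by intro c x y; ext i; fin_cases i <;> simp [octMul] <;> ring)
    (by intro x y y'; ext i; fin_cases i <;> simp [octMul] <;> ring)
    (by intro c x y; ext i; fin_cases i <;> simp [octMul] <;> ring)

theorem isRelated_iff {R : Type*} [CommRing R] (A B C : Matrix (Fin 8) (Fin 8) R) :
    IsRelated A B C ↔ ∀ i j, A *ᵥ octMul (Pi.single i 1) (Pi.single j 1) =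
      octMul (B.col i) (C.col j) := by
  constructor
  · intro h i j
    rw [h]; simp
  · intro h
    have : (octBilin R).compr₂ (Matrix.mulVecLin A) =
        (octBilin R).compl₁₂ (Matrix.mulVecLin B) (Matrix.mulVecLin C) := by
      refine LinearMap.ext_basis (Pi.basisFun R (Fin 8)) (Pi.basisFun R (Fin 8)) ?_
      intro i j
      simpa [octBilin, Pi.basisFun_apply] using h i j
    intro x y
    exact congrArg (fun f => f x y) this

theorem octMul_map {R R' : Type*} [CommRing R] [CommRing R'] (φ : R →+* R') (x y : Fin 8 → R) :
    φ ∘ octMul x y = octMul (φ ∘ x) (φ ∘ y) := by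
  ext i; fin_cases i <;> simp [octMul]

theorem IsRelated.map {R R' : Type*} [CommRing R] [CommRing R'] (φ : R →+* R')
    {A B C : Matrix (Fin 8) (Fin 8) R} (h : IsRelated A B C) :
    IsRelated (A.map φ) (B.map φ) (C.map φ) := by
  rw [isRelated_iff] at h ⊢
  intro i j
  have e : ∀ i : Fin 8, (Pi.single i 1 : Fin 8 → R') = φ ∘ (Pi.single i 1 : Fin 8 → R) := by
    intro i; ext k; by_cases hk : k = i
    · subst hk; simp
    · simp [Pi.single_eq_of_ne hk]
  have h1 := congrArg (fun v => φ ∘ v) (h i j)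
  simp only [octMul_map] at h1
  rw [e i, e j, ← octMul_map]
  have h2 : (A.map φ) *ᵥ (φ ∘ octMul (Pi.single i 1) (Pi.single j 1)) =
      φ ∘ (A *ᵥ octMul (Pi.single i 1) (Pi.single j 1)) := by
    ext k; simp [Matrix.mulVec, dotProduct]
  rw [h2, h1]
  rfl

/-- `A` is an isometry of the norm form. -/
def IsIsom {R : Type*} [CommRing R] (A : Matrix (Fin 8) (Fin 8) R) : Prop :=
  Aᵀ * octGram R * A = octGram R

theorem isIsom_of {R : Type*} [CommRing R] {A : Matrix (Fin 8) (Fin 8) R}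
    (h : ∀ x y : Fin 8 → R, (A *ᵥ x) ⬝ᵥ (octGram R *ᵥ (A *ᵥ y)) = x ⬝ᵥ (octGram R *ᵥ y)) :
    IsIsom A := by
  refine Matrix.ext_of_mulVec_single fun j => ?_
  refine dotProduct_eq _ _ fun x => ?_
  rw [dotProduct_comm, dotProduct_comm _ x, ← h x, ← Matrix.mulVec_mulVec, ← Matrix.mulVec_mulVec,
    Matrix.dotProduct_mulVec, Matrix.vecMul_transpose]

theorem IsIsom.map {R R' : Type*} [CommRing R] [CommRing R'] (φ : R →+* R')
    {A : Matrix (Fin 8) (Fin 8) R} (h : IsIsom A) : IsIsom (A.map φ) := by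
  have := congrArg (fun M => M.map φ) h
  simp only [Matrix.map_mul, octGram_map] at this
  exact this

theorem IsIsom.mul {R : Type*} [CommRing R] {A B : Matrix (Fin 8) (Fin 8) R}
    (hA : IsIsom A) (hB : IsIsom B) : IsIsom (A * B) := by
  unfold IsIsom at *
  calc (A * B)ᵀ * octGram R * (A * B) = Bᵀ * (Aᵀ * octGram R * A) * B := by
        simp only [Matrix.transpose_mul, Matrix.mul_assoc]
    _ = octGram R := by rw [hA, hB]

theorem IsIsom.of_mul_eq_one {R : Type*} [CommRing R] {A B : Matrix (Fin 8) (Fin 8) R}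
    (hA : IsIsom A) (h : A * B = 1) : IsIsom B := by
  unfold IsIsom at *
  have h' : Bᵀ * Aᵀ = 1 := by rw [← Matrix.transpose_mul, h, Matrix.transpose_one]
  calc Bᵀ * octGram R * B = Bᵀ * (Aᵀ * octGram R * A) * B := by rw [hA]
    _ = (Bᵀ * Aᵀ) * octGram R * (A * B) := by simp only [Matrix.mul_assoc]
    _ = octGram R := by rw [h, h']; simp

/-- An isometry of the norm form as an element of `GL₈`. -/
def IsIsom.toGL {R : Type*} [CommRing R] {A : Matrix (Fin 8) (Fin 8) R} (h : IsIsom A) :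
    GL (Fin 8) R :=
  ⟨A, octGram R * Aᵀ * octGram R,
    by
      rw [mul_eq_one_comm]
      have : octGram R * Aᵀ * octGram R * A = octGram R * (Aᵀ * octGram R * A) := by
        simp only [Matrix.mul_assoc]
      rw [this, h, octGram_mul_self],
    by
      have : octGram R * Aᵀ * octGram R * A = octGram R * (Aᵀ * octGram R * A) := by
        simp only [Matrix.mul_assoc]
      rw [this, h, octGram_mul_self]⟩

theorem IsRelated.mul {R : Type*} [CommRing R] {A B C A' B' C' : Matrix (Fin 8) (Fin 8) R}
    (h : IsRelated A B C) (h' : IsRelated A' B' C') : IsRelated (A * A') (B * B') (C * C') := by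
  intro x y
  rw [← Matrix.mulVec_mulVec, h', h]; simp

theorem IsRelated.of_mul_eq_one {R : Type*} [CommRing R]
    {A B C A' B' C' : Matrix (Fin 8) (Fin 8) R} (h : IsRelated A B C)
    (hA : A' * A = 1) (hB : B * B' = 1) (hC : C * C' = 1) : IsRelated A' B' C' := by
  intro x y
  have := h (B' *ᵥ x) (C' *ᵥ y)
  rw [Matrix.mulVec_mulVec, Matrix.mulVec_mulVec, hB, hC, Matrix.one_mulVec,
    Matrix.one_mulVec] at this
  rw [← this, Matrix.mulVec_mulVec, hA, Matrix.one_mulVec]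

/-- The `R`-points of the split group `G` of type `G₂`: the automorphisms of the split octonions.
(For reduced rings every automorphism preserves the norm; this is recorded in the definition.) -/
def G2 (R : Type*) [CommRing R] : Subgroup (GL (Fin 8) R) where
  carrier := {g | IsIsom g.1 ∧ IsRelated g.1 g.1 g.1}
  one_mem' := by
    refine ⟨by simp [IsIsom], fun x y => by simp⟩
  mul_mem' := fun ha hb => ⟨ha.1.mul hb.1, ha.2.mul hb.2⟩
  inv_mem' := fun {g} hg => ⟨hg.1.of_mul_eq_one g.mul_inv,
    hg.2.of_mul_eq_one g.inv_mul g.mul_inv g.mul_inv⟩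

/-- The `R`-points of the simply connected group `H = Spin₈`, realised by triality as the group
of related triples `(t₁, t₂, t₃)` of isometries of the octonion norm, `t₁(xy) = t₂(x) t₃(y)`.
(Isometries in a related triple are automatically proper.) The first projection is the
eight-dimensional vector representation; the other two are the half-spin representations. -/
def Spin8 (R : Type*) [CommRing R] :
    Subgroup (GL (Fin 8) R × GL (Fin 8) R × GL (Fin 8) R) where
  carrier := {t | IsIsom t.1.1 ∧ IsIsom t.2.1.1 ∧ IsIsom t.2.2.1 ∧
    IsRelated t.1.1 t.2.1.1 t.2.2.1}
  one_mem' := by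
    refine ⟨by simp [IsIsom], by simp [IsIsom], by simp [IsIsom], fun x y => by simp⟩
  mul_mem' := fun ha hb => ⟨ha.1.mul hb.1, ha.2.1.mul hb.2.1, ha.2.2.1.mul hb.2.2.1,
    ha.2.2.2.mul hb.2.2.2⟩
  inv_mem' := fun {t} ht => ⟨ht.1.of_mul_eq_one t.1.mul_inv, ht.2.1.of_mul_eq_one t.2.1.mul_inv,
    ht.2.2.1.of_mul_eq_one t.2.2.mul_inv,
    ht.2.2.2.of_mul_eq_one t.1.inv_mul t.2.1.mul_inv t.2.2.mul_inv⟩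

/-- The embedding of `G` in `H` as the centralizer of the group `S₃` of triality automorphisms:
an automorphism `g` of the octonions goes to the triple `(g, g, g)`. -/
def G2.toSpin8 {R : Type*} [CommRing R] : G2 R →* Spin8 R where
  toFun g := ⟨(g.1, g.1, g.1), g.2.1, g.2.1, g.2.1, g.2.2⟩
  map_one' := rfl
  map_mul' _ _ := rfl

/-- Functoriality of `G` in the ring. -/
def G2.map {R R' : Type*} [CommRing R] [CommRing R'] (φ : R →+* R') : G2 R →* G2 R' :=
  ((Matrix.GeneralLinearGroup.map φ).comp (G2 R).subtype).codRestrict (G2 R')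
    (fun g => ⟨g.2.1.map φ, g.2.2.map φ⟩)

/-! ### One-parameter subgroups -/

/-- The matrix `1 + r (a E_{ij} + b E_{kl})`. -/
def elem8 {R : Type*} [CommRing R] (i j : Fin 8) (a : R) (k l : Fin 8) (b : R) :
    Matrix (Fin 8) (Fin 8) R :=
  1 + Matrix.single i j a + Matrix.single k l b

theorem elem8_mulVec {R : Type*} [CommRing R] (i j : Fin 8) (a : R) (k l : Fin 8) (b : R)
    (x : Fin 8 → R) : elem8 i j a k l b *ᵥ x =
      fun m => x m + (if m = i then a * x j else 0) + (if m = k then b * x l else 0) := by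
  ext m
  simp [elem8, Matrix.add_mulVec, Matrix.single_mulVec, Function.update_apply]

/-- Builds an element of `H` from a triple of matrices. -/
def Spin8.mk' {R : Type*} [CommRing R] (A B C : Matrix (Fin 8) (Fin 8) R)
    (hA : IsIsom A) (hB : IsIsom B) (hC : IsIsom C) (h : IsRelated A B C) : Spin8 R :=
  ⟨(hA.toGL, hB.toGL, hC.toGL), hA, hB, hC, h⟩

/-- `x_{α₂}(r)`; `α₂` is the central node of the diagram `D₄`. -/
def xD2 {R : Type*} [CommRing R] (r : R) : Spin8 R :=
  Spin8.mk' (elem8 1 2 r 5 4 (-r))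
    (elem8 1 2 r 5 4 (-r))
    (elem8 1 2 r 5 4 (-r))
    (isIsom_of fun x y => by
      rw [octGram_polar, octGram_polar]; simp [elem8_mulVec, octNorm]; ring)
    (isIsom_of fun x y => by
      rw [octGram_polar, octGram_polar]; simp [elem8_mulVec, octNorm]; ring)
    (isIsom_of fun x y => by
      rw [octGram_polar, octGram_polar]; simp [elem8_mulVec, octNorm]; ring)
    (fun x y => by
      rw [elem8_mulVec, elem8_mulVec, elem8_mulVec]; ext i; fin_cases i <;> simp [octMul] <;> ring)

/-- `x_{-α₂}(r)`. -/
def xD2n {R : Type*} [CommRing R] (r : R) : Spin8 R :=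
  Spin8.mk' (elem8 2 1 r 4 5 (-r))
    (elem8 2 1 r 4 5 (-r))
    (elem8 2 1 r 4 5 (-r))
    (isIsom_of fun x y => by
      rw [octGram_polar, octGram_polar]; simp [elem8_mulVec, octNorm]; ring)
    (isIsom_of fun x y => by
      rw [octGram_polar, octGram_polar]; simp [elem8_mulVec, octNorm]; ring)
    (isIsom_of fun x y => by
      rw [octGram_polar, octGram_polar]; simp [elem8_mulVec, octNorm]; ring)
    (fun x y => by
      rw [elem8_mulVec, elem8_mulVec, elem8_mulVec]; ext i; fin_cases i <;> simp [octMul] <;> ring)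

/-- `x_{α₃}(r)`. -/
def xD3 {R : Type*} [CommRing R] (r : R) : Spin8 R :=
  Spin8.mk' (elem8 0 5 (-r) 2 7 (-r))
    (elem8 0 5 (-r) 2 7 (-r))
    (elem8 4 3 r 6 1 (-r))
    (isIsom_of fun x y => by
      rw [octGram_polar, octGram_polar]; simp [elem8_mulVec, octNorm]; ring)
    (isIsom_of fun x y => by
      rw [octGram_polar, octGram_polar]; simp [elem8_mulVec, octNorm]; ring)
    (isIsom_of fun x y => by
      rw [octGram_polar, octGram_polar]; simp [elem8_mulVec, octNorm]; ring)
    (fun x y => by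
      rw [elem8_mulVec, elem8_mulVec, elem8_mulVec]; ext i; fin_cases i <;> simp [octMul] <;> ring)

/-- `x_{-α₃}(r)`. -/
def xD3n {R : Type*} [CommRing R] (r : R) : Spin8 R :=
  Spin8.mk' (elem8 5 0 (-r) 7 2 (-r))
    (elem8 5 0 (-r) 7 2 (-r))
    (elem8 3 4 r 1 6 (-r))
    (isIsom_of fun x y => by
      rw [octGram_polar, octGram_polar]; simp [elem8_mulVec, octNorm]; ring)
    (isIsom_of fun x y => by
      rw [octGram_polar, octGram_polar]; simp [elem8_mulVec, octNorm]; ring)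
    (isIsom_of fun x y => by
      rw [octGram_polar, octGram_polar]; simp [elem8_mulVec, octNorm]; ring)
    (fun x y => by
      rw [elem8_mulVec, elem8_mulVec, elem8_mulVec]; ext i; fin_cases i <;> simp [octMul] <;> ring)

/-- `x_{-α₁}(r)`. -/
def xD1n {R : Type*} [CommRing R] (r : R) : Spin8 R :=
  Spin8.mk' (elem8 0 2 r 5 7 r)
    (elem8 3 4 r 1 6 (-r))
    (elem8 0 2 r 5 7 r)
    (isIsom_of fun x y => by
      rw [octGram_polar, octGram_polar]; simp [elem8_mulVec, octNorm]; ring)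
    (isIsom_of fun x y => by
      rw [octGram_polar, octGram_polar]; simp [elem8_mulVec, octNorm]; ring)
    (isIsom_of fun x y => by
      rw [octGram_polar, octGram_polar]; simp [elem8_mulVec, octNorm]; ring)
    (fun x y => by
      rw [elem8_mulVec, elem8_mulVec, elem8_mulVec]; ext i; fin_cases i <;> simp [octMul] <;> ring)

/-- Builds an element of `G` from a matrix. -/
def G2.mk' {R : Type*} [CommRing R] (A : Matrix (Fin 8) (Fin 8) R)
    (hA : IsIsom A) (h : IsRelated A A A) : G2 R :=
  ⟨hA.toGL, hA, h⟩

/-- The matrix of `x_{α}(r)`. -/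
def xAMat {R : Type*} [CommRing R] (r : R) : Matrix (Fin 8) (Fin 8) R :=
    !![1, 0, 0, 0, 0, -r, 0, 0;
       0, 1, 0, 0, 0, 0, 0, 0;
       r, 0, 1, 0, 0, -r ^ 2, 0, -r;
       0, 0, 0, 1, 0, 0, 0, 0;
       0, 0, 0, r, 1, 0, 0, 0;
       0, 0, 0, 0, 0, 1, 0, 0;
       0, -r, 0, 0, 0, 0, 1, 0;
       0, 0, 0, 0, 0, r, 0, 1]

theorem xAMat_mulVec {R : Type*} [CommRing R] (r : R) (x : Fin 8 → R) :
    xAMat r *ᵥ x =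
      ![x 0 - r * x 5,
        x 1,
        x 2 + r * x 0 - r * x 7 - r ^ 2 * x 5,
        x 3,
        x 4 + r * x 3,
        x 5,
        x 6 - r * x 1,
        x 7 + r * x 5] := by
  ext i
  fin_cases i <;> simp [xAMat, Matrix.mulVec, dotProduct, Fin.sum_univ_succ] <;> ring

/-- `x_{α}(r)`, a short root subgroup of `G`. -/
def xA {R : Type*} [CommRing R] (r : R) : G2 R :=
  G2.mk' (xAMat r)
    (isIsom_of fun x y => by
      rw [octGram_polar, octGram_polar]; simp [xAMat_mulVec, octNorm]; ring)
    (fun x y => by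
      rw [xAMat_mulVec, xAMat_mulVec, xAMat_mulVec]; ext i; fin_cases i <;> simp [octMul] <;> ring)

/-- `x_{β}(r)`, a long root subgroup of `G`. -/
def xB {R : Type*} [CommRing R] (r : R) : G2 R :=
  G2.mk' (elem8 1 2 r 5 4 (-r))
    (isIsom_of fun x y => by
      rw [octGram_polar, octGram_polar]; simp [elem8_mulVec, octNorm]; ring)
    (fun x y => by
      rw [elem8_mulVec, elem8_mulVec, elem8_mulVec]; ext i; fin_cases i <;> simp [octMul] <;> ring)

/-- The matrix of `x_{α+β}(r)`. -/
def xABMat {R : Type*} [CommRing R] (r : R) : Matrix (Fin 8) (Fin 8) R :=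
    !![1, 0, 0, 0, -r, 0, 0, 0;
       r, 1, 0, 0, -r ^ 2, 0, 0, -r;
       0, 0, 1, 0, 0, 0, 0, 0;
       0, 0, 0, 1, 0, 0, 0, 0;
       0, 0, 0, 0, 1, 0, 0, 0;
       0, 0, 0, -r, 0, 1, 0, 0;
       0, 0, r, 0, 0, 0, 1, 0;
       0, 0, 0, 0, r, 0, 0, 1]

theorem xABMat_mulVec {R : Type*} [CommRing R] (r : R) (x : Fin 8 → R) :
    xABMat r *ᵥ x =
      ![x 0 - r * x 4,
        x 1 + r * x 0 - r * x 7 - r ^ 2 * x 4,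
        x 2,
        x 3,
        x 4,
        x 5 - r * x 3,
        x 6 + r * x 2,
        x 7 + r * x 4] := by
  ext i
  fin_cases i <;> simp [xABMat, Matrix.mulVec, dotProduct, Fin.sum_univ_succ] <;> ring

/-- `x_{α+β}(r)`, a short root subgroup of `G`. -/
def xAB {R : Type*} [CommRing R] (r : R) : G2 R :=
  G2.mk' (xABMat r)
    (isIsom_of fun x y => by
      rw [octGram_polar, octGram_polar]; simp [xABMat_mulVec, octNorm]; ring)
    (fun x y => by
      rw [xABMat_mulVec, xABMat_mulVec, xABMat_mulVec]; ext i; fin_cases i <;> simp [octMul] <;> ring)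

/-- The matrix of `x_{2α+β}(r)`. -/
def x2ABMat {R : Type*} [CommRing R] (r : R) : Matrix (Fin 8) (Fin 8) R :=
    !![1, 0, 0, r, 0, 0, 0, 0;
       0, 1, 0, 0, 0, r, 0, 0;
       0, 0, 1, 0, -r, 0, 0, 0;
       0, 0, 0, 1, 0, 0, 0, 0;
       0, 0, 0, 0, 1, 0, 0, 0;
       0, 0, 0, 0, 0, 1, 0, 0;
       -r, 0, 0, -r ^ 2, 0, 0, 1, r;
       0, 0, 0, -r, 0, 0, 0, 1]

theorem x2ABMat_mulVec {R : Type*} [CommRing R] (r : R) (x : Fin 8 → R) :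
    x2ABMat r *ᵥ x =
      ![x 0 + r * x 3,
        x 1 + r * x 5,
        x 2 - r * x 4,
        x 3,
        x 4,
        x 5,
        x 6 - r * x 0 + r * x 7 - r ^ 2 * x 3,
        x 7 - r * x 3] := by
  ext i
  fin_cases i <;> simp [x2ABMat, Matrix.mulVec, dotProduct, Fin.sum_univ_succ] <;> ring

/-- `x_{2α+β}(r)`, a short root subgroup of `G`. -/
def x2AB {R : Type*} [CommRing R] (r : R) : G2 R :=
  G2.mk' (x2ABMat r)
    (isIsom_of fun x y => by
      rw [octGram_polar, octGram_polar]; simp [x2ABMat_mulVec, octNorm]; ring)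
    (fun x y => by
      rw [x2ABMat_mulVec, x2ABMat_mulVec, x2ABMat_mulVec]; ext i; fin_cases i <;> simp [octMul] <;> ring)

/-- `x_{3α+β}(r)`, a long root subgroup of `G`. -/
def x3AB {R : Type*} [CommRing R] (r : R) : G2 R :=
  G2.mk' (elem8 2 3 r 6 5 (-r))
    (isIsom_of fun x y => by
      rw [octGram_polar, octGram_polar]; simp [elem8_mulVec, octNorm]; ring)
    (fun x y => by
      rw [elem8_mulVec, elem8_mulVec, elem8_mulVec]; ext i; fin_cases i <;> simp [octMul] <;> ring)

/-- `x_{3α+2β}(r)`, a long root subgroup of `G`. -/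
def x3A2B {R : Type*} [CommRing R] (r : R) : G2 R :=
  G2.mk' (elem8 1 3 r 6 4 (-r))
    (isIsom_of fun x y => by
      rw [octGram_polar, octGram_polar]; simp [elem8_mulVec, octNorm]; ring)
    (fun x y => by
      rw [elem8_mulVec, elem8_mulVec, elem8_mulVec]; ext i; fin_cases i <;> simp [octMul] <;> ring)

/-! ### Subgroups of `G` and `H` -/

/-- The vectors lying in the plane spanned by the basis vectors `u₁` and `v₃` (coordinates `1` and
`6`). This plane is isotropic and all products of its elements vanish. -/
def InPlane {R : Type*} [CommRing R] (x : Fin 8 → R) : Prop :=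
  ∀ i, i ≠ 1 → i ≠ 6 → x i = 0

/-- The Heisenberg parabolic subgroup `P_H` of `H`: the stabilizer of the isotropic plane spanned by
`u₁` and `v₃` in the vector representation. It satisfies `P_H ∩ G = P`. -/
def PH (R : Type*) [CommRing R] : Subgroup (Spin8 R) where
  carrier := {p | ∀ x, InPlane (p.1.1.1 *ᵥ x) ↔ InPlane x}
  one_mem' := by intro x; simp
  mul_mem' := by
    intro a b ha hb x
    have h : (a * b).1.1.1 *ᵥ x = a.1.1.1 *ᵥ (b.1.1.1 *ᵥ x) := by
      rw [Matrix.mulVec_mulVec]; rfl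
    rw [h, ha, hb]
  inv_mem' := by
    intro a ha x
    have h : a.1.1.1 *ᵥ ((a⁻¹).1.1.1 *ᵥ x) = x := by
      rw [Matrix.mulVec_mulVec]
      have : a.1.1.1 * (a⁻¹).1.1.1 = 1 := a.1.1.mul_inv
      rw [this, Matrix.one_mulVec]
    rw [← ha, h]

/-- The determinant of the action of `p ∈ P_H` on the isotropic plane; the modulus character of
`P_H` is `δ_{P_H}(p) = |leviDet p| ^ 5`. -/
def leviDet {R : Type*} [CommRing R] (p : Spin8 R) : R :=
  p.1.1.1 1 1 * p.1.1.1 6 6 - p.1.1.1 1 6 * p.1.1.1 6 1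

/-- The unipotent radical `U` of the Heisenberg parabolic subgroup `P` of `G`. -/
def unipU (R : Type*) [CommRing R] : Subgroup (G2 R) :=
  Subgroup.closure (Set.range xB ∪ Set.range xAB ∪ Set.range x2AB ∪ Set.range x3AB ∪
    Set.range x3A2B)

/-- The unipotent radical `V` of the other maximal parabolic subgroup `Q` of `G`. -/
def unipV (R : Type*) [CommRing R] : Subgroup (G2 R) :=
  Subgroup.closure (Set.range xA ∪ Set.range xAB ∪ Set.range x2AB ∪ Set.range x3AB ∪
    Set.range x3A2B)

/-- `u(r₁, …, r₅)`. -/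
def uElt {R : Type*} [CommRing R] (r₁ r₂ r₃ r₄ r₅ : R) : G2 R :=
  xB r₁ * xAB r₂ * x2AB r₃ * x3AB r₄ * x3A2B r₅

/-- The additive map `u(r₁, …, r₅) ↦ r₂ + r₃` on `U`, read off from matrix entries. -/
def psiArg {R : Type*} [CommRing R] (g : G2 R) : R := g.1.1 1 0 + g.1.1 6 7

theorem psiArg_uElt {R : Type*} [CommRing R] (r₁ r₂ r₃ r₄ r₅ : R) :
    psiArg (uElt r₁ r₂ r₃ r₄ r₅) = r₂ + r₃ := by
  have e : ∀ (i j : Fin 8), (uElt r₁ r₂ r₃ r₄ r₅).1.1 i j =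
      (elem8 1 2 r₁ 5 4 (-r₁) *ᵥ (xABMat r₂ *ᵥ (x2ABMat r₃ *ᵥ (elem8 2 3 r₄ 6 5 (-r₄) *ᵥ
        (elem8 1 3 r₅ 6 4 (-r₅) *ᵥ Pi.single j 1))))) i := by
    intro i j
    simp only [Matrix.mulVec_mulVec, Matrix.mulVec_single_one]
    simp only [← Matrix.mul_assoc]
    rfl
  rw [psiArg, e, e]
  have e1 : ∀ j : Fin 8, elem8 1 3 r₅ 6 4 (-r₅) *ᵥ Pi.single j 1 =
      fun m => (Pi.single j 1 : Fin 8 → R) m + (if m = 1 then r₅ * (Pi.single j 1 : Fin 8 → R) 3 else 0) +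
        (if m = 6 then -r₅ * (Pi.single j 1 : Fin 8 → R) 4 else 0) := fun j =>
    elem8_mulVec _ _ _ _ _ _ _
  rw [e1, e1]
  simp [elem8_mulVec, xABMat_mulVec, x2ABMat_mulVec]
  simp [elem8]

/-- The representative `w_{α₂}(1)` of the simple reflection for `α₂`. -/
def w2 (R : Type*) [CommRing R] : Spin8 R := xD2 1 * xD2n (-1) * xD2 1

/-- The representative `w_{α₃}(1)` of the simple reflection for `α₃`. -/
def w3 (R : Type*) [CommRing R] : Spin8 R := xD3 1 * xD3n (-1) * xD3 1

/-- The representative `μ = w₂ w₃ x_{-α₁}(1)` of the open orbit of `G` on `P_H \ H`. -/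
def muH (R : Type*) [CommRing R] : Spin8 R := w2 R * w3 R * xD1n 1

/-- `U^μ = U ∩ μ⁻¹ P_H μ`. -/
def unipUmu (R : Type*) [CommRing R] : Subgroup (G2 R) :=
  unipU R ⊓ (PH R).comap ((MulAut.conj (muH R)).toMonoidHom.comp G2.toSpin8)

/-! ## Quotient measures and integrals over `Y \ X` -/

/-- The coset space `X ⧸ Y` with its Borel structure. -/
def Coset {X : Type*} [Group X] (Y : Subgroup X) : Type _ := X ⧸ Y

instance {X : Type*} [Group X] [TopologicalSpace X] (Y : Subgroup X) :
    TopologicalSpace (Coset Y) := inferInstanceAs (TopologicalSpace (X ⧸ Y))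

instance {X : Type*} [Group X] [TopologicalSpace X] (Y : Subgroup X) :
    MeasurableSpace (Coset Y) := borel _

instance {X : Type*} [Group X] [TopologicalSpace X] (Y : Subgroup X) :
    BorelSpace (Coset Y) := ⟨rfl⟩

instance {X : Type*} [Group X] (Y : Subgroup X) : MulAction X (Coset Y) :=
  inferInstanceAs (MulAction X (X ⧸ Y))

/-- Nonzero invariant Radon measures on a coset space. -/
structure IsInvariantMeasure {X : Type*} [Group X] [TopologicalSpace X] {Y : Subgroup X}
    (ν : Measure (Coset Y)) : Prop where
  regular : ν.Regular
  invariant : ∀ x : X, ν.map (fun q => x • q) = ν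
  ne_zero : ν ≠ 0

/-- A left `Y`-invariant function `Φ` on `X`, viewed as a function on `X ⧸ Y` by means of
`Y x ↦ x⁻¹ Y`. -/
def onCoset {X : Type*} [Group X] (Y : Subgroup X) (Φ : X → ℂ) : Coset Y → ℂ :=
  fun q => Φ (Quotient.out (s := QuotientGroup.leftRel Y) q)⁻¹

/-- The integral of a left `Y`-invariant function `Φ` over `Y \ X`. -/
def cosetIntegral {X : Type*} [Group X] [TopologicalSpace X] {Y : Subgroup X}
    (ν : Measure (Coset Y)) (Φ : X → ℂ) : ℂ :=
  ∫ q, onCoset Y Φ q ∂ν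

/-- Integrability of a left `Y`-invariant function `Φ` over `Y \ X`. -/
def CosetIntegrable {X : Type*} [Group X] [TopologicalSpace X] {Y : Subgroup X}
    (ν : Measure (Coset Y)) (Φ : X → ℂ) : Prop :=
  Integrable (onCoset Y Φ) ν

/-! ## Cuspidal representations of `G(𝔸)` -/

/-- The function `t ↦ f (x γ₁(t₁) ⋯ γₙ(tₙ))` for one-parameter subgroups `γ₁, …, γₙ`. -/
def alongCurves {X : Type*} [Group X] [TopologicalSpace X] (f : X → ℂ) {n : ℕ}
    (γ : Fin n → ContinuousMonoidHom (Multiplicative ℝ) X) (x : X) (t : Fin n → ℝ) : ℂ :=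
  f (x * (List.ofFn fun i => γ i (Multiplicative.ofAdd (t i))).prod)

/-- Smoothness of a function along the archimedean directions of a group, expressed by
one-parameter subgroups; for a Lie group this is the usual notion of a `C^∞` function. Every
one-parameter subgroup of an adelic group takes values in the archimedean component. -/
def IsSmoothFun {X : Type*} [Group X] [TopologicalSpace X] (f : X → ℂ) : Prop :=
  ∀ (n : ℕ) (γ : Fin n → ContinuousMonoidHom (Multiplicative ℝ) X) (x : X),
    ContDiff ℝ ((⊤ : ℕ∞) : WithTop ℕ∞) (alongCurves f γ x)

/-- The adele ring of the number field `K`. -/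
abbrev Adele (K : Type*) [Field K] [NumberField K] : Type _ := AdeleRing (𝓞 K) K

/-- The group `G(K)` of rational points as a subgroup of `G(𝔸)`. -/
def ratG (K : Type*) [Field K] [NumberField K] : Subgroup (G2 (Adele K)) :=
  (G2.map (algebraMap K (Adele K))).range

/-- The adelic height `∏_v max_{ij} |g_{ij}|_v` of `g ∈ G(𝔸)`. -/
def height (K : Type*) [Field K] [NumberField K] (g : G2 (Adele K)) : ℝ :=
  (∏ w : InfinitePlace K, (⨆ p : Fin 8 × Fin 8, ‖(g.1.1 p.1 p.2).1 w‖) ^ w.mult) *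
    ∏ᶠ v : HeightOneSpectrum (𝓞 K), ⨆ p : Fin 8 × Fin 8, ‖(g.1.1 p.1 p.2).2 v‖

/-- The archimedean component of `k ∈ G(𝔸)` is trivial. -/
def InfTrivial {K : Type*} [Field K] [NumberField K] (k : G2 (Adele K)) : Prop :=
  ∀ (i j : Fin 8) (w : InfinitePlace K), (k.1.1 i j).1 w = (1 : Matrix (Fin 8) (Fin 8) _) i j

/-- Smooth cusp forms on `G(𝔸)`: left `G(K)`-invariant functions which are smooth (at the
archimedean places, and right invariant under an open subgroup of the finite adelic points), of
uniformly moderate growth, and whose constant terms along the unipotent radicals of the two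
maximal parabolic subgroups vanish. -/
structure IsCuspForm (K : Type*) [Field K] [NumberField K] (φ : G2 (Adele K) → ℂ) : Prop where
  left_invariant : ∀ γ ∈ ratG K, ∀ g, φ (γ * g) = φ g
  smooth_inf : IsSmoothFun φ
  smooth_fin : ∃ O ∈ 𝓝 (1 : G2 (Adele K)), ∀ k ∈ O, InfTrivial k → ∀ x, φ (x * k) = φ x
  moderate_growth : ∃ N : ℕ, ∀ (n : ℕ)
    (γ : Fin n → ContinuousMonoidHom (Multiplicative ℝ) (G2 (Adele K))), ∃ C : ℝ, ∀ x,
      ‖iteratedFDeriv ℝ n (alongCurves φ γ x) 0 (fun i => Pi.single i 1)‖ ≤ C * height K x ^ N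
  cuspidal_U : ∀ ν : Measure (Coset ((ratG K).subgroupOf (unipU (Adele K)))),
    IsInvariantMeasure ν → ∀ g, cosetIntegral ν (fun u => φ (u.1 * g)) = 0
  cuspidal_V : ∀ ν : Measure (Coset ((ratG K).subgroupOf (unipV (Adele K)))),
    IsInvariantMeasure ν → ∀ g, cosetIntegral ν (fun u => φ (u.1 * g)) = 0

/-- A space `V` of smooth cusp forms which is stable under right translation by `G(𝔸)` and closed
for the `L²`-norm on `G(K) \ G(𝔸)`: the space of smooth vectors of a closed invariant subspace
of the space of square integrable cusp forms. -/
structure IsCuspSubrep (K : Type*) [Field K] [NumberField K] (νG : Measure (Coset (ratG K)))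
    (V : Submodule ℂ (G2 (Adele K) → ℂ)) : Prop where
  cuspForm : ∀ φ ∈ V, IsCuspForm K φ
  translate : ∀ φ ∈ V, ∀ g, (fun x => φ (x * g)) ∈ V
  closed : ∀ φ, IsCuspForm K φ →
    (∀ ε : ENNReal, 0 < ε → ∃ φ' ∈ V, eLpNorm (onCoset (ratG K) (φ - φ')) 2 νG < ε) → φ ∈ V

/-- Irreducible cuspidal representations of `G(𝔸)` (in the space of smooth vectors). -/
structure IsIrredCuspRep (K : Type*) [Field K] [NumberField K] (νG : Measure (Coset (ratG K)))
    (V : Submodule ℂ (G2 (Adele K) → ℂ)) : Prop extends IsCuspSubrep K νG V where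
  ne_bot : V ≠ ⊥
  irreducible : ∀ V' : Submodule ℂ (G2 (Adele K) → ℂ), IsCuspSubrep K νG V' → V' ≤ V →
    V' = ⊥ ∨ V' = V

/-- The split Fourier coefficient
`L_Ψ(φ)(g) = ∫_{U(K)\U(𝔸)} φ(ug) conj(Ψ(u)) du`, `Ψ(u(r₁,…,r₅)) = ψ(r₂ + r₃)`. -/
def fourierCoeff {K : Type*} [Field K] [NumberField K] (ψ : AddChar (Adele K) Circle)
    (νU : Measure (Coset ((ratG K).subgroupOf (unipU (Adele K)))))
    (φ : G2 (Adele K) → ℂ) (g : G2 (Adele K)) : ℂ :=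
  cosetIntegral νU (fun u => φ (u.1 * g) * (starRingEnd ℂ) (ψ (psiArg u.1) : ℂ))

/-! ## The places in `S` -/

/-- `K_S = ∏_{v ∈ S} K_v`, where `S` consists of all archimedean places and a finite set of finite
places. -/
def SRing (K : Type*) [Field K] [NumberField K] (S : Finset (HeightOneSpectrum (𝓞 K))) : Type _ :=
  (∀ w : InfinitePlace K, w.Completion) × (∀ v : S, v.1.adicCompletion K)

instance (K : Type*) [Field K] [NumberField K] (S : Finset (HeightOneSpectrum (𝓞 K))) :
    AddCommGroup (SRing K S) := inferInstanceAs (AddCommGroup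
  ((∀ w : InfinitePlace K, w.Completion) × (∀ v : S, v.1.adicCompletion K)))

instance (K : Type*) [Field K] [NumberField K] (S : Finset (HeightOneSpectrum (𝓞 K))) :
    TopologicalSpace (SRing K S) := inferInstanceAs (TopologicalSpace
  ((∀ w : InfinitePlace K, w.Completion) × (∀ v : S, v.1.adicCompletion K)))

instance (K : Type*) [Field K] [NumberField K] (S : Finset (HeightOneSpectrum (𝓞 K))) :
    MeasurableSpace (SRing K S) := borel _

instance (K : Type*) [Field K] [NumberField K] (S : Finset (HeightOneSpectrum (𝓞 K))) :
    BorelSpace (SRing K S) := ⟨rfl⟩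

/-- `G_S = ∏_{v ∈ S} G(K_v)`. -/
abbrev SGroup (K : Type*) [Field K] [NumberField K] (S : Finset (HeightOneSpectrum (𝓞 K))) :
    Type _ :=
  (∀ w : InfinitePlace K, G2 w.Completion) × (∀ v : S, G2 (v.1.adicCompletion K))

/-- `U_S = ∏_{v ∈ S} U(K_v)`. -/
def SUnip (K : Type*) [Field K] [NumberField K] (S : Finset (HeightOneSpectrum (𝓞 K))) :
    Subgroup (SGroup K S) :=
  (Subgroup.pi Set.univ fun w : InfinitePlace K => unipU w.Completion).prod
    (Subgroup.pi Set.univ fun v : S => unipU (v.1.adicCompletion K))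

open scoped Classical in
/-- The adele with components `x` at the places in `S` and `y` at the other places. -/
def override {K : Type*} [Field K] [NumberField K] (S : Finset (HeightOneSpectrum (𝓞 K)))
    (x : (∀ w : InfinitePlace K, w.Completion) × (∀ v : S, v.1.adicCompletion K))
    (y : Adele K) : Adele K :=
  (x.1, ⟨fun v => if h : v ∈ S then x.2 ⟨v, h⟩ else y.2 v, by
    have h1 := y.2.2
    have h2 : ∀ᶠ v in Filter.cofinite, v ∉ S := by
      simp [Filter.eventually_cofinite]
    filter_upwards [h1, h2] with v hv hS
    rw [dif_neg hS]
    exact hv⟩)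

/-- The projection of the adeles to the archimedean place `w`. -/
def prInf {K : Type*} [Field K] [NumberField K] (w : InfinitePlace K) : Adele K →+* w.Completion where
  toFun x := x.1 w
  map_one' := rfl
  map_mul' _ _ := rfl
  map_zero' := rfl
  map_add' _ _ := rfl

/-- The projection of the adeles to the finite place `v`. -/
def prFin {K : Type*} [Field K] [NumberField K] (v : HeightOneSpectrum (𝓞 K)) :
    Adele K →+* v.adicCompletion K where
  toFun x := x.2 v
  map_one' := rfl
  map_mul' _ _ := rfl
  map_zero' := rfl
  map_add' _ _ := rfl

theorem adele_ext {K : Type*} [Field K] [NumberField K] {x y : Adele K}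
    (h1 : ∀ w, prInf w x = prInf w y) (h2 : ∀ v, prFin v x = prFin v y) : x = y :=
  Prod.ext (funext h1) (FiniteAdeleRing.ext _ h2)

theorem isIsom_adele {K : Type*} [Field K] [NumberField K] {A : Matrix (Fin 8) (Fin 8) (Adele K)}
    (h1 : ∀ w, IsIsom (A.map (prInf w))) (h2 : ∀ v, IsIsom (A.map (prFin v))) : IsIsom A := by
  have key : ∀ {R' : Type _} [CommRing R'] (φ : Adele K →+* R'), IsIsom (A.map φ) →
      (Aᵀ * octGram _ * A).map φ = (octGram (Adele K)).map φ := by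
    intro R' _ φ h
    rw [Matrix.map_mul, Matrix.map_mul, octGram_map]
    exact h
  ext i j
  exact adele_ext (fun w => congrFun (congrFun (key _ (h1 w)) i) j)
    (fun v => congrFun (congrFun (key _ (h2 v)) i) j)

theorem isRelated_adele {K : Type*} [Field K] [NumberField K]
    {A B C : Matrix (Fin 8) (Fin 8) (Adele K)}
    (h1 : ∀ w, IsRelated (A.map (prInf w)) (B.map (prInf w)) (C.map (prInf w)))
    (h2 : ∀ v, IsRelated (A.map (prFin v)) (B.map (prFin v)) (C.map (prFin v))) :
    IsRelated A B C := by
  have mv : ∀ {R' : Type _} [CommRing R'] (φ : Adele K →+* R')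
      (M : Matrix (Fin 8) (Fin 8) (Adele K)) (x : Fin 8 → Adele K),
      φ ∘ (M *ᵥ x) = M.map φ *ᵥ (φ ∘ x) := by
    intro R' _ φ M x
    ext i; simp [Matrix.mulVec, dotProduct]
  have key : ∀ {R' : Type _} [CommRing R'] (φ : Adele K →+* R'),
      IsRelated (A.map φ) (B.map φ) (C.map φ) → ∀ x y,
      φ ∘ (A *ᵥ octMul x y) = φ ∘ (octMul (B *ᵥ x) (C *ᵥ y)) := by
    intro R' _ φ h x y
    rw [mv, octMul_map, octMul_map, h, mv, mv]
  intro x y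
  ext i
  exact adele_ext (fun w => congrFun (key _ (h1 w) x y) i) (fun v => congrFun (key _ (h2 v) x y) i)

/-- The matrix over the adeles with components `g_v` for `v ∈ S` and `1` for `v ∉ S`. -/
def SGroup.mat {K : Type*} [Field K] [NumberField K] {S : Finset (HeightOneSpectrum (𝓞 K))}
    (g : SGroup K S) : Matrix (Fin 8) (Fin 8) (Adele K) :=
  Matrix.of fun i j =>
    override S (fun w => (g.1 w).1.1 i j, fun v => (g.2 v).1.1 i j)
      ((1 : Matrix (Fin 8) (Fin 8) (Adele K)) i j)

theorem SGroup.mat_inf {K : Type*} [Field K] [NumberField K]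
    {S : Finset (HeightOneSpectrum (𝓞 K))} (g : SGroup K S) (w : InfinitePlace K) :
    g.mat.map (prInf w) = (g.1 w).1.1 := rfl

theorem SGroup.mat_fin {K : Type*} [Field K] [NumberField K]
    {S : Finset (HeightOneSpectrum (𝓞 K))} (g : SGroup K S) (v : S) :
    g.mat.map (prFin v.1) = (g.2 v).1.1 := by
  refine Matrix.ext fun i j => ?_
  exact dif_pos v.2

theorem SGroup.mat_fin_out {K : Type*} [Field K] [NumberField K]
    {S : Finset (HeightOneSpectrum (𝓞 K))} (g : SGroup K S) (v : HeightOneSpectrum (𝓞 K))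
    (hv : v ∉ S) : g.mat.map (prFin v) = 1 := by
  have : g.mat.map (prFin v) = (1 : Matrix (Fin 8) (Fin 8) (Adele K)).map (prFin v) := by
    refine Matrix.ext fun i j => ?_
    exact dif_neg hv
  rw [this]
  simp

/-- The embedding of `G_S` in `G(𝔸)`, with trivial components outside `S`. -/
def SGroup.toAdele {K : Type*} [Field K] [NumberField K] {S : Finset (HeightOneSpectrum (𝓞 K))}
    (g : SGroup K S) : G2 (Adele K) :=
  G2.mk' g.mat
    (isIsom_adele (fun w => by rw [SGroup.mat_inf]; exact (g.1 w).2.1) (fun v => by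
      by_cases hv : v ∈ S
      · rw [SGroup.mat_fin g ⟨v, hv⟩]; exact (g.2 ⟨v, hv⟩).2.1
      · rw [SGroup.mat_fin_out g v hv]; simp [IsIsom]))
    (isRelated_adele (fun w => by rw [SGroup.mat_inf]; exact (g.1 w).2.2) (fun v => by
      by_cases hv : v ∈ S
      · rw [SGroup.mat_fin g ⟨v, hv⟩]; exact (g.2 ⟨v, hv⟩).2.2
      · rw [SGroup.mat_fin_out g v hv]; intro x y; simp))

/-- `φ` is spherical outside `S`: right invariant under `G(𝒪_v)` for all `v ∉ S`. -/
def IsSphericalOutside {K : Type*} [Field K] [NumberField K]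
    (S : Finset (HeightOneSpectrum (𝓞 K))) (φ : G2 (Adele K) → ℂ) : Prop :=
  ∀ k : G2 (Adele K), InfTrivial k →
    (∀ v ∈ S, ∀ i j, (k.1.1 i j).2 v = (1 : Matrix (Fin 8) (Fin 8) _) i j) →
    (∀ v ∉ S, ∀ i j, (k.1.1 i j).2 v ∈ v.adicCompletionIntegers K) →
    ∀ x, φ (x * k) = φ x

open scoped Classical in
/-- The action of `⊗_{v ∈ S} a_v`, where `a_v` is a finite linear combination of elements of
`G(K_v)`, on functions on `G(𝔸)` through right translation. It maps a pure tensor `⊗_v φ_v` to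
the pure tensor `⊗_{v ∈ S} (a_v φ_v) ⊗ ⊗_{v ∉ S} φ_v`. -/
def localAct {K : Type*} [Field K] [NumberField K] {S : Finset (HeightOneSpectrum (𝓞 K))}
    (aI : ∀ w : InfinitePlace K, G2 w.Completion →₀ ℂ)
    (aF : ∀ v : S, G2 (v.1.adicCompletion K) →₀ ℂ)
    (φ : G2 (Adele K) → ℂ) : G2 (Adele K) → ℂ := fun x =>
  ∑ g₁ ∈ Fintype.piFinset (fun w => (aI w).support),
    ∑ g₂ ∈ Fintype.piFinset (fun v => (aF v).support),
      ((∏ w, aI w (g₁ w)) * ∏ v, aF v (g₂ v)) * φ (x * SGroup.toAdele (S := S) (g₁, g₂))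

/-! ## Sections of the induced representations of `H` -/

/-- `f_s ∈ Ind_{P_H}^H δ_{P_H}^s` for all `s` (unnormalized induction), where `nrm` is the normalized
absolute value of the local field. -/
def IsInduced {k : Type*} [CommRing k] (nrm : k → ℝ) (f : ℂ → Spin8 k → ℂ) : Prop :=
  ∀ s, ∀ p ∈ PH k, ∀ h, f s (p * h) = ((nrm (leviDet p) ^ 5 : ℝ) : ℂ) ^ s * f s h

/-- Standard sections at a finite place: smooth, and the restriction to the maximal compact
subgroup `H(𝒪_v)` does not depend on `s`. -/
structure IsFinSection {K : Type*} [Field K] [NumberField K] (v : HeightOneSpectrum (𝓞 K))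
    (f : ℂ → Spin8 (v.adicCompletion K) → ℂ) : Prop where
  induced : IsInduced (fun x : v.adicCompletion K => ‖x‖) f
  smooth : ∀ s, ∃ O ∈ 𝓝 (1 : Spin8 (v.adicCompletion K)), ∀ k ∈ O, ∀ h, f s (h * k) = f s h
  standard : ∀ k : Spin8 (v.adicCompletion K),
    (∀ i j, k.1.1.1 i j ∈ v.adicCompletionIntegers K ∧
      k.1.2.1.1 i j ∈ v.adicCompletionIntegers K ∧
      k.1.2.2.1 i j ∈ v.adicCompletionIntegers K) →
    ∀ s s' : ℂ, f s k = f s' k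

/-- Sections at an archimedean place: smooth, and depending on `s` only through exponential
factors, i.e. `f_s(h) = c(h) e^{b(h) s}` with `b(h)` real. -/
structure IsInfSection {K : Type*} [Field K] [NumberField K] (w : InfinitePlace K)
    (f : ℂ → Spin8 w.Completion → ℂ) : Prop where
  induced : IsInduced (fun x : w.Completion => ‖x‖ ^ w.mult) f
  smooth : ∀ s, IsSmoothFun (f s)
  exponential : ∀ h, ∃ (c : ℂ) (b : ℝ), ∀ s : ℂ, f s h = c * Complex.exp (b * s)

/-! ## The function `d_S` -/

open scoped Classical in
/-- The local zeta factor at an archimedean place. -/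
def zetaInf {K : Type*} [Field K] [NumberField K] (w : InfinitePlace K) (s : ℂ) : ℂ :=
  if w.IsReal then Complex.Gammaℝ s else Complex.Gammaℂ s

/-- The local zeta factor `(1 - q_v^{-s})⁻¹` at a finite place. -/
def zetaFin {K : Type*} [Field K] [NumberField K] (v : HeightOneSpectrum (𝓞 K)) (s : ℂ) : ℂ :=
  (1 - (Ideal.absNorm v.asIdeal : ℂ) ^ (-s))⁻¹

/-- `j(s) = ζ(5s) ζ(5s-1)² ζ(10s-4)`. -/
def jFactor (ζ : ℂ → ℂ) (s : ℂ) : ℂ := ζ (5 * s) * ζ (5 * s - 1) ^ 2 * ζ (10 * s - 4)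

/-- `j_S(s) = ∏_{v ∈ S} j_v(s)`. -/
def jS {K : Type*} [Field K] [NumberField K] (S : Finset (HeightOneSpectrum (𝓞 K))) (s : ℂ) : ℂ :=
  (∏ w : InfinitePlace K, jFactor (zetaInf w) s) * ∏ v ∈ S, jFactor (zetaFin v) s

/-- `f_S(μ g, s) = ∏_{v ∈ S} f_v(μ g_v, s)`. -/
def sectionProd {K : Type*} [Field K] [NumberField K] {S : Finset (HeightOneSpectrum (𝓞 K))}
    (fI : ∀ w : InfinitePlace K, ℂ → Spin8 w.Completion → ℂ)
    (fF : ∀ v : S, ℂ → Spin8 (v.1.adicCompletion K) → ℂ) (s : ℂ) (g : SGroup K S) : ℂ :=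
  (∏ w, fI w s (muH _ * G2.toSpin8 (g.1 w))) * ∏ v, fF v s (muH _ * G2.toSpin8 (g.2 v))

/-- `x_{α+β}(r) ∈ G_S` for `r ∈ K_S`. -/
def xABS {K : Type*} [Field K] [NumberField K] {S : Finset (HeightOneSpectrum (𝓞 K))}
    (r : SRing K S) : SGroup K S :=
  (fun w => xAB (r.1 w), fun v => xAB (r.2 v))

/-- The integrand `f_S(μ x_{α+β}(r) g, s) ψ_S(r)` of `F*`. -/
def fStarIntegrand {K : Type*} [Field K] [NumberField K] {S : Finset (HeightOneSpectrum (𝓞 K))}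
    (ψ : AddChar (Adele K) Circle)
    (fI : ∀ w : InfinitePlace K, ℂ → Spin8 w.Completion → ℂ)
    (fF : ∀ v : S, ℂ → Spin8 (v.1.adicCompletion K) → ℂ) (s : ℂ) (g : SGroup K S)
    (r : SRing K S) : ℂ :=
  sectionProd fI fF s (xABS r * g) * (ψ (override S r 0) : ℂ)

/-- `F*(g, s) = j_S(s) ∫_{K_S} f_S(μ x_{α+β}(r) g, s) ψ_S(r) dr`, for `g ∈ G_S`. -/
def fStar {K : Type*} [Field K] [NumberField K] {S : Finset (HeightOneSpectrum (𝓞 K))}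
    (ψ : AddChar (Adele K) Circle) (νr : Measure (SRing K S))
    (fI : ∀ w : InfinitePlace K, ℂ → Spin8 w.Completion → ℂ)
    (fF : ∀ v : S, ℂ → Spin8 (v.1.adicCompletion K) → ℂ) (s : ℂ) (g : SGroup K S) : ℂ :=
  jS S s * ∫ r, fStarIntegrand ψ fI fF s g r ∂νr

/-- The integrand `L_Ψ(φ)(g) F*(g, s)` of `d_S`. -/
def dSIntegrand {K : Type*} [Field K] [NumberField K] {S : Finset (HeightOneSpectrum (𝓞 K))}
    (ψ : AddChar (Adele K) Circle)
    (νU : Measure (Coset ((ratG K).subgroupOf (unipU (Adele K)))))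
    (νr : Measure (SRing K S)) (φ : G2 (Adele K) → ℂ)
    (fI : ∀ w : InfinitePlace K, ℂ → Spin8 w.Completion → ℂ)
    (fF : ∀ v : S, ℂ → Spin8 (v.1.adicCompletion K) → ℂ) (s : ℂ) (g : SGroup K S) : ℂ :=
  fourierCoeff ψ νU φ g.toAdele * fStar ψ νr fI fF s g

/-- `d_S(s, φ_S, f_S) = ∫_{U_S \ G_S} L_Ψ(φ)(g) F*(g, s) dg`. -/
def dS {K : Type*} [Field K] [NumberField K] {S : Finset (HeightOneSpectrum (𝓞 K))}
    (ψ : AddChar (Adele K) Circle)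
    (νU : Measure (Coset ((ratG K).subgroupOf (unipU (Adele K)))))
    (νr : Measure (SRing K S)) (νS : Measure (Coset (SUnip K S))) (φ : G2 (Adele K) → ℂ)
    (fI : ∀ w : InfinitePlace K, ℂ → Spin8 w.Completion → ℂ)
    (fF : ∀ v : S, ℂ → Spin8 (v.1.adicCompletion K) → ℂ) (s : ℂ) : ℂ :=
  cosetIntegral νS (dSIntegrand ψ νU νr φ fI fF s)

/-! ## Local representations at finite places -/

open scoped Classical in
/-- The adele with component `x` at the finite place `v` and `0` elsewhere. -/
def adeleAt {K : Type*} [Field K] [NumberField K] (v : HeightOneSpectrum (𝓞 K))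
    (x : v.adicCompletion K) : Adele K :=
  (0, ⟨Pi.single (M := fun v : HeightOneSpectrum (𝓞 K) => v.adicCompletion K) v x, by
    have h : ∀ᶠ u in Filter.cofinite, u ≠ v := by
      simp [Filter.eventually_cofinite]
    filter_upwards [h] with u hu
    rw [Pi.single_eq_of_ne hu]
    exact (u.adicCompletionIntegers K).zero_mem⟩)

/-- Smooth representations of `G(K_v)`: every vector is fixed by an open subgroup. -/
def IsSmoothRep {K : Type*} [Field K] [NumberField K] {v : HeightOneSpectrum (𝓞 K)}
    {E : Type*} [AddCommGroup E] [Module ℂ E]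
    (ρ : Representation ℂ (G2 (v.adicCompletion K)) E) : Prop :=
  ∀ x : E, ∃ O ∈ 𝓝 (1 : G2 (v.adicCompletion K)), ∀ g ∈ O, ρ g x = x

/-- `l ∈ Hom_{U(K_v)}(ρ, ℂ_Ψ)`, where `Ψ(u(r₁,…,r₅)) = ψ_v(r₂ + r₃)`. -/
def IsSplitFunctional {K : Type*} [Field K] [NumberField K] (ψ : AddChar (Adele K) Circle)
    {v : HeightOneSpectrum (𝓞 K)} {E : Type*} [AddCommGroup E] [Module ℂ E]
    (ρ : Representation ℂ (G2 (v.adicCompletion K)) E) (l : E →ₗ[ℂ] ℂ) : Prop :=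
  ∀ u ∈ unipU (v.adicCompletion K), ∀ x, l (ρ u x) = (ψ (adeleAt v (psiArg u)) : ℂ) * l x

end G2Zeta

end

noncomputable section

namespace G2Zeta

section Algebra

variable {R : Type*} [CommRing R]

theorem G2.ext_val {g h : G2 R} (H : g.1.1 = h.1.1) : g = h :=
  Subtype.ext (Units.ext H)

theorem G2.val_mul (g h : G2 R) : (g * h).1.1 = g.1.1 * h.1.1 := rfl

theorem G2.val_one : (1 : G2 R).1.1 = 1 := rfl

theorem G2.val_inv (g : G2 R) : (g⁻¹).1.1 = octGram R * g.1.1ᵀ * octGram R := by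
  have h1 : (octGram R * g.1.1ᵀ * octGram R) * g.1.1 = 1 := by
    calc _ = octGram R * (g.1.1ᵀ * octGram R * g.1.1) := by simp only [Matrix.mul_assoc]
      _ = 1 := by rw [g.2.1, octGram_mul_self]
  have h2 : g.1.1 * (g⁻¹).1.1 = 1 := g.1.mul_inv
  calc (g⁻¹).1.1 = ((octGram R * g.1.1ᵀ * octGram R) * g.1.1) * (g⁻¹).1.1 := by rw [h1, one_mul]
    _ = _ := by rw [Matrix.mul_assoc, h2, mul_one]

/-- The Gram matrix of the norm form, as an automorphism of the octonions. -/
def gramG (R : Type*) [CommRing R] : G2 R :=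
  G2.mk' (octGram R)
    (isIsom_of fun x y => by
      simp [octGram, dotProduct, Matrix.mulVec, Fin.sum_univ_succ]; ring)
    (fun x y => by
      ext i; fin_cases i <;>
        simp [octGram, octMul, dotProduct, Matrix.mulVec, Fin.sum_univ_succ] <;> ring)

/-- The group `G` is stable under transposition. -/
def G2.tr (g : G2 R) : G2 R := gramG R * g⁻¹ * gramG R

theorem G2.tr_val (g : G2 R) : (G2.tr g).1.1 = g.1.1ᵀ := by
  have h : (gramG R).1.1 = octGram R := rfl
  rw [G2.tr, G2.val_mul, G2.val_mul, h, G2.val_inv]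
  calc _ = (octGram R * octGram R) * g.1.1ᵀ * (octGram R * octGram R) := by
        simp only [Matrix.mul_assoc]
    _ = _ := by rw [octGram_mul_self, one_mul, mul_one]

theorem G2.tr_mul (g h : G2 R) : G2.tr (g * h) = G2.tr h * G2.tr g :=
  G2.ext_val (by simp only [G2.tr_val, G2.val_mul, Matrix.transpose_mul])

theorem G2.tr_tr (g : G2 R) : G2.tr (G2.tr g) = g :=
  G2.ext_val (by simp only [G2.tr_val, Matrix.transpose_transpose])

/-- The rows of an automorphism multiply like the basis vectors. -/
theorem G2.row_mul (g : G2 R) (i j : Fin 8) :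
    octMul (g.1.1 i) (g.1.1 j) =
      g.1.1ᵀ *ᵥ octMul (Pi.single i 1) (Pi.single j 1) := by
  have h := (G2.tr g).2.2 (Pi.single i 1) (Pi.single j 1)
  rw [show ((G2.tr g).1 : Matrix (Fin 8) (Fin 8) R) = g.1.1ᵀ from G2.tr_val g] at h
  rw [h, Matrix.mulVec_single_one, Matrix.mulVec_single_one]
  rfl

theorem transpose_mulVec_apply (M : Matrix (Fin 8) (Fin 8) R) (x : Fin 8 → R) (j : Fin 8) :
    (Mᵀ *ᵥ x) j = x 0 * M 0 j + x 1 * M 1 j + x 2 * M 2 j + x 3 * M 3 j + x 4 * M 4 j +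
      x 5 * M 5 j + x 6 * M 6 j + x 7 * M 7 j := by
  simp [Matrix.mulVec, dotProduct, Fin.sum_univ_succ]; ring

theorem G2.row12 (g : G2 R) : octMul (g.1.1 1) (g.1.1 2) = g.1.1 6 := by
  rw [G2.row_mul]; ext j; rw [transpose_mulVec_apply]; simp [octMul]
theorem G2.row23 (g : G2 R) : octMul (g.1.1 2) (g.1.1 3) = g.1.1 4 := by
  rw [G2.row_mul]; ext j; rw [transpose_mulVec_apply]; simp [octMul]
theorem G2.row31 (g : G2 R) : octMul (g.1.1 3) (g.1.1 1) = g.1.1 5 := by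
  rw [G2.row_mul]; ext j; rw [transpose_mulVec_apply]; simp [octMul]
theorem G2.row14 (g : G2 R) : octMul (g.1.1 1) (g.1.1 4) = g.1.1 0 := by
  rw [G2.row_mul]; ext j; rw [transpose_mulVec_apply]; simp [octMul]
theorem G2.row41 (g : G2 R) : octMul (g.1.1 4) (g.1.1 1) = g.1.1 7 := by
  rw [G2.row_mul]; ext j; rw [transpose_mulVec_apply]; simp [octMul]
theorem G2.row03 (g : G2 R) : octMul (g.1.1 0) (g.1.1 3) = g.1.1 3 := by
  rw [G2.row_mul]; ext j; rw [transpose_mulVec_apply]; simp [octMul]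
theorem G2.row30 (g : G2 R) : octMul (g.1.1 3) (g.1.1 0) = 0 := by
  rw [G2.row_mul]; ext j; rw [transpose_mulVec_apply]; simp [octMul]
theorem G2.row04 (g : G2 R) : octMul (g.1.1 0) (g.1.1 4) = 0 := by
  rw [G2.row_mul]; ext j; rw [transpose_mulVec_apply]; simp [octMul]
theorem G2.row40 (g : G2 R) : octMul (g.1.1 4) (g.1.1 0) = g.1.1 4 := by
  rw [G2.row_mul]; ext j; rw [transpose_mulVec_apply]; simp [octMul]
theorem G2.row20 (g : G2 R) : octMul (g.1.1 2) (g.1.1 0) = 0 := by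
  rw [G2.row_mul]; ext j; rw [transpose_mulVec_apply]; simp [octMul]
theorem G2.row10 (g : G2 R) : octMul (g.1.1 1) (g.1.1 0) = 0 := by
  rw [G2.row_mul]; ext j; rw [transpose_mulVec_apply]; simp [octMul]
theorem G2.row32 (g : G2 R) : octMul (g.1.1 3) (g.1.1 2) = -g.1.1 4 := by
  rw [G2.row_mul]; ext j; rw [transpose_mulVec_apply]; simp [octMul]
theorem G2.row34 (g : G2 R) : octMul (g.1.1 3) (g.1.1 4) = 0 := by
  rw [G2.row_mul]; ext j; rw [transpose_mulVec_apply]; simp [octMul]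

theorem octMul_one_right (x : Fin 8 → R) : octMul x (Pi.single 0 1 + Pi.single 7 1) = x := by
  ext i; fin_cases i <;> simp [octMul]

theorem octMul_one_left (x : Fin 8 → R) : octMul (Pi.single 0 1 + Pi.single 7 1) x = x := by
  ext i; fin_cases i <;> simp [octMul]

theorem G2.mulVec_one (g : G2 R) :
    g.1.1 *ᵥ (Pi.single 0 1 + Pi.single 7 1) = Pi.single 0 1 + Pi.single 7 1 := by
  have h := g.2.2 (Pi.single 0 1 + Pi.single 7 1)
    ((g⁻¹).1.1 *ᵥ (Pi.single 0 1 + Pi.single 7 1))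
  have h2 : (g.1 : Matrix (Fin 8) (Fin 8) R) * (g⁻¹).1.1 = 1 := g.1.mul_inv
  rw [octMul_one_left, Matrix.mulVec_mulVec, h2, Matrix.one_mulVec, octMul_one_right] at h
  exact h.symm

/-- The trace of the rows of an automorphism. -/
theorem G2.row_trace (g : G2 R) (i : Fin 8) :
    g.1.1 i 0 + g.1.1 i 7 = (Pi.single 0 1 + Pi.single 7 1 : Fin 8 → R) i := by
  rw [← congrFun (G2.mulVec_one g) i]
  simp [Matrix.mulVec, dotProduct, Fin.sum_univ_succ]

theorem G2.row_zero_add_row_seven (g : G2 R) :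
    g.1.1 0 + g.1.1 7 = Pi.single 0 1 + Pi.single 7 1 := by
  have h := G2.mulVec_one (G2.tr g)
  rw [G2.tr_val] at h
  rw [← h]
  ext j
  rw [transpose_mulVec_apply]; simp

theorem G2.ext_rows {g h : G2 R} (h1 : g.1.1 1 = h.1.1 1) (h2 : g.1.1 2 = h.1.1 2)
    (h3 : g.1.1 3 = h.1.1 3) : g = h := by
  have h4 : g.1.1 4 = h.1.1 4 := by rw [← G2.row23, ← G2.row23, h2, h3]
  refine G2.ext_val (funext fun i => ?_)
  fin_cases i
  · exact (by rw [← G2.row14, ← G2.row14, h1, h4] : g.1.1 0 = h.1.1 0)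
  · exact h1
  · exact h2
  · exact h3
  · exact h4
  · exact (by rw [← G2.row31, ← G2.row31, h1, h3] : g.1.1 5 = h.1.1 5)
  · exact (by rw [← G2.row12, ← G2.row12, h1, h2] : g.1.1 6 = h.1.1 6)
  · exact (by rw [← G2.row41, ← G2.row41, h1, h4] : g.1.1 7 = h.1.1 7)

/-- The matrix of `u(r₁, …, r₅)`. -/
def uMat (a b c d e : R) : Matrix (Fin 8) (Fin 8) R :=
  !![1, 0, 0, c, -b, 0, 0, 0;
     b, 1, a, a * d + 2 * b * c + e, -a * c - b ^ 2, c, 0, -b;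
     0, 0, 1, d, -c, 0, 0, 0;
     0, 0, 0, 1, 0, 0, 0, 0;
     0, 0, 0, 0, 1, 0, 0, 0;
     0, 0, 0, -b, -a, 1, 0, 0;
     -c, 0, b, b * d - c ^ 2, -b * c - e, -d, 1, c;
     0, 0, 0, -c, b, 0, 0, 1]

theorem uElt_val (a b c d e : R) : (uElt a b c d e).1.1 = uMat a b c d e := by
  have h : (uElt a b c d e).1.1 = elem8 1 2 a 5 4 (-a) * xABMat b * x2ABMat c *
      elem8 2 3 d 6 5 (-d) * elem8 1 3 e 6 4 (-e) := rfl
  rw [h]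
  refine Matrix.ext_of_mulVec_single fun j => ?_
  simp only [← Matrix.mulVec_mulVec]
  generalize (Pi.single j 1 : Fin 8 → R) = x
  rw [elem8_mulVec, elem8_mulVec, elem8_mulVec, xABMat_mulVec, x2ABMat_mulVec]
  ext i
  fin_cases i <;> simp [uMat, Matrix.mulVec, dotProduct, Fin.sum_univ_succ] <;> ring

/-- The automorphisms fixing the rows `3` and `4` form the group `U`. -/
theorem eq_uElt_of_rows {g : G2 R} (h3 : g.1.1 3 = Pi.single 3 1) (h4 : g.1.1 4 = Pi.single 4 1) :
    g = uElt (g.1.1 1 2) (-g.1.1 0 4) (g.1.1 0 3) (g.1.1 2 3)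
      (g.1.1 1 3 - g.1.1 1 2 * g.1.1 2 3 + 2 * g.1.1 0 4 * g.1.1 0 3) := by
  have e03 := G2.row03 g
  have e04 := G2.row04 g
  have e40 := G2.row40 g
  have e30 := G2.row30 g
  have e32 := G2.row32 g
  have e20 := G2.row20 g
  have e10 := G2.row10 g
  have e41 := G2.row41 g
  have e14 := G2.row14 g
  have e07 := G2.row_zero_add_row_seven g
  rw [h3] at e03 e30 e32
  rw [h4] at e04 e40 e41 e14 e32
  generalize g.1.1 0 = y at *
  have y0 : y 0 = 1 := by simpa [octMul] using congrFun e03 3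
  have y1 : y 1 = 0 := by simpa [octMul] using congrFun e30 5
  have y2 : y 2 = 0 := by simpa [octMul] using congrFun e30 4
  have y5 : y 5 = 0 := by simpa [octMul] using congrFun e40 3
  have y6 : y 6 = 0 := by simpa [octMul] using congrFun e40 2
  have y7 : y 7 = 0 := by simpa [octMul] using congrFun e30 3
  have z1 : g.1.1 2 1 = 0 := by simpa [octMul] using congrFun e32 5
  have z2 : g.1.1 2 2 = 1 := by simpa [octMul] using congrFun e32 4
  have z6 : g.1.1 2 6 = 0 := by simpa [octMul] using congrFun e32 0
  have z7 : g.1.1 2 7 = 0 := by simpa [octMul] using congrFun e32 3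
  have z0 : g.1.1 2 0 = 0 := by simpa [octMul, z1, z2, z6, z7, y0, y1, y2, y5, y6, y7] using congrFun e20 0
  have z4 : g.1.1 2 4 + y 3 = 0 := by
    simpa [octMul, z1, z2, z6, z7, y0, y1, y2, y5, y6, y7] using congrFun e20 4
  have z5 : g.1.1 2 5 = 0 := by
    simpa [octMul, z1, z2, z6, z7, y0, y1, y2, y5, y6, y7] using congrFun e20 5
  have s7 : g.1.1 7 = Pi.single 0 1 + Pi.single 7 1 - y := by rw [← e07]; simp
  rw [s7] at e41
  have x1 : g.1.1 1 1 = 1 := by simpa [octMul, y7] using congrFun e41 7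
  have x0 : g.1.1 1 0 = - y 4 := by simpa [octMul] using congrFun e41 4
  have x5 : g.1.1 1 5 = y 3 := by simpa [octMul] using congrFun e41 3
  have x6 : g.1.1 1 6 = 0 := by simpa [octMul, y2] using congrFun e41 2
  have x7 : g.1.1 1 7 = y 4 := by simpa [octMul] using congrFun e14 4
  have x4 : g.1.1 1 4 + (y 4 * y 4 + g.1.1 1 2 * y 3) = 0 := by
    have := congrFun e10 4
    simp [octMul, y0, y1, y2, y5, y6, y7, x7] at this
    linear_combination this
  refine G2.ext_rows ?_ ?_ ?_
  · rw [uElt_val]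
    ext j; fin_cases j <;> simp [uMat, x0, x1, x5, x6, x7]
    · ring
    · linear_combination x4
  · rw [uElt_val]
    ext j; fin_cases j <;> simp [uMat, z0, z1, z2, z5, z6, z7]
    linear_combination z4
  · rw [uElt_val, h3]
    ext j; fin_cases j <;> simp [uMat]

theorem uElt_mem_unipU (a b c d e : R) : uElt a b c d e ∈ unipU R := by
  have h : ∀ {s : Set (G2 R)} {x : G2 R}, s ⊆ (Set.range xB ∪ Set.range xAB ∪ Set.range x2AB ∪
      Set.range x3AB ∪ Set.range x3A2B) → x ∈ s → x ∈ unipU R :=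
    fun hs hx => Subgroup.subset_closure (hs hx)
  refine mul_mem (mul_mem (mul_mem (mul_mem ?_ ?_) ?_) ?_) ?_
  · exact h (s := Set.range xB) (by intro x hx; simp only [Set.mem_union]; tauto) ⟨a, rfl⟩
  · exact h (s := Set.range xAB) (by intro x hx; simp only [Set.mem_union]; tauto) ⟨b, rfl⟩
  · exact h (s := Set.range x2AB) (by intro x hx; simp only [Set.mem_union]; tauto) ⟨c, rfl⟩
  · exact h (s := Set.range x3AB) (by intro x hx; simp only [Set.mem_union]; tauto) ⟨d, rfl⟩
  · exact h (s := Set.range x3A2B) (by intro x hx; simp only [Set.mem_union]; tauto) ⟨e, rfl⟩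

/-- The automorphisms with trivial rows `3` and `4`. -/
def rowStab (R : Type*) [CommRing R] : Subgroup (G2 R) where
  carrier := {g | g.1.1 3 = Pi.single 3 1 ∧ g.1.1 4 = Pi.single 4 1}
  one_mem' := by
    constructor <;> ext j <;> simp [Matrix.one_apply, Pi.single_apply, eq_comm]
  mul_mem' := by
    intro a b ha hb
    have key : ∀ i, (a * b).1.1 i = a.1.1 i ᵥ* b.1.1 := fun i => rfl
    refine ⟨?_, ?_⟩
    · rw [key, ha.1, Matrix.single_one_vecMul]; exact hb.1
    · rw [key, ha.2, Matrix.single_one_vecMul]; exact hb.2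
  inv_mem' := by
    intro a ha
    have h : (a.1.1 : Matrix (Fin 8) (Fin 8) R) * (a⁻¹).1.1 = 1 := a.1.mul_inv
    have key : ∀ i, a.1.1 i = Pi.single i 1 → (a⁻¹).1.1 i = Pi.single i 1 := by
      intro i hi
      have h1 := congrFun h i
      have h2 : (a.1.1 * (a⁻¹).1.1) i = a.1.1 i ᵥ* (a⁻¹).1.1 := rfl
      rw [h2, hi, Matrix.single_one_vecMul] at h1
      refine Eq.trans h1 ?_
      ext j; simp [Matrix.one_apply, Pi.single_apply, eq_comm]
    exact ⟨key 3 ha.1, key 4 ha.2⟩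

theorem unipU_eq_rowStab : unipU R = rowStab R := by
  apply le_antisymm
  · rw [unipU, Subgroup.closure_le]
    rintro g ((((⟨r, rfl⟩ | ⟨r, rfl⟩) | ⟨r, rfl⟩) | ⟨r, rfl⟩) | ⟨r, rfl⟩)
    · have : xB r = uElt r 0 0 0 0 := by
        refine G2.ext_val ?_
        rw [uElt_val]
        change elem8 1 2 r 5 4 (-r) = _
        ext i j; fin_cases i <;> fin_cases j <;> simp [elem8, uMat]
      rw [this]
      constructor <;> rw [uElt_val] <;> ext j <;> fin_cases j <;> simp [uMat]
    · constructor <;> change xABMat r _ = _ <;> ext j <;> fin_cases j <;> simp [xABMat]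
    · constructor <;> change x2ABMat r _ = _ <;> ext j <;> fin_cases j <;> simp [x2ABMat]
    · constructor <;> change elem8 2 3 r 6 5 (-r) _ = _ <;> ext j <;> fin_cases j <;>
        simp [elem8]
    · constructor <;> change elem8 1 3 r 6 4 (-r) _ = _ <;> ext j <;> fin_cases j <;>
        simp [elem8]
  · rintro g ⟨h3, h4⟩
    rw [eq_uElt_of_rows h3 h4]
    exact uElt_mem_unipU _ _ _ _ _

theorem mem_unipU_iff {g : G2 R} :
    g ∈ unipU R ↔ g.1.1 3 = Pi.single 3 1 ∧ g.1.1 4 = Pi.single 4 1 := by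
  rw [unipU_eq_rowStab]; rfl

theorem exists_eq_uElt {g : G2 R} (hg : g ∈ unipU R) : ∃ a b c d e, g = uElt a b c d e :=
  ⟨_, _, _, _, _, eq_uElt_of_rows (mem_unipU_iff.1 hg).1 (mem_unipU_iff.1 hg).2⟩

theorem uElt_mul (a b c d e a' b' c' d' e' : R) :
    uElt a b c d e * uElt a' b' c' d' e' = uElt (a + a') (b + b') (c + c') (d + d')
      (e + e' - d * a' - 3 * c * b') := by
  refine G2.ext_rows ?_ ?_ ?_ <;> rw [G2.val_mul] <;> simp only [uElt_val] <;> ext j <;>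
    fin_cases j <;> simp [uMat, Matrix.mul_apply, Fin.sum_univ_succ] <;> ring

theorem psiArg_mul {g h : G2 R} (hg : g ∈ unipU R) (hh : h ∈ unipU R) :
    psiArg (g * h) = psiArg g + psiArg h := by
  obtain ⟨a, b, c, d, e, rfl⟩ := exists_eq_uElt hg
  obtain ⟨a', b', c', d', e', rfl⟩ := exists_eq_uElt hh
  rw [uElt_mul, psiArg_uElt, psiArg_uElt, psiArg_uElt]; ring

end Algebra

section Pluecker

variable {R : Type*} [CommRing R]

/-- The `2 × 2` minors of a pair of rows. -/
def pm (A B : Fin 8 → R) (i j : Fin 8) : R := A i * B j - A j * B i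

/-- The contraction of `A ∧ B` with the octonion trace. -/
def pa (A B : Fin 8 → R) (j : Fin 8) : R := pm A B j 0 + pm A B j 7

/-- The trace zero part of the octonion product `conj(A) B`, as a function of `A ∧ B`. -/
def pc (A B : Fin 8 → R) : Fin 8 → R :=
  ![0, pm A B 7 1 + pm A B 5 6, pm A B 7 2 + pm A B 6 4, pm A B 7 3 + pm A B 4 5,
    pm A B 0 4 + pm A B 3 2, pm A B 0 5 + pm A B 1 3, pm A B 0 6 + pm A B 2 1, 0]

/-- Replaces the coordinates `0` and `7` by zero. -/
def midPart (x : Fin 8 → R) : Fin 8 → R := ![0, x 1, x 2, x 3, x 4, x 5, x 6, 0]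

theorem pm_lin (A B : Fin 8 → R) (a b c d : R) (i j : Fin 8) :
    pm (a • A + b • B) (c • A + d • B) i j = (a * d - b * c) * pm A B i j := by
  simp [pm]; ring

theorem vecMul_elem8 (i j : Fin 8) (a : R) (k l : Fin 8) (b : R) (x : Fin 8 → R) :
    x ᵥ* elem8 i j a k l b =
      fun m => x m + (if m = j then x i * a else 0) + (if m = l then x k * b else 0) := by
  ext m
  simp only [elem8, Matrix.vecMul_add, Matrix.vecMul_one, Pi.add_apply]
  congr 1
  · congr 1
    simp [Matrix.vecMul, dotProduct, Matrix.single_apply, ite_and, eq_comm]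
  · simp [Matrix.vecMul, dotProduct, Matrix.single_apply, ite_and, eq_comm]

theorem muH_row (i : Fin 8) : (muH R).1.1.1 i = Pi.single i 1 ᵥ* elem8 1 2 1 5 4 (-1) ᵥ*
    elem8 2 1 (-1) 4 5 (- -1) ᵥ* elem8 1 2 1 5 4 (-1) ᵥ* elem8 0 5 (-1) 2 7 (-1) ᵥ*
    elem8 5 0 (- -1) 7 2 (- -1) ᵥ* elem8 0 5 (-1) 2 7 (-1) ᵥ* elem8 0 2 1 5 7 1 := by
  have h : (muH R).1.1.1 = elem8 1 2 1 5 4 (-1) * elem8 2 1 (-1) 4 5 (- -1) *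
    elem8 1 2 1 5 4 (-1) * (elem8 0 5 (-1) 2 7 (-1) * elem8 5 0 (- -1) 7 2 (- -1) *
    elem8 0 5 (-1) 2 7 (-1)) * elem8 0 2 1 5 7 1 := rfl
  rw [h]
  simp only [Matrix.vecMul_vecMul, Matrix.mul_assoc]
  exact (Matrix.single_one_vecMul _ _).symm

theorem muH_row_three : (muH R).1.1.1 3 = Pi.single 3 1 := by
  rw [muH_row]
  simp only [vecMul_elem8]
  ext j; fin_cases j <;> simp

theorem muH_row_four : (muH R).1.1.1 4 = Pi.single 0 1 + Pi.single 2 1 := by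
  rw [muH_row]
  simp only [vecMul_elem8]
  ext j; fin_cases j <;> simp

/-- The rows `3` and `4` of an element of `H`. -/
def rowA (h : Spin8 R) : Fin 8 → R := h.1.1.1 3

/-- The rows `3` and `4` of an element of `H`. -/
def rowB (h : Spin8 R) : Fin 8 → R := h.1.1.1 4

theorem spin_mul_row (p h : Spin8 R) (i : Fin 8) :
    (p * h).1.1.1 i = p.1.1.1 i ᵥ* h.1.1.1 := rfl

theorem rowA_muH_mul (g : G2 R) : rowA (muH R * G2.toSpin8 g) = g.1.1 3 := by
  rw [rowA, spin_mul_row, muH_row_three, Matrix.single_one_vecMul]; rfl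

theorem rowB_muH_mul (g : G2 R) : rowB (muH R * G2.toSpin8 g) = g.1.1 0 + g.1.1 2 := by
  rw [rowB, spin_mul_row, muH_row_four, Matrix.add_vecMul, Matrix.single_one_vecMul,
    Matrix.single_one_vecMul]; rfl

theorem G2.trace_three (g : G2 R) : g.1.1 3 7 = - g.1.1 3 0 := by
  have := G2.row_trace g 3; simp at this; linear_combination this

theorem G2.pa_rows (g : G2 R) (j : Fin 8) : pa (g.1.1 3) (g.1.1 0 + g.1.1 2) j = g.1.1 3 j := by
  have h0 := G2.row_trace g 0
  have h2 := G2.row_trace g 2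
  have h3 := G2.row_trace g 3
  simp at h0 h2 h3
  simp only [pa, pm, Pi.add_apply]
  linear_combination g.1.1 3 j * h0 + g.1.1 3 j * h2 - (g.1.1 0 j + g.1.1 2 j) * h3

theorem G2.pc_rows (g : G2 R) : pc (g.1.1 3) (g.1.1 0 + g.1.1 2) = midPart (g.1.1 4) := by
  have h3 := G2.trace_three g
  have e0 := fun j => congrFun (G2.row30 g) j
  have e2 := fun j => congrFun (G2.row32 g) j
  ext j
  fin_cases j
  · simp [pc, midPart]
  · have a := e0 1; have b := e2 1
    simp [octMul] at a b; simp [pc, midPart, pm, h3]; linear_combination -a - b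
  · have a := e0 2; have b := e2 2
    simp [octMul] at a b; simp [pc, midPart, pm, h3]; linear_combination -a - b
  · have a := e0 3; have b := e2 3
    simp [octMul] at a b; simp [pc, midPart, pm, h3]; linear_combination -a - b
  · have a := e0 4; have b := e2 4
    simp [octMul] at a b; simp [pc, midPart, pm]; linear_combination -a - b + (g.1.1 0 4 + g.1.1 2 4) * h3
  · have a := e0 5; have b := e2 5
    simp [octMul] at a b; simp [pc, midPart, pm]; linear_combination -a - b + (g.1.1 0 5 + g.1.1 2 5) * h3
  · have a := e0 6; have b := e2 6
    simp [octMul] at a b; simp [pc, midPart, pm]; linear_combination -a - b + (g.1.1 0 6 + g.1.1 2 6) * h3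
  · simp [pc, midPart]

/-- The minor `D = A₃C₄ - A₄C₃` of the rows `A`, `C` with index `3`, `4` of `g ∈ G`. -/
def detD (g : G2 R) : R := g.1.1 3 3 * g.1.1 4 4 - g.1.1 3 4 * g.1.1 4 3

/-- The minor with index `(3, 4)` of the rows `3`, `4` of `μ g`. -/
def kap (g : G2 R) : R := pm (g.1.1 3) (g.1.1 0 + g.1.1 2) 3 4

theorem pa_rows_mu (g : G2 R) :
    pa (rowA (muH R * G2.toSpin8 g)) (rowB (muH R * G2.toSpin8 g)) = g.1.1 3 := by
  rw [rowA_muH_mul, rowB_muH_mul]; exact funext (G2.pa_rows g)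

theorem pc_rows_mu (g : G2 R) :
    pc (rowA (muH R * G2.toSpin8 g)) (rowB (muH R * G2.toSpin8 g)) = midPart (g.1.1 4) := by
  rw [rowA_muH_mul, rowB_muH_mul]; exact G2.pc_rows g

/-! ### The action of `P_H` on the rows -/

theorem isIsom_entries {A : Matrix (Fin 8) (Fin 8) R} (h : IsIsom A) (i j : Fin 8) :
    A 0 i * A 7 j + A 7 i * A 0 j - A 1 i * A 4 j - A 4 i * A 1 j - A 2 i * A 5 j - A 5 i * A 2 j
      - A 3 i * A 6 j - A 6 i * A 3 j = octGram R i j := by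
  rw [← congrFun (congrFun h i) j]
  simp [Matrix.mul_apply, Fin.sum_univ_succ, octGram]
  ring

theorem PH.col {p : Spin8 R} (hp : p ∈ PH R) (i j : Fin 8) (hj : j = 1 ∨ j = 6) (h1 : i ≠ 1)
    (h6 : i ≠ 6) : p.1.1.1 i j = 0 := by
  have h := (hp (Pi.single j 1)).2 (by
    intro m hm1 hm6
    rw [Pi.single_eq_of_ne]
    rintro rfl
    exact hj.elim hm1 hm6)
  have := h i h1 h6
  rwa [Matrix.mulVec_single_one] at this

/-- The determinant of the block of `p ∈ P_H` with rows and columns `3`, `4`. -/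
def dualDet (p : Spin8 R) : R := p.1.1.1 3 3 * p.1.1.1 4 4 - p.1.1.1 3 4 * p.1.1.1 4 3

theorem PH.block {p : Spin8 R} (hp : p ∈ PH R) (j : Fin 8) :
    p.1.1.1 1 1 * p.1.1.1 4 j + p.1.1.1 6 1 * p.1.1.1 3 j = (if j = 4 then 1 else 0) ∧
    p.1.1.1 1 6 * p.1.1.1 4 j + p.1.1.1 6 6 * p.1.1.1 3 j = (if j = 3 then 1 else 0) := by
  have hI := isIsom_entries p.2.1
  have hc := PH.col hp
  constructor
  · have := hI 1 j
    rw [hc 0 1 (by simp) (by decide) (by decide), hc 7 1 (by simp) (by decide) (by decide),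
      hc 4 1 (by simp) (by decide) (by decide), hc 2 1 (by simp) (by decide) (by decide),
      hc 5 1 (by simp) (by decide) (by decide), hc 3 1 (by simp) (by decide) (by decide)] at this
    have e : octGram R 1 j = -(if j = 4 then 1 else 0) := by
      fin_cases j <;> simp [octGram]
    rw [e] at this; linear_combination -this
  · have := hI 6 j
    rw [hc 0 6 (by simp) (by decide) (by decide), hc 7 6 (by simp) (by decide) (by decide),
      hc 4 6 (by simp) (by decide) (by decide), hc 2 6 (by simp) (by decide) (by decide),
      hc 5 6 (by simp) (by decide) (by decide), hc 3 6 (by simp) (by decide) (by decide)] at this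
    have e : octGram R 6 j = -(if j = 3 then 1 else 0) := by
      fin_cases j <;> simp [octGram]
    rw [e] at this; linear_combination -this

theorem PH.leviDet_mul_dualDet {p : Spin8 R} (hp : p ∈ PH R) : leviDet p * dualDet p = 1 := by
  have a := PH.block hp 3
  have b := PH.block hp 4
  simp at a b
  obtain ⟨a1, a2⟩ := a
  obtain ⟨b1, b2⟩ := b
  rw [leviDet, dualDet]
  linear_combination (p.1.1.1 1 6 * p.1.1.1 4 3 + p.1.1.1 6 6 * p.1.1.1 3 3) * b1 -
    (p.1.1.1 1 6 * p.1.1.1 4 4 + p.1.1.1 6 6 * p.1.1.1 3 4) * a1 + a2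

theorem PH.row {p : Spin8 R} (hp : p ∈ PH R) :
    p.1.1.1 3 = p.1.1.1 3 3 • Pi.single 3 1 + p.1.1.1 3 4 • Pi.single 4 1 ∧
    p.1.1.1 4 = p.1.1.1 4 3 • Pi.single 3 1 + p.1.1.1 4 4 • Pi.single 4 1 := by
  have hd := PH.leviDet_mul_dualDet hp
  have key : ∀ j, j ≠ 3 → j ≠ 4 → p.1.1.1 3 j = 0 ∧ p.1.1.1 4 j = 0 := by
    intro j h3 h4
    obtain ⟨e1, e2⟩ := PH.block hp j
    rw [if_neg h4] at e1
    rw [if_neg h3] at e2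
    have a : leviDet p * p.1.1.1 3 j = 0 := by
      rw [leviDet]; linear_combination p.1.1.1 1 1 * e2 - p.1.1.1 1 6 * e1
    have b : leviDet p * p.1.1.1 4 j = 0 := by
      rw [leviDet]; linear_combination p.1.1.1 6 6 * e1 - p.1.1.1 6 1 * e2
    constructor
    · linear_combination dualDet p * a - p.1.1.1 3 j * hd
    · linear_combination dualDet p * b - p.1.1.1 4 j * hd
  constructor
  · ext j
    by_cases h3 : j = 3
    · subst h3; simp
    by_cases h4 : j = 4
    · subst h4; simp
    simp [Pi.single_eq_of_ne h3, Pi.single_eq_of_ne h4, (key j h3 h4).1]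
  · ext j
    by_cases h3 : j = 3
    · subst h3; simp
    by_cases h4 : j = 4
    · subst h4; simp
    simp [Pi.single_eq_of_ne h3, Pi.single_eq_of_ne h4, (key j h3 h4).2]

theorem rowA_PH_mul {p : Spin8 R} (hp : p ∈ PH R) (h : Spin8 R) :
    rowA (p * h) = p.1.1.1 3 3 • rowA h + p.1.1.1 3 4 • rowB h := by
  rw [rowA, spin_mul_row, (PH.row hp).1, Matrix.add_vecMul, Matrix.smul_vecMul, Matrix.smul_vecMul,
    Matrix.single_one_vecMul, Matrix.single_one_vecMul]; simp; rfl

theorem rowB_PH_mul {p : Spin8 R} (hp : p ∈ PH R) (h : Spin8 R) :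
    rowB (p * h) = p.1.1.1 4 3 • rowA h + p.1.1.1 4 4 • rowB h := by
  rw [rowB, spin_mul_row, (PH.row hp).2, Matrix.add_vecMul, Matrix.smul_vecMul, Matrix.smul_vecMul,
    Matrix.single_one_vecMul, Matrix.single_one_vecMul]; simp; rfl

theorem pm_PH_mul {p : Spin8 R} (hp : p ∈ PH R) (h : Spin8 R) (i j : Fin 8) :
    pm (rowA (p * h)) (rowB (p * h)) i j = dualDet p * pm (rowA h) (rowB h) i j := by
  rw [rowA_PH_mul hp, rowB_PH_mul hp, pm_lin]; rfl

theorem mulVec_inv_spin (h : Spin8 R) :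
    (h⁻¹).1.1.1 = octGram R * h.1.1.1ᵀ * octGram R := by
  have h1 : (octGram R * h.1.1.1ᵀ * octGram R) * h.1.1.1 = 1 := by
    calc _ = octGram R * (h.1.1.1ᵀ * octGram R * h.1.1.1) := by simp only [Matrix.mul_assoc]
      _ = 1 := by rw [h.2.1, octGram_mul_self]
  have h2 : h.1.1.1 * (h⁻¹).1.1.1 = 1 := h.1.1.mul_inv
  calc (h⁻¹).1.1.1 = ((octGram R * h.1.1.1ᵀ * octGram R) * h.1.1.1) * (h⁻¹).1.1.1 := by
        rw [h1, one_mul]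
    _ = _ := by rw [Matrix.mul_assoc, h2, mul_one]

theorem inPlane_inv_mulVec {q : Spin8 R} (h3 : ∀ j, j ≠ 3 → j ≠ 4 → q.1.1.1 3 j = 0)
    (h4 : ∀ j, j ≠ 3 → j ≠ 4 → q.1.1.1 4 j = 0) {x : Fin 8 → R} (hx : InPlane x) :
    InPlane ((q⁻¹).1.1.1 *ᵥ x) := by
  intro i h1 h6
  have e : x = x 1 • Pi.single 1 1 + x 6 • Pi.single 6 1 := by
    ext j
    by_cases h1 : j = 1
    · subst h1; simp
    by_cases h6 : j = 6
    · subst h6; simp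
    simp [Pi.single_eq_of_ne h1, Pi.single_eq_of_ne h6, hx j h1 h6]
  rw [e, Matrix.mulVec_add, Matrix.mulVec_smul, Matrix.mulVec_smul, Matrix.mulVec_single_one,
    Matrix.mulVec_single_one, mulVec_inv_spin]
  have c1 : (octGram R * q.1.1.1ᵀ * octGram R).col 1 = -(octGram R *ᵥ q.1.1.1 4) := by
    have hG : octGram R *ᵥ Pi.single 1 1 = - Pi.single 4 1 := by
      ext i; fin_cases i <;> simp [octGram]
    rw [← Matrix.mulVec_single_one, ← Matrix.mulVec_mulVec, ← Matrix.mulVec_mulVec, hG,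
      Matrix.mulVec_neg, Matrix.mulVec_single_one, Matrix.mulVec_neg]
    rfl
  have c6 : (octGram R * q.1.1.1ᵀ * octGram R).col 6 = -(octGram R *ᵥ q.1.1.1 3) := by
    have hG : octGram R *ᵥ Pi.single 6 1 = - Pi.single 3 1 := by
      ext i; fin_cases i <;> simp [octGram]
    rw [← Matrix.mulVec_single_one, ← Matrix.mulVec_mulVec, ← Matrix.mulVec_mulVec, hG,
      Matrix.mulVec_neg, Matrix.mulVec_single_one, Matrix.mulVec_neg]
    rfl
  have v : ∀ y : Fin 8 → R, (∀ j, j ≠ 3 → j ≠ 4 → y j = 0) → (octGram R *ᵥ y) i = 0 := by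
    intro y hy
    have y0 := hy 0 (by decide) (by decide)
    have y1 := hy 1 (by decide) (by decide)
    have y2 := hy 2 (by decide) (by decide)
    have y5 := hy 5 (by decide) (by decide)
    have y6 := hy 6 (by decide) (by decide)
    have y7 := hy 7 (by decide) (by decide)
    clear e
    fin_cases i <;> simp [octGram, y0, y1, y2, y5, y6, y7, Matrix.vecHead, Matrix.vecTail] at h1 h6 ⊢
  rw [c1, c6]
  simp [v _ h3, v _ h4]

theorem mem_PH_of_rows {q : Spin8 R} {c : R} (h3 : q.1.1.1 3 = Pi.single 3 1)
    (h4 : q.1.1.1 4 = Pi.single 4 1 + c • Pi.single 3 1) : q ∈ PH R := by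
  have hq : q.1.1.1 * (q⁻¹).1.1.1 = 1 := q.1.1.mul_inv
  have i3 : (q⁻¹).1.1.1 3 = Pi.single 3 1 := by
    have h1 := congrFun hq 3
    have h2 : (q.1.1.1 * (q⁻¹).1.1.1) 3 = q.1.1.1 3 ᵥ* (q⁻¹).1.1.1 := rfl
    rw [h2, h3, Matrix.single_one_vecMul] at h1
    refine Eq.trans h1 ?_
    ext j; simp [Matrix.one_apply, Pi.single_apply, eq_comm]
  have i4 : (q⁻¹).1.1.1 4 = Pi.single 4 1 - c • Pi.single 3 1 := by
    have h1 := congrFun hq 4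
    have h2 : (q.1.1.1 * (q⁻¹).1.1.1) 4 = q.1.1.1 4 ᵥ* (q⁻¹).1.1.1 := rfl
    rw [h2, h4, Matrix.add_vecMul, Matrix.smul_vecMul, Matrix.single_one_vecMul,
      Matrix.single_one_vecMul] at h1
    have h5 : (q⁻¹).1.1.1.row 3 = Pi.single 3 1 := i3
    rw [h5] at h1
    refine Eq.trans (eq_sub_of_add_eq h1) ?_
    congr 1
    ext j; simp [Matrix.one_apply, Pi.single_apply, eq_comm]
  intro x
  constructor
  · intro hx
    have := inPlane_inv_mulVec (q := q) (fun j h _ => by rw [h3, Pi.single_eq_of_ne h])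
      (fun j h h' => by rw [h4]; simp [Pi.single_eq_of_ne h, Pi.single_eq_of_ne h']) hx
    rw [Matrix.mulVec_mulVec] at this
    have h' : (q⁻¹).1.1.1 * q.1.1.1 = 1 := q.1.1.inv_mul
    rwa [h', Matrix.one_mulVec] at this
  · intro hx
    have := inPlane_inv_mulVec (q := q⁻¹) (fun j h _ => by rw [i3, Pi.single_eq_of_ne h])
      (fun j h h' => by rw [i4]; simp [Pi.single_eq_of_ne h, Pi.single_eq_of_ne h']) hx
    rwa [inv_inv] at this

theorem mem_unipUmu_iff {u : G2 R} (hu : u ∈ unipU R) : u ∈ unipUmu R ↔ psiArg u = 0 := by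
  obtain ⟨a, b, c, d, e, rfl⟩ := exists_eq_uElt hu
  rw [psiArg_uElt]
  set q : Spin8 R := muH R * G2.toSpin8 (uElt a b c d e) * (muH R)⁻¹ with hq
  have hm : uElt a b c d e ∈ unipUmu R ↔ q ∈ PH R := by
    rw [unipUmu, Subgroup.mem_inf]
    exact ⟨fun h => h.2, fun h => ⟨hu, h⟩⟩
  have hqm : q * muH R = muH R * G2.toSpin8 (uElt a b c d e) := by rw [hq]; group
  rw [hm]
  constructor
  · intro hp
    have e1 := rowB_PH_mul hp (muH R)
    have e2 : q.1.1.1 4 4 = 1 := by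
      have := congrFun e1 0
      rw [hqm, rowB_muH_mul, rowA, rowB, muH_row_three, muH_row_four, uElt_val] at this
      simpa [uMat] using this.symm
    have := congrFun e1 4
    rw [hqm, rowB_muH_mul, rowA, rowB, muH_row_three, muH_row_four, uElt_val] at this
    simp [uMat] at this
    linear_combination -this
  · intro h
    have inv : ∀ i, q.1.1.1 i = (muH R * G2.toSpin8 (uElt a b c d e)).1.1.1 i ᵥ*
        ((muH R)⁻¹).1.1.1 := fun i => rfl
    have hmu : (muH R).1.1.1 * ((muH R)⁻¹).1.1.1 = 1 := (muH R).1.1.mul_inv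
    have key : ∀ i, (muH R).1.1.1 i ᵥ* ((muH R)⁻¹).1.1.1 = Pi.single i 1 := by
      intro i
      refine Eq.trans (congrFun hmu i) ?_
      ext j; simp [Matrix.one_apply, Pi.single_apply, eq_comm]
    have r3 : (muH R * G2.toSpin8 (uElt a b c d e)).1.1.1 3 = (muH R).1.1.1 3 := by
      rw [muH_row_three]
      refine (rowA_muH_mul _).trans ?_
      rw [uElt_val]; ext j; fin_cases j <;> simp [uMat]
    have r4 : (muH R * G2.toSpin8 (uElt a b c d e)).1.1.1 4 =
        (muH R).1.1.1 4 + (c + d) • (muH R).1.1.1 3 := by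
      rw [muH_row_three, muH_row_four]
      refine (rowB_muH_mul _).trans ?_
      rw [uElt_val]; ext j; fin_cases j <;> simp [uMat]
      linear_combination -h
    refine mem_PH_of_rows (c := c + d) ?_ ?_
    · rw [inv, r3, key]
    · rw [inv, r4, Matrix.add_vecMul, Matrix.smul_vecMul, key, key]

end Pluecker

section TopG2

variable {R : Type*} [CommRing R] [TopologicalSpace R] [IsTopologicalRing R]

theorem G2.isInducing_val : IsInducing (fun g : G2 R => g.1.1) := by
  have h1 : IsInducing (fun g : G2 R => Units.embedProduct (Matrix (Fin 8) (Fin 8) R) g.1) :=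
    Units.isInducing_embedProduct.comp IsInducing.subtypeVal
  let F : Matrix (Fin 8) (Fin 8) R → Matrix (Fin 8) (Fin 8) R × (Matrix (Fin 8) (Fin 8) R)ᵐᵒᵖ :=
    fun M => (M, MulOpposite.op (octGram R * Mᵀ * octGram R))
  have hF : Continuous F := by
    refine continuous_id.prodMk (MulOpposite.continuous_op.comp ?_)
    exact (continuous_const.matrix_mul (continuous_id.matrix_transpose)).matrix_mul continuous_const
  have h2 : (fun g : G2 R => Units.embedProduct (Matrix (Fin 8) (Fin 8) R) g.1) =
      F ∘ (fun g : G2 R => g.1.1) := by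
    funext g
    exact Prod.ext rfl (congrArg MulOpposite.op (G2.val_inv g))
  rw [h2] at h1
  refine IsInducing.of_comp ?_ hF h1
  exact Units.continuous_val.comp continuous_subtype_val

theorem G2.tendsto_iff {α : Type*} {l : Filter α} {f : α → G2 R} {g : G2 R} :
    Filter.Tendsto f l (𝓝 g) ↔
      ∀ i j, Filter.Tendsto (fun x => (f x).1.1 i j) l (𝓝 (g.1.1 i j)) := by
  exact G2.isInducing_val.tendsto_nhds_iff.trans
    (tendsto_pi_nhds.trans (forall_congr' fun i => tendsto_pi_nhds))

theorem G2.continuous_iff {X : Type*} [TopologicalSpace X] {f : X → G2 R} :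
    Continuous f ↔ ∀ i j, Continuous (fun x => (f x).1.1 i j) := by
  exact G2.isInducing_val.continuous_iff.trans
    (continuous_pi_iff.trans (forall_congr' fun i => continuous_pi_iff))

theorem G2.continuous_entry (i j : Fin 8) : Continuous (fun g : G2 R => g.1.1 i j) :=
  (G2.continuous_iff.1 continuous_id) i j

theorem continuous_elem8 (i j k l : Fin 8) {f g : R → R} (hf : Continuous f) (hg : Continuous g) :
    Continuous fun r => elem8 i j (f r) k l (g r) := by
  refine (continuous_const.add ?_).add ?_
  · exact continuous_matrix fun a b => by
      simp only [Matrix.single_apply]; split_ifs <;> fun_prop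
  · exact continuous_matrix fun a b => by
      simp only [Matrix.single_apply]; split_ifs <;> fun_prop

theorem G2.continuous_of_val {X : Type*} [TopologicalSpace X] {f : X → G2 R}
    (h : Continuous fun x => (f x).1.1) : Continuous f :=
  G2.isInducing_val.continuous_iff.2 h

theorem continuous_xB : Continuous (xB : R → G2 R) :=
  G2.continuous_of_val (continuous_elem8 _ _ _ _ continuous_id continuous_neg)
theorem continuous_x3AB : Continuous (x3AB : R → G2 R) :=
  G2.continuous_of_val (continuous_elem8 _ _ _ _ continuous_id continuous_neg)
theorem continuous_x3A2B : Continuous (x3A2B : R → G2 R) :=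
  G2.continuous_of_val (continuous_elem8 _ _ _ _ continuous_id continuous_neg)
theorem continuous_xA : Continuous (xA : R → G2 R) := by
  refine G2.continuous_iff.2 fun i j => ?_
  change Continuous fun r => xAMat r i j
  fin_cases i <;> fin_cases j <;> simp [xAMat] <;> fun_prop
theorem continuous_xAB : Continuous (xAB : R → G2 R) := by
  refine G2.continuous_iff.2 fun i j => ?_
  change Continuous fun r => xABMat r i j
  fin_cases i <;> fin_cases j <;> simp [xABMat] <;> fun_prop
theorem continuous_x2AB : Continuous (x2AB : R → G2 R) := by
  refine G2.continuous_iff.2 fun i j => ?_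
  change Continuous fun r => x2ABMat r i j
  fin_cases i <;> fin_cases j <;> simp [x2ABMat] <;> fun_prop

theorem G2.continuous_tr : Continuous (G2.tr : G2 R → G2 R) :=
  G2.continuous_iff.2 fun i j => by
    simp only [G2.tr_val, Matrix.transpose_apply]; exact G2.continuous_entry j i

end TopG2

section OneParam

variable {R : Type*} [CommRing R]

theorem xA_add (r s : R) : xA (r + s) = xA r * xA s := by
  refine G2.ext_val ?_
  change xAMat (r + s) = xAMat r * xAMat s
  refine Matrix.ext_of_mulVec_single fun j => ?_
  simp only [← Matrix.mulVec_mulVec, xAMat_mulVec]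
  ext i; fin_cases i <;> simp <;> ring
theorem xAB_add (r s : R) : xAB (r + s) = xAB r * xAB s := by
  refine G2.ext_val ?_
  change xABMat (r + s) = xABMat r * xABMat s
  refine Matrix.ext_of_mulVec_single fun j => ?_
  simp only [← Matrix.mulVec_mulVec, xABMat_mulVec]
  ext i; fin_cases i <;> simp <;> ring
theorem x2AB_add (r s : R) : x2AB (r + s) = x2AB r * x2AB s := by
  refine G2.ext_val ?_
  change x2ABMat (r + s) = x2ABMat r * x2ABMat s
  refine Matrix.ext_of_mulVec_single fun j => ?_
  simp only [← Matrix.mulVec_mulVec, x2ABMat_mulVec]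
  ext i; fin_cases i <;> simp <;> ring
theorem xB_add (r s : R) : xB (r + s) = xB r * xB s := by
  refine G2.ext_val ?_
  change elem8 1 2 (r + s) 5 4 (-(r + s)) = elem8 1 2 r 5 4 (-r) * elem8 1 2 s 5 4 (-s)
  refine Matrix.ext_of_mulVec_single fun j => ?_
  simp only [← Matrix.mulVec_mulVec, elem8_mulVec]
  ext i; fin_cases i <;> simp <;> ring
theorem x3AB_add (r s : R) : x3AB (r + s) = x3AB r * x3AB s := by
  refine G2.ext_val ?_
  change elem8 2 3 (r + s) 6 5 (-(r + s)) = elem8 2 3 r 6 5 (-r) * elem8 2 3 s 6 5 (-s)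
  refine Matrix.ext_of_mulVec_single fun j => ?_
  simp only [← Matrix.mulVec_mulVec, elem8_mulVec]
  ext i; fin_cases i <;> simp <;> ring
theorem x3A2B_add (r s : R) : x3A2B (r + s) = x3A2B r * x3A2B s := by
  refine G2.ext_val ?_
  change elem8 1 3 (r + s) 6 4 (-(r + s)) = elem8 1 3 r 6 4 (-r) * elem8 1 3 s 6 4 (-s)
  refine Matrix.ext_of_mulVec_single fun j => ?_
  simp only [← Matrix.mulVec_mulVec, elem8_mulVec]
  ext i; fin_cases i <;> simp <;> ring

/-- A map from the additive group of `R` to a group as a homomorphism. -/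
def addParam {X : Type*} [Group X] (f : R → X) (hf : ∀ r s, f (r + s) = f r * f s) :
    Multiplicative R →* X :=
  MonoidHom.mk' (fun r => f r.toAdd) (fun _ _ => hf _ _)

theorem addParam_zero {X : Type*} [Group X] {f : R → X} (hf : ∀ r s, f (r + s) = f r * f s) :
    f 0 = 1 := (addParam f hf).map_one

theorem addParam_neg {X : Type*} [Group X] {f : R → X} (hf : ∀ r s, f (r + s) = f r * f s) (r : R) :
    f (-r) = (f r)⁻¹ := (addParam f hf).map_inv (Multiplicative.ofAdd r)

/-- The diagonal torus of `G`. -/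
def torus (a b : Rˣ) : G2 R :=
  G2.mk' (Matrix.diagonal ![1, a, b, ↑(a * b)⁻¹, ↑a⁻¹, ↑b⁻¹, a * b, 1])
    (isIsom_of fun x y => by
      rw [octGram_polar, octGram_polar]
      have ha : (a : R) * ↑a⁻¹ = 1 := a.mul_inv
      have hb : (b : R) * ↑b⁻¹ = 1 := b.mul_inv
      simp only [Matrix.mulVec_diagonal, octNorm, mul_inv, Units.val_mul, Pi.add_apply]
      simp
      linear_combination (x 1 * y 4 + x 4 * y 1) * (-ha) + (x 2 * y 5 + x 5 * y 2) * (-hb) +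
        (x 3 * y 6 + x 6 * y 3) * (-(a : R) * ↑a⁻¹ * hb - ha))
    (fun x y => by
      have ha : (a : R) * ↑a⁻¹ = 1 := a.mul_inv
      have hb : (b : R) * ↑b⁻¹ = 1 := b.mul_inv
      have e : ∀ z : Fin 8 → R, Matrix.diagonal ![1, (a : R), b, ↑(a * b)⁻¹, ↑a⁻¹, ↑b⁻¹, a * b, 1]
          *ᵥ z = ![z 0, a * z 1, b * z 2, ↑a⁻¹ * ↑b⁻¹ * z 3, ↑a⁻¹ * z 4, ↑b⁻¹ * z 5,
            a * b * z 6, z 7] := by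
        intro z; ext i; fin_cases i <;> simp [Matrix.mulVec_diagonal]; ring
      rw [e, e, e]
      generalize ((a⁻¹ : Rˣ) : R) = a' at *
      generalize ((b⁻¹ : Rˣ) : R) = b' at *
      ext i; fin_cases i <;> simp [octMul]
      · linear_combination (-(x 1 * y 4)) * ha - (x 2 * y 5) * hb - (x 3 * y 6) * (a * a' * hb + ha)
      · linear_combination (a * (x 5 * y 6 - x 6 * y 5)) * hb
      · linear_combination (b * (x 6 * y 4 - x 4 * y 6)) * ha
      · ring
      · linear_combination (-a' * (x 2 * y 3 - x 3 * y 2)) * hb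
      · linear_combination (-b' * (x 3 * y 1 - x 1 * y 3)) * ha
      · ring
      · linear_combination (-(x 4 * y 1)) * ha - (x 5 * y 2) * hb - (x 6 * y 3) * (a * a' * hb + ha))

theorem torus_val (a b : Rˣ) : (torus a b).1.1 =
    Matrix.diagonal ![1, (a : R), b, ↑(a * b)⁻¹, ↑a⁻¹, ↑b⁻¹, a * b, 1] := rfl

theorem torus_mul (a b a' b' : Rˣ) : torus (a * a') (b * b') = torus a b * torus a' b' := by
  refine G2.ext_val ?_
  rw [G2.val_mul, torus_val, torus_val, torus_val, Matrix.diagonal_mul_diagonal]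
  congr 1
  ext i
  fin_cases i <;> simp <;> ring

theorem torus_one : torus (1 : Rˣ) 1 = 1 := by
  refine G2.ext_val ?_
  rw [torus_val, G2.val_one, ← Matrix.diagonal_one]
  congr 1
  ext i
  fin_cases i <;> simp

end OneParam

section Elimination

variable {k : Type*} [Field k]

open scoped Classical in
/-- The diagonal torus with field parameters. -/
def torusF (a b : k) : G2 k :=
  if h : a ≠ 0 ∧ b ≠ 0 then torus (Units.mk0 a h.1) (Units.mk0 b h.2) else 1

theorem torusF_val {a b : k} (ha : a ≠ 0) (hb : b ≠ 0) : (torusF a b).1.1 =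
    Matrix.diagonal ![1, a, b, (a * b)⁻¹, a⁻¹, b⁻¹, a * b, 1] := by
  rw [torusF, dif_pos ⟨ha, hb⟩, torus_val]
  simp [mul_comm]

theorem torusF_mul {a b a' b' : k} (ha : a ≠ 0) (hb : b ≠ 0) (ha' : a' ≠ 0) (hb' : b' ≠ 0) :
    torusF (a * a') (b * b') = torusF a b * torusF a' b' := by
  rw [torusF, torusF, torusF, dif_pos ⟨mul_ne_zero ha ha', mul_ne_zero hb hb'⟩,
    dif_pos ⟨ha, hb⟩, dif_pos ⟨ha', hb'⟩, ← torus_mul]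
  congr 1 <;> ext <;> simp

theorem G2.norm_row_three (g : G2 k) :
    g.1.1 3 0 * g.1.1 3 7 = g.1.1 3 1 * g.1.1 3 4 + g.1.1 3 2 * g.1.1 3 5 +
      g.1.1 3 3 * g.1.1 3 6 := by
  have h := congrFun (G2.row_mul g 3 3) 0
  rw [transpose_mulVec_apply] at h
  have h3 := G2.trace_three g
  simp [octMul] at h
  linear_combination -h + g.1.1 3 0 * h3

/-- The first half of the elimination. -/
def elimA (r₀ r₁ r₂ r₃ r₄ : k) : G2 k :=
  x3A2B r₄ * x3AB r₃ * x2AB r₂ * xAB r₁ * xA r₀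

/-- The elements used to move the rows `3`, `4` of an automorphism to the basis vectors. -/
def elimElt (r : Fin 7 → k) (a b : k) : G2 k :=
  G2.tr (xA (r 6)) * torusF a b * xB (r 5) * elimA (r 0) (r 1) (r 2) (r 3) (r 4)

theorem elim_vec (x : Fin 8 → k) (r₀ r₁ r₂ r₃ r₄ : k)
    (a0 : x 4 + r₀ * x 3 = 0) (a1 : x 5 = r₁ * x 3) (a2 : x 0 - r₀ * x 5 + r₂ * x 3 = 0)
    (a3 : x 2 + r₀ * x 0 - r₀ * x 7 - r₀ ^ 2 * x 5 + r₃ * x 3 = 0)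
    (a4 : x 1 + r₁ * (x 0 - r₀ * x 5) - r₁ * (x 7 + r₀ * x 5) + r₄ * x 3 = 0)
    {A : Fin 8 → k} (e : A = elem8 1 3 r₄ 6 4 (-r₄) *ᵥ
      (elem8 2 3 r₃ 6 5 (-r₃) *ᵥ (x2ABMat r₂ *ᵥ (xABMat r₁ *ᵥ (xAMat r₀ *ᵥ x))))) :
    A 0 = 0 ∧ A 1 = 0 ∧ A 2 = 0 ∧ A 3 = x 3 ∧ A 4 = 0 ∧ A 5 = 0 := by
  rw [elem8_mulVec, elem8_mulVec, x2ABMat_mulVec, xABMat_mulVec, xAMat_mulVec] at e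
  refine ⟨?_, ?_, ?_, ?_, ?_, ?_⟩ <;> rw [e] <;> simp
  · linear_combination a2 - r₁ * a0
  · linear_combination a4 - r₁ ^ 2 * a0 + r₂ * a1
  · linear_combination a3 - r₂ * a0
  · linear_combination a0
  · linear_combination a1

theorem elimA_row (g : G2 k) (r₀ r₁ r₂ r₃ r₄ : k) (i : Fin 8) :
    (g * G2.tr (elimA r₀ r₁ r₂ r₃ r₄)).1.1 i = elem8 1 3 r₄ 6 4 (-r₄) *ᵥ
      (elem8 2 3 r₃ 6 5 (-r₃) *ᵥ (x2ABMat r₂ *ᵥ (xABMat r₁ *ᵥ (xAMat r₀ *ᵥ g.1.1 i)))) := by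
  have h : (elimA r₀ r₁ r₂ r₃ r₄).1.1 = elem8 1 3 r₄ 6 4 (-r₄) * elem8 2 3 r₃ 6 5 (-r₃) *
    x2ABMat r₂ * xABMat r₁ * xAMat r₀ := rfl
  simp only [Matrix.mulVec_mulVec]
  rw [← Matrix.vecMul_transpose]
  simp only [← Matrix.mul_assoc]
  rw [← h, ← G2.tr_val]
  rfl

theorem elimA_col_three (g : G2 k) (h3 : g.1.1 3 3 ≠ 0) (r₀ r₁ r₂ r₃ r₄ : k)
    (h0 : r₀ = -g.1.1 3 4 / g.1.1 3 3) (h1 : r₁ = g.1.1 3 5 / g.1.1 3 3)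
    (h2 : r₂ = -(g.1.1 3 0 - r₀ * g.1.1 3 5) / g.1.1 3 3)
    (h4 : r₃ = -(g.1.1 3 2 + r₀ * g.1.1 3 0 - r₀ * g.1.1 3 7 - r₀ ^ 2 * g.1.1 3 5)
      / g.1.1 3 3)
    (h5 : r₄ = -(g.1.1 3 1 + r₁ * (g.1.1 3 0 - r₀ * g.1.1 3 5) -
      r₁ * (g.1.1 3 7 + r₀ * g.1.1 3 5)) / g.1.1 3 3) :
    (g * G2.tr (elimA r₀ r₁ r₂ r₃ r₄)).1.1 3 = g.1.1 3 3 • Pi.single 3 1 := by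
  have t' := G2.trace_three (g * G2.tr (elimA r₀ r₁ r₂ r₃ r₄))
  have n' := G2.norm_row_three (g * G2.tr (elimA r₀ r₁ r₂ r₃ r₄))
  obtain ⟨c0, c1, c2, c3, c4, c5⟩ := elim_vec (g.1.1 3) r₀ r₁ r₂ r₃ r₄
    (by rw [h0]; field_simp; ring) (by rw [h1]; field_simp) (by rw [h2]; field_simp; ring)
    (by rw [h4]; field_simp; ring) (by rw [h5]; field_simp; ring) (elimA_row g r₀ r₁ r₂ r₃ r₄ 3)
  generalize (g * G2.tr (elimA r₀ r₁ r₂ r₃ r₄)).1.1 3 = A at t' n' c0 c1 c2 c3 c4 c5 ⊢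
  have c7 : A 7 = 0 := by rw [t', c0, neg_zero]
  have c6 : A 6 = 0 := by
    rw [c0, c1, c2, c3] at n'
    simpa [h3] using n'
  ext j; fin_cases j <;> simp [c0, c1, c2, c3, c4, c5, c6, c7]

variable [TopologicalSpace k] [IsTopologicalDivisionRing k]

theorem tendsto_torusF {α : Type*} {l : Filter α} {a b : α → k} {a₀ b₀ : k} (ha₀ : a₀ ≠ 0)
    (hb₀ : b₀ ≠ 0) [T1Space k] (ha : Filter.Tendsto a l (𝓝 a₀)) (hb : Filter.Tendsto b l (𝓝 b₀)) :
    Filter.Tendsto (fun x => torusF (a x) (b x)) l (𝓝 (torusF a₀ b₀)) := by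
  rw [G2.tendsto_iff]
  intro i j
  have ea : ∀ᶠ x in l, a x ≠ 0 := ha.eventually_ne ha₀
  have eb : ∀ᶠ x in l, b x ≠ 0 := hb.eventually_ne hb₀
  rw [torusF_val ha₀ hb₀]
  have : Filter.Tendsto (fun x => Matrix.diagonal ![1, a x, b x, (a x * b x)⁻¹, (a x)⁻¹, (b x)⁻¹,
      a x * b x, 1] i j) l
      (𝓝 (Matrix.diagonal ![1, a₀, b₀, (a₀ * b₀)⁻¹, a₀⁻¹, b₀⁻¹, a₀ * b₀, 1] i j)) := by
    by_cases hij : i = j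
    · subst hij
      simp only [Matrix.diagonal_apply_eq]
      fin_cases i
      · exact tendsto_const_nhds
      · exact ha
      · exact hb
      · exact (ha.mul hb).inv₀ (mul_ne_zero ha₀ hb₀)
      · exact ha.inv₀ ha₀
      · exact hb.inv₀ hb₀
      · exact ha.mul hb
      · exact tendsto_const_nhds
    · simp only [Matrix.diagonal_apply_ne _ hij]
      exact tendsto_const_nhds
  refine this.congr' ?_
  filter_upwards [ea, eb] with x h1 h2
  rw [torusF_val h1 h2]

theorem tendsto_elimA {α : Type*} {l : Filter α} {r₀ r₁ r₂ r₃ r₄ : α → k}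
    (h0 : Filter.Tendsto r₀ l (𝓝 0)) (h1 : Filter.Tendsto r₁ l (𝓝 0))
    (h2 : Filter.Tendsto r₂ l (𝓝 0)) (h3 : Filter.Tendsto r₃ l (𝓝 0))
    (h4 : Filter.Tendsto r₄ l (𝓝 0)) :
    Filter.Tendsto (fun x => elimA (r₀ x) (r₁ x) (r₂ x) (r₃ x) (r₄ x)) l (𝓝 1) := by
  have key : ∀ {f : k → G2 k} (_ : Continuous f) (_ : ∀ r s, f (r + s) = f r * f s) {r : α → k}
      (_ : Filter.Tendsto r l (𝓝 0)), Filter.Tendsto (fun x => f (r x)) l (𝓝 1) := by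
    intro f hf hadd r hr
    have := (hf.tendsto 0).comp hr
    rwa [addParam_zero hadd] at this
  have := ((((key continuous_x3A2B x3A2B_add h4).mul (key continuous_x3AB x3AB_add h3)).mul
    (key continuous_x2AB x2AB_add h2)).mul (key continuous_xAB xAB_add h1)).mul
    (key continuous_xA xA_add h0)
  simpa [elimA] using this

theorem tendsto_elimElt [T1Space k] {α : Type*} {l : Filter α} {r : Fin 7 → α → k} {a b : α → k}
    (hr : ∀ i, Filter.Tendsto (r i) l (𝓝 0)) (ha : Filter.Tendsto a l (𝓝 1))
    (hb : Filter.Tendsto b l (𝓝 1)) :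
    Filter.Tendsto (fun x => elimElt (fun i => r i x) (a x) (b x)) l (𝓝 1) := by
  have h1 : Filter.Tendsto (fun x => G2.tr (xA (r 6 x))) l (𝓝 1) := by
    have := ((G2.continuous_tr.comp continuous_xA).tendsto 0).comp (hr 6)
    simp only [Function.comp_def] at this
    rwa [addParam_zero xA_add, show G2.tr (1 : G2 k) = 1 from
      G2.ext_val (by rw [G2.tr_val, G2.val_one, Matrix.transpose_one])] at this
  have h2 : Filter.Tendsto (fun x => xB (r 5 x)) l (𝓝 1) := by
    have := (continuous_xB.tendsto 0).comp (hr 5)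
    rwa [addParam_zero xB_add] at this
  have h3 : torusF (1 : k) 1 = 1 := by
    rw [torusF, dif_pos ⟨one_ne_zero, one_ne_zero⟩, ← torus_one]
    congr 1 <;> ext <;> simp
  have h4 := tendsto_torusF one_ne_zero one_ne_zero ha hb
  rw [h3] at h4
  have := ((h1.mul h4).mul h2).mul (tendsto_elimA (hr 0) (hr 1) (hr 2) (hr 3) (hr 4))
  simpa [elimElt] using this

/-- Elements of `G` whose rows `3`, `4` are close to the basis vectors are products of an element of
`U` and an element close to the identity. -/
theorem exists_elim [T1Space k] {α : Type*} {l : Filter α} {g : α → G2 k}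
    (hg3 : ∀ j, Filter.Tendsto (fun x => (g x).1.1 3 j) l (𝓝 ((Pi.single 3 1 : Fin 8 → k) j)))
    (hg4 : ∀ j, Filter.Tendsto (fun x => (g x).1.1 4 j) l (𝓝 ((Pi.single 4 1 : Fin 8 → k) j))) :
    ∃ (r : Fin 7 → α → k) (a b : α → k), (∀ i, Filter.Tendsto (r i) l (𝓝 0)) ∧
      Filter.Tendsto a l (𝓝 1) ∧ Filter.Tendsto b l (𝓝 1) ∧
      ∀ᶠ x in l, g x * G2.tr (elimElt (fun i => r i x) (a x) (b x)) ∈ unipU k := by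
  have t30 := hg3 0
  have t31 := hg3 1
  have t32 := hg3 2
  have t33 := hg3 3
  have t34 := hg3 4
  have t35 := hg3 5
  have t37 := hg3 7
  simp at t30 t31 t32 t33 t34 t35 t37
  let A : Fin 8 → α → k := fun j x => (g x).1.1 3 j
  let r0 : α → k := fun x => -A 4 x / A 3 x
  let r1 : α → k := fun x => A 5 x / A 3 x
  let r2 : α → k := fun x => -(A 0 x - r0 x * A 5 x) / A 3 x
  let r3 : α → k := fun x =>
    -(A 2 x + r0 x * A 0 x - r0 x * A 7 x - r0 x ^ 2 * A 5 x) / A 3 x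
  let r4 : α → k := fun x => -(A 1 x + r1 x * (A 0 x - r0 x * A 5 x) -
      r1 x * (A 7 x + r0 x * A 5 x)) / A 3 x
  have zero_of : ∀ {f : α → k} {c : k}, Filter.Tendsto f l (𝓝 c) → c = 0 →
      Filter.Tendsto f l (𝓝 0) := fun h hc => hc ▸ h
  have q0 : Filter.Tendsto r0 l (𝓝 0) := zero_of (t34.neg.div t33 one_ne_zero) (by simp)
  have q1 : Filter.Tendsto r1 l (𝓝 0) := zero_of (t35.div t33 one_ne_zero) (by simp)
  have q2 : Filter.Tendsto r2 l (𝓝 0) :=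
    zero_of (((t30.sub (q0.mul t35)).neg).div t33 one_ne_zero) (by simp)
  have q3 : Filter.Tendsto r3 l (𝓝 0) :=
    zero_of (((((t32.add (q0.mul t30)).sub (q0.mul t37)).sub ((q0.pow 2).mul t35)).neg).div t33
      one_ne_zero) (by simp)
  have q4 : Filter.Tendsto r4 l (𝓝 0) :=
    zero_of ((((t31.add (q1.mul (t30.sub (q0.mul t35)))).sub
      (q1.mul (t37.add (q0.mul t35)))).neg).div t33 one_ne_zero) (by simp)
  let w : α → G2 k := fun x => elimA (r0 x) (r1 x) (r2 x) (r3 x) (r4 x)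
  have hw : Filter.Tendsto w l (𝓝 1) := tendsto_elimA q0 q1 q2 q3 q4
  let h : α → G2 k := fun x => g x * G2.tr (w x)
  have e3 : ∀ᶠ x in l, (g x).1.1 3 3 ≠ 0 := t33.eventually_ne one_ne_zero
  have hrow3 : ∀ x, (g x).1.1 3 3 ≠ 0 → (h x).1.1 3 = (g x).1.1 3 3 • Pi.single 3 1 := by
    intro x hx
    exact elimA_col_three (g x) hx _ _ _ _ _ rfl rfl rfl rfl rfl
  have hrow4 : ∀ x, (g x).1.1 3 3 ≠ 0 → (h x).1.1 4 0 = 0 ∧ (h x).1.1 4 1 = 0 ∧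
      (h x).1.1 4 2 = 0 ∧ (h x).1.1 4 6 = 0 ∧ (h x).1.1 4 7 = 0 := by
    intro x hx
    have e := G2.row34 (h x)
    have tr4 := G2.row_trace (h x) 4
    rw [hrow3 x hx] at e
    have b1 : (h x).1.1 4 1 = 0 := by simpa [octMul, hx] using congrFun e 5
    have b2 : (h x).1.1 4 2 = 0 := by simpa [octMul, hx] using congrFun e 4
    have b6 : (h x).1.1 4 6 = 0 := by simpa [octMul, hx] using congrFun e 0
    have b7 : (h x).1.1 4 7 = 0 := by simpa [octMul, hx] using congrFun e 3
    refine ⟨?_, b1, b2, b6, b7⟩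
    simpa [b7] using tr4
  have hh4 : ∀ j, Filter.Tendsto (fun x => (h x).1.1 4 j) l
      (𝓝 ((Pi.single 4 1 : Fin 8 → k) j)) := by
    intro j
    have e : ∀ x, (h x).1.1 4 j = ∑ i, (g x).1.1 4 i * (w x).1.1 j i := by
      intro x
      change ((g x).1.1 * (G2.tr (w x)).1.1) 4 j = _
      rw [G2.tr_val]; rfl
    simp only [e]
    have : Filter.Tendsto (fun x => ∑ i, (g x).1.1 4 i * (w x).1.1 j i) l
        (𝓝 (∑ i, (Pi.single 4 1 : Fin 8 → k) i * (1 : Matrix (Fin 8) (Fin 8) k) j i)) :=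
      tendsto_finsetSum _ fun i _ => (hg4 i).mul ((G2.tendsto_iff.1 hw) j i)
    convert this using 2
    simp [Matrix.one_apply]
  have s3 := hh4 3
  have s4 := hh4 4
  have s5 := hh4 5
  simp at s3 s4 s5
  have e4 : ∀ᶠ x in l, (h x).1.1 4 4 ≠ 0 := s4.eventually_ne one_ne_zero
  let C : Fin 8 → α → k := fun j x => (h x).1.1 4 j
  let r5 : α → k := fun x => C 5 x / C 4 x
  let r6 : α → k := fun x => -C 3 x / A 3 x
  have q5 : Filter.Tendsto r5 l (𝓝 0) := zero_of (s5.div s4 one_ne_zero) (by simp)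
  have q6 : Filter.Tendsto r6 l (𝓝 0) := zero_of (s3.neg.div t33 one_ne_zero) (by simp)
  refine ⟨![r0, r1, r2, r3, r4, r5, r6], C 4, fun x => A 3 x / C 4 x, ?_, s4, ?_, ?_⟩
  · intro i
    fin_cases i
    · exact q0
    · exact q1
    · exact q2
    · exact q3
    · exact q4
    · exact q5
    · exact q6
  · have := t33.div s4 one_ne_zero
    rwa [div_one] at this
  · filter_upwards [e3, e4] with x hx3 hx4
    have hA3 : A 3 x ≠ 0 := hx3
    have hC4 : C 4 x ≠ 0 := hx4
    have e1 : g x * G2.tr (elimElt (fun i => ![r0, r1, r2, r3, r4, r5, r6] i x) (C 4 x)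
        (A 3 x / C 4 x)) = h x * G2.tr (G2.tr (xA (r6 x)) * torusF (C 4 x) (A 3 x / C 4 x) *
        xB (r5 x)) := by
      rw [elimElt, G2.tr_mul, ← mul_assoc]; rfl
    rw [e1]
    have key : ∀ i, (h x * G2.tr (G2.tr (xA (r6 x)) * torusF (C 4 x) (A 3 x / C 4 x) *
        xB (r5 x))).1.1 i = (xAMat (r6 x))ᵀ *ᵥ (Matrix.diagonal ![1, C 4 x,
        A 3 x / C 4 x, (C 4 x * (A 3 x / C 4 x))⁻¹, (C 4 x)⁻¹, (A 3 x / C 4 x)⁻¹,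
        C 4 x * (A 3 x / C 4 x), 1] *ᵥ (elem8 1 2 (r5 x) 5 4 (-r5 x) *ᵥ (h x).1.1 i)) := by
      intro i
      rw [Matrix.mulVec_mulVec, Matrix.mulVec_mulVec,
        ← torusF_val hC4 (div_ne_zero hA3 hC4)]
      generalize h x = y
      have : (G2.tr (xA (r6 x)) * torusF (C 4 x) (A 3 x / C 4 x) * xB (r5 x)).1.1 =
          (xAMat (r6 x))ᵀ * (torusF (C 4 x) (A 3 x / C 4 x)).1.1 *
          elem8 1 2 (r5 x) 5 4 (-r5 x) := by
        rw [G2.val_mul, G2.val_mul, G2.tr_val]; rfl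
      rw [← this, ← Matrix.vecMul_transpose, ← G2.tr_val]
      rfl
    rw [mem_unipU_iff, key, key, hrow3 x hx3, elem8_mulVec, elem8_mulVec]
    obtain ⟨b0, b1, b2, b6, b7⟩ := hrow4 x hx3
    have c4 : (h x).1.1 4 4 = C 4 x := rfl
    have c3 : (h x).1.1 4 3 = C 3 x := rfl
    have c5 : (h x).1.1 4 5 = C 5 x := rfl
    have a3 : (g x).1.1 3 3 = A 3 x := rfl
    constructor
    · ext j
      rw [transpose_mulVec_apply]
      simp only [Matrix.mulVec_diagonal]
      fin_cases j <;> simp [xAMat, a3]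
      field_simp
    · ext j
      rw [transpose_mulVec_apply]
      simp only [Matrix.mulVec_diagonal]
      fin_cases j <;> simp [xAMat, b0, b1, b2, b6, b7, c3, c4, c5, r5, r6]
      · field_simp; ring
      · field_simp
      · right; rw [div_mul_cancel₀ _ hC4, add_neg_cancel]

/-- Elements of `G` whose rows `3`, `4` are close to the basis vectors are products of an element of
`U` and an element close to the identity. -/
theorem eventually_exists_unipU_mul [T1Space k] {α : Type*} {l : Filter α} {g : α → G2 k}
    (hg3 : ∀ j, Filter.Tendsto (fun x => (g x).1.1 3 j) l (𝓝 ((Pi.single 3 1 : Fin 8 → k) j)))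
    (hg4 : ∀ j, Filter.Tendsto (fun x => (g x).1.1 4 j) l (𝓝 ((Pi.single 4 1 : Fin 8 → k) j)))
    {N : Set (G2 k)} (hN : N ∈ 𝓝 (1 : G2 k)) :
    ∀ᶠ x in l, ∃ u ∈ unipU k, ∃ n ∈ N, g x = u * n := by
  obtain ⟨r, a, b, hr, ha, hb, hx⟩ := exists_elim hg3 hg4
  have h1 := (G2.continuous_tr.tendsto _).comp (tendsto_elimElt hr ha hb)
  rw [show G2.tr (1 : G2 k) = 1 from
      G2.ext_val (by rw [G2.tr_val, G2.val_one, Matrix.transpose_one])] at h1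
  have h2 := h1.inv
  rw [inv_one] at h2
  filter_upwards [hx, h2 hN] with x h3 h4
  exact ⟨_, h3, _, h4, by simp⟩

end Elimination

theorem withZero_le_exp_neg_one_of_lt_one {x : WithZero (Multiplicative ℤ)} (hx : x < 1) :
    x ≤ WithZero.exp (-1) := by
  rcases eq_or_ne x 0 with rfl | h
  · exact zero_le
  · rw [← WithZero.exp_log h, ← WithZero.exp_zero, WithZero.exp_lt_exp] at hx
    rw [← WithZero.exp_log h, WithZero.exp_le_exp]
    omega

section FinitePlaces

open IsDedekindDomain.HeightOneSpectrum

variable {K : Type*} [Field K] [NumberField K] (v : HeightOneSpectrum (𝓞 K))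

variable {v} in
theorem mem_integers_iff {x : v.adicCompletion K} : x ∈ v.adicCompletionIntegers K ↔ ‖x‖ ≤ 1 :=
  (mem_adicCompletionIntegers (𝓞 K) K v).trans Valued.toNormedField.norm_le_one_iff.symm

variable {v} in
theorem norm_le_norm_iff {x y : v.adicCompletion K} : ‖x‖ ≤ ‖y‖ ↔ Valued.v x ≤ Valued.v y :=
  Valued.toNormedField.norm_le_iff

theorem norm_algebraMap_le_one (r : 𝓞 K) :
    ‖algebraMap K (v.adicCompletion K) (algebraMap (𝓞 K) K r)‖ ≤ 1 :=
  mem_integers_iff.1 (coe_algebraMap_mem (𝓞 K) K v r)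

theorem valued_algebraMap (x : K) :
    Valued.v (algebraMap K (v.adicCompletion K) x) = v.valuation K x :=
  valuedAdicCompletion_eq_valuation' v x

variable {v} in
theorem exists_ringOfIntegers_valued_sub_lt_one {x : v.adicCompletion K} (hx : ‖x‖ ≤ 1) :
    ∃ r : 𝓞 K, Valued.v (x - algebraMap K (v.adicCompletion K) (algebraMap (𝓞 K) K r)) < 1 := by
  obtain ⟨k, hk⟩ := (denseRange_algebraMap (R := 𝓞 K) K v).exists_mem_open
    (Metric.isOpen_ball (x := x) (ε := 1)) ⟨x, Metric.mem_ball_self one_pos⟩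
  have h1 : Valued.v (x - algebraMap K (v.adicCompletion K) k) < 1 := by
    rw [← Valued.toNormedField.norm_lt_one_iff, ← dist_eq_norm, dist_comm]; exact hk
  have h2 : v.valuation K k ≤ 1 := by
    rw [← valued_algebraMap]
    have : algebraMap K (v.adicCompletion K) k = x - (x - algebraMap K (v.adicCompletion K) k) := by
      ring
    rw [this]
    exact (Valuation.map_sub _ _ _).trans
      (max_le (Valued.toNormedField.norm_le_one_iff.1 hx) h1.le)
  obtain ⟨a, b, hb, rfl⟩ := IsFractionRing.div_surjective (A := 𝓞 K) k
  have hb0 : b ≠ 0 := nonZeroDivisors.ne_zero hb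
  have hbK : algebraMap (𝓞 K) K b ≠ 0 := by simpa using hb0
  obtain ⟨m, hm⟩ : ∃ m : ℕ, v.intValuation b = WithZero.exp (-(m : ℤ)) :=
    ⟨_, v.intValuation_if_neg hb0⟩
  have hvb : v.valuation K (algebraMap (𝓞 K) K b) = WithZero.exp (-(m : ℤ)) := by
    rw [valuation_of_algebraMap, hm]
  have ha : a ∈ v.asIdeal ^ m := by
    rw [← intValuation_le_pow_iff_mem, ← hm, ← valuation_of_algebraMap (K := K),
      ← valuation_of_algebraMap (K := K)]
    rw [map_div₀] at h2
    exact (div_le_one₀ (by rw [hvb]; exact WithZero.exp_pos)).1 h2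
  have hbm : b ∈ v.asIdeal ^ m := by rw [← intValuation_le_pow_iff_mem, hm]
  have hbm' : b ∉ v.asIdeal ^ (m + 1) := by
    rw [← intValuation_le_pow_iff_mem, hm, not_le, WithZero.exp_lt_exp]; push_cast; linarith
  have := v.isPrime
  obtain ⟨d, e, he, hde⟩ := Ideal.exists_mul_add_mem_pow_succ v.ne_bot b a hbm hbm' ha
  refine ⟨d, ?_⟩
  have e1 : x - algebraMap K (v.adicCompletion K) (algebraMap (𝓞 K) K d) =
      (x - algebraMap K (v.adicCompletion K) (algebraMap (𝓞 K) K a / algebraMap (𝓞 K) K b)) +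
      algebraMap K (v.adicCompletion K) (algebraMap (𝓞 K) K e / algebraMap (𝓞 K) K b) := by
    have : algebraMap (𝓞 K) K a / algebraMap (𝓞 K) K b = algebraMap (𝓞 K) K d +
        algebraMap (𝓞 K) K e / algebraMap (𝓞 K) K b := by
      rw [← hde, map_add, map_mul]; field_simp
    rw [this, map_add]; ring
  rw [e1]
  refine Valuation.map_add_lt _ h1 ?_
  rw [valued_algebraMap, map_div₀, hvb, div_lt_one₀ WithZero.exp_pos]
  rw [← intValuation_le_pow_iff_mem, ← valuation_of_algebraMap (K := K)] at he
  refine he.trans_lt ?_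
  rw [WithZero.exp_lt_exp]; push_cast; linarith

variable {v} in
theorem exists_ringOfIntegers_valued_sub_le {x : v.adicCompletion K} (hx : ‖x‖ ≤ 1) (n : ℕ) :
    ∃ r : 𝓞 K, Valued.v (x - algebraMap K (v.adicCompletion K) (algebraMap (𝓞 K) K r)) ≤
      WithZero.exp (-(n : ℤ)) := by
  induction n with
  | zero => exact ⟨0, by simpa using Valued.toNormedField.norm_le_one_iff.1 hx⟩
  | succ n ih =>
    obtain ⟨r, hr⟩ := ih
    obtain ⟨p, hp⟩ := v.intValuation_exists_uniformizer
    set P := algebraMap K (v.adicCompletion K) (algebraMap (𝓞 K) K p)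
    have hP : Valued.v P = WithZero.exp (-1) := by
      rw [valued_algebraMap, valuation_of_algebraMap, hp]
    have hP0 : P ≠ 0 := by
      intro h; rw [h, map_zero] at hP; exact WithZero.exp_ne_zero hP.symm
    have hPn : Valued.v (P ^ n) = WithZero.exp (-(n : ℤ)) := by
      rw [map_pow, hP, ← WithZero.exp_nsmul]; simp
    set y := x - algebraMap K (v.adicCompletion K) (algebraMap (𝓞 K) K r)
    have hy : ‖y / P ^ n‖ ≤ 1 := by
      rw [Valued.toNormedField.norm_le_one_iff, map_div₀, hPn, div_le_one₀ WithZero.exp_pos]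
      exact hr
    obtain ⟨r', hr'⟩ := exists_ringOfIntegers_valued_sub_lt_one hy
    refine ⟨r + p ^ n * r', ?_⟩
    have : x - algebraMap K (v.adicCompletion K) (algebraMap (𝓞 K) K (r + p ^ n * r')) =
        P ^ n * (y / P ^ n - algebraMap K (v.adicCompletion K) (algebraMap (𝓞 K) K r')) := by
      simp only [map_add, map_mul, map_pow, y]
      rw [mul_sub, mul_div_cancel₀ _ (pow_ne_zero n hP0)]
      ring
    rw [this, map_mul, hPn]
    have h1 : Valued.v (y / P ^ n - algebraMap K (v.adicCompletion K)
        (algebraMap (𝓞 K) K r')) ≤ WithZero.exp (-1) := withZero_le_exp_neg_one_of_lt_one hr'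
    calc _ ≤ WithZero.exp (-(n : ℤ)) * WithZero.exp (-1) := by gcongr
      _ = _ := by rw [← WithZero.exp_add]; congr 1; push_cast; ring

instance : IsDiscreteValuationRing (Valued.integer (v.adicCompletion K)) :=
  inferInstanceAs (IsDiscreteValuationRing (v.adicCompletionIntegers K))

theorem finite_residueField_of_cover {F Γ ι : Type*} [Field F] [LinearOrderedCommGroupWithZero Γ]
    [Valued F Γ] [Finite ι] (c : ι → F) (hc : ∀ i, Valued.v (c i) ≤ 1)
    (h : ∀ x : F, Valued.v x ≤ 1 → ∃ i, Valued.v (x - c i) < 1) :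
    Finite (Valued.ResidueField F) := by
  refine Finite.of_surjective
    (fun i => IsLocalRing.residue (Valued.integer F) ⟨c i, hc i⟩) fun y => ?_
  obtain ⟨x, rfl⟩ := IsLocalRing.residue_surjective y
  obtain ⟨i, hi⟩ := h x.1 x.2
  refine ⟨i, ?_⟩
  rw [eq_comm, ← sub_eq_zero, ← map_sub, IsLocalRing.residue_eq_zero_iff]
  exact (Valuation.mem_maximalIdeal_iff (v := (Valued.v : Valuation F Γ))).2 hi

instance finite_residueField : Finite (Valued.ResidueField (v.adicCompletion K)) := by
  have : Finite (𝓞 K ⧸ v.asIdeal) := Ideal.finiteQuotientOfFreeOfNeBot _ v.ne_bot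
  refine finite_residueField_of_cover (ι := 𝓞 K ⧸ v.asIdeal)
    (fun q => algebraMap K (v.adicCompletion K) (algebraMap (𝓞 K) K q.out))
    (fun q => coe_algebraMap_mem (𝓞 K) K v _) fun x hx => ?_
  obtain ⟨r, hr⟩ := exists_ringOfIntegers_valued_sub_lt_one
    (Valued.toNormedField.norm_le_one_iff.2 hx)
  refine ⟨Ideal.Quotient.mk _ r, ?_⟩
  have h1 : r - (Ideal.Quotient.mk v.asIdeal r).out ∈ v.asIdeal := by
    rw [← Ideal.Quotient.eq, Ideal.Quotient.mk_out]
  rw [← valuation_lt_one_iff_mem (K := K)] at h1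
  have h1' : v.valuation K (algebraMap (𝓞 K) K (r - (Ideal.Quotient.mk v.asIdeal r).out)) < 1 := h1
  have h2 := Valuation.map_add_lt _ hr ((valued_algebraMap v _).trans_lt h1')
  convert h2 using 2
  rw [map_sub, map_sub]; ring

instance : CompactSpace (Valued.integer (v.adicCompletion K)) := by
  rw [Valued.integer.compactSpace_iff_completeSpace_and_isDiscreteValuationRing_and_finite_residueField]
  exact ⟨(Valued.isClosed_integer _).completeSpace_coe, inferInstance, inferInstance⟩

instance : ProperSpace (v.adicCompletion K) :=
  Valued.integer.properSpace_iff_compactSpace_integer.2 inferInstance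

end FinitePlaces

theorem norm_sub_le_max_norm {F : Type*} [SeminormedAddCommGroup F] [IsUltrametricDist F] (x y : F) :
    ‖x - y‖ ≤ max ‖x‖ ‖y‖ := by
  simpa [sub_eq_add_neg] using IsUltrametricDist.norm_add_le_max x (-y)

section Cocompact

open IsDedekindDomain.HeightOneSpectrum InfinitePlace InfinitePlace.Completion

variable {K : Type*} [Field K] [NumberField K]

instance (w : InfinitePlace K) : ProperSpace w.Completion where
  isCompact_closedBall x r := by
    have h := isometry_extensionEmbedding w
    have := h.isClosedEmbedding.isCompact_preimage
      (isCompact_closedBall (extensionEmbedding w x) r)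
    rwa [h.preimage_closedBall] at this

theorem exists_ringOfIntegers_norm_sub_le : ∃ R : ℝ, ∀ x : InfiniteAdeleRing K, ∃ r : 𝓞 K,
    ∀ w, ‖x w - algebraMap K w.Completion (algebraMap (𝓞 K) K r)‖ ≤ R := by
  classical
  let b := mixedEmbedding.latticeBasis K
  refine ⟨∑ i, ‖b i‖, fun x => ?_⟩
  have h1 := ZSpan.norm_fract_le b (InfiniteAdeleRing.ringEquiv_mixedSpace K x)
  have h2 : (ZSpan.floor b (InfiniteAdeleRing.ringEquiv_mixedSpace K x) : mixedEmbedding.mixedSpace K)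
      ∈ Submodule.span ℤ (Set.range b) := (ZSpan.floor b _).2
  rw [mixedEmbedding.mem_span_latticeBasis] at h2
  obtain ⟨r, hr⟩ := h2
  refine ⟨r, ?_⟩
  rw [ZSpan.fract_apply, ← hr] at h1
  have h3 : InfiniteAdeleRing.ringEquiv_mixedSpace K x -
      ((mixedEmbedding K).comp (algebraMap (𝓞 K) K)).toIntAlgHom.toLinearMap r =
      InfiniteAdeleRing.ringEquiv_mixedSpace K
        (x - algebraMap K (InfiniteAdeleRing K) (algebraMap (𝓞 K) K r)) := by
    rw [map_sub, ← InfiniteAdeleRing.mixedEmbedding_eq_algebraMap_comp]; rfl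
  have h4 : ‖InfiniteAdeleRing.ringEquiv_mixedSpace K
        (x - algebraMap K (InfiniteAdeleRing K) (algebraMap (𝓞 K) K r))‖ ≤ ∑ i, ‖b i‖ := by
    rw [← h3]; exact h1
  intro w
  rw [InfiniteAdeleRing.ringEquiv_mixedSpace_apply, Prod.norm_def, max_le_iff] at h4
  by_cases hw : w.IsReal
  · have := (norm_le_pi_norm _ (⟨w, hw⟩ : {w : InfinitePlace K // IsReal w})).trans h4.1
    rwa [(isometry_extensionEmbeddingOfIsReal hw).norm_map_of_map_zero (map_zero _)] at this
  · rw [not_isReal_iff_isComplex] at hw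
    have := (norm_le_pi_norm _ (⟨w, hw⟩ : {w : InfinitePlace K // IsComplex w})).trans h4.2
    rwa [(isometry_extensionEmbedding w).norm_map_of_map_zero (map_zero _)] at this

theorem exists_mul_integral (x : FiniteAdeleRing (𝓞 K) K) : ∃ d : 𝓞 K, d ≠ 0 ∧
    ∀ v, ‖algebraMap K (v.adicCompletion K) (algebraMap (𝓞 K) K d) * x v‖ ≤ 1 := by
  classical
  have hfin : {v | ¬ ‖x v‖ ≤ 1}.Finite := by
    have := x.2
    rw [Filter.eventually_cofinite] at this
    exact this.subset fun v hv h => hv (mem_integers_iff.1 h)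
  have h1 : ∀ v : HeightOneSpectrum (𝓞 K), ∃ b : 𝓞 K, b ≠ 0 ∧
      ‖algebraMap K (v.adicCompletion K) (algebraMap (𝓞 K) K b) * x v‖ ≤ 1 := by
    intro v
    obtain ⟨b, hb, hb'⟩ := adicCompletion.mul_nonZeroDivisor_mem_adicCompletionIntegers v (x v)
    exact ⟨b, nonZeroDivisors.ne_zero hb, by rw [mul_comm]; exact mem_integers_iff.1 hb'⟩
  choose b hb hb' using h1
  refine ⟨∏ v ∈ hfin.toFinset, b v, Finset.prod_ne_zero_iff.2 fun v _ => hb v, fun v => ?_⟩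
  by_cases hv : ‖x v‖ ≤ 1
  · rw [norm_mul]
    exact mul_le_one₀ (norm_algebraMap_le_one v _) (norm_nonneg _) hv
  · rw [← Finset.mul_prod_erase _ _ (hfin.mem_toFinset.2 hv), map_mul, map_mul, mul_comm, ← mul_assoc,
      norm_mul]
    refine mul_le_one₀ ?_ (norm_nonneg _) (norm_algebraMap_le_one v _)
    rw [mul_comm]
    exact hb' v

theorem exists_ringOfIntegers_sub_le_norm {d : 𝓞 K} (hd : d ≠ 0)
    (y : ∀ v : HeightOneSpectrum (𝓞 K), v.adicCompletion K) (hy : ∀ v, ‖y v‖ ≤ 1) : ∃ r : 𝓞 K,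
    ∀ v, ‖y v - algebraMap K (v.adicCompletion K) (algebraMap (𝓞 K) K r)‖ ≤
      ‖algebraMap K (v.adicCompletion K) (algebraMap (𝓞 K) K d)‖ := by
  classical
  have h1 : ∀ v : HeightOneSpectrum (𝓞 K), ∃ m : ℕ, v.intValuation d = WithZero.exp (-(m : ℤ)) :=
    fun v => ⟨_, v.intValuation_if_neg hd⟩
  choose m hm using h1
  have hvd : ∀ v : HeightOneSpectrum (𝓞 K), Valued.v (algebraMap K (v.adicCompletion K)
      (algebraMap (𝓞 K) K d)) = WithZero.exp (-(m v : ℤ)) := by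
    intro v
    rw [valued_algebraMap, valuation_of_algebraMap, hm]
  have hfin : {v | ¬ d ∉ HeightOneSpectrum.asIdeal v}.Finite := by
    have := Ideal.finite_factors (I := Ideal.span {d}) (by simpa using hd)
    refine this.subset fun v hv => ?_
    simp only [Set.mem_ofPred_eq, not_not] at hv
    simpa [Ideal.dvd_span_singleton] using hv
  choose r hr using fun v => exists_ringOfIntegers_valued_sub_le (hy v) (m v)
  obtain ⟨s, hs⟩ := IsDedekindDomain.exists_forall_sub_mem_ideal (s := hfin.toFinset)
    (fun v => v.asIdeal) m (fun v _ => v.prime) (fun v _ w _ h h' => h (HeightOneSpectrum.ext h'))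
    (fun v => r v.1)
  refine ⟨s, fun v => ?_⟩
  by_cases hv : d ∈ v.asIdeal
  · rw [norm_le_norm_iff, hvd]
    have h2 := hs v (hfin.mem_toFinset.2 (by simpa using hv))
    rw [← intValuation_le_pow_iff_mem, ← valuation_of_algebraMap (K := K), ← valued_algebraMap] at h2
    have h2' : Valued.v (algebraMap K (v.adicCompletion K) (algebraMap (𝓞 K) K (s - r v))) ≤ _ := h2
    have h3 := Valuation.map_sub_le _ (hr v) h2'
    convert h3 using 2
    rw [map_sub, map_sub]; ring
  · have : ‖algebraMap K (v.adicCompletion K) (algebraMap (𝓞 K) K d)‖ = 1 :=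
      (FinitePlace.norm_eq_one_iff_notMem K v d).2 hv
    rw [this]
    exact (norm_sub_le_max_norm _ _).trans (max_le (hy v) (norm_algebraMap_le_one v _))

theorem exists_norm_sub_algebraMap_le_one (x : FiniteAdeleRing (𝓞 K) K) : ∃ k : K,
    ∀ v, ‖x v - algebraMap K (v.adicCompletion K) k‖ ≤ 1 := by
  obtain ⟨d, hd, hx⟩ := exists_mul_integral x
  obtain ⟨r, hr⟩ := exists_ringOfIntegers_sub_le_norm hd _ hx
  refine ⟨algebraMap (𝓞 K) K r / algebraMap (𝓞 K) K d, fun v => ?_⟩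
  have hd' : algebraMap K (v.adicCompletion K) (algebraMap (𝓞 K) K d) ≠ 0 := by simpa using hd
  have := hr v
  rw [← div_le_one₀ (norm_pos_iff.2 hd'), ← norm_div] at this
  have e : x v - algebraMap K (v.adicCompletion K) (algebraMap (𝓞 K) K r / algebraMap (𝓞 K) K d) =
      (algebraMap K (v.adicCompletion K) (algebraMap (𝓞 K) K d) * x v -
        algebraMap K (v.adicCompletion K) (algebraMap (𝓞 K) K r)) /
        algebraMap K (v.adicCompletion K) (algebraMap (𝓞 K) K d) := by
    rw [map_div₀]; field_simp
  rwa [e]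

/-- The adeles with integral finite components and archimedean components of norm at most `R`. -/
def adeleBox (K : Type*) [Field K] [NumberField K] (R : ℝ) : Set (Adele K) :=
  {x | (∀ w, ‖x.1 w‖ ≤ R) ∧ ∀ v, ‖x.2 v‖ ≤ 1}

theorem isCompact_adeleBox (R : ℝ) : IsCompact (adeleBox K R) := by
  have h1 : IsCompact {x : InfiniteAdeleRing K | ∀ w, ‖x w‖ ≤ R} := by
    have := isCompact_univ_pi (s := fun w : InfinitePlace K =>
      Metric.closedBall (0 : w.Completion) R) fun w => isCompact_closedBall _ _
    have e : {x : ∀ w : InfinitePlace K, w.Completion | ∀ w, ‖x w‖ ≤ R} =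
        Set.univ.pi fun w : InfinitePlace K => Metric.closedBall (0 : w.Completion) R := by
      ext x; simp
    rw [← e] at this
    exact this
  have h2 : IsCompact {x : FiniteAdeleRing (𝓞 K) K | ∀ v, ‖x v‖ ≤ 1} := by
    have hc : ∀ v : HeightOneSpectrum (𝓞 K), CompactSpace (v.adicCompletionIntegers K) :=
      fun v => inferInstanceAs (CompactSpace (Valued.integer (v.adicCompletion K)))
    have := isCompact_range (RestrictedProduct.isEmbedding_structureMap
      (R := fun v : HeightOneSpectrum (𝓞 K) => v.adicCompletion K)
      (A := fun v => (v.adicCompletionIntegers K : Set (v.adicCompletion K)))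
      (𝓕 := Filter.cofinite)).continuous
    rw [RestrictedProduct.range_structureMap] at this
    have e : {x : FiniteAdeleRing (𝓞 K) K | ∀ v, ‖x v‖ ≤ 1} =
        {x : FiniteAdeleRing (𝓞 K) K | ∀ v, x v ∈ v.adicCompletionIntegers K} := by
      ext x
      exact forall_congr' fun v => mem_integers_iff.symm
    rw [e]
    exact this
  exact h1.prod h2

/-- `K \ 𝔸` is compact. -/
theorem exists_adele_sub_mem_box : ∃ R : ℝ, ∀ x : Adele K, ∃ k : K,
    x - algebraMap K (Adele K) k ∈ adeleBox K R := by
  obtain ⟨R, hR⟩ := exists_ringOfIntegers_norm_sub_le (K := K)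
  refine ⟨R, fun x => ?_⟩
  obtain ⟨k, hk⟩ := exists_norm_sub_algebraMap_le_one x.2
  obtain ⟨r, hr⟩ := hR (x.1 - algebraMap K _ k)
  refine ⟨k + algebraMap (𝓞 K) K r, fun w => ?_, fun v => ?_⟩
  · have := hr w
    convert this using 2
    change x.1 w - algebraMap K w.Completion (k + algebraMap (𝓞 K) K r) = x.1 w - algebraMap K w.Completion k - _
    rw [map_add]; ring
  · have := (norm_sub_le_max_norm _ _).trans
      (max_le (hk v) (norm_algebraMap_le_one v r))
    have e : x.2 v - algebraMap K (v.adicCompletion K) (k + algebraMap (𝓞 K) K r) =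
        x.2 v - algebraMap K (v.adicCompletion K) k -
        algebraMap K (v.adicCompletion K) (algebraMap (𝓞 K) K r) := by
      rw [map_add]; ring
    rw [← e] at this
    exact this

end Cocompact

section LocalCharacters

open IsDedekindDomain.HeightOneSpectrum InfinitePlace InfinitePlace.Completion
open scoped nonZeroDivisors NNReal

variable {K : Type*} [Field K] [NumberField K]

open scoped Classical in
/-- The adele with component `x` at the archimedean place `w` and `0` elsewhere. -/
def adeleAtInf (w : InfinitePlace K) (x : w.Completion) : Adele K :=
  (Pi.single (M := fun w : InfinitePlace K => w.Completion) w x, 0)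

theorem exists_norm_algebraMap_lt (v : HeightOneSpectrum (𝓞 K)) {δ : ℝ} (hδ : 0 < δ) :
    ∃ d : 𝓞 K, d ≠ 0 ∧ ‖algebraMap K (v.adicCompletion K) (algebraMap (𝓞 K) K d)‖ < δ := by
  obtain ⟨p, hp, hp0⟩ := Submodule.exists_mem_ne_zero_of_ne_bot v.ne_bot
  have h1 : ‖algebraMap K (v.adicCompletion K) (algebraMap (𝓞 K) K p)‖ < 1 :=
    (FinitePlace.norm_lt_one_iff_mem K v p).2 hp
  obtain ⟨n, hn⟩ := exists_pow_lt_of_lt_one hδ h1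
  exact ⟨p ^ n, pow_ne_zero _ hp0, by rwa [map_pow, map_pow, norm_pow]⟩

theorem exists_box_subset {N : Set (Adele K)} (hN : N ∈ 𝓝 (0 : Adele K)) :
    ∃ ε > 0, ∃ d : 𝓞 K, d ≠ 0 ∧ ∀ x : Adele K, (∀ w, ‖x.1 w‖ < ε) →
      (∀ v, ‖x.2 v‖ ≤ ‖algebraMap K (v.adicCompletion K) (algebraMap (𝓞 K) K d)‖) → x ∈ N := by
  obtain ⟨N₁, h1, N₂, h2, h12⟩ := mem_nhds_prod_iff.1 (show N ∈ 𝓝 ((0 : InfiniteAdeleRing K),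
    (0 : FiniteAdeleRing (𝓞 K) K)) from hN)
  have h1' : N₁ ∈ 𝓝 (0 : ∀ w : InfinitePlace K, w.Completion) := h1
  obtain ⟨ε, hε, h1'⟩ := Metric.mem_nhds_iff.1 h1'
  have hA : ∀ v : HeightOneSpectrum (𝓞 K), IsOpen (v.adicCompletionIntegers K :
      Set (v.adicCompletion K)) := fun v => Valued.isOpen_valuationSubring _
  have h2' : N₂ ∈ Filter.map (RestrictedProduct.structureMap
      (fun v : HeightOneSpectrum (𝓞 K) => v.adicCompletion K)
      (fun v => (v.adicCompletionIntegers K : Set (v.adicCompletion K))) Filter.cofinite)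
      (𝓝 (fun v => (0 : v.adicCompletionIntegers K))) := by
    rw [← RestrictedProduct.nhds_eq_map_structureMap hA]
    exact h2
  replace h2' := Filter.mem_map.1 h2'
  rw [nhds_pi, Filter.mem_pi] at h2'
  obtain ⟨T, hT, t, ht, h2'⟩ := h2'
  have h3 : ∀ v : HeightOneSpectrum (𝓞 K), ∃ d : 𝓞 K, d ≠ 0 ∧ ∀ x : v.adicCompletionIntegers K,
      ‖x.1‖ ≤ ‖algebraMap K (v.adicCompletion K) (algebraMap (𝓞 K) K d)‖ → x ∈ t v := by
    intro v
    obtain ⟨t', ht', htt⟩ := mem_nhds_induced _ _ _ |>.1 (ht v)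
    obtain ⟨δ, hδ, hb⟩ := Metric.mem_nhds_iff.1 ht'
    obtain ⟨d, hd, hd'⟩ := exists_norm_algebraMap_lt v hδ
    refine ⟨d, hd, fun x hx => htt (hb ?_)⟩
    rw [mem_ball_iff_norm]
    simpa using hx.trans_lt hd'
  choose d hd hd' using h3
  classical
  refine ⟨ε, hε, ∏ v ∈ hT.toFinset, d v, Finset.prod_ne_zero_iff.2 fun v _ => hd v,
    fun x hx1 hx2 => h12 ⟨h1' ?_, ?_⟩⟩
  · have : ∀ y : ∀ w : InfinitePlace K, w.Completion, (∀ w, ‖y w‖ < ε) → y ∈ Metric.ball 0 ε := by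
      intro y hy
      rw [mem_ball_iff_norm, sub_zero, pi_norm_lt_iff hε]
      exact hy
    exact this x.1 hx1
  · have hx3 : ∀ v, x.2 v ∈ v.adicCompletionIntegers K := fun v =>
      mem_integers_iff.2 ((hx2 v).trans (norm_algebraMap_le_one v _))
    have : (fun v : HeightOneSpectrum (𝓞 K) =>
        (⟨x.2 v, hx3 v⟩ : v.adicCompletionIntegers K)) ∈ T.pi t := by
      intro v hv
      refine hd' v _ ((hx2 v).trans ?_)
      rw [← Finset.mul_prod_erase _ _ (hT.mem_toFinset.2 hv), map_mul, map_mul, norm_mul]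
      exact mul_le_of_le_one_right (norm_nonneg _) (norm_algebraMap_le_one v _)
    exact h2' this

theorem char_eq_one_of_forall_nhds {ψ : AddChar (Adele K) Circle} (hψ : Continuous ψ)
    (hψK : ∀ x : K, ψ (algebraMap K (Adele K) x) = 1)
    (h : ∀ R : ℝ, ∀ N ∈ 𝓝 (0 : Adele K), ∃ a : K, a ≠ 0 ∧ ∀ b ∈ adeleBox K R, ∃ n ∈ N,
      ψ (algebraMap K (Adele K) a * b) = ψ n) : ψ = 1 := by
  obtain ⟨R, hR⟩ := exists_adele_sub_mem_box (K := K)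
  ext1 x
  by_contra hx
  have hN : ψ ⁻¹' {ψ x}ᶜ ∈ 𝓝 (0 : Adele K) :=
    hψ.continuousAt.preimage_mem_nhds (by
      rw [AddChar.map_zero_eq_one]
      exact isOpen_compl_singleton.mem_nhds fun h => hx (by simpa using h.symm))
  obtain ⟨a, ha, hab⟩ := h R _ hN
  obtain ⟨k, hk⟩ := hR (algebraMap K (Adele K) a⁻¹ * x)
  obtain ⟨n, hn, e⟩ := hab _ hk
  refine hn ?_
  rw [Set.mem_singleton_iff, ← e]
  have : algebraMap K (Adele K) a * (algebraMap K (Adele K) a⁻¹ * x - algebraMap K (Adele K) k) =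
      x - algebraMap K (Adele K) (a * k) := by
    rw [mul_sub, ← mul_assoc, ← map_mul, mul_inv_cancel₀ ha, map_one, one_mul, map_mul]
  rw [this, AddChar.map_sub_eq_div, hψK, div_one]

theorem eq_adeleAtInf_add (w : InfinitePlace K) (x : Adele K) : ∃ n : Adele K,
    x = adeleAtInf w (x.1 w) + n ∧ n.1 w = 0 ∧ (∀ w' ≠ w, n.1 w' = x.1 w') ∧ n.2 = x.2 := by
  classical
  refine ⟨x - adeleAtInf w (x.1 w), by ring, ?_, fun w' hw' => ?_, ?_⟩
  · change x.1 w - Pi.single (M := fun w : InfinitePlace K => w.Completion) w (x.1 w) w = 0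
    rw [Pi.single_eq_same, sub_self]
  · change x.1 w' - Pi.single (M := fun w : InfinitePlace K => w.Completion) w (x.1 w) w' = _
    rw [Pi.single_eq_of_ne hw', sub_zero]
  · change x.2 - 0 = x.2
    rw [sub_zero]

theorem eq_adeleAt_add (v : HeightOneSpectrum (𝓞 K)) (x : Adele K) : ∃ n : Adele K,
    x = adeleAt v (x.2 v) + n ∧ n.1 = x.1 ∧ n.2 v = 0 ∧ (∀ v' ≠ v, n.2 v' = x.2 v') := by
  classical
  refine ⟨x - adeleAt v (x.2 v), by ring, ?_, ?_, fun v' hv' => ?_⟩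
  · change x.1 - 0 = x.1
    rw [sub_zero]
  · change x.2 v - Pi.single (M := fun v : HeightOneSpectrum (𝓞 K) => v.adicCompletion K) v
      (x.2 v) v = 0
    rw [Pi.single_eq_same, sub_self]
  · change x.2 v' - Pi.single (M := fun v : HeightOneSpectrum (𝓞 K) => v.adicCompletion K) v
      (x.2 v) v' = _
    rw [Pi.single_eq_of_ne hv', sub_zero]

theorem norm_algebraMap_infinite (w : InfinitePlace K) (a : K) :
    ‖algebraMap K w.Completion a‖ = w a :=
  (norm_coe (v := w) (WithAbs.toAbs w.1 a)).trans rfl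

theorem norm_le_of_mem_span {d : 𝓞 K} {b a : K} {v : HeightOneSpectrum (𝓞 K)}
    (hb : ‖algebraMap K (v.adicCompletion K) b‖ = 1)
    (h : b * a ∈ FractionalIdeal.spanSingleton (𝓞 K)⁰ (algebraMap (𝓞 K) K d)) :
    ‖algebraMap K (v.adicCompletion K) a‖ ≤
      ‖algebraMap K (v.adicCompletion K) (algebraMap (𝓞 K) K d)‖ := by
  obtain ⟨c, hc⟩ := (FractionalIdeal.mem_spanSingleton _).1 h
  have : ‖algebraMap K (v.adicCompletion K) (b * a)‖ = ‖algebraMap K (v.adicCompletion K) a‖ := by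
    rw [map_mul, norm_mul, hb, one_mul]
  rw [← this, ← hc, Algebra.smul_def, map_mul, norm_mul]
  exact mul_le_of_le_one_left (norm_nonneg _) (norm_algebraMap_le_one v c)

theorem exists_adeleAtInf_ne_one {ψ : AddChar (Adele K) Circle} (hψ : Continuous ψ)
    (hψK : ∀ x : K, ψ (algebraMap K (Adele K) x) = 1) (hψ1 : ψ ≠ 1) (w₀ : InfinitePlace K) :
    ∃ x, ψ (adeleAtInf w₀ x) ≠ 1 := by
  by_contra! h
  refine hψ1 (char_eq_one_of_forall_nhds hψ hψK fun R N hN => ?_)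
  obtain ⟨ε, hε, d, hd, hbox⟩ := exists_box_subset hN
  have hR : 0 < |R| + 1 := by positivity
  let I : (FractionalIdeal (𝓞 K)⁰ K)ˣ := Units.mk0
    (FractionalIdeal.spanSingleton _ (algebraMap (𝓞 K) K d)) (FractionalIdeal.spanSingleton_ne_zero_iff.2 (by simpa using hd))
  obtain ⟨g, hg, hg'⟩ := mixedEmbedding.adjust_f K (w₁ := w₀)
    (f := fun _ => Real.toNNReal (ε / (|R| + 1))) ((mixedEmbedding.minkowskiBound K I).toNNReal + 1)
    (fun w _ => by simpa using div_pos hε hR)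
  obtain ⟨a, haI, ha0, ha⟩ := mixedEmbedding.exists_ne_zero_mem_ideal_lt K I (f := g) (by
    rw [mixedEmbedding.convexBodyLT_volume, hg']
    have h1 := ENNReal.coe_toNNReal (mixedEmbedding.minkowskiBound_lt_top K I).ne
    rw [← h1]
    norm_cast
    refine lt_of_lt_of_le (lt_add_one _) (le_mul_of_one_le_left zero_le
      (mixedEmbedding.one_le_convexBodyLTFactor K)))
  refine ⟨a, ha0, fun b hb => ?_⟩
  obtain ⟨n, hn, hn0, hn1, hn2⟩ := eq_adeleAtInf_add w₀ (algebraMap K (Adele K) a * b)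
  refine ⟨n, hbox n (fun w => ?_) (fun v => ?_), ?_⟩
  · by_cases hw : w = w₀
    · subst hw; rwa [hn0, norm_zero]
    · rw [hn1 w hw]
      change ‖algebraMap K w.Completion a * b.1 w‖ < ε
      rw [norm_mul, norm_algebraMap_infinite]
      have h1 := ha w
      rw [hg w hw, Real.coe_toNNReal _ (div_pos hε hR).le] at h1
      calc w a * ‖b.1 w‖ ≤ w a * |R| := by
            gcongr
            exact (hb.1 w).trans (le_abs_self R)
        _ ≤ ε / (|R| + 1) * |R| := by gcongr
        _ < ε := by rw [div_mul_eq_mul_div, div_lt_iff₀ hR]; nlinarith [abs_nonneg R]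
  · rw [hn2]
    change ‖algebraMap K (v.adicCompletion K) a * b.2 v‖ ≤ _
    rw [norm_mul]
    refine (mul_le_of_le_one_right (norm_nonneg _) (hb.2 v)).trans ?_
    exact norm_le_of_mem_span (b := 1) (by simp) (by rw [one_mul]; exact haI)
  · rw [hn, AddChar.map_add_eq_mul, h, one_mul]

theorem exists_adeleAt_ne_one {ψ : AddChar (Adele K) Circle} (hψ : Continuous ψ)
    (hψK : ∀ x : K, ψ (algebraMap K (Adele K) x) = 1) (hψ1 : ψ ≠ 1) (v₀ : HeightOneSpectrum (𝓞 K)) :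
    ∃ x, ψ (adeleAt v₀ x) ≠ 1 := by
  by_contra! h
  refine hψ1 (char_eq_one_of_forall_nhds hψ hψK fun R N hN => ?_)
  obtain ⟨ε, hε, d, hd, hbox⟩ := exists_box_subset hN
  have hR : 0 < |R| + 1 := by positivity
  let J : FractionalIdeal (𝓞 K)⁰ K := (v₀.asIdeal : FractionalIdeal (𝓞 K)⁰ K)
  have hJ : J ≠ 0 := by simpa [J] using v₀.ne_bot
  let D : FractionalIdeal (𝓞 K)⁰ K := FractionalIdeal.spanSingleton _ (algebraMap (𝓞 K) K d)
  have hD : D ≠ 0 := FractionalIdeal.spanSingleton_ne_zero_iff.2 (by simpa using hd)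
  let I : ℕ → (FractionalIdeal (𝓞 K)⁰ K)ˣ := fun m => Units.mk0 (D / J ^ m)
    (div_ne_zero hD (pow_ne_zero m hJ))
  have hJn : 1 < FractionalIdeal.absNorm J := by
    simp only [J, FractionalIdeal.coeIdeal_absNorm]
    exact_mod_cast NumberField.HeightOneSpectrum.one_lt_absNorm v₀
  let f : InfinitePlace K → ℝ≥0 := fun _ => Real.toNNReal (ε / (|R| + 1))
  have hlim : Filter.Tendsto (fun m => mixedEmbedding.minkowskiBound K (I m)) Filter.atTop (𝓝 0) := by
    classical
    have h1 : ∀ m, mixedEmbedding.minkowskiBound K (I m) =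
        ENNReal.ofReal ((FractionalIdeal.absNorm D : ℝ) * ((FractionalIdeal.absNorm J : ℝ)⁻¹) ^ m) *
        mixedEmbedding.minkowskiBound K 1 := by
      intro m
      rw [mixedEmbedding.minkowskiBound, mixedEmbedding.minkowskiBound,
        mixedEmbedding.volume_fundamentalDomain_fractionalIdealLatticeBasis,
        mixedEmbedding.volume_fundamentalDomain_fractionalIdealLatticeBasis]
      simp [I, div_eq_mul_inv, mul_assoc]
    simp only [h1]
    have h2 : Filter.Tendsto (fun m : ℕ => (FractionalIdeal.absNorm D : ℝ) *
        ((FractionalIdeal.absNorm J : ℝ)⁻¹) ^ m) Filter.atTop (𝓝 0) := by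
      have := (tendsto_pow_atTop_nhds_zero_of_lt_one (r := (FractionalIdeal.absNorm J : ℝ)⁻¹)
        (by positivity) (inv_lt_one_of_one_lt₀ (by exact_mod_cast hJn))).const_mul
        (FractionalIdeal.absNorm D : ℝ)
      rwa [mul_zero] at this
    have h3 := ENNReal.Tendsto.mul_const (b := mixedEmbedding.minkowskiBound K 1)
      (ENNReal.tendsto_ofReal h2)
      (Or.inr (mixedEmbedding.minkowskiBound_lt_top K 1).ne)
    simpa using h3
  classical
  have hvol : 0 < volume (mixedEmbedding.convexBodyLT K f) := by
    rw [mixedEmbedding.convexBodyLT_volume]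
    refine ENNReal.mul_pos ?_ ?_
    · simpa using mixedEmbedding.convexBodyLTFactor_ne_zero K
    · simp only [ne_eq, ENNReal.coe_eq_zero, Finset.prod_eq_zero_iff, not_exists]
      rintro w ⟨-, hw⟩
      have : f w = 0 := by simpa using hw
      simp only [f, Real.toNNReal_eq_zero] at this
      exact absurd (div_pos hε hR) (not_lt.2 this)
  obtain ⟨m, hm⟩ := (hlim.eventually_lt_const hvol).exists
  obtain ⟨a, haI, ha0, ha⟩ := mixedEmbedding.exists_ne_zero_mem_ideal_lt K (I m) hm
  refine ⟨a, ha0, fun b hb => ?_⟩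
  obtain ⟨n, hn, hn1, hn0, hn2⟩ := eq_adeleAt_add v₀ (algebraMap K (Adele K) a * b)
  refine ⟨n, hbox n (fun w => ?_) (fun v => ?_), ?_⟩
  · rw [hn1]
    change ‖algebraMap K w.Completion a * b.1 w‖ < ε
    rw [norm_mul, norm_algebraMap_infinite]
    have h1 := ha w
    simp only [f] at h1
    rw [Real.coe_toNNReal _ (div_pos hε hR).le] at h1
    calc w a * ‖b.1 w‖ ≤ w a * |R| := by
          gcongr
          exact (hb.1 w).trans (le_abs_self R)
      _ ≤ ε / (|R| + 1) * |R| := by gcongr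
      _ < ε := by rw [div_mul_eq_mul_div, div_lt_iff₀ hR]; nlinarith [abs_nonneg R]
  · by_cases hv : v = v₀
    · subst hv; rw [hn0, norm_zero]; exact norm_nonneg _
    · rw [hn2 v hv]
      change ‖algebraMap K (v.adicCompletion K) a * b.2 v‖ ≤ _
      rw [norm_mul]
      refine (mul_le_of_le_one_right (norm_nonneg _) (hb.2 v)).trans ?_
      obtain ⟨c, hc, hcv⟩ : ∃ c ∈ v₀.asIdeal, c ∉ v.asIdeal := by
        by_contra! hle
        exact hv (HeightOneSpectrum.ext ((v₀.isMaximal.eq_of_le v.isPrime.ne_top hle).symm))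
      have hcm : c ^ m ∉ v.asIdeal := fun h' => hcv (v.isPrime.mem_of_pow_mem _ h')
      refine norm_le_of_mem_span (b := algebraMap (𝓞 K) K (c ^ m))
        ((FinitePlace.norm_eq_one_iff_notMem K v _).2 hcm) ?_
      have h3 : a ∈ D / J ^ m := haI
      rw [FractionalIdeal.mem_div_iff_of_ne_zero (pow_ne_zero m hJ)] at h3
      rw [mul_comm]
      refine h3 _ ?_
      rw [← FractionalIdeal.coeIdeal_pow, FractionalIdeal.mem_coeIdeal]
      exact ⟨c ^ m, Ideal.pow_mem_pow hc m, rfl⟩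
  · rw [hn, AddChar.map_add_eq_mul, h, one_mul]

end LocalCharacters

section CosetLemmas

variable {X : Type*} [Group X] {Y : Subgroup X}

/-- The class `x⁻¹ Y`, representing `Y x`. -/
def toCoset (Y : Subgroup X) (x : X) : Coset Y := (QuotientGroup.mk x⁻¹ : X ⧸ Y)

theorem toCoset_surjective : Function.Surjective (toCoset Y) := fun q => by
  obtain ⟨x, hx⟩ := QuotientGroup.mk_surjective (s := Y) q
  exact ⟨x⁻¹, by rw [← hx]; exact congrArg _ (inv_inv x)⟩

theorem smul_toCoset (x y : X) : x • toCoset Y y = toCoset Y (y * x⁻¹) := by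
  simp only [toCoset, mul_inv_rev, inv_inv]; rfl

theorem toCoset_mul_left {y : X} (hy : y ∈ Y) (x : X) : toCoset Y (y * x) = toCoset Y x := by
  refine QuotientGroup.eq.2 ?_
  simpa using hy

theorem toCoset_eq_iff {x x' : X} : toCoset Y x = toCoset Y x' ↔ ∃ y ∈ Y, x' = y * x := by
  constructor
  · intro h
    have := QuotientGroup.eq.1 h
    rw [inv_inv] at this
    exact ⟨x' * x⁻¹, by simpa using Y.inv_mem this, by simp⟩
  · rintro ⟨y, hy, rfl⟩
    exact (toCoset_mul_left hy x).symm

theorem exists_onCoset_eq (Φ : X → ℂ) (q : Coset Y) : ∃ x, q = toCoset Y x ∧ onCoset Y Φ q = Φ x :=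
  ⟨_, by
    have := Quotient.out_eq (s := QuotientGroup.leftRel Y) q
    rw [toCoset, inv_inv]
    exact this.symm, rfl⟩

theorem onCoset_toCoset {Φ : X → ℂ} (hΦ : ∀ y ∈ Y, ∀ x, Φ (y * x) = Φ x) (x : X) :
    onCoset Y Φ (toCoset Y x) = Φ x := by
  obtain ⟨x', h1, h2⟩ := exists_onCoset_eq Φ (toCoset Y x)
  obtain ⟨y, hy, rfl⟩ := toCoset_eq_iff.1 h1
  rw [h2, hΦ y hy]

variable [TopologicalSpace X] [IsTopologicalGroup X]

theorem isOpenQuotientMap_toCoset : IsOpenQuotientMap (toCoset Y) :=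
  (QuotientGroup.isOpenQuotientMap_mk (N := Y)).comp (Homeomorph.inv X).isOpenQuotientMap

theorem continuous_toCoset : Continuous (toCoset Y) := isOpenQuotientMap_toCoset.continuous

theorem continuous_onCoset {Φ : X → ℂ} (hΦ : ∀ y ∈ Y, ∀ x, Φ (y * x) = Φ x) (hc : Continuous Φ) :
    Continuous (onCoset Y Φ) := by
  rw [isOpenQuotientMap_toCoset.isQuotientMap.continuous_iff]
  have : onCoset Y Φ ∘ toCoset Y = Φ := funext fun x => onCoset_toCoset hΦ x
  rwa [this]

instance : ContinuousConstSMul X (Coset Y) := inferInstanceAs (ContinuousConstSMul X (X ⧸ Y))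

instance : MulAction.IsMinimal X (Coset Y) where
  dense_orbit q := by
    have : MulAction.orbit X q = Set.univ := by
      ext q'
      obtain ⟨x, rfl⟩ := toCoset_surjective q
      obtain ⟨x', rfl⟩ := toCoset_surjective q'
      simp only [Set.mem_univ, iff_true]
      exact ⟨x'⁻¹ * x, (smul_toCoset _ _).trans (by simp)⟩
    rw [this]; exact dense_univ

variable {ν : Measure (Coset Y)}

theorem IsInvariantMeasure.smulInvariant (hν : IsInvariantMeasure ν) :
    SMulInvariantMeasure X (Coset Y) ν where
  measure_preimage_smul c s hs := by
    conv_rhs => rw [← hν.invariant c]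
    rw [Measure.map_apply (measurable_const_smul c) hs]

theorem IsInvariantMeasure.measure_pos (hν : IsInvariantMeasure ν) {U : Set (Coset Y)}
    (hU : IsOpen U) (hne : U.Nonempty) : 0 < ν U := by
  have := hν.smulInvariant
  have := hν.regular
  exact measure_isOpen_pos_of_smulInvariant_of_ne_zero X hν.ne_zero hU hne

theorem cosetIntegral_mul_right (hν : IsInvariantMeasure ν) {Φ : X → ℂ}
    (hΦ : ∀ y ∈ Y, ∀ x, Φ (y * x) = Φ x) (u : X) :
    cosetIntegral ν (fun x => Φ (x * u)) = cosetIntegral ν Φ := by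
  have := hν.smulInvariant
  rw [cosetIntegral, cosetIntegral]
  have h1 : ∀ q : Coset Y, onCoset Y (fun x => Φ (x * u)) q = onCoset Y Φ (u⁻¹ • q) := by
    intro q
    obtain ⟨x, rfl⟩ := toCoset_surjective q
    rw [onCoset_toCoset (fun y hy x => by rw [mul_assoc, hΦ y hy]), smul_toCoset,
      onCoset_toCoset hΦ, inv_inv]
  simp only [h1]
  exact integral_smul_eq_self (onCoset Y Φ) (g := u⁻¹)

theorem cosetIntegrable_of_support (hν : IsInvariantMeasure ν) {Φ : X → ℂ}
    (hΦ : ∀ y ∈ Y, ∀ x, Φ (y * x) = Φ x) (hc : Continuous Φ) {C : Set X} (hC : IsCompact C)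
    (hs : ∀ x, Φ x ≠ 0 → ∃ y ∈ Y, y * x ∈ C) : CosetIntegrable ν Φ := by
  have := hν.regular
  have hcont := continuous_onCoset hΦ hc
  have hopen : IsOpen {q : Coset Y | onCoset Y Φ q ≠ 0} := isOpen_ne_fun hcont continuous_const
  have hsub : {q : Coset Y | onCoset Y Φ q ≠ 0} ⊆ toCoset Y '' C := by
    intro q hq
    obtain ⟨x, rfl⟩ := toCoset_surjective q
    rw [Set.mem_ofPred_eq, onCoset_toCoset hΦ] at hq
    obtain ⟨y, hy, hyx⟩ := hs x hq
    exact ⟨_, hyx, toCoset_mul_left hy x⟩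
  have hfin : ν {q : Coset Y | onCoset Y Φ q ≠ 0} < ⊤ :=
    (measure_mono hsub).trans_lt (hC.image continuous_toCoset).measure_lt_top
  obtain ⟨M, hM⟩ := (hC.image hc).isBounded.exists_norm_le
  have : IntegrableOn (onCoset Y Φ) {q : Coset Y | onCoset Y Φ q ≠ 0} ν := by
    refine Measure.integrableOn_of_bounded (M := M) hfin.ne hcont.aestronglyMeasurable ?_
    refine (ae_restrict_iff' hopen.measurableSet).2 (ae_of_all _ fun q hq => ?_)
    obtain ⟨x, hx, rfl⟩ := hsub hq
    rw [onCoset_toCoset hΦ]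
    exact hM _ ⟨x, hx, rfl⟩
  rw [CosetIntegrable]
  exact (integrableOn_iff_integrable_of_support_subset (fun q hq => hq)).1 this

/-- Integrals of continuous functions over compact quotients depend continuously on parameters. -/
theorem continuous_cosetIntegral [CompactSpace (Coset Y)] (hν : IsInvariantMeasure ν)
    {Z : Type*} [TopologicalSpace Z] {Φ : Z → X → ℂ}
    (hΦ : ∀ z, ∀ y ∈ Y, ∀ x, Φ z (y * x) = Φ z x) (hc : Continuous fun p : Z × X => Φ p.1 p.2) :
    Continuous fun z => cosetIntegral ν (Φ z) := by
  have := hν.regular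
  have hF : Continuous fun p : Z × Coset Y => onCoset Y (Φ p.1) p.2 := by
    have h1 : IsOpenQuotientMap (Prod.map id (toCoset Y) : Z × X → Z × Coset Y) :=
      IsOpenQuotientMap.prodMap .id isOpenQuotientMap_toCoset
    rw [h1.isQuotientMap.continuous_iff]
    convert hc using 1
    funext p
    exact onCoset_toCoset (hΦ p.1) p.2
  let G : C(Z, C(Coset Y, ℂ)) := ContinuousMap.curry ⟨_, hF⟩
  have h2 : Continuous fun f : C(Coset Y, ℂ) => ∫ q, f q ∂ν := by
    refine LipschitzWith.continuous (K := ⟨ν.real Set.univ, measureReal_nonneg⟩)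
      (LipschitzWith.of_dist_le_mul fun f g => ?_)
    have hi : ∀ f : C(Coset Y, ℂ), Integrable (fun q => f q) ν := fun f =>
      Integrable.of_bound f.continuous.aestronglyMeasurable ‖f‖ (ae_of_all _ f.norm_coe_le_norm)
    rw [dist_eq_norm, ← integral_sub (hi f) (hi g), mul_comm]
    refine (norm_integral_le_of_norm_le_const (C := dist f g) (ae_of_all _ fun q => ?_))
    rw [← dist_eq_norm]
    exact f.dist_apply_le_dist q
  exact h2.comp G.continuous

end CosetLemmas

section UnipCompact

variable {R R' : Type*} [CommRing R] [CommRing R']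

theorem G2.map_val (f : R →+* R') (g : G2 R) : (G2.map f g).1.1 = g.1.1.map f := rfl

theorem G2.map_uElt (f : R →+* R') (a b c d e : R) :
    G2.map f (uElt a b c d e) = uElt (f a) (f b) (f c) (f d) (f e) := by
  refine G2.ext_val ?_
  rw [G2.map_val, uElt_val, uElt_val]
  ext i j
  fin_cases i <;> fin_cases j <;> simp [uMat, map_ofNat]

theorem psiArg_map (f : R →+* R') (g : G2 R) : psiArg (G2.map f g) = f (psiArg g) := by
  rw [psiArg, psiArg, map_add]; rfl

theorem continuous_uElt [TopologicalSpace R] [IsTopologicalRing R] :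
    Continuous fun r : Fin 5 → R => uElt (r 0) (r 1) (r 2) (r 3) (r 4) :=
  ((((continuous_xB.comp (continuous_apply 0)).mul (continuous_xAB.comp (continuous_apply 1))).mul
    (continuous_x2AB.comp (continuous_apply 2))).mul (continuous_x3AB.comp (continuous_apply 3))).mul
    (continuous_x3A2B.comp (continuous_apply 4))

theorem continuous_psiArg [TopologicalSpace R] [IsTopologicalRing R] :
    Continuous (psiArg : G2 R → R) :=
  (G2.continuous_entry 1 0).add (G2.continuous_entry 6 7)

variable {K : Type*} [Field K] [NumberField K]

theorem uElt_algebraMap_mem_ratG (a b c d e : K) :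
    uElt (algebraMap K (Adele K) a) (algebraMap K (Adele K) b) (algebraMap K (Adele K) c)
      (algebraMap K (Adele K) d) (algebraMap K (Adele K) e) ∈ ratG K :=
  ⟨uElt a b c d e, G2.map_uElt _ _ _ _ _ _⟩

/-- `U(K) \ U(𝔸)` is compact. -/
instance : CompactSpace (Coset ((ratG K).subgroupOf (unipU (Adele K)))) := by
  obtain ⟨R, hR⟩ := exists_adele_sub_mem_box (K := K)
  let B : Set (Fin 5 → Adele K) := Set.univ.pi fun _ => adeleBox K R
  have hB : IsCompact B := isCompact_univ_pi fun _ => isCompact_adeleBox R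
  let f : (Fin 5 → Adele K) → unipU (Adele K) := fun r =>
    ⟨uElt (r 0) (r 1) (r 2) (r 3) (r 4), uElt_mem_unipU _ _ _ _ _⟩
  have hf : Continuous f := continuous_uElt.subtype_mk _
  let m : unipU (Adele K) → Coset ((ratG K).subgroupOf (unipU (Adele K))) :=
    fun x => (QuotientGroup.mk x : _ ⧸ ((ratG K).subgroupOf (unipU (Adele K))))
  have hm : Continuous m := QuotientGroup.continuous_mk
  refine ⟨?_⟩
  convert (hB.image hf).image hm
  symm
  rw [Set.eq_univ_iff_forall]
  intro q
  obtain ⟨⟨u, hu⟩, rfl⟩ := QuotientGroup.mk_surjective q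
  obtain ⟨a, b, c, d, e, rfl⟩ := exists_eq_uElt hu
  obtain ⟨a', ha⟩ := hR a
  obtain ⟨b', hb⟩ := hR b
  obtain ⟨c', hc⟩ := hR c
  obtain ⟨d', hd⟩ := hR d
  obtain ⟨e', he⟩ := hR (e - d * algebraMap K (Adele K) (-a') - 3 * c * algebraMap K (Adele K) (-b'))
  refine ⟨_, ⟨![a - algebraMap K _ a', b - algebraMap K _ b', c - algebraMap K _ c',
    d - algebraMap K _ d', e - d * algebraMap K (Adele K) (-a') -
      3 * c * algebraMap K (Adele K) (-b') - algebraMap K _ e'], ?_, rfl⟩, ?_⟩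
  · intro i _
    fin_cases i <;> assumption
  · symm
    refine QuotientGroup.eq.2 ?_
    rw [Subgroup.mem_subgroupOf]
    have h1 := uElt_mul a b c d e (algebraMap K (Adele K) (-a')) (algebraMap K (Adele K) (-b'))
      (algebraMap K (Adele K) (-c')) (algebraMap K (Adele K) (-d')) (algebraMap K (Adele K) (-e'))
    convert uElt_algebraMap_mem_ratG (-a') (-b') (-c') (-d') (-e') using 1
    change (uElt a b c d e)⁻¹ * uElt _ _ _ _ _ = _
    rw [inv_mul_eq_iff_eq_mul, h1]
    congr 1 <;> simp [map_neg] <;> ring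

end UnipCompact

section Reach

variable {X : Type*} [Group X] [TopologicalSpace X] {α : Type*} {l : Filter α}

/-- Near `l`, the elements `g a` are products of values of finitely many one-parameter subgroups at
parameters tending to zero. -/
def Reach (l : Filter α) (g : α → X) : Prop :=
  ∃ L : List ((α → ℝ) × ContinuousMonoidHom (Multiplicative ℝ) X),
    (∀ p ∈ L, Filter.Tendsto p.1 l (𝓝 0)) ∧
    ∀ᶠ a in l, g a = (L.map fun p => p.2 (Multiplicative.ofAdd (p.1 a))).prod

theorem Reach.congr {g h : α → X} (hg : Reach l g) (e : ∀ᶠ a in l, h a = g a) : Reach l h := by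
  obtain ⟨L, h1, h2⟩ := hg
  exact ⟨L, h1, by filter_upwards [h2, e] with a ha ha'; rw [ha', ha]⟩

theorem Reach.one : Reach l (fun _ => (1 : X)) :=
  ⟨[], by simp, by simp⟩

theorem Reach.mul {g h : α → X} (hg : Reach l g) (hh : Reach l h) :
    Reach l (fun a => g a * h a) := by
  obtain ⟨L, h1, h2⟩ := hg
  obtain ⟨L', h1', h2'⟩ := hh
  refine ⟨L ++ L', fun p hp => ?_, ?_⟩
  · rcases List.mem_append.1 hp with hp | hp
    exacts [h1 p hp, h1' p hp]
  · filter_upwards [h2, h2'] with a ha ha'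
    rw [ha, ha', List.map_append, List.prod_append]

theorem Reach.inv {g : α → X} (hg : Reach l g) : Reach l (fun a => (g a)⁻¹) := by
  obtain ⟨L, h1, h2⟩ := hg
  refine ⟨(L.map fun p => (fun a => -p.1 a, p.2)).reverse, fun p hp => ?_, ?_⟩
  · rw [List.mem_reverse, List.mem_map] at hp
    obtain ⟨q, hq, rfl⟩ := hp
    simpa using (h1 q hq).neg
  · filter_upwards [h2] with a ha
    rw [ha, List.prod_inv_reverse, List.map_reverse, List.map_map, List.map_map]
    congr 3
    funext p
    simp

theorem Reach.map {X' : Type*} [Group X'] [TopologicalSpace X'] {g : α → X} (hg : Reach l g)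
    (f : ContinuousMonoidHom X X') : Reach l (fun a => f (g a)) := by
  obtain ⟨L, h1, h2⟩ := hg
  refine ⟨L.map fun p => (p.1, f.comp p.2), fun p hp => ?_, ?_⟩
  · obtain ⟨q, hq, rfl⟩ := List.mem_map.1 hp
    exact h1 q hq
  · filter_upwards [h2] with a ha
    rw [ha, List.map_map, map_list_prod, List.map_map]
    rfl

theorem Reach.tendsto_of_isSmoothFun {g : α → X} (hg : Reach l g) {φ : X → ℂ}
    (hφ : IsSmoothFun φ) (x : X) : Filter.Tendsto (fun a => φ (x * g a)) l (𝓝 (φ x)) := by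
  obtain ⟨L, h1, h2⟩ := hg
  let γ : Fin L.length → ContinuousMonoidHom (Multiplicative ℝ) X := fun i => L[i].2
  have hc := (hφ L.length γ x).continuous.tendsto 0
  have h0 : alongCurves φ γ x 0 = φ x := by
    have : (List.ofFn fun i => γ i (Multiplicative.ofAdd ((0 : Fin L.length → ℝ) i))).prod = 1 := by
      refine List.prod_eq_one fun y hy => ?_
      obtain ⟨i, rfl⟩ := (List.mem_ofFn' _ _).1 hy
      exact map_one (γ i)
    rw [alongCurves, this, mul_one]
  rw [h0] at hc
  have ht : Filter.Tendsto (fun a => fun i : Fin L.length => L[i].1 a) l (𝓝 0) :=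
    tendsto_pi_nhds.2 fun i => h1 _ (List.getElem_mem _)
  refine (hc.comp ht).congr' ?_
  filter_upwards [h2] with a ha
  rw [ha, Function.comp, alongCurves]
  congr 3
  refine List.ext_getElem (by simp) fun i hi hi' => ?_
  simp [γ]

variable {k : Type*} [NormedField k] [NormedAlgebra ℝ k] [FiniteDimensional ℝ k]

theorem Reach.of_addParam {f : k → X} (hf : ∀ r s, f (r + s) = f r * f s) (hc : Continuous f)
    {r : α → k} (hr : Filter.Tendsto r l (𝓝 0)) : Reach l (fun a => f (r a)) := by
  let b := Module.finBasis ℝ k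
  let F : Multiplicative k →* X := addParam f hf
  let γ : Fin (Module.finrank ℝ k) → ContinuousMonoidHom (Multiplicative ℝ) X := fun i =>
    { toMonoidHom := F.comp (AddMonoidHom.toMultiplicative ((smulAddHom ℝ k).flip (b i)))
      continuous_toFun := hc.comp ((continuous_toAdd).smul continuous_const) }
  refine ⟨List.ofFn fun i => (fun a => b.repr (r a) i, γ i), fun p hp => ?_,
    Filter.Eventually.of_forall fun a => ?_⟩
  · obtain ⟨i, rfl⟩ := (List.mem_ofFn' _ _).1 hp
    have h1 : Continuous fun x : k => b.repr x i :=
      (b.coord i).continuous_of_finiteDimensional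
    have := (h1.tendsto 0).comp hr
    simp only [map_zero, Finsupp.coe_zero, Pi.zero_apply] at this
    exact this
  · have h1 : r a = (List.ofFn fun i => b.repr (r a) i • b i).sum := by
      rw [List.sum_ofFn, b.sum_repr]
    have h2 : f (r a) = F (Multiplicative.ofAdd (r a)) := rfl
    change f (r a) = _
    rw [h2]
    conv_lhs => rw [h1, ofAdd_list_prod, map_list_prod]
    rw [List.map_ofFn, List.map_ofFn, List.map_ofFn]
    rfl

theorem exists_exp_eq {a : α → k} (ha : Filter.Tendsto a l (𝓝 1)) :
    ∃ c : α → k, Filter.Tendsto c l (𝓝 0) ∧ ∀ᶠ x in l, NormedSpace.exp (c x) = a x := by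
  have : CompleteSpace k := FiniteDimensional.complete ℝ k
  let _ : NormedAlgebra ℚ k := NormedAlgebra.restrictScalars ℚ ℝ k
  have h := hasStrictFDerivAt_exp_zero (𝕂 := ℝ) (𝔸 := k)
  have h' : HasStrictFDerivAt (NormedSpace.exp : k → k)
    ((ContinuousLinearEquiv.refl ℝ k : k ≃L[ℝ] k) : k →L[ℝ] k) 0 := h
  have e0 : NormedSpace.exp (0 : k) = 1 := NormedSpace.exp_zero
  have h1 := h'.localInverse_continuousAt
  have h2 := h'.eventually_right_inverse
  rw [ContinuousAt, h'.localInverse_apply_image] at h1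
  rw [e0] at h1 h2
  exact ⟨fun x => h'.localInverse _ _ _ (a x), h1.comp ha, ha.eventually h2⟩

theorem exp_ne_zero_of_field (c : k) : NormedSpace.exp c ≠ 0 := by
  have : CompleteSpace k := FiniteDimensional.complete ℝ k
  let _ : NormedAlgebra ℚ k := NormedAlgebra.restrictScalars ℚ ℝ k
  exact (NormedSpace.isUnit_exp c).ne_zero

theorem reach_torusF {a b : α → k} (ha : Filter.Tendsto a l (𝓝 1))
    (hb : Filter.Tendsto b l (𝓝 1)) : Reach l (fun x => torusF (a x) (b x)) := by
  have : CompleteSpace k := FiniteDimensional.complete ℝ k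
  let _ : NormedAlgebra ℚ k := NormedAlgebra.restrictScalars ℚ ℝ k
  obtain ⟨c, hc, ec⟩ := exists_exp_eq ha
  obtain ⟨d, hd, ed⟩ := exists_exp_eq hb
  have key : ∀ {u : k → k × k}, Continuous u → (∀ r, (u r).1 ≠ 0 ∧ (u r).2 ≠ 0) →
      Continuous fun r => torusF (u r).1 (u r).2 := by
    intro u hu h0
    refine continuous_iff_continuousAt.2 fun r => ?_
    exact tendsto_torusF (h0 r).1 (h0 r).2 (hu.fst.tendsto r) (hu.snd.tendsto r)
  have h1 : Reach l (fun x => torusF (NormedSpace.exp (c x)) 1) :=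
    Reach.of_addParam (f := fun r : k => torusF (NormedSpace.exp r) 1) (fun r s => by
      rw [← torusF_mul (exp_ne_zero_of_field _) one_ne_zero (exp_ne_zero_of_field _) one_ne_zero,
        NormedSpace.exp_add, one_mul])
      (key (u := fun r => (NormedSpace.exp r, 1)) (NormedSpace.exp_continuous.prodMk
        continuous_const) fun r => ⟨exp_ne_zero_of_field _, one_ne_zero⟩) hc
  have h2 : Reach l (fun x => torusF 1 (NormedSpace.exp (d x))) :=
    Reach.of_addParam (f := fun r : k => torusF 1 (NormedSpace.exp r)) (fun r s => by
      rw [← torusF_mul one_ne_zero (exp_ne_zero_of_field _) one_ne_zero (exp_ne_zero_of_field _),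
        NormedSpace.exp_add, one_mul])
      (key (u := fun r => (1, NormedSpace.exp r)) (continuous_const.prodMk
        NormedSpace.exp_continuous) fun r => ⟨one_ne_zero, exp_ne_zero_of_field _⟩) hd
  refine (h1.mul h2).congr ?_
  filter_upwards [ec, ed] with x hx hx'
  rw [hx, hx', ← torusF_mul (hx ▸ exp_ne_zero_of_field _) one_ne_zero one_ne_zero
    (hx' ▸ exp_ne_zero_of_field _), mul_one, one_mul]

theorem G2.tr_tendsto_one {g : α → G2 k} (hg : Filter.Tendsto g l (𝓝 1)) :
    Filter.Tendsto (fun x => G2.tr (g x)) l (𝓝 1) := by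
  have := (G2.continuous_tr.tendsto _).comp hg
  rwa [show G2.tr (1 : G2 k) = 1 from
      G2.ext_val (by rw [G2.tr_val, G2.val_one, Matrix.transpose_one])] at this

theorem reach_unipU {u : α → G2 k} (h : ∀ᶠ x in l, u x ∈ unipU k)
    (hu : Filter.Tendsto u l (𝓝 1)) : Reach l u := by
  have hc : ∀ i j, Filter.Tendsto (fun x => (u x).1.1 i j) l
      (𝓝 ((1 : Matrix (Fin 8) (Fin 8) k) i j)) := G2.tendsto_iff.1 hu
  have z : ∀ {f : α → k} {c : k}, Filter.Tendsto f l (𝓝 c) → c = 0 →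
      Filter.Tendsto f l (𝓝 0) := fun h hc => hc ▸ h
  have h1 := Reach.of_addParam xB_add continuous_xB (z (hc 1 2) (by simp))
  have h2 := Reach.of_addParam xAB_add continuous_xAB (z (hc 0 4).neg (by simp))
  have h3 := Reach.of_addParam x2AB_add continuous_x2AB (z (hc 0 3) (by simp))
  have h4 := Reach.of_addParam x3AB_add continuous_x3AB (z (hc 2 3) (by simp))
  have h5 := Reach.of_addParam x3A2B_add continuous_x3A2B
    (z (((hc 1 3).sub ((hc 1 2).mul (hc 2 3))).add ((tendsto_const_nhds (x := (2 : k))).mul (hc 0 4) |>.mul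
      (hc 0 3))) (by simp))
  refine ((((h1.mul h2).mul h3).mul h4).mul h5).congr ?_
  filter_upwards [h] with x hx
  exact eq_uElt_of_rows (mem_unipU_iff.1 hx).1 (mem_unipU_iff.1 hx).2

theorem Reach.of_tr_addParam {f : k → G2 k} (hf : ∀ r s, f (r + s) = f r * f s)
    (hc : Continuous f) {r : α → k} (hr : Filter.Tendsto r l (𝓝 0)) :
    Reach l (fun a => G2.tr (f (r a))) :=
  Reach.of_addParam (f := fun r => G2.tr (f r))
    (fun r s => by rw [add_comm, hf, G2.tr_mul]) (G2.continuous_tr.comp hc) hr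

/-- Elements of `G(k)` close to the identity are products of values of one-parameter subgroups. -/
theorem reach_G2 {g : α → G2 k} (hg : Filter.Tendsto g l (𝓝 1)) : Reach l g := by
  have hc : ∀ i j, Filter.Tendsto (fun x => (g x).1.1 i j) l
      (𝓝 ((1 : Matrix (Fin 8) (Fin 8) k) i j)) := G2.tendsto_iff.1 hg
  have hrow : ∀ i j, (1 : Matrix (Fin 8) (Fin 8) k) i j = (Pi.single i 1 : Fin 8 → k) j := by
    intro i j
    rw [Matrix.one_apply, Pi.single_apply]
    simp [eq_comm]
  obtain ⟨r, a, b, hr, ha, hb, hx⟩ := exists_elim (g := g)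
    (fun j => by rw [← hrow]; exact hc 3 j) (fun j => by rw [← hrow]; exact hc 4 j)
  have he : Filter.Tendsto (fun x => G2.tr (elimElt (fun i => r i x) (a x) (b x))) l (𝓝 1) :=
    G2.tr_tendsto_one (tendsto_elimElt hr ha hb)
  have hu := reach_unipU hx (by simpa using hg.mul he)
  have ht : Reach l (fun x => G2.tr (torusF (a x) (b x))) := by
    refine (reach_torusF ha hb).congr ?_
    filter_upwards [ha.eventually_ne one_ne_zero, hb.eventually_ne one_ne_zero] with x h1 h2
    refine G2.ext_val ?_
    rw [G2.tr_val, torusF_val h1 h2, Matrix.diagonal_transpose]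
  have hE : Reach l (fun x => G2.tr (elimElt (fun i => r i x) (a x) (b x))) := by
    have e : ∀ x, G2.tr (elimElt (fun i => r i x) (a x) (b x)) =
        G2.tr (xA (r 0 x)) * (G2.tr (xAB (r 1 x)) * (G2.tr (x2AB (r 2 x)) * (G2.tr (x3AB (r 3 x)) *
          G2.tr (x3A2B (r 4 x))))) *
        (G2.tr (xB (r 5 x)) * (G2.tr (torusF (a x) (b x)) * xA (r 6 x))) := by
      intro x
      simp only [elimElt, elimA, G2.tr_mul, G2.tr_tr]
    simp only [e]
    exact ((Reach.of_tr_addParam xA_add continuous_xA (hr 0)).mul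
      ((Reach.of_tr_addParam xAB_add continuous_xAB (hr 1)).mul
      ((Reach.of_tr_addParam x2AB_add continuous_x2AB (hr 2)).mul
      ((Reach.of_tr_addParam x3AB_add continuous_x3AB (hr 3)).mul
      (Reach.of_tr_addParam x3A2B_add continuous_x3A2B (hr 4)))))).mul
      ((Reach.of_tr_addParam xB_add continuous_xB (hr 5)).mul
      (ht.mul (Reach.of_addParam xA_add continuous_xA (hr 6))))
  exact (hu.mul hE.inv).congr (Filter.Eventually.of_forall fun x => by simp)

end Reach

section ArchAlgebra

open InfinitePlace InfinitePlace.Completion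

variable {K : Type*} [Field K]

open scoped Classical in
/-- The embedding of the real numbers in an archimedean completion. -/
def realHom (w : InfinitePlace K) : ℝ →+* w.Completion :=
  if h : w.IsReal then (ringEquivRealOfIsReal h).symm.toRingHom
  else (ringEquivComplexOfIsComplex (not_isReal_iff_isComplex.1 h)).symm.toRingHom.comp
    Complex.ofRealHom

theorem norm_realHom (w : InfinitePlace K) (r : ℝ) : ‖realHom w r‖ = ‖r‖ := by
  by_cases h : w.IsReal
  · have e : ringEquivRealOfIsReal h (realHom w r) = r := by
      rw [realHom, dif_pos h]; exact (ringEquivRealOfIsReal h).apply_symm_apply r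
    have := (isometry_extensionEmbeddingOfIsReal h).norm_map_of_map_zero (map_zero _) (realHom w r)
    rw [← this]
    exact congrArg norm e
  · have hc := not_isReal_iff_isComplex.1 h
    have e : ringEquivComplexOfIsComplex hc (realHom w r) = (r : ℂ) := by
      rw [realHom, dif_neg h]
      exact (ringEquivComplexOfIsComplex hc).apply_symm_apply (r : ℂ)
    have := (isometry_extensionEmbedding w).norm_map_of_map_zero (map_zero _) (realHom w r)
    rw [← this, ← Complex.norm_real]
    exact congrArg norm e

instance (w : InfinitePlace K) : NormedAlgebra ℝ w.Completion where
  toAlgebra := (realHom w).toAlgebra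
  norm_smul_le r x := by
    change ‖realHom w r * x‖ ≤ _
    rw [norm_mul, norm_realHom]

instance [NumberField K] (w : InfinitePlace K) : FiniteDimensional ℝ w.Completion :=
  FiniteDimensional.of_locallyCompactSpace ℝ

end ArchAlgebra

section Adelic

variable {K : Type*} [Field K] [NumberField K] {S : Finset (HeightOneSpectrum (𝓞 K))}

open scoped Classical in
/-- `adeleAt v` as an additive homomorphism. -/
def adeleAtHom (v : HeightOneSpectrum (𝓞 K)) : v.adicCompletion K →+ Adele K where
  toFun := adeleAt v
  map_zero' := by
    refine adele_ext (fun w => rfl) fun u => ?_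
    change Pi.single (M := fun v : HeightOneSpectrum (𝓞 K) => v.adicCompletion K) v 0 u = 0
    rw [Pi.single_zero]; rfl
  map_add' := fun x y => by
    refine adele_ext (fun w => (add_zero _).symm) fun u => ?_
    change Pi.single (M := fun v : HeightOneSpectrum (𝓞 K) => v.adicCompletion K) v (x + y) u =
      Pi.single (M := fun v : HeightOneSpectrum (𝓞 K) => v.adicCompletion K) v x u +
      Pi.single (M := fun v : HeightOneSpectrum (𝓞 K) => v.adicCompletion K) v y u
    rw [Pi.single_add]; rfl

theorem continuous_adeleAt (v : HeightOneSpectrum (𝓞 K)) :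
    Continuous (adeleAt v : v.adicCompletion K → Adele K) := by
  classical
  let f := adeleAtHom v
  refine continuous_of_continuousAt_zero f ?_
  rw [ContinuousAt, map_zero]
  intro N hN
  rw [Filter.mem_map]
  obtain ⟨ε, hε, d, hd, hbox⟩ := exists_box_subset hN
  have hd' : 0 < ‖algebraMap K (v.adicCompletion K) (algebraMap (𝓞 K) K d)‖ :=
    norm_pos_iff.2 (by simpa using hd)
  filter_upwards [Metric.ball_mem_nhds (0 : v.adicCompletion K) hd'] with x hx
  refine hbox _ (fun w => ?_) fun u => ?_
  · change ‖(0 : w.Completion)‖ < ε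
    rwa [norm_zero]
  · change ‖Pi.single (M := fun v : HeightOneSpectrum (𝓞 K) => v.adicCompletion K) v x u‖ ≤ _
    by_cases hu : u = v
    · subst hu
      rw [Pi.single_eq_same]
      exact (mem_ball_zero_iff.1 hx).le
    · rw [Pi.single_eq_of_ne hu, norm_zero]
      exact norm_nonneg _

/-- The adele with archimedean components `x` and vanishing finite components. -/
def adeleInf (x : ∀ w : InfinitePlace K, w.Completion) : Adele K := (x, 0)

theorem continuous_adeleInf : Continuous (adeleInf : _ → Adele K) :=
  (Continuous.prodMk_left (0 : FiniteAdeleRing (𝓞 K) K) :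
    Continuous fun x : InfiniteAdeleRing K => (x, (0 : FiniteAdeleRing (𝓞 K) K)))

theorem continuous_prInf (w : InfinitePlace K) : Continuous (prInf w : Adele K → w.Completion) := by
  have : Continuous fun x : InfiniteAdeleRing K × FiniteAdeleRing (𝓞 K) K => x.1 w :=
    Continuous.comp (g := fun y : ∀ w : InfinitePlace K, w.Completion => y w) (continuous_apply w)
      continuous_fst
  exact this

theorem override_eq (x : (∀ w : InfinitePlace K, w.Completion) × (∀ v : S, v.1.adicCompletion K))
    (y : Adele K) : override S x y = adeleInf x.1 +
      ∑ v : S, adeleAt v.1 (x.2 v) + override S 0 y := by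
  classical
  refine adele_ext (fun w => ?_) fun u => ?_
  · rw [map_add, map_add, map_sum]
    have : ∀ v : S, prInf w (adeleAt v.1 (x.2 v)) = 0 := fun v => rfl
    simp only [this, Finset.sum_const_zero, add_zero]
    exact (add_zero _).symm
  · rw [map_add, map_add, map_sum]
    have h0 : ∀ v : S, prFin u (adeleAt v.1 (x.2 v)) =
      Pi.single (M := fun v : HeightOneSpectrum (𝓞 K) => v.adicCompletion K) v.1 (x.2 v) u :=
      fun v => rfl
    simp only [h0]
    have h1 : prFin u (adeleInf x.1) = 0 :=
      rfl
    rw [h1, zero_add]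
    by_cases hu : u ∈ S
    · have h2 : prFin u (override S 0 y) = 0 := dif_pos hu
      have h3 : prFin u (override S x y) = x.2 ⟨u, hu⟩ := dif_pos hu
      rw [h2, h3, add_zero, Finset.sum_eq_single ⟨u, hu⟩]
      · exact (Pi.single_eq_same (M := fun v : HeightOneSpectrum (𝓞 K) => v.adicCompletion K) u
          (x.2 ⟨u, hu⟩)).symm
      · intro v _ hv
        exact Pi.single_eq_of_ne (fun h => hv (Subtype.ext h.symm)) _
      · simp
    · have h2 : prFin u (override S 0 y) = y.2 u := dif_neg hu
      have h3 : prFin u (override S x y) = y.2 u := dif_neg hu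
      rw [h2, h3, Finset.sum_eq_zero, zero_add]
      intro v _
      exact Pi.single_eq_of_ne (fun h : u = v.1 => hu (h ▸ v.2)) _

theorem continuous_override (y : Adele K) : Continuous fun x : (∀ w : InfinitePlace K, w.Completion) ×
    (∀ v : S, v.1.adicCompletion K) => override S x y := by
  rw [show (fun x : (∀ w : InfinitePlace K, w.Completion) × (∀ v : S, v.1.adicCompletion K) =>
      override S x y) = _ from funext fun x => override_eq x y]
  refine Continuous.add (Continuous.add ?_ ?_) continuous_const
  · exact continuous_adeleInf.comp continuous_fst
  · exact continuous_finsetSum _ fun v _ =>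
      (continuous_adeleAt v.1).comp ((continuous_apply v).comp continuous_snd)

theorem continuous_toAdele : Continuous (SGroup.toAdele : SGroup K S → G2 (Adele K)) := by
  rw [G2.continuous_iff]
  intro i j
  refine (continuous_override ((1 : Matrix (Fin 8) (Fin 8) (Adele K)) i j)).comp ?_
  exact (continuous_pi fun w => (G2.continuous_entry i j).comp
      ((continuous_apply w).comp continuous_fst)).prodMk
    (continuous_pi fun v => (G2.continuous_entry i j).comp
      ((continuous_apply v).comp continuous_snd))

theorem G2.adele_ext {g h : G2 (Adele K)} (h1 : ∀ w, g.1.1.map (prInf w) = h.1.1.map (prInf w))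
    (h2 : ∀ v, g.1.1.map (prFin v) = h.1.1.map (prFin v)) : g = h := by
  refine G2.ext_val (Matrix.ext fun i j => G2Zeta.adele_ext (fun w => ?_) fun v => ?_)
  · exact congrFun (congrFun (h1 w) i) j
  · exact congrFun (congrFun (h2 v) i) j

theorem SGroup.toAdele_val (g : SGroup K S) : (SGroup.toAdele g).1.1 = g.mat := rfl

theorem SGroup.toAdele_mul (g h : SGroup K S) :
    SGroup.toAdele (g * h) = SGroup.toAdele g * SGroup.toAdele h := by
  refine G2.adele_ext (fun w => ?_) fun v => ?_
  · rw [G2.val_mul, Matrix.map_mul, SGroup.toAdele_val, SGroup.toAdele_val, SGroup.toAdele_val,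
      SGroup.mat_inf, SGroup.mat_inf, SGroup.mat_inf]
    rfl
  · rw [G2.val_mul, Matrix.map_mul, SGroup.toAdele_val, SGroup.toAdele_val, SGroup.toAdele_val]
    by_cases hv : v ∈ S
    · have e := fun x : SGroup K S => SGroup.mat_fin x ⟨v, hv⟩
      exact (e _).trans (congrArg₂ (· * ·) (e g).symm (e h).symm)
    · rw [SGroup.mat_fin_out _ _ hv, SGroup.mat_fin_out _ _ hv, SGroup.mat_fin_out _ _ hv, mul_one]

/-- The embedding of `G_S` in `G(𝔸)` as a continuous homomorphism. -/
def toAdeleHom (S : Finset (HeightOneSpectrum (𝓞 K))) :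
    ContinuousMonoidHom (SGroup K S) (G2 (Adele K)) where
  toMonoidHom := MonoidHom.mk' SGroup.toAdele SGroup.toAdele_mul
  continuous_toFun := continuous_toAdele

theorem reach_pi {α ι : Type*} [Fintype ι] {G : ι → Type*} [∀ i, Group (G i)]
    [∀ i, TopologicalSpace (G i)] {l : Filter α} {g : α → ∀ i, G i}
    (h : ∀ i, Reach l fun a => g a i) : Reach l g := by
  classical
  have key : ∀ s : Finset ι, Reach l (fun a i => if i ∈ s then g a i else 1) := by
    intro s
    induction s using Finset.induction_on with
    | empty => exact Reach.one.congr (Filter.Eventually.of_forall fun a => by funext i; simp)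
    | insert i s hi ih =>
      have hm := (h i).map (⟨MonoidHom.mulSingle G i, continuous_mulSingle i⟩ :
        ContinuousMonoidHom (G i) (∀ i, G i))
      refine (hm.mul ih).congr (Filter.Eventually.of_forall fun a => ?_)
      funext j
      change _ = (Pi.mulSingle i (g a i) : ∀ i, G i) j * _
      by_cases hj : j = i
      · subst hj; simp [hi]
      · rw [Pi.mulSingle_eq_of_ne hj]; simp [hj]
  exact (key Finset.univ).congr (Filter.Eventually.of_forall fun a => by funext i; simp)

/-- Smooth cusp forms are continuous. -/
theorem IsCuspForm.continuous {φ : G2 (Adele K) → ℂ} (hφ : IsCuspForm K φ) : Continuous φ := by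
  obtain ⟨O, hO, hOφ⟩ := hφ.smooth_fin
  let I : G2 (Adele K) → SGroup K (∅ : Finset (HeightOneSpectrum (𝓞 K))) := fun n =>
    (fun w => G2.map (prInf w) n, fun v => 1)
  let J : G2 (Adele K) → G2 (Adele K) := fun n => (toAdeleHom ∅ (I n))⁻¹ * n
  have hI : Continuous I := by
    refine (continuous_pi fun w => ?_).prodMk continuous_const
    rw [G2.continuous_iff]
    intro i j
    exact (continuous_prInf w).comp (G2.continuous_entry i j)
  have hJ : Continuous J := (((toAdeleHom ∅).continuous.comp hI).inv).mul continuous_id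
  have hI1 : I 1 = 1 := Prod.ext (funext fun w => map_one _) rfl
  have hJ1 : J 1 = 1 := by simp only [J, hI1, map_one, inv_one, mul_one]
  have hJt : ∀ n, InfTrivial (J n) := by
    intro n i j w
    have h1 : (toAdeleHom ∅ (I n) * J n) = n := by simp [J]
    have h2 : G2.map (prInf w) (J n) = 1 := by
      have := congrArg (G2.map (prInf w)) h1
      rw [map_mul] at this
      have h3 : G2.map (prInf w) (toAdeleHom ∅ (I n)) = G2.map (prInf w) n :=
        G2.ext_val (SGroup.mat_inf (I n) w)
      rw [h3] at this
      exact mul_eq_left.1 this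
    exact congrFun (congrFun (congrArg (fun g : G2 w.Completion => g.1.1) h2) i) j
  have hreach : Reach (𝓝 1) I := by
    have h1 : Reach (𝓝 (1 : G2 (Adele K))) fun n => (I n).1 := by
      refine reach_pi fun w => reach_G2 ?_
      have := ((continuous_apply w).comp (continuous_fst.comp hI)).tendsto 1
      rw [Function.comp, Function.comp, hI1] at this
      exact this
    have h2 := h1.map (⟨MonoidHom.inl _ _, continuous_id.prodMk continuous_const⟩ :
      ContinuousMonoidHom (∀ w : InfinitePlace K, G2 w.Completion)
        (SGroup K (∅ : Finset (HeightOneSpectrum (𝓞 K)))))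
    exact h2
  have hreach' := hreach.map (toAdeleHom ∅)
  refine continuous_iff_continuousAt.2 fun x => ?_
  have key : Filter.Tendsto (fun n => φ (x * n)) (𝓝 1) (𝓝 (φ x)) := by
    refine (hreach'.tendsto_of_isSmoothFun hφ.smooth_inf x).congr' ?_
    have := (hJ.tendsto 1)
    rw [hJ1] at this
    filter_upwards [this hO] with n hn
    rw [← hOφ _ hn (hJt n)]
    simp [J, mul_assoc]
  have h2 : Filter.Tendsto (fun y => x⁻¹ * y) (𝓝 x) (𝓝 1) := by
    have := (continuous_const_mul x⁻¹).tendsto x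
    simpa using this
  have h3 := key.comp h2
  simpa [ContinuousAt, Function.comp_def] using h3

variable {ψ : AddChar (Adele K) Circle}
  {νU : Measure (Coset ((ratG K).subgroupOf (unipU (Adele K))))}

theorem fourierCoeff_invariant (hψK : ∀ x : K, ψ (algebraMap K (Adele K) x) = 1)
    {φ : G2 (Adele K) → ℂ} (hφ : ∀ γ ∈ ratG K, ∀ g, φ (γ * g) = φ g) (g : G2 (Adele K)) :
    ∀ y ∈ (ratG K).subgroupOf (unipU (Adele K)), ∀ x : unipU (Adele K),
      φ ((y * x).1 * g) * (starRingEnd ℂ) (ψ (psiArg (y * x).1) : ℂ) =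
      φ (x.1 * g) * (starRingEnd ℂ) (ψ (psiArg x.1) : ℂ) := by
  intro y hy x
  obtain ⟨γ, hγ⟩ := Subgroup.mem_subgroupOf.1 hy
  have h1 : psiArg y.1 = algebraMap K (Adele K) (psiArg γ) := by rw [← psiArg_map, ← hγ]
  have h2 : ((y * x : unipU (Adele K)) : G2 (Adele K)) = y.1 * x.1 := rfl
  rw [h2, psiArg_mul y.2 x.2, AddChar.map_add_eq_mul, h1, hψK, one_mul, mul_assoc,
    hφ _ (Subgroup.mem_subgroupOf.1 hy)]

theorem fourierCoeff_unip_mul (hψK : ∀ x : K, ψ (algebraMap K (Adele K) x) = 1)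
    (hνU : IsInvariantMeasure νU) {φ : G2 (Adele K) → ℂ}
    (hφ : ∀ γ ∈ ratG K, ∀ g, φ (γ * g) = φ g) {u : G2 (Adele K)} (hu : u ∈ unipU (Adele K))
    (g : G2 (Adele K)) :
    fourierCoeff ψ νU φ (u * g) = (ψ (psiArg u) : ℂ) * fourierCoeff ψ νU φ g := by
  have h1 := cosetIntegral_mul_right hνU
    (Φ := fun x : unipU (Adele K) => φ (x.1 * g) * (starRingEnd ℂ) (ψ (psiArg x.1) : ℂ))
    (fourierCoeff_invariant hψK hφ g) ⟨u, hu⟩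
  rw [fourierCoeff, fourierCoeff, ← h1, cosetIntegral, cosetIntegral, ← integral_const_mul]
  congr 1
  funext q
  obtain ⟨x, rfl⟩ := toCoset_surjective q
  simp only [onCoset]
  generalize (Quotient.out (toCoset ((ratG K).subgroupOf (unipU (Adele K))) x))⁻¹ = y
  have h2 : ((y * ⟨u, hu⟩ : unipU (Adele K)) : G2 (Adele K)) = y.1 * u := rfl
  rw [h2, psiArg_mul y.2 hu, AddChar.map_add_eq_mul, Circle.coe_mul, map_mul, mul_assoc y.1]
  have h3 : (ψ (psiArg u) : ℂ) * (starRingEnd ℂ) (ψ (psiArg u) : ℂ) = 1 := by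
    rw [Complex.mul_conj, Circle.normSq_coe, Complex.ofReal_one]
  linear_combination (-φ (y.1 * (u * g)) * (starRingEnd ℂ) (ψ (psiArg y.1) : ℂ)) * h3

theorem continuous_fourierCoeff (hψ : Continuous ψ)
    (hψK : ∀ x : K, ψ (algebraMap K (Adele K) x) = 1)
    (hνU : IsInvariantMeasure νU) {φ : G2 (Adele K) → ℂ} (hφ : IsCuspForm K φ) :
    Continuous (fourierCoeff ψ νU φ) := by
  refine continuous_cosetIntegral hνU (Z := G2 (Adele K))
    (Φ := fun g u => φ (u.1 * g) * (starRingEnd ℂ) (ψ (psiArg u.1) : ℂ))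
    (fun g => fourierCoeff_invariant hψK hφ.left_invariant g) ?_
  refine Continuous.mul ?_ ?_
  · exact hφ.continuous.comp ((continuous_subtype_val.comp continuous_snd).mul continuous_fst)
  · exact Complex.continuous_conj.comp (continuous_subtype_val.comp (hψ.comp
      (continuous_psiArg.comp (continuous_subtype_val.comp continuous_snd))))

theorem fourierCoeff_translate (φ : G2 (Adele K) → ℂ) (h g : G2 (Adele K)) :
    fourierCoeff ψ νU (fun x => φ (x * h)) g = fourierCoeff ψ νU φ (g * h) := by
  simp only [fourierCoeff, mul_assoc]

/-- Existence of vectors spherical outside all sufficiently large sets of places. -/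
theorem exists_spherical {V : Submodule ℂ (G2 (Adele K) → ℂ)} {νG : Measure (Coset (ratG K))}
    (hV : IsCuspSubrep K νG V) (h : ∃ φ ∈ V, ∃ g, fourierCoeff ψ νU φ g ≠ 0) :
    ∃ S₀ : Finset (HeightOneSpectrum (𝓞 K)), ∀ S : Finset (HeightOneSpectrum (𝓞 K)), S₀ ⊆ S →
      ∃ φ ∈ V, IsSphericalOutside S φ ∧
        ∃ g : SGroup K S, fourierCoeff ψ νU φ g.toAdele ≠ 0 := by
  obtain ⟨φ, hφ, g, hg⟩ := h
  have hφ' := hV.translate φ hφ g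
  obtain ⟨O, hO, hOφ⟩ := (hV.cuspForm _ hφ').smooth_fin
  rw [G2.isInducing_val.nhds_eq_comap, Filter.mem_comap] at hO
  obtain ⟨O', hO', hOO⟩ := hO
  have h1 : Filter.Tendsto (fun x : Fin 8 → Fin 8 → Adele K =>
      (1 : Matrix (Fin 8) (Fin 8) (Adele K)) + Matrix.of x) (𝓝 0) (𝓝 1) := by
    have : Continuous (fun x : Fin 8 → Fin 8 → Adele K =>
      (1 : Matrix (Fin 8) (Fin 8) (Adele K)) + Matrix.of x) := continuous_const.add continuous_id
    have h2 := this.tendsto 0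
    rwa [show (1 : Matrix (Fin 8) (Fin 8) (Adele K)) + Matrix.of 0 = 1 from add_zero _] at h2
  have h2 := h1 hO'
  rw [Filter.mem_map, nhds_pi, Filter.mem_pi'] at h2
  obtain ⟨T, t, ht, hsub⟩ := h2
  have h3 : ∀ i, ∃ N ∈ 𝓝 (0 : Adele K), ∀ x : Fin 8 → Adele K, (∀ j, x j ∈ N) → x ∈ t i := by
    intro i
    have := ht i
    rw [nhds_pi, Filter.mem_pi'] at this
    obtain ⟨T', t', ht', hsub'⟩ := this
    exact ⟨⋂ j, t' j, (Filter.iInter_mem).2 ht', fun x hx => hsub' fun j _ =>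
      Set.mem_iInter.1 (hx j) j⟩
  choose N hN hNt using h3
  obtain ⟨ε, hε, d, hd, hbox⟩ := exists_box_subset ((Filter.iInter_mem).2 hN)
  have hfin : {v : HeightOneSpectrum (𝓞 K) | d ∈ v.asIdeal}.Finite := by
    have := Ideal.finite_factors (I := Ideal.span {d}) (by simpa using hd)
    refine this.subset fun v hv => ?_
    simpa [Ideal.dvd_span_singleton] using hv
  refine ⟨hfin.toFinset, fun S hS => ⟨_, hφ', fun k hk hkS hkO x => ?_, 1, ?_⟩⟩
  · refine hOφ k (hOO ?_) hk x
    have h4 : k.1.1 = 1 + Matrix.of (fun i j => k.1.1 i j - (1 : Matrix (Fin 8) (Fin 8) (Adele K)) i j) := by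
      ext i j; simp
    rw [Set.mem_preimage, h4]
    refine hsub fun i _ => hNt i _ fun j => ?_
    have e1 : ∀ w, ((1 : Matrix (Fin 8) (Fin 8) (Adele K)) i j).1 w =
        (1 : Matrix (Fin 8) (Fin 8) w.Completion) i j := by
      intro w
      have := congrFun (congrFun (Matrix.map_one (n := Fin 8) (prInf w) (map_zero _) (map_one _)) i) j
      exact this
    have e2 : ∀ v, ((1 : Matrix (Fin 8) (Fin 8) (Adele K)) i j).2 v =
        (1 : Matrix (Fin 8) (Fin 8) (v.adicCompletion K)) i j := by
      intro v
      have := congrFun (congrFun (Matrix.map_one (n := Fin 8) (prFin v) (map_zero _) (map_one _)) i) j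
      exact this
    refine Set.mem_iInter.1 (hbox _ (fun w => ?_) fun v => ?_) i
    · change ‖(k.1.1 i j).1 w - ((1 : Matrix (Fin 8) (Fin 8) (Adele K)) i j).1 w‖ < ε
      rw [hk, e1, sub_self, norm_zero]
      exact hε
    · change ‖(k.1.1 i j).2 v - ((1 : Matrix (Fin 8) (Fin 8) (Adele K)) i j).2 v‖ ≤ _
      rw [e2]
      by_cases hv : v ∈ S
      · rw [hkS v hv, sub_self, norm_zero]
        exact norm_nonneg _
      · have hdv : d ∉ v.asIdeal := fun h => hv (hS (hfin.mem_toFinset.2 h))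
        have : ‖algebraMap K (v.adicCompletion K) (algebraMap (𝓞 K) K d)‖ = 1 :=
          (FinitePlace.norm_eq_one_iff_notMem K v d).2 hdv
        rw [this]
        refine (norm_sub_le_max_norm _ _).trans (max_le (mem_integers_iff.1 (hkO v hv i j)) ?_)
        rw [Matrix.one_apply]
        split_ifs <;> simp
  · have : SGroup.toAdele (1 : SGroup K S) = 1 := map_one (toAdeleHom S)
    rw [this, fourierCoeff_translate, one_mul]
    exact hg

end Adelic

/-! ### The minors of the rows `3`, `4` -/

section Minors

variable {R : Type*} [CommRing R]

/-- The minors of the rows `3`, `4` of an element of `H`. -/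
def minors (h : Spin8 R) : Fin 8 × Fin 8 → R := fun p => pm (rowA h) (rowB h) p.1 p.2

theorem minors_PH_mul {p : Spin8 R} (hp : p ∈ PH R) (h : Spin8 R) :
    minors (p * h) = dualDet p • minors h := funext fun q => pm_PH_mul hp h q.1 q.2

theorem minors_mul (h n : Spin8 R) (p : Fin 8 × Fin 8) :
    minors (h * n) p =
      ∑ a, ∑ b, minors h (a, b) * (n.1.1.1 a p.1 * n.1.1.1 b p.2) := by
  have hr : ∀ i j, (h * n).1.1.1 i j = ∑ a, h.1.1.1 i a * n.1.1.1 a j := fun i j => rfl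
  simp only [minors, pm, rowA, rowB]
  rw [hr, hr, hr, hr, Finset.sum_mul_sum, Finset.sum_mul_sum, Finset.sum_comm (γ := Fin 8)
    (f := fun a b => h.1.1.1 3 a * n.1.1.1 a p.2 * (h.1.1.1 4 b * n.1.1.1 b p.1)),
    ← Finset.sum_sub_distrib]
  refine Finset.sum_congr rfl fun a _ => ?_
  rw [← Finset.sum_sub_distrib]
  exact Finset.sum_congr rfl fun b _ => by ring

theorem minors_one_apply : minors (1 : Spin8 R) (3, 4) = 1 := by
  simp [minors, pm, rowA, rowB]

theorem minors_muH_apply (p : Fin 8 × Fin 8) : minors (muH R) p =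
    (Pi.single 3 1 : Fin 8 → R) p.1 * (Pi.single 0 1 + Pi.single 2 1 : Fin 8 → R) p.2 -
      (Pi.single 3 1 : Fin 8 → R) p.2 * (Pi.single 0 1 + Pi.single 2 1 : Fin 8 → R) p.1 := by
  simp only [minors, pm, rowA, rowB, muH_row_three, muH_row_four]

/-- The coordinate `A₃` of `(pa, pc)`. -/
def zMin (m : Fin 8 × Fin 8 → R) : R := m (3, 0) + m (3, 7)

theorem zMin_smul (c : R) (m : Fin 8 × Fin 8 → R) : zMin (c • m) = c * zMin m := by
  simp [zMin]; ring

theorem zMin_sub (m m' : Fin 8 × Fin 8 → R) : zMin (m - m') = zMin m - zMin m' := by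
  simp [zMin]; ring

theorem zMin_minors_mu (g : G2 R) : zMin (minors (muH R * G2.toSpin8 g)) = g.1.1 3 3 :=
  congrFun (pa_rows_mu g) 3

theorem uElt_mul_row_three {u : G2 R} (hu : u ∈ unipU R) (g : G2 R) :
    (u * g).1.1 3 = g.1.1 3 := by
  have h : (u * g).1.1 3 = u.1.1 3 ᵥ* g.1.1 := rfl
  rw [h, (mem_unipU_iff.1 hu).1, Matrix.single_one_vecMul]; rfl

theorem uElt_mul_row_four {u : G2 R} (hu : u ∈ unipU R) (g : G2 R) :
    (u * g).1.1 4 = g.1.1 4 := by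
  have h : (u * g).1.1 4 = u.1.1 4 ᵥ* g.1.1 := rfl
  rw [h, (mem_unipU_iff.1 hu).2, Matrix.single_one_vecMul]; rfl

theorem exists_uElt_mul_row {u : G2 R} (hu : u ∈ unipU R) (g : G2 R) : ∃ t : R,
    (u * g).1.1 0 + (u * g).1.1 2 =
      g.1.1 0 + g.1.1 2 + t • g.1.1 3 - psiArg u • g.1.1 4 := by
  obtain ⟨a, b, c, d, e, rfl⟩ := exists_eq_uElt hu
  have h : ∀ i, (uElt a b c d e * g).1.1 i = (uElt a b c d e).1.1 i ᵥ* g.1.1 := fun i => rfl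
  have e2 : uMat a b c d e 0 + uMat a b c d e 2 = Pi.single 0 1 + Pi.single 2 1 +
      (c + d) • Pi.single 3 1 - (b + c) • Pi.single 4 1 := by
    ext j; fin_cases j <;> simp [uMat]; ring
  refine ⟨c + d, ?_⟩
  rw [h, h, ← Matrix.add_vecMul, uElt_val, e2, psiArg_uElt, Matrix.sub_vecMul, Matrix.add_vecMul,
    Matrix.add_vecMul, Matrix.smul_vecMul, Matrix.smul_vecMul, Matrix.single_one_vecMul,
    Matrix.single_one_vecMul, Matrix.single_one_vecMul, Matrix.single_one_vecMul]; rfl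

theorem kap_unip_mul {u : G2 R} (hu : u ∈ unipU R) (g : G2 R) :
    kap (u * g) = kap g - psiArg u * detD g := by
  obtain ⟨t, ht⟩ := exists_uElt_mul_row hu g
  rw [kap, ht, uElt_mul_row_three hu]
  simp [kap, pm, detD]; ring

theorem detD_unip_mul {u : G2 R} (hu : u ∈ unipU R) (g : G2 R) : detD (u * g) = detD g := by
  rw [detD, uElt_mul_row_three hu, uElt_mul_row_four hu]; rfl

theorem minors_unipUmu_mul {u : G2 R} (hu : u ∈ unipUmu R) (g : G2 R) :
    minors (muH R * G2.toSpin8 (u * g)) = minors (muH R * G2.toSpin8 g) := by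
  have huU : u ∈ unipU R := hu.1
  obtain ⟨t, ht⟩ := exists_uElt_mul_row huU g
  rw [(mem_unipUmu_iff huU).1 hu] at ht
  funext p
  rw [minors, minors, rowA_muH_mul, rowB_muH_mul, rowA_muH_mul, rowB_muH_mul, ht,
    uElt_mul_row_three huU]
  simp [pm]; ring

theorem minors_mu_apply (g : G2 R) :
    minors (muH R * G2.toSpin8 g) (3, 4) = kap g := by
  rw [minors, rowA_muH_mul, rowB_muH_mul]; rfl

end Minors

section Torus

variable {k : Type*} [Field k]

theorem torusF_mul_row {a : k} (ha : a ≠ 0) (g : G2 k) (i : Fin 8) :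
    (torusF a 1 * g).1.1 i = (![1, a, 1, a⁻¹, a⁻¹, 1, a, 1] : Fin 8 → k) i • g.1.1 i := by
  rw [G2.val_mul, torusF_val ha one_ne_zero, mul_one, inv_one]
  ext j
  rw [Matrix.diagonal_mul]; rfl

theorem torusF_inv {a : k} (ha : a ≠ 0) : (torusF a 1)⁻¹ = torusF a⁻¹ 1 := by
  rw [inv_eq_iff_mul_eq_one, ← torusF_mul ha one_ne_zero (inv_ne_zero ha) one_ne_zero,
    mul_inv_cancel₀ ha, mul_one, torusF, dif_pos ⟨one_ne_zero, one_ne_zero⟩, Units.mk0_one,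
    torus_one]

theorem torusF_conj_val {a : k} (ha : a ≠ 0) (g : G2 k) (i j : Fin 8) :
    (torusF a 1 * g * (torusF a 1)⁻¹).1.1 i j =
      (![1, a, 1, a⁻¹, a⁻¹, 1, a, 1] : Fin 8 → k) i * g.1.1 i j *
        (![1, a⁻¹, 1, a, a, 1, a⁻¹, 1] : Fin 8 → k) j := by
  rw [torusF_inv ha, G2.val_mul, torusF_val (inv_ne_zero ha) one_ne_zero, mul_one, inv_one, inv_inv,
    Matrix.mul_diagonal, torusF_mul_row ha]; rfl

theorem torusF_conj_mem {a : k} (ha : a ≠ 0) {u : G2 k} (hu : u ∈ unipU k) :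
    torusF a 1 * u * (torusF a 1)⁻¹ ∈ unipU k := by
  rw [mem_unipU_iff] at hu ⊢
  constructor <;> ext j <;> rw [torusF_conj_val ha]
  · rw [hu.1]; fin_cases j <;> simp [ha]
  · rw [hu.2]; fin_cases j <;> simp [ha]

theorem psiArg_torusF_conj {a : k} (ha : a ≠ 0) (u : G2 k) :
    psiArg (torusF a 1 * u * (torusF a 1)⁻¹) = a * psiArg u := by
  rw [psiArg, torusF_conj_val ha, torusF_conj_val ha, psiArg]; simp; ring

theorem xAB_mem_unipU {R : Type*} [CommRing R] (r : R) : xAB r ∈ unipU R :=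
  Subgroup.subset_closure (by simp)

theorem psiArg_xAB {R : Type*} [CommRing R] (r : R) : psiArg (xAB r) = r := by
  have h : psiArg (xAB r) = xABMat r 1 0 + xABMat r 6 7 := rfl
  rw [h]; simp [xABMat]

theorem xAB_mul_torusF {a : k} (ha : a ≠ 0) (r : k) :
    xAB (a * r) * torusF a 1 = torusF a 1 * xAB r := by
  refine eq_mul_inv_iff_mul_eq.1 (G2.ext_val (Matrix.ext fun i j => ?_))
  rw [torusF_conj_val ha]
  change xABMat (a * r) i j = _ * xABMat r i j * _
  fin_cases i <;> fin_cases j <;> simp [xABMat, ha] <;> ring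

theorem kap_torusF_mul {a : k} (ha : a ≠ 0) (g : G2 k) : kap (torusF a 1 * g) = a⁻¹ * kap g := by
  rw [kap, torusF_mul_row ha, torusF_mul_row ha, torusF_mul_row ha]
  simp [kap, pm]; ring

theorem detD_torusF_mul {a : k} (ha : a ≠ 0) (g : G2 k) :
    detD (torusF a 1 * g) = a⁻¹ ^ 2 * detD g := by
  rw [detD, torusF_mul_row ha, torusF_mul_row ha]
  simp [detD]; ring

theorem G2.norm_row_four (g : G2 k) :
    g.1.1 4 0 * g.1.1 4 7 = g.1.1 4 1 * g.1.1 4 4 + g.1.1 4 2 * g.1.1 4 5 +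
      g.1.1 4 3 * g.1.1 4 6 := by
  have h := congrFun (G2.row_mul g 4 4) 0
  rw [transpose_mulVec_apply] at h
  have h3 := G2.row_trace g 4
  simp at h3
  simp [octMul] at h
  linear_combination g.1.1 4 0 * h3 - h

end Torus

section Elim

variable {k : Type*} [NormedField k]

/-- If the rows `3`, `4` of `g` are close to multiples of the basis vectors, then `g` lies in
`τ U N` with `τ` in the torus and a small neighbourhood `N` of `1`. -/
theorem eventually_exists_torusF_mul {α : Type*} {l : Filter α} {g : α → G2 k}
    (hne : ∀ᶠ x in l, (g x).1.1 3 3 ≠ 0)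
    (hg3 : ∀ j, Filter.Tendsto (fun x => ((g x).1.1 3 3)⁻¹ * (g x).1.1 3 j) l
      (𝓝 ((Pi.single 3 1 : Fin 8 → k) j)))
    (hg4 : ∀ j, Filter.Tendsto (fun x => ((g x).1.1 3 3)⁻¹ * midPart ((g x).1.1 4) j) l
      (𝓝 ((Pi.single 4 1 : Fin 8 → k) j)))
    {N : Set (G2 k)} (hN : N ∈ 𝓝 (1 : G2 k)) :
    ∀ᶠ x in l, ∃ u ∈ unipU k, ∃ n ∈ N, g x = torusF ((g x).1.1 3 3)⁻¹ 1 * u * n := by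
  have hrow : ∀ᶠ x in l, ∀ j, (torusF ((g x).1.1 3 3) 1 * g x).1.1 3 j =
      ((g x).1.1 3 3)⁻¹ * (g x).1.1 3 j ∧ (torusF ((g x).1.1 3 3) 1 * g x).1.1 4 j =
      ((g x).1.1 3 3)⁻¹ * (g x).1.1 4 j := by
    filter_upwards [hne] with x hx j
    rw [torusF_mul_row hx, torusF_mul_row hx]; exact ⟨rfl, rfl⟩
  have h0 : Filter.Tendsto (fun x => ((g x).1.1 3 3)⁻¹ * (g x).1.1 4 0) l (𝓝 0) := by
    have h1 := ((hg4 1).mul (hg4 4)).add ((hg4 2).mul (hg4 5)) |>.add ((hg4 3).mul (hg4 6))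
    simp only [midPart] at h1
    simp at h1
    have h2 : Filter.Tendsto
        (fun x => ‖(((g x).1.1 3 3)⁻¹ * (g x).1.1 4 0) ^ 2‖) l (𝓝 0) := by
      rw [← norm_zero (E := k)]
      refine Filter.Tendsto.norm ?_
      have h1' := h1.neg
      rw [neg_zero] at h1'
      refine h1'.congr fun x => ?_
      have e1 := G2.norm_row_four (g x)
      have e2 := G2.row_trace (g x) 4
      simp at e2
      linear_combination ((g x).1.1 3 3)⁻¹ ^ 2 * (e1 - (g x).1.1 4 0 * e2)
    rw [tendsto_zero_iff_norm_tendsto_zero]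
    have h3 := h2.sqrt
    rw [Real.sqrt_zero] at h3
    refine h3.congr fun x => ?_
    rw [norm_pow, Real.sqrt_sq (norm_nonneg _)]
  have hg4' : ∀ j, Filter.Tendsto (fun x => ((g x).1.1 3 3)⁻¹ * (g x).1.1 4 j) l
      (𝓝 ((Pi.single 4 1 : Fin 8 → k) j)) := by
    intro j
    by_cases hj0 : j = 0
    · subst hj0; exact h0
    by_cases hj7 : j = 7
    · subst hj7
      have h1 := h0.neg
      rw [neg_zero] at h1
      refine h1.congr fun x => ?_
      have e2 := G2.row_trace (g x) 4
      simp at e2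
      linear_combination -((g x).1.1 3 3)⁻¹ * e2
    · refine (hg4 j).congr fun x => ?_
      congr 1
      fin_cases j <;> first | rfl | simp at hj0 hj7
  have key := eventually_exists_unipU_mul (g := fun x => torusF ((g x).1.1 3 3) 1 * g x)
    (fun j => (hg3 j).congr' (hrow.mono fun x hx => (hx j).1.symm))
    (fun j => (hg4' j).congr' (hrow.mono fun x hx => (hx j).2.symm)) hN
  filter_upwards [key, hne] with x ⟨u, hu, n, hn, e⟩ hx
  refine ⟨u, hu, n, hn, ?_⟩
  rw [mul_assoc, ← e, ← mul_assoc, ← torusF_inv hx, inv_mul_cancel, one_mul]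

theorem isCompact_bounded [ProperSpace k] (C : ℝ) :
    IsCompact {g : G2 k | ∀ i j, ‖g.1.1 i j‖ ≤ C} := by
  rw [G2.isInducing_val.isCompact_iff]
  have e : (fun g : G2 k => g.1.1) '' {g | ∀ i j, ‖g.1.1 i j‖ ≤ C} =
      {M : Matrix (Fin 8) (Fin 8) k | ∀ i j, ‖M i j‖ ≤ C} ∩
        ({M | IsIsom M} ∩ {M | IsRelated M M M}) := by
    ext M
    constructor
    · rintro ⟨g, hg, rfl⟩; exact ⟨hg, g.2.1, g.2.2⟩
    · rintro ⟨h1, h2, h3⟩; exact ⟨G2.mk' M h2 h3, h1, rfl⟩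
  rw [e]
  have hid : Continuous fun M : Matrix (Fin 8) (Fin 8) k => M := continuous_id
  refine IsCompact.inter_right ?_ (IsClosed.inter ?_ ?_)
  · have : {M : Matrix (Fin 8) (Fin 8) k | ∀ i j, ‖M i j‖ ≤ C} =
        Set.univ.pi fun _ => Set.univ.pi fun _ => Metric.closedBall (0 : k) C := by
      ext M
      exact ⟨fun h i _ j _ => mem_closedBall_zero_iff.2 (h i j),
        fun h i j => mem_closedBall_zero_iff.1 (h i trivial j trivial)⟩
    rw [this]
    exact isCompact_univ_pi fun _ => isCompact_univ_pi fun _ => isCompact_closedBall _ _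
  · exact isClosed_eq (by fun_prop) continuous_const
  · simp only [isRelated_iff, Set.ofPred_forall]
    refine isClosed_iInter fun i => isClosed_iInter fun j => isClosed_eq (by fun_prop) ?_
    refine continuous_pi fun m => ?_
    have h : ∀ a b : Fin 8, Continuous fun M : Matrix (Fin 8) (Fin 8) k => M.col b a :=
      fun a b => hid.matrix_elem a b
    have h' : ∀ a b : Fin 8, Continuous fun M : Matrix (Fin 8) (Fin 8) k => M a b :=
      fun a b => hid.matrix_elem a b
    fin_cases m <;> simp only [octMul, Matrix.col, Matrix.transpose_apply] <;> simp <;> fun_prop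

end Elim

/-! ### Sections at the finite places -/

section FinSections

variable {k : Type*} [NormedField k]

theorem continuous_spin_entry {R : Type*} [CommRing R] [TopologicalSpace R] (i j : Fin 8) :
    Continuous fun h : Spin8 R => h.1.1.1 i j :=
  (Units.continuous_val.comp (continuous_fst.comp continuous_subtype_val)).matrix_elem i j

/-- Right translation by elements near `1` moves the minors little, relative to their size. -/
theorem eventually_minors_mul_near {δ : ℝ} (hδ : 0 < δ) :
    ∀ᶠ n in 𝓝 (1 : Spin8 k), ∀ h : Spin8 k, ‖minors (h * n) - minors h‖ ≤ δ * ‖minors h‖ := by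
  let E : Spin8 k → ℝ := fun n => ∑ i, ∑ j, ∑ a, ∑ b,
    ‖n.1.1.1 a i * n.1.1.1 b j - (1 : Spin8 k).1.1.1 a i * (1 : Spin8 k).1.1.1 b j‖
  have hE : Continuous E := by
    have := fun i j => continuous_spin_entry (R := k) i j
    fun_prop
  have hE1 : E 1 = 0 := by simp [E]
  have h1 : ∀ᶠ n in 𝓝 (1 : Spin8 k), E n < δ := by
    have := hE.tendsto 1
    rw [hE1] at this
    exact this.eventually (gt_mem_nhds hδ)
  filter_upwards [h1] with n hn h
  refine (pi_norm_le_iff_of_nonneg (by positivity)).2 fun p => ?_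
  have e : (minors (h * n) - minors h) p = ∑ a, ∑ b, minors h (a, b) *
      (n.1.1.1 a p.1 * n.1.1.1 b p.2 - (1 : Spin8 k).1.1.1 a p.1 * (1 : Spin8 k).1.1.1 b p.2) := by
    have e1 := minors_mul h 1 p
    rw [mul_one] at e1
    rw [Pi.sub_apply, e1, minors_mul]
    simp only [mul_sub, Finset.sum_sub_distrib]
  rw [e]
  have h2 : ∑ a, ∑ b, ‖n.1.1.1 a p.1 * n.1.1.1 b p.2 -
      (1 : Spin8 k).1.1.1 a p.1 * (1 : Spin8 k).1.1.1 b p.2‖ ≤ E n := by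
    refine le_trans ?_ (Finset.single_le_sum (f := fun i => ∑ j, ∑ a, ∑ b,
      ‖n.1.1.1 a i * n.1.1.1 b j - (1 : Spin8 k).1.1.1 a i * (1 : Spin8 k).1.1.1 b j‖)
      (fun i _ => by positivity) (Finset.mem_univ p.1))
    exact Finset.single_le_sum (f := fun j => ∑ a, ∑ b,
      ‖n.1.1.1 a p.1 * n.1.1.1 b j - (1 : Spin8 k).1.1.1 a p.1 * (1 : Spin8 k).1.1.1 b j‖)
      (fun i _ => by positivity) (Finset.mem_univ p.2)
  calc _ ≤ ∑ a, ∑ b, ‖minors h‖ * ‖n.1.1.1 a p.1 * n.1.1.1 b p.2 -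
        (1 : Spin8 k).1.1.1 a p.1 * (1 : Spin8 k).1.1.1 b p.2‖ := by
        refine (norm_sum_le _ _).trans (Finset.sum_le_sum fun a _ => ?_)
        refine (norm_sum_le _ _).trans (Finset.sum_le_sum fun b _ => ?_)
        rw [norm_mul]
        exact mul_le_mul_of_nonneg_right (norm_le_pi_norm _ (a, b)) (norm_nonneg _)
    _ = ‖minors h‖ * ∑ a, ∑ b, ‖n.1.1.1 a p.1 * n.1.1.1 b p.2 -
        (1 : Spin8 k).1.1.1 a p.1 * (1 : Spin8 k).1.1.1 b p.2‖ := by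
        simp only [Finset.mul_sum]
    _ ≤ ‖minors h‖ * δ := mul_le_mul_of_nonneg_left (h2.trans hn.le) (norm_nonneg _)
    _ = _ := mul_comm _ _

variable [IsUltrametricDist k]

theorem norm_minors_mul_le (h n : Spin8 k) (hn : ∀ i j, ‖n.1.1.1 i j‖ ≤ 1) :
    ‖minors (h * n)‖ ≤ ‖minors h‖ := by
  refine (pi_norm_le_iff_of_nonneg (norm_nonneg _)).2 fun p => ?_
  rw [minors_mul]
  refine IsUltrametricDist.norm_sum_le_of_forall_le_of_nonneg (norm_nonneg _) fun a _ => ?_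
  refine IsUltrametricDist.norm_sum_le_of_forall_le_of_nonneg (norm_nonneg _) fun b _ => ?_
  rw [norm_mul, norm_mul]
  calc _ ≤ ‖minors h‖ * (1 * 1) := by
        gcongr
        · exact norm_le_pi_norm _ (a, b)
        · exact hn _ _
        · exact hn _ _
    _ = _ := by ring

theorem norm_minors_integral {h : Spin8 k} (hh : ∀ i j, ‖h.1.1.1 i j‖ ≤ 1) : ‖minors h‖ = 1 := by
  have h1 : ‖minors (1 : Spin8 k)‖ ≤ 1 := by
    refine (pi_norm_le_iff_of_nonneg zero_le_one).2 fun p => ?_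
    have e : ∀ i j, (1 : Spin8 k).1.1.1 i j = (1 : Matrix (Fin 8) (Fin 8) k) i j := fun i j => rfl
    simp only [minors, pm, rowA, rowB, e, Matrix.one_apply]
    split_ifs <;> simp
  have h1' : 1 ≤ ‖minors (1 : Spin8 k)‖ := by
    have := norm_le_pi_norm (minors (1 : Spin8 k)) (3, 4)
    rwa [minors_one_apply, norm_one] at this
  have hi : ∀ i j, ‖(h⁻¹).1.1.1 i j‖ ≤ 1 := by
    intro i j
    have e : (h⁻¹).1.1.1 i j = ∑ b, (∑ a, octGram k i a * h.1.1.1 b a) * octGram k b j := by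
      rw [mulVec_inv_spin]; rfl
    have hG : ∀ i j, ‖octGram k i j‖ ≤ 1 := by
      intro i j; fin_cases i <;> fin_cases j <;> simp [octGram]
    rw [e]
    refine IsUltrametricDist.norm_sum_le_of_forall_le_of_nonneg zero_le_one fun b _ => ?_
    rw [norm_mul]
    refine mul_le_one₀ ?_ (norm_nonneg _) (hG _ _)
    refine IsUltrametricDist.norm_sum_le_of_forall_le_of_nonneg zero_le_one fun a _ => ?_
    rw [norm_mul]
    exact mul_le_one₀ (hG _ _) (norm_nonneg _) (hh _ _)
  refine le_antisymm ?_ ?_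
  · rw [← one_mul h]; exact (norm_minors_mul_le 1 h hh).trans h1
  · rw [← mul_inv_cancel h] at h1'
    exact h1'.trans (norm_minors_mul_le h h⁻¹ hi)

open scoped Classical in
/-- The function of degree zero on the space of minors with the values `Θ` for `A₃ = 1`. -/
def homogExt (Θ : (Fin 8 × Fin 8 → k) → ℂ) (m : Fin 8 × Fin 8 → k) : ℂ :=
  if zMin m = 0 then 0 else Θ ((zMin m)⁻¹ • m)

theorem homogExt_smul (Θ : (Fin 8 × Fin 8 → k) → ℂ) {c : k} (hc : c ≠ 0)
    (m : Fin 8 × Fin 8 → k) : homogExt Θ (c • m) = homogExt Θ m := by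
  rw [homogExt, homogExt, zMin_smul]
  by_cases hz : zMin m = 0
  · rw [if_pos hz, if_pos (by rw [hz, mul_zero])]
  · rw [if_neg hz, if_neg (mul_ne_zero hc hz), smul_smul]
    congr 2
    field_simp

theorem norm_zMin_le (m : Fin 8 × Fin 8 → k) : ‖zMin m‖ ≤ ‖m‖ :=
  (IsUltrametricDist.norm_add_le_max _ _).trans
    (max_le (norm_le_pi_norm m _) (norm_le_pi_norm m _))

theorem norm_eq_of_near {V : Type*} [SeminormedAddCommGroup V] [IsUltrametricDist V]
    {m m' : V} (h : ‖m' - m‖ < ‖m‖) : ‖m'‖ = ‖m‖ := by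
  have := IsUltrametricDist.norm_add_eq_max_of_norm_ne_norm (x := m' - m) (y := m) h.ne
  rwa [sub_add_cancel, max_eq_right h.le] at this

theorem homogExt_stable {Θ : (Fin 8 × Fin 8 → k) → ℂ} {C η : ℝ} (hη : 0 < η)
    (hC : ∀ x, Θ x ≠ 0 → ‖x‖ ≤ C) (hΘ : ∀ x y, ‖x - y‖ ≤ η → Θ x = Θ y) :
    ∃ δ > 0, δ < 1 ∧ ∀ m m' : Fin 8 × Fin 8 → k, ‖m' - m‖ ≤ δ * ‖m‖ →
      homogExt Θ m' = homogExt Θ m := by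
  set C' := max C 1 with hC'
  have hC1 : 1 ≤ C' := le_max_right _ _
  obtain ⟨δ, hδ0, hδ1, hδ2⟩ : ∃ δ > 0, δ * C' < 1 ∧ δ * C' * C' ≤ η := by
    refine ⟨min (1 / (2 * C')) (η / (C' * C')), by positivity, ?_, ?_⟩
    · calc _ ≤ 1 / (2 * C') * C' := by gcongr; exact min_le_left _ _
        _ < 1 := by field_simp; norm_num
    · calc _ ≤ η / (C' * C') * C' * C' := by gcongr; exact min_le_right _ _
        _ = η := by field_simp
  have hδ : δ < 1 := by nlinarith
  have key : ∀ m m' : Fin 8 × Fin 8 → k, ‖m' - m‖ ≤ δ * ‖m‖ → homogExt Θ m ≠ 0 →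
      homogExt Θ m' = homogExt Θ m := by
    intro m m' hm hne
    have hz : zMin m ≠ 0 := fun h => hne (by rw [homogExt, if_pos h])
    rw [homogExt, if_neg hz] at hne
    have h1 := (hC _ hne).trans (le_max_left C 1)
    rw [← hC', norm_smul, norm_inv, inv_mul_le_iff₀ (norm_pos_iff.2 hz), mul_comm] at h1
    have h2 : ‖m' - m‖ ≤ δ * C' * ‖zMin m‖ := by
      rw [mul_assoc]; exact hm.trans (by gcongr)
    have h3 : ‖zMin m' - zMin m‖ ≤ δ * C' * ‖zMin m‖ := by
      rw [← zMin_sub]; exact (norm_zMin_le _).trans h2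
    have h4 : ‖zMin m'‖ = ‖zMin m‖ := norm_eq_of_near
      (h3.trans_lt (by have := norm_pos_iff.2 hz; nlinarith))
    have hz' : zMin m' ≠ 0 := by rw [← norm_pos_iff, h4]; exact norm_pos_iff.2 hz
    rw [homogExt, homogExt, if_neg hz, if_neg hz']
    refine hΘ _ _ ?_
    have e : (zMin m')⁻¹ • m' - (zMin m)⁻¹ • m = (zMin m')⁻¹ • (m' - m) +
        ((zMin m')⁻¹ * (zMin m - zMin m') * (zMin m)⁻¹) • m := by
      have : (zMin m')⁻¹ * (zMin m - zMin m') * (zMin m)⁻¹ = (zMin m')⁻¹ - (zMin m)⁻¹ := by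
        field_simp
      rw [this, sub_smul, smul_sub]; abel
    have hp := norm_pos_iff.2 hz
    rw [e]
    refine (IsUltrametricDist.norm_add_le_max _ _).trans (max_le ?_ ?_)
    · rw [norm_smul, norm_inv, h4, inv_mul_le_iff₀ hp]
      calc _ ≤ δ * C' * ‖zMin m‖ := h2
        _ ≤ δ * C' * C' * ‖zMin m‖ := by
          gcongr
          exact le_mul_of_one_le_right (by positivity) hC1
        _ ≤ _ := by rw [mul_comm]; gcongr
    · rw [norm_smul, norm_mul, norm_mul, norm_inv, norm_inv, h4, norm_sub_rev (zMin m)]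
      calc _ ≤ ‖zMin m‖⁻¹ * (δ * C' * ‖zMin m‖) * ‖zMin m‖⁻¹ * (C' * ‖zMin m‖) := by gcongr
        _ = δ * C' * C' := by field_simp
        _ ≤ η := hδ2
  refine ⟨δ, hδ0, hδ, fun m m' hm => ?_⟩
  by_cases h : homogExt Θ m = 0
  · by_contra hne
    rw [h] at hne
    rcases eq_or_ne m 0 with rfl | hm0
    · rw [norm_zero, mul_zero, sub_zero] at hm
      rw [norm_le_zero_iff.1 hm] at hne
      exact hne h
    have hn : ‖m'‖ = ‖m‖ := norm_eq_of_near
      (hm.trans_lt (by have := norm_pos_iff.2 hm0; nlinarith))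
    exact hne ((key m' m (by rwa [norm_sub_rev, hn]) hne) ▸ h)
  · exact key m m' hm h

end FinSections

section FinSection

variable {K : Type*} [Field K] [NumberField K] {v : HeightOneSpectrum (𝓞 K)}

/-- The standard section with values `Θ` on the minors, normalised by `A₃ = 1`, of `h y⁻¹`. -/
def finSec (Θ : (Fin 8 × Fin 8 → v.adicCompletion K) → ℂ) (y : Spin8 (v.adicCompletion K)) (s : ℂ)
    (h : Spin8 (v.adicCompletion K)) : ℂ :=
  homogExt Θ (minors (h * y⁻¹)) * ((‖minors h‖ ^ 5 : ℝ) : ℂ) ^ (-s)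

theorem isFinSection_finSec {Θ : (Fin 8 × Fin 8 → v.adicCompletion K) → ℂ} {C η : ℝ} (hη : 0 < η)
    (hC : ∀ x, Θ x ≠ 0 → ‖x‖ ≤ C) (hΘ : ∀ x y, ‖x - y‖ ≤ η → Θ x = Θ y)
    (y : Spin8 (v.adicCompletion K)) : IsFinSection v (finSec Θ y) where
  induced s p hp h := by
    have hd := PH.leviDet_mul_dualDet hp
    have hd0 : dualDet p ≠ 0 := right_ne_zero_of_mul_eq_one hd
    have e : dualDet p = (leviDet p)⁻¹ := eq_inv_of_mul_eq_one_right hd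
    rw [finSec, finSec, mul_assoc p, minors_PH_mul hp, homogExt_smul _ hd0, minors_PH_mul hp,
      norm_smul, mul_pow, Complex.ofReal_mul, Complex.mul_cpow_ofReal_nonneg (by positivity)
      (by positivity), e, norm_inv, inv_pow, Complex.ofReal_inv, Complex.inv_cpow _ _
      (by rw [Complex.arg_ofReal_of_nonneg (by positivity)]; exact Real.pi_pos.ne),
      ← Complex.cpow_neg, neg_neg]
    ring
  smooth s := by
    obtain ⟨δ, hδ0, hδ1, hst⟩ := homogExt_stable hη hC hΘ
    have h1 := eventually_minors_mul_near (k := v.adicCompletion K) hδ0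
    have hc : Filter.Tendsto (fun n : Spin8 (v.adicCompletion K) => y * n * y⁻¹) (𝓝 1) (𝓝 1) := by
      have : Continuous fun n : Spin8 (v.adicCompletion K) => y * n * y⁻¹ := by fun_prop
      have := this.tendsto 1
      simpa using this
    refine ⟨_, (hc.eventually h1).and h1, fun n hn h => ?_⟩
    obtain ⟨hn1, hn2⟩ := hn
    have a := hst _ _ (hn1 (h * y⁻¹))
    rw [show h * y⁻¹ * (y * n * y⁻¹) = h * n * y⁻¹ by group] at a
    have b : ‖minors (h * n)‖ = ‖minors h‖ := by
      rcases eq_or_ne (minors h) 0 with h0 | h0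
      · have := hn2 h
        rw [h0, norm_zero, mul_zero, sub_zero] at this
        rw [h0, norm_le_zero_iff.1 this]
      · exact norm_eq_of_near ((hn2 h).trans_lt (by have := norm_pos_iff.2 h0; nlinarith))
    rw [finSec, finSec, a, b]
  standard h hh s s' := by
    have : ‖minors h‖ = 1 := norm_minors_integral fun i j => mem_integers_iff.1 (hh i j).1
    rw [finSec, finSec, this]; simp

end FinSection

/-! ### Averages and indicator functions -/

theorem Circle.eq_one_of_forall_pow {z : Circle} (h : ∀ n : ℕ, ‖(z ^ n : ℂ) - 1‖ ≤ 1 / 2) :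
    z = 1 := by
  by_contra hne
  have hd : 0 < ‖(z : ℂ) - 1‖ := norm_pos_iff.2 (sub_ne_zero.2 fun e => hne (Circle.ext e))
  have key : ∀ n : ℕ, (3 / 2 : ℝ) ^ n * ‖(z : ℂ) - 1‖ ≤ ‖(z ^ 2 ^ n : ℂ) - 1‖ := by
    intro n
    induction n with
    | zero => simp
    | succ n ih =>
      have e : (z ^ 2 ^ (n + 1) : ℂ) - 1 = (z ^ 2 ^ n - 1) * (z ^ 2 ^ n + 1) := by ring
      have h1 : 3 / 2 ≤ ‖(z ^ 2 ^ n : ℂ) + 1‖ := by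
        have h2 := norm_sub_le (2 : ℂ) ((z ^ 2 ^ n : ℂ) + 1)
        have h3 := norm_sub_norm_le (2 : ℂ) (1 - (z ^ 2 ^ n : ℂ))
        rw [norm_sub_rev] at h3
        have h4 := h (2 ^ n)
        rw [norm_sub_rev] at h4
        have e2 : (2 : ℂ) - (1 - z ^ 2 ^ n) = z ^ 2 ^ n + 1 := by ring
        have h5 := norm_sub_norm_le (2 : ℂ) (1 - (z ^ 2 ^ n : ℂ))
        rw [e2] at h5
        have h6 : ‖(2 : ℂ)‖ = 2 := by simp
        linarith
      rw [e, norm_mul, pow_succ]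
      calc _ = ((3 / 2 : ℝ) ^ n * ‖(z : ℂ) - 1‖) * (3 / 2) := by ring
        _ ≤ _ := by gcongr
  obtain ⟨n, hn⟩ := pow_unbounded_of_one_lt (1 / ‖(z : ℂ) - 1‖) (show (1 : ℝ) < 3 / 2 by norm_num)
  rw [div_lt_iff₀ hd] at hn
  have := (key n).trans (h (2 ^ n))
  linarith

/-- A continuous character of a non-archimedean field is trivial near `0`. -/
theorem exists_addChar_eq_one {k : Type*} [NormedField k] [IsUltrametricDist k]
    {ψ : AddChar k Circle} (hψ : Continuous ψ) : ∃ ε > 0, ∀ x, ‖x‖ ≤ ε → ψ x = 1 := by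
  have h1 : Filter.Tendsto (fun x => ‖(ψ x : ℂ) - 1‖) (𝓝 0) (𝓝 0) := by
    have : Continuous fun x => ‖(ψ x : ℂ) - 1‖ := by fun_prop
    have := this.tendsto 0
    simpa using this
  obtain ⟨ε, hε, hb⟩ := Metric.eventually_nhds_iff.1
    (h1.eventually (ge_mem_nhds (show (0 : ℝ) < 1 / 2 by norm_num)))
  refine ⟨ε / 2, by positivity, fun x hx => Circle.eq_one_of_forall_pow fun n => ?_⟩
  have h2 : ‖n • x‖ ≤ ε / 2 := by
    rw [nsmul_eq_mul, norm_mul]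
    exact (mul_le_of_le_one_left (norm_nonneg _) (IsUltrametricDist.norm_natCast_le_one k n)).trans hx
  have h3 := hb (y := n • x) (by rw [dist_zero_right]; linarith)
  rwa [AddChar.map_nsmul_eq_pow, Circle.coe_pow] at h3

/-- Averaging a vector with locally constant orbit over a compact group. -/
theorem exists_average {B E : Type*} [AddGroup B] [TopologicalSpace B] [CompactSpace B]
    [AddCommGroup E] [Module ℂ E] {σ : B → E →ₗ[ℂ] E} (hσ : ∀ b c x, σ (b + c) x = σ b (σ c x))
    (h0 : ∀ x, σ 0 x = x) {x₀ : E} (hlc : IsLocallyConstant fun b => σ b x₀) :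
    ∃ x, (∀ b, σ b x = x) ∧ ∀ (l : E →ₗ[ℂ] ℂ) c, (∀ b, l (σ b x₀) = c) → l x = c := by
  have hfin := hlc.range_finite
  have hc0 : (hfin.toFinset.card : ℂ) ≠ 0 := by
    rw [Nat.cast_ne_zero, Finset.card_ne_zero]
    exact ⟨σ 0 x₀, by simp⟩
  refine ⟨(hfin.toFinset.card : ℂ)⁻¹ • ∑ y ∈ hfin.toFinset, y, fun b => ?_, fun l c hl => ?_⟩
  · rw [map_smul, map_sum]
    congr 1
    have hm : ∀ b, ∀ y ∈ hfin.toFinset, σ b y ∈ hfin.toFinset := by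
      intro b y hy
      rw [Set.Finite.mem_toFinset] at hy ⊢
      obtain ⟨c, rfl⟩ := hy
      exact ⟨b + c, hσ b c x₀⟩
    refine Finset.sum_nbij' (σ b) (σ (-b)) (hm b) (hm (-b)) ?_ ?_ ?_
    · intro y _; rw [← hσ, neg_add_cancel, h0]
    · intro y _; rw [← hσ, add_neg_cancel, h0]
    · intro y _; rfl
  · rw [map_smul, map_sum, Finset.sum_congr rfl (g := fun _ => c), Finset.sum_const, nsmul_eq_mul,
      smul_eq_mul, inv_mul_cancel_left₀ hc0]
    intro y hy
    rw [Set.Finite.mem_toFinset] at hy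
    obtain ⟨b, rfl⟩ := hy
    exact hl b

open scoped Classical in
/-- The integral of the indicator function of a set which is open and compact modulo `Y`. -/
theorem cosetIntegral_indicator {X : Type*} [Group X] [TopologicalSpace X] [IsTopologicalGroup X]
    {Y : Subgroup X} {ν : Measure (Coset Y)} (hν : IsInvariantMeasure ν) {W C : Set X}
    (hW : IsOpen W) (hY : ∀ y ∈ Y, ∀ x, y * x ∈ W ↔ x ∈ W) (hne : W.Nonempty) (hC : IsCompact C)
    (hs : ∀ x ∈ W, ∃ y ∈ Y, y * x ∈ C) :
    ∃ V : ℝ, 0 < V ∧ ∀ c : ℂ, CosetIntegrable ν (fun x => if x ∈ W then c else 0) ∧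
      cosetIntegral ν (fun x => if x ∈ W then c else 0) = V * c := by
  have := hν.regular
  set A : Set (Coset Y) := toCoset Y '' W with hA
  have hopen : IsOpen A := isOpenQuotientMap_toCoset.isOpenMap _ hW
  have hsub : A ⊆ toCoset Y '' C := by
    rintro _ ⟨x, hx, rfl⟩
    obtain ⟨y, hy, hyx⟩ := hs x hx
    exact ⟨y * x, hyx, toCoset_mul_left hy x⟩
  have hfin : ν A < ⊤ := (measure_mono hsub).trans_lt
    (hC.image continuous_toCoset).measure_lt_top
  have hpos : 0 < ν A := hν.measure_pos hopen (hne.image _)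
  have e : ∀ c : ℂ, onCoset Y (fun x => if x ∈ W then c else 0) = A.indicator fun _ => c := by
    intro c
    funext q
    obtain ⟨x, rfl⟩ := toCoset_surjective q
    have hm : toCoset Y x ∈ A ↔ x ∈ W := by
      constructor
      · rintro ⟨x', hx', h⟩
        obtain ⟨y, hy, rfl⟩ := toCoset_eq_iff.1 h
        exact (hY y hy x').2 hx'
      · exact fun h => ⟨x, h, rfl⟩
    rw [onCoset_toCoset (fun y hy x => by simp only [hY y hy x]), Set.indicator_apply]
    simp only [hm]
  refine ⟨(ν A).toReal, ENNReal.toReal_pos hpos.ne' hfin.ne, fun c => ⟨?_, ?_⟩⟩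
  · rw [CosetIntegrable, e]
    exact (integrable_indicator_iff hopen.measurableSet).2 (integrableOn_const hfin.ne)
  · rw [cosetIntegral, e, integral_indicator hopen.measurableSet, setIntegral_const]
    simp [Measure.real]

/-! ### The local integral over `U^μ \ G` -/

section MuRatio

variable {k : Type*} [NormedField k]

/-- The minors of `μ g`, normalised by `A₃ = 1`. -/
def muRatio (g : G2 k) : Fin 8 × Fin 8 → k :=
  (g.1.1 3 3)⁻¹ • minors (muH k * G2.toSpin8 g)

/-- `pc` as a function of the minors. -/
def pcMin (m : Fin 8 × Fin 8 → k) : Fin 8 → k :=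
  ![0, m (7, 1) + m (5, 6), m (7, 2) + m (6, 4), m (7, 3) + m (4, 5),
    m (0, 4) + m (3, 2), m (0, 5) + m (1, 3), m (0, 6) + m (2, 1), 0]

theorem pcMin_muRatio (g : G2 k) (j : Fin 8) :
    pcMin (muRatio g) j = (g.1.1 3 3)⁻¹ * midPart (g.1.1 4) j := by
  rw [← pc_rows_mu g]
  fin_cases j <;> simp [pcMin, muRatio, pc, minors, mul_add]

theorem paMin_muRatio (g : G2 k) (j : Fin 8) :
    muRatio g (j, 0) + muRatio g (j, 7) = (g.1.1 3 3)⁻¹ * g.1.1 3 j := by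
  rw [← congrFun (pa_rows_mu g) j]
  simp [muRatio, minors, pa, mul_add]

theorem muRatio_one : muRatio (1 : G2 k) = minors (muH k) := by
  have h : (1 : G2 k).1.1 3 3 = 1 := by rw [G2.val_one, Matrix.one_apply_eq]
  rw [muRatio, map_one, mul_one, h, inv_one, one_smul]

theorem muRatio_three_four (g : G2 k) : muRatio g (3, 4) = (g.1.1 3 3)⁻¹ * kap g := by
  rw [← minors_mu_apply]; rfl

theorem exists_torusF_mul_of_muRatio_near {N : Set (G2 k)} (hN : N ∈ 𝓝 (1 : G2 k)) :
    ∃ ε > 0, ∀ g : G2 k, g.1.1 3 3 ≠ 0 → ‖muRatio g - muRatio 1‖ ≤ ε →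
      ∃ u ∈ unipU k, ∃ n ∈ N, g = torusF (g.1.1 3 3)⁻¹ 1 * u * n := by
  have ht : Filter.Tendsto (muRatio : G2 k → _)
      (Filter.comap muRatio (𝓝 (muRatio (1 : G2 k))) ⊓ Filter.principal {g | g.1.1 3 3 ≠ 0})
      (𝓝 (muRatio (1 : G2 k))) := Filter.tendsto_comap.mono_left inf_le_left
  have h1 : ∀ p, Filter.Tendsto (fun g : G2 k => muRatio g p) _ _ := tendsto_pi_nhds.1 ht
  have key := eventually_exists_torusF_mul
    (l := Filter.comap muRatio (𝓝 (muRatio (1 : G2 k))) ⊓ Filter.principal {g | g.1.1 3 3 ≠ 0})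
    (g := fun g : G2 k => g)
    (Filter.mem_inf_of_right (Filter.mem_principal_self _)) (fun j => ?_) (fun j => ?_) hN
  · rw [((Metric.nhds_basis_closedBall.comap _).inf_principal _).eventually_iff] at key
    obtain ⟨ε, hε, h⟩ := key
    exact ⟨ε, hε, fun g hg hd => h ⟨by
      rw [Set.mem_preimage, mem_closedBall_iff_norm]; exact hd, hg⟩⟩
  · have := (h1 (j, 0)).add (h1 (j, 7))
    rw [paMin_muRatio] at this
    refine (this.congr fun g => paMin_muRatio g j).trans_eq ?_
    congr 1
    rw [G2.val_one]
    simp [Matrix.one_apply, Pi.single_apply, eq_comm]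
  · have hc : Continuous fun m : Fin 8 × Fin 8 → k => pcMin m j := by
      fin_cases j <;> simp [pcMin] <;> fun_prop
    have := (hc.tendsto _).comp ht
    rw [pcMin_muRatio] at this
    refine (this.congr fun g => pcMin_muRatio g j).trans_eq ?_
    congr 1
    rw [G2.val_one]
    fin_cases j <;> simp [midPart]

end MuRatio

section LocalIntegral

variable {k : Type*} [NormedField k] [IsUltrametricDist k]

theorem norm_muRatio_one : ‖muRatio (1 : G2 k)‖ = 1 := by
  rw [muRatio_one]
  refine le_antisymm ((pi_norm_le_iff_of_nonneg zero_le_one).2 fun p => ?_) ?_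
  · have h : ∀ i, ‖(Pi.single 3 1 : Fin 8 → k) i‖ ≤ 1 := by
      intro i; rw [Pi.single_apply]; split_ifs <;> simp
    have h' : ∀ i, ‖(Pi.single 0 1 + Pi.single 2 1 : Fin 8 → k) i‖ ≤ 1 := by
      intro i; fin_cases i <;> simp
    rw [minors_muH_apply, sub_eq_add_neg]
    refine (IsUltrametricDist.norm_add_le_max _ _).trans (max_le ?_ ?_)
    · rw [norm_mul]; exact mul_le_one₀ (h _) (norm_nonneg _) (h' _)
    · rw [norm_neg, norm_mul]; exact mul_le_one₀ (h _) (norm_nonneg _) (h' _)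
  · have := norm_le_pi_norm (minors (muH k)) (3, 0)
    rw [minors_muH_apply] at this
    simpa using this

/-- The elements of `U` close to the big cell: decomposition with control of the character. -/
theorem exists_decomp_of_muRatio_near {N : Set (G2 k)} (hN : N ∈ 𝓝 (1 : G2 k)) {η : ℝ}
    (hη : 0 < η) :
    ∃ ε > 0, ∀ g : G2 k, g.1.1 3 3 ≠ 0 → ‖muRatio g - muRatio 1‖ ≤ ε →
      ∃ u ∈ unipU k, ∃ n ∈ N, g = torusF (g.1.1 3 3)⁻¹ 1 * u * n ∧ ‖psiArg u‖ ≤ η := by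
  have hk : Continuous (kap : G2 k → k) := by
    have := G2.continuous_entry (R := k)
    unfold kap pm; simp only [Pi.add_apply]; fun_prop
  have hd : Continuous (detD : G2 k → k) := by
    have := G2.continuous_entry (R := k)
    unfold detD; fun_prop
  have hk1 : kap (1 : G2 k) = 0 := by simp [kap, pm]
  have hd1 : detD (1 : G2 k) = 1 := by simp [detD]
  have hkN : ∀ᶠ n in 𝓝 (1 : G2 k), ‖kap n‖ < η := by
    have := hk.norm.tendsto 1
    rw [hk1, norm_zero] at this
    exact this.eventually (gt_mem_nhds hη)
  have hdN : ∀ᶠ n in 𝓝 (1 : G2 k), ‖detD n - 1‖ < 1 := by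
    have hc : Continuous fun n : G2 k => ‖detD n - 1‖ := (hd.sub continuous_const).norm
    have := hc.tendsto 1
    rw [hd1, sub_self, norm_zero] at this
    exact this.eventually (gt_mem_nhds one_pos)
  obtain ⟨ε, hε, h⟩ := exists_torusF_mul_of_muRatio_near
    (Filter.inter_mem hN (Filter.inter_mem hkN hdN))
  refine ⟨min ε η, lt_min hε hη, fun g hg hm => ?_⟩
  obtain ⟨u, hu, n, ⟨hn, hn1, hn2⟩, e⟩ := h g hg (hm.trans (min_le_left _ _))
  refine ⟨u, hu, n, hn, e, ?_⟩
  have e1 : kap g = g.1.1 3 3 * (kap n - psiArg u * detD n) := by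
    conv_lhs => rw [e]
    rw [mul_assoc, kap_torusF_mul (inv_ne_zero hg), kap_unip_mul hu, inv_inv]
  have e2 : muRatio g (3, 4) = kap n - psiArg u * detD n := by
    rw [muRatio_three_four, e1, inv_mul_cancel_left₀ hg]
  have e3 : (muRatio g - muRatio (1 : G2 k)) (3, 4) = kap n - psiArg u * detD n := by
    rw [Pi.sub_apply, e2, muRatio_three_four, hk1, mul_zero, sub_zero]
  have h3 := (norm_le_pi_norm (muRatio g - muRatio (1 : G2 k)) (3, 4)).trans
    (hm.trans (min_le_right _ _))
  rw [e3] at h3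
  have hd' : ‖detD n‖ = 1 := by
    rw [← norm_one (α := k)]; exact norm_eq_of_near (by rwa [norm_one])
  calc ‖psiArg u‖ = ‖psiArg u * detD n‖ := by rw [norm_mul, hd', mul_one]
    _ = ‖kap n - (kap n - psiArg u * detD n)‖ := by rw [sub_sub_cancel]
    _ ≤ max ‖kap n‖ ‖kap n - psiArg u * detD n‖ := by
      rw [sub_eq_add_neg, ← norm_neg (kap n - psiArg u * detD n)]
      exact IsUltrametricDist.norm_add_le_max _ _
    _ ≤ η := max_le (le_of_lt hn1) h3

end LocalIntegral

section LocalIntegral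

variable {k : Type*} [NormedField k] [IsUltrametricDist k] [ProperSpace k]
  {E : Type*} [AddCommGroup E] [Module ℂ E]

/-- Averaging `x₀` over a large compact subgroup of `x_{α+β}`, with respect to `ψ`. -/
theorem exists_average_xAB {ψ : AddChar k Circle} (hψ : Continuous ψ)
    (ρ : Representation ℂ (G2 k) E) {x₀ : E} (hx₀ : ∀ᶠ g in 𝓝 (1 : G2 k), ρ g x₀ = x₀) {R : ℝ}
    (hR : 0 ≤ R) :
    ∃ x, (∀ r, ‖r‖ ≤ R → ρ (xAB r) x = (ψ r : ℂ) • x) ∧ ∀ (l : E →ₗ[ℂ] ℂ) c,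
      (∀ r, ‖r‖ ≤ R → (ψ (-r) : ℂ) * l (ρ (xAB r) x₀) = c) → l x = c := by
  let B : AddSubgroup k :=
    { carrier := {r | ‖r‖ ≤ R}
      zero_mem' := by simpa using hR
      add_mem' := fun {a b} ha hb => (IsUltrametricDist.norm_add_le_max a b).trans (max_le ha hb)
      neg_mem' := fun {a} ha => by simpa using ha }
  have hBc : CompactSpace B := by
    suffices h : IsCompact (B : Set k) from isCompact_iff_compactSpace.1 h
    have : (B : Set k) = Metric.closedBall 0 R := by
      ext r; exact mem_closedBall_zero_iff.symm
    rw [this]; exact isCompact_closedBall _ _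
  let σ : B → E →ₗ[ℂ] E := fun b => (ψ (-b.1) : ℂ) • ρ (xAB b.1)
  have hσ : ∀ b c x, σ (b + c) x = σ b (σ c x) := by
    intro b c x
    have e : xAB ((b + c : B) : k) = xAB b.1 * xAB c.1 := xAB_add _ _
    simp only [σ, LinearMap.smul_apply, map_smul, smul_smul]
    rw [e, map_mul, Module.End.mul_apply]
    congr 1
    rw [← Circle.coe_mul, ← AddChar.map_add_eq_mul]
    congr 2
    rw [AddSubgroup.coe_add]; ring
  have h1 : xAB (0 : k) = 1 := addParam_zero xAB_add
  have h0 : ∀ x, σ 0 x = x := by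
    intro x
    simp [σ, h1]
  have hev : ∀ᶠ b in 𝓝 (0 : B), σ b x₀ = x₀ := by
    obtain ⟨ε, hε, hψε⟩ := exists_addChar_eq_one hψ
    have t1 : Filter.Tendsto (fun b : B => xAB b.1) (𝓝 0) (𝓝 1) := by
      have := (continuous_xAB (R := k)).comp (continuous_subtype_val (p := (· ∈ B)))
      have := this.tendsto 0
      rwa [Function.comp_apply, AddSubgroup.coe_zero, h1] at this
    have t2 : ∀ᶠ b : B in 𝓝 0, ‖-b.1‖ < ε := by
      have : Continuous fun b : B => ‖-b.1‖ := by fun_prop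
      have := this.tendsto 0
      simp only [AddSubgroup.coe_zero, neg_zero, norm_zero] at this
      exact this.eventually (gt_mem_nhds hε)
    filter_upwards [t1.eventually hx₀, t2] with b hb hb'
    simp [σ, hb, hψε _ hb'.le]
  have hlc : IsLocallyConstant fun b => σ b x₀ := by
    rw [IsLocallyConstant.iff_eventually_eq]
    intro b
    have t : Filter.Tendsto (fun c : B => -b + c) (𝓝 b) (𝓝 0) := by
      have : Continuous fun c : B => -b + c := by fun_prop
      have := this.tendsto b
      rwa [neg_add_cancel] at this
    filter_upwards [t.eventually hev] with c hc
    have := hσ b (-b + c) x₀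
    rwa [add_neg_cancel_left, hc] at this
  obtain ⟨x, hx1, hx2⟩ := exists_average hσ h0 hlc
  refine ⟨x, fun r hr => ?_, fun l c hl => hx2 l c fun b => ?_⟩
  · have := hx1 ⟨r, hr⟩
    simp only [σ, LinearMap.smul_apply] at this
    conv_rhs => rw [← this, smul_smul, ← Circle.coe_mul, ← AddChar.map_add_eq_mul, add_neg_cancel,
      AddChar.map_zero_eq_one, Circle.coe_one, one_smul]
  · have := hl b.1 b.2
    simpa [σ] using this

/-- The set on which the integrand of the local integral does not vanish. -/
def goodSet (ψ : AddChar k Circle) (ε R : ℝ) : Set (G2 k) :=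
  {g | g.1.1 3 3 ≠ 0 ∧ ‖muRatio g - muRatio 1‖ ≤ ε ∧
    ∀ r, ‖r‖ ≤ R → ψ (((g.1.1 3 3)⁻¹ - 1) * r) = 1}

theorem isOpen_goodSet {ψ : AddChar k Circle} (hψ : Continuous ψ) {ε R : ℝ} (hε : 0 < ε)
    (hR : 0 < R) : IsOpen (goodSet ψ ε R) := by
  rw [isOpen_iff_mem_nhds]
  rintro g ⟨h1, h2, h3⟩
  obtain ⟨η, hη, hψη⟩ := exists_addChar_eq_one hψ
  have c33 : Filter.Tendsto (fun g : G2 k => g.1.1 3 3) (𝓝 g) (𝓝 (g.1.1 3 3)) :=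
    (G2.continuous_entry 3 3).tendsto g
  have ci := c33.inv₀ h1
  have cm : Filter.Tendsto (fun g : G2 k => muRatio g) (𝓝 g) (𝓝 (muRatio g)) := by
    refine ci.smul (Continuous.tendsto (continuous_pi fun p => ?_) g)
    have := G2.continuous_entry (R := k)
    simp only [minors, rowA_muH_mul, rowB_muH_mul, pm, Pi.add_apply]; fun_prop
  have e2 : ∀ᶠ g' in 𝓝 g, ‖muRatio g' - muRatio 1‖ ≤ ε := by
    have ho := IsUltrametricDist.isOpen_closedBall (muRatio (1 : G2 k)) hε.ne'
    filter_upwards [cm.eventually (ho.mem_nhds (mem_closedBall_iff_norm.2 h2))] with g' hg'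
    exact mem_closedBall_iff_norm.1 hg'
  have e3 : ∀ᶠ g' in 𝓝 g, ‖(g'.1.1 3 3)⁻¹ - (g.1.1 3 3)⁻¹‖ < η / R := by
    have := (ci.sub_const (g.1.1 3 3)⁻¹).norm
    rw [sub_self, norm_zero] at this
    exact this.eventually (gt_mem_nhds (by positivity))
  filter_upwards [c33.eventually_ne h1, e2, e3] with g' h1' h2' h3'
  refine ⟨h1', h2', fun r hr => ?_⟩
  have e : ((g'.1.1 3 3)⁻¹ - 1) * r = ((g'.1.1 3 3)⁻¹ - (g.1.1 3 3)⁻¹) * r +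
    ((g.1.1 3 3)⁻¹ - 1) * r := by ring
  rw [e, AddChar.map_add_eq_mul, h3 r hr, mul_one]
  refine hψη _ ?_
  rw [norm_mul]
  calc _ ≤ η / R * R := by gcongr
    _ = η := by field_simp

theorem mem_goodSet_unipUmu_mul {ψ : AddChar k Circle} {ε R : ℝ} {u : G2 k}
    (hu : u ∈ unipUmu k) (g : G2 k) : u * g ∈ goodSet ψ ε R ↔ g ∈ goodSet ψ ε R := by
  have h3 : (u * g).1.1 3 3 = g.1.1 3 3 := congrFun (uElt_mul_row_three hu.1 g) 3
  have hm : muRatio (u * g) = muRatio g := by rw [muRatio, muRatio, h3, minors_unipUmu_mul hu]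
  change (_ ∧ _ ∧ _) ↔ (_ ∧ _ ∧ _)
  rw [h3, hm]

/-- A vector and a neighbourhood for the computation of the local integral. -/
theorem exists_local_vector {ψ : AddChar k Circle} (hψ : Continuous ψ) (hψ1 : ψ ≠ 1)
    (ρ : Representation ℂ (G2 k) E) (hρ : ∀ x, ∀ᶠ g in 𝓝 (1 : G2 k), ρ g x = x) (x₀ : E) :
    ∃ (x : E) (ε R : ℝ), 0 < ε ∧ 0 < R ∧
      (∀ g ∈ goodSet ψ ε R, ‖minors (muH k * G2.toSpin8 g)‖ = 1) ∧
      (∃ C : Set (G2 k), IsCompact C ∧ ∀ g ∈ goodSet ψ ε R, ∃ u ∈ unipUmu k, u * g ∈ C) ∧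
      ∀ l : E →ₗ[ℂ] ℂ, (∀ u ∈ unipU k, ∀ x, l (ρ u x) = (ψ (psiArg u) : ℂ) * l x) →
        l x = l x₀ ∧ (∀ g ∈ goodSet ψ ε R, l (ρ g x) = l x₀) ∧
        ∀ g : G2 k, g.1.1 3 3 ≠ 0 → ‖muRatio g - muRatio 1‖ ≤ ε → g ∉ goodSet ψ ε R →
          l (ρ g x) = 0 := by
  obtain ⟨y₀, hy₀⟩ : ∃ y₀, ψ y₀ ≠ 1 := by
    by_contra! h
    exact hψ1 (DFunLike.ext _ _ h)
  have hy0 : 0 < ‖y₀‖ := norm_pos_iff.2 fun h => hy₀ (by rw [h, AddChar.map_zero_eq_one])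
  obtain ⟨δ, hδ, hδ1, hfix⟩ : ∃ δ > 0, δ < 1 ∧ ∀ a : k, ‖a - 1‖ ≤ δ → ρ (torusF a 1) x₀ = x₀ := by
    have h1 : Filter.Tendsto (fun a : k => torusF a 1) (𝓝 1) (𝓝 1) := by
      have := tendsto_torusF (k := k) one_ne_zero one_ne_zero (Filter.tendsto_id (x := 𝓝 1))
        (tendsto_const_nhds (x := (1 : k)))
      have e : torusF (1 : k) 1 = 1 := by
        rw [torusF, dif_pos ⟨one_ne_zero, one_ne_zero⟩, Units.mk0_one, torus_one]
      rwa [e] at this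
    obtain ⟨δ, hδ, h⟩ := Metric.nhds_basis_closedBall.eventually_iff.1 (h1.eventually (hρ x₀))
    exact ⟨min δ (1 / 2), by positivity, (min_le_right _ _).trans_lt (by norm_num), fun a ha =>
      h (mem_closedBall_iff_norm.2 (ha.trans (min_le_left _ _)))⟩
  set R := ‖y₀‖ / δ with hRd
  have hR : 0 < R := by positivity
  obtain ⟨x, hx1, hx2⟩ := exists_average_xAB hψ ρ (hρ x₀) hR.le
  obtain ⟨η, hη, hψη⟩ := exists_addChar_eq_one hψ
  have hone : ∀ a : k, (∀ r, ‖r‖ ≤ R → ψ ((a - 1) * r) = 1) → ‖a - 1‖ < δ := by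
    intro a ha
    by_contra! hle
    have hne : a - 1 ≠ 0 := norm_pos_iff.1 (hδ.trans_le hle)
    refine hy₀ ?_
    rw [← mul_div_cancel₀ y₀ hne]
    refine ha _ ?_
    rw [norm_div, hRd]; gcongr
  have hbd : ∀ᶠ n in 𝓝 (1 : G2 k), ∀ i j, ‖n.1.1 i j‖ < 2 := by
    simp only [Filter.eventually_all]
    intro i j
    have := (G2.continuous_entry (R := k) i j).norm.tendsto 1
    refine this.eventually (gt_mem_nhds ?_)
    rw [G2.val_one, Matrix.one_apply]
    split_ifs <;> simp
  obtain ⟨ε, hε, hdec⟩ := exists_decomp_of_muRatio_near (Filter.inter_mem (hρ x) hbd) hη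
  have hnorm : ∀ g ∈ goodSet ψ (min ε (1 / 2)) R, ‖(g.1.1 3 3)⁻¹‖ = 1 := by
    rintro g ⟨-, -, h3⟩
    rw [← norm_one (α := k)]
    exact norm_eq_of_near (by rw [norm_one]; exact (hone _ h3).trans hδ1)
  refine ⟨x, min ε (1 / 2), R, by positivity, hR, fun g hg => ?_,
    ⟨_, isCompact_bounded ((1 + η + η ^ 2) * 2), fun g hg => ?_⟩, fun l hl => ?_⟩
  · have h1 : ‖muRatio g‖ = 1 := by
      rw [← norm_muRatio_one (k := k)]
      refine norm_eq_of_near ((hg.2.1.trans (min_le_right _ _)).trans_lt ?_)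
      rw [norm_muRatio_one]; norm_num
    rwa [muRatio, norm_smul, hnorm g hg, one_mul] at h1
  · obtain ⟨u, hu, n, ⟨-, hn⟩, e, hp⟩ := hdec g hg.1 (hg.2.1.trans (min_le_left _ _))
    have hna := hnorm g hg
    have ha := inv_ne_zero hg.1
    set a := (g.1.1 3 3)⁻¹
    set u' := u * (xAB (psiArg u))⁻¹ with hu'
    have hu'U : u' ∈ unipU k := mul_mem hu (inv_mem (xAB_mem_unipU _))
    have hu'0 : psiArg u' = 0 := by
      rw [hu', ← addParam_neg xAB_add, psiArg_mul hu (xAB_mem_unipU _), psiArg_xAB, add_neg_cancel]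
    refine ⟨(torusF a 1 * u' * (torusF a 1)⁻¹)⁻¹, inv_mem ?_, ?_⟩
    · rw [mem_unipUmu_iff (torusF_conj_mem ha hu'U), psiArg_torusF_conj ha, hu'0, mul_zero]
    · have e2 : (torusF a 1 * u' * (torusF a 1)⁻¹)⁻¹ * g =
          torusF a 1 * (xAB (psiArg u) * n) := by
        rw [e, hu']; group
      rw [e2]
      intro i j
      have h1 : ‖(![1, a, 1, a⁻¹, a⁻¹, 1, a, 1] : Fin 8 → k) i‖ ≤ 1 := by
        fin_cases i <;> simp [hna]
      have h2 : ‖(xAB (psiArg u) * n).1.1 i j‖ ≤ (1 + η + η ^ 2) * 2 := by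
        change ‖∑ m, xABMat (psiArg u) i m * n.1.1 m j‖ ≤ _
        refine IsUltrametricDist.norm_sum_le_of_forall_le_of_nonneg (by positivity) fun m _ => ?_
        have h3 : ‖xABMat (psiArg u) i m‖ ≤ 1 + η + η ^ 2 := by
          have : ‖psiArg u‖ ^ 2 ≤ η ^ 2 := by gcongr
          have := sq_nonneg η
          fin_cases i <;> fin_cases m <;> simp [xABMat] <;> first | positivity | linarith
        rw [norm_mul]
        exact mul_le_mul h3 (hn m j).le (norm_nonneg _) (by positivity)
      rw [torusF_mul_row ha, Pi.smul_apply, norm_smul]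
      exact (mul_le_of_le_one_left (norm_nonneg _) h1).trans h2
  have hτ : ∀ a : k, a ≠ 0 → (∀ r, ‖r‖ ≤ R → ψ ((a - 1) * r) = 1) →
      l (ρ (torusF a 1) x) = l x₀ := by
    intro a ha h
    refine hx2 (l ∘ₗ ρ (torusF a 1)) _ fun r hr => ?_
    rw [LinearMap.comp_apply, ← Module.End.mul_apply, ← map_mul, ← xAB_mul_torusF ha, map_mul,
      Module.End.mul_apply, hl _ (xAB_mem_unipU _), psiArg_xAB, hfix a (hone a h).le, ← mul_assoc,
      ← Circle.coe_mul, ← AddChar.map_add_eq_mul, show -r + a * r = (a - 1) * r by ring, h r hr,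
      Circle.coe_one, one_mul]
  have hτ0 : ∀ a : k, a ≠ 0 → (¬ ∀ r, ‖r‖ ≤ R → ψ ((a - 1) * r) = 1) →
      l (ρ (torusF a 1) x) = 0 := by
    intro a ha h
    push Not at h
    obtain ⟨r, hr, hne⟩ := h
    have e1 : l (ρ (xAB (a * r)) (ρ (torusF a 1) x)) = (ψ r : ℂ) * l (ρ (torusF a 1) x) := by
      rw [← Module.End.mul_apply, ← map_mul, xAB_mul_torusF ha, map_mul, Module.End.mul_apply,
        hx1 r hr, map_smul, map_smul, smul_eq_mul]
    rw [hl _ (xAB_mem_unipU _), psiArg_xAB] at e1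
    have e2 : ((ψ (a * r) : ℂ) - ψ r) * l (ρ (torusF a 1) x) = 0 := by rw [sub_mul, e1, sub_self]
    refine (mul_eq_zero.1 e2).resolve_left fun h0 => hne ?_
    have e3 : ψ (a * r) = ψ r := Circle.ext (sub_eq_zero.1 h0)
    rw [show (a - 1) * r = a * r - r by ring, AddChar.map_sub_eq_div, e3, div_self']
  have hg : ∀ g : G2 k, g.1.1 3 3 ≠ 0 → ‖muRatio g - muRatio 1‖ ≤ min ε (1 / 2) →
      ∃ p : k, ‖p‖ ≤ η ∧ l (ρ g x) =
        (ψ ((g.1.1 3 3)⁻¹ * p) : ℂ) * l (ρ (torusF (g.1.1 3 3)⁻¹ 1) x) := by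
    intro g hg hm
    obtain ⟨u, hu, n, ⟨hn, -⟩, e, hp⟩ := hdec g hg (hm.trans (min_le_left _ _))
    refine ⟨psiArg u, hp, ?_⟩
    have ha := inv_ne_zero hg
    have hn' : ρ n x = x := hn
    conv_lhs => rw [e, map_mul, Module.End.mul_apply, hn',
      ← inv_mul_cancel_right (torusF (g.1.1 3 3)⁻¹ 1 * u) (torusF (g.1.1 3 3)⁻¹ 1), map_mul,
      Module.End.mul_apply, hl _ (torusF_conj_mem ha hu), psiArg_torusF_conj ha]
  refine ⟨?_, ?_, ?_⟩
  · refine hx2 l _ fun r _ => ?_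
    rw [hl _ (xAB_mem_unipU _), psiArg_xAB, ← mul_assoc, ← Circle.coe_mul,
      ← AddChar.map_add_eq_mul, neg_add_cancel, AddChar.map_zero_eq_one, Circle.coe_one, one_mul]
  · rintro g ⟨h1, h2, h3⟩
    obtain ⟨p, hp, e⟩ := hg g h1 h2
    rw [e, hτ _ (inv_ne_zero h1) h3, hψη, Circle.coe_one, one_mul]
    rw [norm_mul]
    rwa [hnorm g ⟨h1, h2, h3⟩, one_mul]
  · intro g h1 h2 h3
    obtain ⟨p, hp, e⟩ := hg g h1 h2
    rw [e, hτ0 _ (inv_ne_zero h1) fun h => h3 ⟨h1, h2, h⟩, mul_zero]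

end LocalIntegral

section PartThree

variable {K : Type*} [Field K] [NumberField K] {ψ : AddChar (Adele K) Circle}
  {v : HeightOneSpectrum (𝓞 K)}

/-- The local component of a character of the adeles at a finite place. -/
def localChar (ψ : AddChar (Adele K) Circle) (v : HeightOneSpectrum (𝓞 K)) :
    AddChar (v.adicCompletion K) Circle where
  toFun x := ψ (adeleAtHom v x)
  map_zero_eq_one' := by rw [map_zero, AddChar.map_zero_eq_one]
  map_add_eq_mul' x y := by rw [map_add, AddChar.map_add_eq_mul]

open scoped Classical in
theorem exists_local_integral (hψ : Continuous ψ) (hψK : ∀ x : K, ψ (algebraMap K (Adele K) x) = 1)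
    (hψ1 : ψ ≠ 1) {E : Type*} [AddCommGroup E] [Module ℂ E]
    (ρ : Representation ℂ (G2 (v.adicCompletion K)) E) (hρ : IsSmoothRep ρ)
    {ν : Measure (Coset (unipUmu (v.adicCompletion K)))} (hν : IsInvariantMeasure ν) (x₀ : E) :
    ∃ (x : E) (f : ℂ → Spin8 (v.adicCompletion K) → ℂ), IsFinSection v f ∧
        ∀ l : E →ₗ[ℂ] ℂ, IsSplitFunctional ψ ρ l → l x = l x₀ ∧ ∀ s : ℂ,
          CosetIntegrable ν (fun g => l (ρ g x) * f s (muH _ * G2.toSpin8 g)) ∧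
          cosetIntegral ν (fun g => l (ρ g x) * f s (muH _ * G2.toSpin8 g)) = l x := by
  have hc : Continuous (localChar ψ v) := hψ.comp (continuous_adeleAt v)
  have h1 : localChar ψ v ≠ 1 := by
    obtain ⟨x, hx⟩ := exists_adeleAt_ne_one hψ hψK hψ1 v
    exact fun h => hx (DFunLike.congr_fun h x)
  obtain ⟨x, ε, R, hε, hR, hn, ⟨C, hC, hWC⟩, hl⟩ := exists_local_vector hc h1 ρ
    (fun x => by
      obtain ⟨O, hO, h⟩ := hρ x
      filter_upwards [hO] with g hg using h g hg) x₀
  set W := goodSet (localChar ψ v) ε R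
  have hone : (1 : G2 (v.adicCompletion K)).1.1 3 3 = 1 := by rw [G2.val_one, Matrix.one_apply_eq]
  obtain ⟨V, hV, hVi⟩ := cosetIntegral_indicator hν (isOpen_goodSet hc hε hR)
    (fun u hu g => mem_goodSet_unipUmu_mul hu g)
    ⟨1, by rw [hone]; exact one_ne_zero, by rw [sub_self, norm_zero]; exact hε.le, fun r _ => by
      rw [hone, inv_one, sub_self, zero_mul, AddChar.map_zero_eq_one]⟩ hC hWC
  let Θ : (Fin 8 × Fin 8 → v.adicCompletion K) → ℂ :=
    fun m => if ‖m - muRatio (1 : G2 (v.adicCompletion K))‖ ≤ ε then (V : ℂ)⁻¹ else 0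
  refine ⟨x, finSec Θ 1, isFinSection_finSec (C := 1 + ε) (η := ε) hε ?_ ?_ 1, fun l hls => ?_⟩
  · intro m hm
    have hm' : ‖m - muRatio (1 : G2 (v.adicCompletion K))‖ ≤ ε := by
      by_contra h; exact hm (if_neg h)
    have := norm_le_norm_add_norm_sub' m (muRatio (1 : G2 (v.adicCompletion K)))
    rw [norm_muRatio_one] at this
    linarith
  · have key : ∀ m m' : Fin 8 × Fin 8 → v.adicCompletion K, ‖m' - m‖ ≤ ε →
        ‖m - muRatio (1 : G2 (v.adicCompletion K))‖ ≤ ε →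
        ‖m' - muRatio (1 : G2 (v.adicCompletion K))‖ ≤ ε := by
      intro m m' h1 h2
      rw [← sub_add_sub_cancel m' m]
      exact (IsUltrametricDist.norm_add_le_max _ _).trans (max_le h1 h2)
    intro m m' h
    have : ‖m - muRatio (1 : G2 (v.adicCompletion K))‖ ≤ ε ↔
        ‖m' - muRatio (1 : G2 (v.adicCompletion K))‖ ≤ ε :=
      ⟨key _ _ (by rwa [norm_sub_rev]), key _ _ h⟩
    simp only [Θ, this]
  · obtain ⟨hlx, hlW, hl0⟩ := hl l hls
    refine ⟨hlx, fun s => ?_⟩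
    have e : (fun g => l (ρ g x) * finSec Θ 1 s (muH _ * G2.toSpin8 g)) =
        fun g => if g ∈ W then l x₀ * (V : ℂ)⁻¹ else 0 := by
      funext g
      rw [finSec, inv_one, mul_one, homogExt, zMin_minors_mu]
      by_cases hg : g.1.1 3 3 = 0
      · rw [if_pos hg, zero_mul, mul_zero, if_neg fun h => h.1 hg]
      rw [if_neg hg]
      change _ * (Θ (muRatio g) * _) = _
      by_cases hm : ‖muRatio g - muRatio (1 : G2 (v.adicCompletion K))‖ ≤ ε
      · rw [show Θ (muRatio g) = (V : ℂ)⁻¹ from if_pos hm]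
        by_cases hW : g ∈ W
        · rw [if_pos hW, hlW g hW, hn g hW]; simp
        · rw [if_neg hW, hl0 g hg hm hW, zero_mul]
      · rw [show Θ (muRatio g) = 0 from if_neg hm, zero_mul, mul_zero, if_neg fun h => hm h.2.1]
    rw [e]
    refine ⟨(hVi _).1, (hVi _).2.trans ?_⟩
    have : (V : ℂ) ≠ 0 := by exact_mod_cast hV.ne'
    rw [hlx]; field_simp

end PartThree

/-! ### Schwartz functions and inversion -/

section Inversion

open scoped SchwartzMap

variable {V : Type} [NormedAddCommGroup V] [InnerProductSpace ℝ V]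

/-- The function `|x|^λ Ψ(x / |x|²)`, extended by zero to the origin. -/
def flatExt {E : Type} [NormedAddCommGroup E] [NormedSpace ℝ E] [NormedSpace ℂ E] (l : ℂ)
    (Ψ : V → E) (x : V) : E :=
  Set.indicator {0}ᶜ (fun x => Complex.exp (l * Real.log ‖x‖) • Ψ ((‖x‖ ^ 2)⁻¹ • x)) x

/-- The derivative of the inversion at the point whose image is `u`. -/
def invDeriv (u : V) : V →L[ℝ] V :=
  (‖u‖ ^ 2) • ContinuousLinearMap.id ℝ V - (2 : ℝ) • (innerSL ℝ u).smulRight u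

theorem hasFDerivAt_inversion {x : V} (hx : x ≠ 0) :
    HasFDerivAt (fun x : V => (‖x‖ ^ 2)⁻¹ • x) (invDeriv ((‖x‖ ^ 2)⁻¹ • x)) x := by
  have hn : ‖x‖ ≠ 0 := norm_ne_zero_iff.2 hx
  have h1 : HasFDerivAt (fun x : V => ‖x‖ ^ 2) (2 • innerSL ℝ x) x :=
    (hasStrictFDerivAt_norm_sq x).hasFDerivAt
  have h2 := ((hasDerivAt_inv (pow_ne_zero 2 hn)).comp_hasFDerivAt x h1).smul (hasFDerivAt_id x)
  refine h2.congr_fderiv ?_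
  ext v
  simp [invDeriv, norm_smul]
  rw [smul_smul, smul_smul, sub_eq_add_neg, ← neg_smul]
  congr 1
  · congr 1
    field_simp
  · rw [← neg_smul]
    congr 1
    field_simp

theorem hasFDerivAt_exp_log_norm (l : ℂ) {x : V} (hx : x ≠ 0) :
    HasFDerivAt (fun x : V => Complex.exp (l * Real.log ‖x‖))
      ((Complex.exp (l * Real.log ‖x‖)) •
        ((innerSL ℝ ((‖x‖ ^ 2)⁻¹ • x)).smulRight l : V →L[ℝ] ℂ)) x := by
  have hn : ‖x‖ ≠ 0 := norm_ne_zero_iff.2 hx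
  have h1 : HasFDerivAt (fun x : V => ‖x‖ ^ 2) (2 • innerSL ℝ x) x :=
    (hasStrictFDerivAt_norm_sq x).hasFDerivAt
  have h2 := (Real.hasDerivAt_log (pow_ne_zero 2 hn)).comp_hasFDerivAt x h1
  have h3 : HasFDerivAt (fun x : V => l * (Real.log ‖x‖ : ℂ))
      ((innerSL ℝ ((‖x‖ ^ 2)⁻¹ • x)).smulRight l : V →L[ℝ] ℂ) x := by
    have h4 := (Complex.ofRealCLM.hasFDerivAt.comp x h2).const_mul (l / 2)
    refine (h4.congr_fderiv ?_).congr_of_eventuallyEq (Filter.Eventually.of_forall fun y => ?_)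
    · ext v
      simp
      field_simp
    · simp [Real.log_pow]
      ring
  exact h3.cexp

variable {E : Type} [NormedAddCommGroup E] [NormedSpace ℝ E] [NormedSpace ℂ E] [IsScalarTower ℝ ℂ E]

/-- The derivative of `flatExt l Ψ` is again of this form. -/
def flatDeriv (l : ℂ) (Ψ : 𝓢(V, E)) : 𝓢(V, V →L[ℝ] E) :=
  SchwartzMap.bilinLeftCLM
      (((ContinuousLinearMap.smulRightL ℝ V E).comp
        (innerSL ℝ : V →L[ℝ] V →L[ℝ] ℝ)).flip.comp (l • ContinuousLinearMap.id ℝ E))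
      (Function.HasTemperateGrowth.id' : Function.HasTemperateGrowth fun u : V => u) Ψ +
    SchwartzMap.bilinLeftCLM (ContinuousLinearMap.compL ℝ V V E)
      (g := invDeriv) (by
        refine Function.HasTemperateGrowth.sub ?_ ?_
        · exact Function.HasTemperateGrowth.smul (Function.hasTemperateGrowth_norm_sq V)
            (Function.HasTemperateGrowth.const _)
        · exact Function.HasTemperateGrowth.smul (f := fun _ : V => (2 : ℝ))
            (Function.HasTemperateGrowth.const _)
            (ContinuousLinearMap.bilinear_hasTemperateGrowth
              (ContinuousLinearMap.smulRightL ℝ V V)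
              (ContinuousLinearMap.hasTemperateGrowth (innerSL ℝ : V →L[ℝ] V →L[ℝ] ℝ))
              Function.HasTemperateGrowth.id'))
      (SchwartzMap.fderivCLM ℝ V E Ψ)

theorem flatDeriv_apply (l : ℂ) (Ψ : 𝓢(V, E)) (u : V) :
    flatDeriv l Ψ u = (innerSL ℝ u).smulRight (l • Ψ u) + (fderiv ℝ Ψ u).comp (invDeriv u) := rfl

theorem norm_flatExt_le (l : ℂ) (Ψ : 𝓢(V, E)) :
    ∃ C, 0 ≤ C ∧ ∀ x : V, ‖x‖ ≤ 1 → ‖flatExt l Ψ x‖ ≤ C * ‖x‖ ^ 2 := by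
  obtain ⟨m, hm⟩ := exists_nat_gt (2 - l.re)
  obtain ⟨C, hC, h⟩ := Ψ.decay m 0
  refine ⟨C, hC.le, fun x hx => ?_⟩
  by_cases h0 : x = 0
  · simp [flatExt, h0]
  have hn : 0 < ‖x‖ := norm_pos_iff.2 h0
  have hu : ‖(‖x‖ ^ 2)⁻¹ • x‖ = ‖x‖⁻¹ := by
    rw [norm_smul, norm_inv, norm_pow, norm_norm]; field_simp
  have h1 := h ((‖x‖ ^ 2)⁻¹ • x)
  rw [norm_iteratedFDeriv_zero, hu, inv_pow, inv_mul_le_iff₀ (by positivity)] at h1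
  rw [flatExt, Set.indicator_of_mem h0, norm_smul, Complex.norm_exp]
  have h2 : (l * (Real.log ‖x‖ : ℂ)).re = Real.log ‖x‖ * l.re := by simp [mul_comm]
  rw [h2, ← Real.rpow_def_of_pos hn]
  calc ‖x‖ ^ l.re * ‖Ψ ((‖x‖ ^ 2)⁻¹ • x)‖ ≤ ‖x‖ ^ l.re * (‖x‖ ^ m * C) := by gcongr
    _ = C * ‖x‖ ^ (l.re + m) := by rw [Real.rpow_add hn, Real.rpow_natCast]; ring
    _ ≤ C * ‖x‖ ^ (2 : ℝ) := by
      refine mul_le_mul_of_nonneg_left ?_ hC.le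
      exact Real.rpow_le_rpow_of_exponent_ge hn hx (by linarith)
    _ = _ := by rw [Real.rpow_two]

theorem hasFDerivAt_flatExt (l : ℂ) (Ψ : 𝓢(V, E)) (x : V) :
    HasFDerivAt (flatExt l Ψ) (flatExt l (flatDeriv l Ψ) x) x := by
  by_cases h0 : x = 0
  · subst h0
    obtain ⟨C, hC, h⟩ := norm_flatExt_le l Ψ
    have e : ∀ {F : Type} [NormedAddCommGroup F] [NormedSpace ℝ F] [NormedSpace ℂ F]
        (f : V → F), flatExt l f 0 = 0 := by
      intro F _ _ _ f; simp [flatExt]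
    rw [e, hasFDerivAt_iff_isLittleO_nhds_zero]
    simp only [zero_add, e, sub_zero, zero_apply]
    have h1 : (fun x : V => flatExt l Ψ x) =O[𝓝 0] fun x => ‖x‖ ^ 2 := by
      refine Asymptotics.IsBigO.of_bound C ?_
      filter_upwards [Metric.closedBall_mem_nhds (0 : V) one_pos] with x hx
      rw [norm_pow, norm_norm]
      exact h x (mem_closedBall_zero_iff.1 hx)
    refine h1.trans_isLittleO ?_
    exact Asymptotics.isLittleO_norm_pow_id one_lt_two
  · have hev : flatExt l Ψ =ᶠ[𝓝 x]
        fun x => Complex.exp (l * Real.log ‖x‖) • Ψ ((‖x‖ ^ 2)⁻¹ • x) := by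
      filter_upwards [isOpen_compl_singleton.mem_nhds h0] with y hy
      exact Set.indicator_of_mem hy _
    have h1 := (hasFDerivAt_exp_log_norm l h0).smul
      (((Ψ.hasFDerivAt _).comp x (hasFDerivAt_inversion h0)))
    refine (h1.congr_fderiv ?_).congr_of_eventuallyEq hev
    rw [flatExt, Set.indicator_of_mem h0]
    ext v
    simp only [flatDeriv_apply]
    simp only [add_apply, smul_apply,
      ContinuousLinearMap.smulRight_apply, ContinuousLinearMap.comp_apply, Function.comp_apply]
    rw [smul_add, add_comm]
    congr 1
    rw [smul_assoc, smul_assoc]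

theorem contDiff_flatExt (n : ℕ) : ∀ {E : Type} [NormedAddCommGroup E] [NormedSpace ℝ E]
    [NormedSpace ℂ E] [IsScalarTower ℝ ℂ E] (l : ℂ) (Ψ : 𝓢(V, E)),
    ContDiff ℝ n (flatExt l Ψ) := by
  induction n with
  | zero => intro E _ _ _ _ l Ψ
            exact contDiff_zero.2 (continuous_iff_continuousAt.2 fun x =>
              (hasFDerivAt_flatExt l Ψ x).continuousAt)
  | succ n ih =>
    intro E _ _ _ _ l Ψ
    push_cast
    rw [contDiff_succ_iff_fderiv]
    refine ⟨fun x => (hasFDerivAt_flatExt l Ψ x).differentiableAt, by simp, ?_⟩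
    have : fderiv ℝ (flatExt l Ψ) = flatExt l (flatDeriv l Ψ) :=
      funext fun x => (hasFDerivAt_flatExt l Ψ x).fderiv
    rw [this]
    exact ih l _

end Inversion

/-! ### Schwartz functions from functions of fewer variables -/

section Cylinder

open scoped SchwartzMap

theorem hasTemperateGrowth_smoothTransition :
    Function.HasTemperateGrowth Real.smoothTransition := by
  have hd : ContDiff ℝ (⊤ : ℕ∞) Real.smoothTransition := Real.smoothTransition.contDiff
  have hc : HasCompactSupport (fderiv ℝ Real.smoothTransition) := by
    refine HasCompactSupport.of_support_subset_isCompact (isCompact_Icc (a := (0 : ℝ)) (b := 1)) ?_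
    intro x hx
    by_contra hI
    refine hx ?_
    rcases lt_or_ge x 0 with h | h
    · have : Real.smoothTransition =ᶠ[𝓝 x] fun _ => 0 := by
        filter_upwards [gt_mem_nhds h] with y hy
        exact Real.smoothTransition.zero_of_nonpos hy.le
      rw [this.fderiv_eq]; simp
    · have h1 : 1 < x := by
        by_contra h1
        exact hI ⟨h, not_lt.1 h1⟩
      have : Real.smoothTransition =ᶠ[𝓝 x] fun _ => 1 := by
        filter_upwards [lt_mem_nhds h1] with y hy
        exact Real.smoothTransition.one_of_one_le hy.le
      rw [this.fderiv_eq]; simp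
  refine Function.HasTemperateGrowth.of_fderiv (k := 0) (C := 1)
    (hc.toSchwartzMap (hd.fderiv_right (m := (⊤ : ℕ∞)) le_rfl)).hasTemperateGrowth
    (hd.differentiable (by simp)) fun x => ?_
  rw [Real.norm_of_nonneg (Real.smoothTransition.nonneg x)]
  simpa using Real.smoothTransition.le_one x

variable {V W : Type} [NormedAddCommGroup V] [NormedSpace ℝ V] [NormedAddCommGroup W]
  [NormedSpace ℝ W]

theorem exists_schwartz_mul {θ : V → ℂ} (hθ : θ.HasTemperateGrowth) (φ : 𝓢(W, ℂ))
    (L : V →L[ℝ] W) {C : ℝ} (hC : ∀ x, θ x ≠ 0 → ‖x‖ ≤ C * (1 + ‖L x‖)) :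
    ∃ Ψ : 𝓢(V, ℂ), ∀ x, Ψ x = θ x * φ (L x) := by
  have hL : ContDiff ℝ (⊤ : ℕ∞) fun x => φ (L x) := φ.smooth'.comp L.contDiff
  have hC0 : 0 ≤ |C| := abs_nonneg C
  have hle : ∀ j : ℕ, (j : WithTop ℕ∞) ≤ ((⊤ : ℕ∞) : WithTop ℕ∞) := fun j => by
    exact_mod_cast le_top
  have hsupp : ∀ x ∈ tsupport θ, 1 + ‖x‖ ≤ (1 + |C|) * (1 + ‖L x‖) := by
    intro x hx
    have hcl : IsClosed {x : V | ‖x‖ ≤ C * (1 + ‖L x‖)} := isClosed_le (by fun_prop) (by fun_prop)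
    have h1 : ‖x‖ ≤ C * (1 + ‖L x‖) := closure_minimal (fun x hx => hC x hx) hcl hx
    have h2 : C * (1 + ‖L x‖) ≤ |C| * (1 + ‖L x‖) := by gcongr; exact le_abs_self C
    nlinarith [norm_nonneg (L x)]
  refine ⟨⟨fun x => θ x * φ (L x), hθ.1.mul hL, fun k n => ?_⟩, fun x => rfl⟩
  obtain ⟨N, B, hB, hθb⟩ := hθ.norm_iteratedFDeriv_le_uniform n
  set S := 2 ^ (k + N) * (Finset.Iic (k + N, n)).sup (fun m => SchwartzMap.seminorm ℝ m.1 m.2) φ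
    with hS
  have hφb : ∀ j ≤ n, ∀ y, (1 + ‖y‖) ^ (k + N) * ‖iteratedFDeriv ℝ j φ y‖ ≤ S := fun j hj y =>
    SchwartzMap.one_add_le_sup_seminorm_apply (𝕜 := ℝ) (m := (k + N, n)) le_rfl hj φ y
  have hS0 : 0 ≤ S := le_trans (by positivity) (hφb 0 (Nat.zero_le _) 0)
  refine ⟨∑ i ∈ Finset.range (n + 1), (n.choose i : ℝ) *
    (B * (1 + |C|) ^ (k + N) * S * ‖L‖ ^ (n - i)), fun x => ?_⟩
  by_cases hx : x ∈ tsupport θ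
  · have h := norm_iteratedFDeriv_mul_le (hθ.1) hL x (n := n) (by exact_mod_cast le_top)
    refine (mul_le_mul_of_nonneg_left h (by positivity)).trans ?_
    rw [Finset.mul_sum]
    refine Finset.sum_le_sum fun i hi => ?_
    have hi' : i ≤ n := Nat.lt_succ_iff.1 (Finset.mem_range.1 hi)
    have h1 := hθb i hi' x
    have h2 : ‖iteratedFDeriv ℝ (n - i) (fun x => φ (L x)) x‖ ≤
        ‖iteratedFDeriv ℝ (n - i) φ (L x)‖ * ‖L‖ ^ (n - i) := by
      have e := L.iteratedFDeriv_comp_right (f := φ) φ.smooth' x (i := n - i) (hle _)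
      rw [show (fun x => φ (L x)) = φ ∘ L from rfl, e]
      refine (ContinuousMultilinearMap.norm_compContinuousLinearMap_le _ _).trans ?_
      simp
    have h3 := hφb (n - i) (Nat.sub_le _ _) (L x)
    have h4 := hsupp x hx
    have h5 : ‖x‖ ^ k * (1 + ‖x‖) ^ N ≤ (1 + |C|) ^ (k + N) * (1 + ‖L x‖) ^ (k + N) := by
      rw [← mul_pow]
      calc ‖x‖ ^ k * (1 + ‖x‖) ^ N ≤ (1 + ‖x‖) ^ k * (1 + ‖x‖) ^ N := by
            gcongr; linarith
        _ = (1 + ‖x‖) ^ (k + N) := (pow_add _ _ _).symm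
        _ ≤ _ := by gcongr
    calc ‖x‖ ^ k * (n.choose i * ‖iteratedFDeriv ℝ i θ x‖ *
          ‖iteratedFDeriv ℝ (n - i) (fun x => φ (L x)) x‖)
        ≤ ‖x‖ ^ k * (n.choose i * (B * (1 + ‖x‖) ^ N) *
          (‖iteratedFDeriv ℝ (n - i) φ (L x)‖ * ‖L‖ ^ (n - i))) := by gcongr
      _ = n.choose i * (B * ((‖x‖ ^ k * (1 + ‖x‖) ^ N) * ‖iteratedFDeriv ℝ (n - i) φ (L x)‖) *
          ‖L‖ ^ (n - i)) := by ring
      _ ≤ n.choose i * (B * (((1 + |C|) ^ (k + N) * (1 + ‖L x‖) ^ (k + N)) *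
          ‖iteratedFDeriv ℝ (n - i) φ (L x)‖) * ‖L‖ ^ (n - i)) := by gcongr
      _ = n.choose i * (B * ((1 + |C|) ^ (k + N) * ((1 + ‖L x‖) ^ (k + N) *
          ‖iteratedFDeriv ℝ (n - i) φ (L x)‖)) * ‖L‖ ^ (n - i)) := by ring
      _ ≤ n.choose i * (B * ((1 + |C|) ^ (k + N) * S) * ‖L‖ ^ (n - i)) := by gcongr
      _ = _ := by ring
  · have h0 : iteratedFDeriv ℝ n (fun x => θ x * φ (L x)) x = 0 := by
      by_contra h
      refine hx (closure_mono ?_ (support_iteratedFDeriv_subset n h))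
      exact Function.support_mul_subset_left _ _
    rw [h0, norm_zero, mul_zero]
    positivity

end Cylinder

/-! ### Continuous one-parameter groups are smooth -/

section OneParam

variable {A : Type*} [NormedRing A] [NormedAlgebra ℝ A] [CompleteSpace A]

theorem exists_hasDerivAt_of_oneParam {M : ℝ → A} (hM : Continuous M) (h0 : M 0 = 1)
    (hadd : ∀ s t, M (s + t) = M s * M t) :
    ∃ (a : ℝ) (Y : A), ∀ t, HasDerivAt M ((M (t + a) - M t) * Y) t := by
  have hint : ∀ a b, IntervalIntegrable M volume a b := fun a b => hM.intervalIntegrable a b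
  have hder : ∀ t, HasDerivAt (fun t => ∫ x in (0 : ℝ)..t, M x) (M t) t := fun t =>
    intervalIntegral.integral_hasDerivAt_right (hint 0 t) (hM.stronglyMeasurableAtFilter _ _)
      hM.continuousAt
  have h1 : Filter.Tendsto (fun a : ℝ => a⁻¹ • ∫ x in (0 : ℝ)..a, M x) (𝓝[≠] 0) (𝓝 1) := by
    have := (hasDerivAt_iff_tendsto_slope_zero.1 (hder 0))
    rw [h0] at this
    simpa using this
  obtain ⟨a, ⟨ha, ⟨X, hX⟩⟩⟩ := ((eventually_mem_nhdsWithin (a := (0 : ℝ)) (s := {0}ᶜ)).and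
    (h1.eventually (Units.isOpen.mem_nhds isUnit_one))).exists
  have ha0 : a ≠ 0 := ha
  set Y : A := a⁻¹ • ((X⁻¹ : Aˣ) : A) with hY
  have hXY : (∫ x in (0 : ℝ)..a, M x) * Y = 1 := by
    rw [hY, mul_smul_comm, ← smul_mul_assoc, ← hX]
    exact X.mul_inv
  have key : ∀ t, M t = ((∫ x in (0 : ℝ)..(t + a), M x) - ∫ x in (0 : ℝ)..t, M x) * Y := by
    intro t
    have e1 : (∫ x in (0 : ℝ)..(t + a), M x) - ∫ x in (0 : ℝ)..t, M x =
        M t * ∫ x in (0 : ℝ)..a, M x := by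
      have e3 := (ContinuousLinearMap.mul ℝ A (M t)).intervalIntegral_comp_comm (hint 0 a)
      simp only [ContinuousLinearMap.mul_apply', ← hadd] at e3
      rw [intervalIntegral.integral_interval_sub_left (hint _ _) (hint _ _), ← e3,
        intervalIntegral.integral_comp_add_left, add_zero]
    rw [e1, mul_assoc, hXY, mul_one]
  refine ⟨a, Y, fun t => ?_⟩
  have e2 : M = fun t => ((∫ x in (0 : ℝ)..(t + a), M x) - ∫ x in (0 : ℝ)..t, M x) * Y :=
    funext key
  conv => arg 1; rw [e2]
  exact (((hder (t + a)).comp_add_const t a).sub (hder t)).mul_const Y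

theorem contDiff_of_oneParam {M : ℝ → A} (hM : Continuous M) (h0 : M 0 = 1)
    (hadd : ∀ s t, M (s + t) = M s * M t) : ContDiff ℝ (⊤ : ℕ∞) M := by
  obtain ⟨a, Y, h⟩ := exists_hasDerivAt_of_oneParam hM h0 hadd
  rw [contDiff_infty]
  intro n
  induction n with
  | zero => exact contDiff_zero.2 hM
  | succ n ih =>
    push_cast
    rw [contDiff_succ_iff_deriv]
    refine ⟨fun t => (h t).differentiableAt, by simp, ?_⟩
    rw [show deriv M = fun t => (M (t + a) - M t) * Y from funext fun t => (h t).deriv]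
    exact ((ih.comp (contDiff_id.add contDiff_const)).sub ih).mul contDiff_const

theorem contDiff_list_prod {X : Type*} [NormedAddCommGroup X] [NormedSpace ℝ X]
    {n : WithTop ℕ∞} (L : List (X → A)) (hL : ∀ f ∈ L, ContDiff ℝ n f) :
    ContDiff ℝ n fun t => (L.map fun f => f t).prod := by
  induction L with
  | nil => simpa using contDiff_const
  | cons f L ih =>
    simp only [List.map_cons, List.prod_cons]
    exact (hL f List.mem_cons_self).mul (ih fun g hg => hL g (List.mem_cons_of_mem _ hg))

end OneParam

section SpinCurves

variable {k : Type*} [NormedField k] {𝕜 : Type} [RCLike 𝕜]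

attribute [local instance] Matrix.linftyOpNormedRing Matrix.linftyOpNormedAlgebra

/-- The vector representation of `H`, with the coefficients transported to `𝕜`. -/
def spinMat (e : k →+* 𝕜) : Spin8 k →* Matrix (Fin 8) (Fin 8) 𝕜 where
  toFun h := h.1.1.1.map e
  map_one' := by
    change (1 : Matrix (Fin 8) (Fin 8) k).map e = 1
    simp
  map_mul' h h' := by
    change (h.1.1.1 * h'.1.1.1).map e = _
    rw [Matrix.map_mul]

theorem contDiff_spinMat_curves (e : k →+* 𝕜) (he : Continuous e) {n : ℕ}
    (γ : Fin n → ContinuousMonoidHom (Multiplicative ℝ) (Spin8 k)) (x : Spin8 k) (i j : Fin 8) :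
    ContDiff ℝ (⊤ : ℕ∞) fun t : Fin n → ℝ =>
      spinMat e (x * (List.ofFn fun i => γ i (Multiplicative.ofAdd (t i))).prod) i j := by
  have hone : ∀ i, ContDiff ℝ (⊤ : ℕ∞) fun t : ℝ => spinMat e (γ i (Multiplicative.ofAdd t)) := by
    intro i
    refine contDiff_of_oneParam ?_ ?_ ?_
    · refine continuous_matrix fun a b => ?_
      exact he.comp ((continuous_spin_entry a b).comp
        ((γ i).continuous_toFun.comp continuous_ofAdd))
    · simp
    · intro s t
      rw [ofAdd_add, map_mul, map_mul]
  have h : ContDiff ℝ (⊤ : ℕ∞) fun t : Fin n → ℝ =>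
      spinMat e (x * (List.ofFn fun i => γ i (Multiplicative.ofAdd (t i))).prod) := by
    have h2 := contDiff_list_prod (n := (⊤ : ℕ∞)) (List.ofFn fun i => fun t : Fin n → ℝ =>
      spinMat e (γ i (Multiplicative.ofAdd (t i)))) (by
        intro f hf
        obtain ⟨i, rfl⟩ := List.mem_ofFn.1 hf
        exact (hone i).comp (contDiff_apply ℝ ℝ i))
    have h3 := (contDiff_const (c := spinMat e x)).mul h2
    convert h3 using 1
    funext t
    rw [map_mul, map_list_prod, List.map_ofFn, List.map_ofFn]
    rfl
  exact (Matrix.entryLinearMap ℝ 𝕜 i j).toContinuousLinearMap.contDiff.comp h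

end SpinCurves

/-! ### Sections at the archimedean places -/

section ArchSection

open scoped SchwartzMap ComplexConjugate

/-- The space of the coordinates of the minors. -/
abbrev MinorSpace (𝕜 : Type) : Type := EuclideanSpace 𝕜 (Fin 8 × Fin 8)

variable {𝕜 : Type} [RCLike 𝕜]

/-- The coordinate that gives the entry `A₃` on the orbit of `μ`. -/
def zVec (x : MinorSpace 𝕜) : 𝕜 := x (3, 0) + x (3, 7)

theorem contDiffAt_homog (l : ℂ) (Ψ : 𝓢(MinorSpace 𝕜, ℂ)) {x : MinorSpace 𝕜} (hx : x ≠ 0)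
    (n : ℕ) :
    ContDiffAt ℝ n (fun x : MinorSpace 𝕜 => Complex.exp (l * Real.log ‖x‖) *
      flatExt l Ψ ((‖x‖ ^ 2)⁻¹ • conj (zVec x) • x)) x := by
  have h1 : ContDiffAt ℝ n (fun x : MinorSpace 𝕜 => ‖x‖) x := contDiffAt_norm ℝ hx
  have hn : ‖x‖ ≠ 0 := norm_ne_zero_iff.2 hx
  have h2 : ContDiffAt ℝ n (fun x : MinorSpace 𝕜 => conj (zVec x)) x := by
    have hp : ∀ p, ContDiff ℝ n fun x : MinorSpace 𝕜 => x p := fun p =>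
      (PiLp.proj (𝕜 := ℝ) 2 (fun _ : Fin 8 × Fin 8 => 𝕜) p).contDiff
    exact (RCLike.conjCLE (K := 𝕜)).contDiff.contDiffAt.comp x
      ((hp (3, 0)).add (hp (3, 7))).contDiffAt
  have h3 : ContDiffAt ℝ n (fun x : MinorSpace 𝕜 =>
      (‖x‖ ^ 2)⁻¹ • conj (zVec x) • x) x :=
    ((h1.pow 2).inv (pow_ne_zero 2 hn)).smul (h2.smul contDiffAt_id)
  refine ContDiffAt.mul ?_ ((contDiff_flatExt n l Ψ).contDiffAt.comp x h3)
  exact (contDiffAt_const.mul (Complex.ofRealCLM.contDiff.contDiffAt.comp x (h1.log hn))).cexp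

theorem homog_eq (l : ℂ) (Ψ : 𝓢(MinorSpace 𝕜, ℂ)) {x : MinorSpace 𝕜} (hx : x ≠ 0) :
    Complex.exp (l * Real.log ‖x‖) *
      flatExt l Ψ ((‖x‖ ^ 2)⁻¹ • conj (zVec x) • x) =
    if zVec x = 0 then 0 else
      Ψ ((zVec x)⁻¹ • x) * Complex.exp (l * Real.log ‖zVec x‖) := by
  set z := zVec x
  have hn : ‖x‖ ≠ 0 := norm_ne_zero_iff.2 hx
  split_ifs with hz
  · simp [hz, flatExt]
  · have hzn : ‖z‖ ≠ 0 := norm_ne_zero_iff.2 hz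
    have hc : conj z ≠ 0 := by simpa using hz
    have hy : (‖x‖ ^ 2)⁻¹ • conj z • x ≠ 0 :=
      smul_ne_zero (inv_ne_zero (pow_ne_zero 2 hn)) (smul_ne_zero hc hx)
    have hyn : ‖(‖x‖ ^ 2)⁻¹ • conj z • x‖ = ‖z‖ / ‖x‖ := by
      rw [norm_smul, norm_smul, norm_inv, norm_pow, norm_norm, RCLike.norm_conj]
      field_simp
    rw [flatExt, Set.indicator_of_mem hy, hyn, Real.log_div hzn hn, smul_eq_mul, ← mul_assoc,
      ← Complex.exp_add, mul_comm (Ψ _)]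
    congr 2
    · push_cast; ring_nf
    · have hzc : conj z = (‖z‖ : 𝕜) ^ 2 / z := by
        rw [eq_div_iff hz, mul_comm, RCLike.mul_conj]
      have hz1 : (‖z‖ : 𝕜) ≠ 0 := by exact_mod_cast hzn
      have hn1 : (‖x‖ : 𝕜) ≠ 0 := by exact_mod_cast hn
      ext p
      simp only [PiLp.smul_apply, RCLike.real_smul_eq_coe_mul, smul_eq_mul, hzc]
      push_cast
      field_simp

variable {K : Type*} [Field K] [NumberField K] {w : InfinitePlace K}

/-- The minors with the coefficients transported to `𝕜`. -/
def archMinors (e : w.Completion →+* 𝕜) (m : Fin 8 × Fin 8 → w.Completion) : MinorSpace 𝕜 :=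
  WithLp.toLp 2 fun p => e (m p)

open scoped Classical in
/-- The section at an archimedean place attached to a Schwartz function. -/
def archSec (e : w.Completion →+* 𝕜) (Ψ : MinorSpace 𝕜 → ℂ) (s : ℂ) (h : Spin8 w.Completion) : ℂ :=
  if zMin (minors h) = 0 then 0 else
    Ψ (archMinors e ((zMin (minors h))⁻¹ • minors h)) *
      Complex.exp ((-(5 * w.mult * Real.log ‖zMin (minors h)‖) : ℝ) * s)

theorem minors_ne_zero {R : Type*} [CommRing R] [Nontrivial R] (h : Spin8 R) : minors h ≠ 0 := by
  intro h0
  have h1 := minors_one_apply (R := R)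
  rw [← mul_inv_cancel h, minors_mul, h0] at h1
  simp at h1

theorem isInfSection_archSec (e : w.Completion →+* 𝕜) (he : ∀ x, ‖e x‖ = ‖x‖)
    (Ψ : 𝓢(MinorSpace 𝕜, ℂ)) : IsInfSection w (archSec e Ψ) where
  induced s p hp h := by
    have hd := PH.leviDet_mul_dualDet hp
    have hd0 : dualDet p ≠ 0 := right_ne_zero_of_mul_eq_one hd
    have hl0 : leviDet p ≠ 0 := left_ne_zero_of_mul_eq_one hd
    have hl : ‖dualDet p‖ = ‖leviDet p‖⁻¹ := by
      rw [← norm_inv]; congr 1; exact eq_inv_of_mul_eq_one_right hd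
    unfold archSec
    rw [minors_PH_mul hp, zMin_smul]
    by_cases hz : zMin (minors h) = 0
    · rw [if_pos hz, if_pos (by rw [hz, mul_zero]), mul_zero]
    · rw [if_neg hz, if_neg (mul_ne_zero hd0 hz)]
      have eA : (dualDet p * zMin (minors h))⁻¹ • dualDet p • minors h =
          (zMin (minors h))⁻¹ • minors h := by
        rw [smul_smul, mul_inv, mul_comm (dualDet p)⁻¹, mul_assoc, inv_mul_cancel₀ hd0, mul_one]
      have hln : ‖leviDet p‖ ≠ 0 := norm_ne_zero_iff.2 hl0
      have hzn : ‖zMin (minors h)‖ ≠ 0 := norm_ne_zero_iff.2 hz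
      have hpos : 0 < (‖leviDet p‖ ^ w.mult) ^ 5 := by positivity
      have eB : Complex.exp ((-(5 * w.mult * Real.log ‖dualDet p * zMin (minors h)‖) : ℝ) * s) =
          ((((‖leviDet p‖ ^ w.mult) ^ 5 : ℝ) : ℂ)) ^ s *
            Complex.exp ((-(5 * w.mult * Real.log ‖zMin (minors h)‖) : ℝ) * s) := by
        rw [Complex.cpow_def_of_ne_zero (by exact_mod_cast hpos.ne'),
          ← Complex.ofReal_log hpos.le, ← Complex.exp_add, norm_mul, hl,
          Real.log_mul (inv_ne_zero hln) hzn, Real.log_inv, Real.log_pow, Real.log_pow]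
        congr 1
        push_cast
        ring
      rw [eA, eB]
      ring
  smooth s := by
    intro n γ x
    rw [contDiff_infty]
    intro N
    set y : (Fin n → ℝ) → Spin8 w.Completion := fun t =>
      x * (List.ofFn fun i => γ i (Multiplicative.ofAdd (t i))).prod with hy
    have hec : Continuous e :=
      (AddMonoidHomClass.isometry_of_norm e he).continuous
    have h1 : ContDiff ℝ N fun t => archMinors e (minors (y t)) := by
      refine (contDiff_piLp 2).2 fun p => ?_
      have h2 : ∀ i j, ContDiff ℝ N fun t => spinMat e (y t) i j := fun i j =>
        (contDiff_spinMat_curves e hec γ x i j).of_le (by exact_mod_cast le_top)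
      have h3 := ((h2 3 p.1).mul (h2 4 p.2)).sub ((h2 3 p.2).mul (h2 4 p.1))
      have ef : (fun t => e (minors (y t) p)) = fun t => spinMat e (y t) 3 p.1 *
          spinMat e (y t) 4 p.2 - spinMat e (y t) 3 p.2 * spinMat e (y t) 4 p.1 := by
        funext t
        change e (_ * _ - _ * _) = e _ * e _ - e _ * e _
        rw [map_sub, map_mul, map_mul]
        rfl
      rw [← ef] at h3
      exact h3
    have h0 : ∀ t, archMinors e (minors (y t)) ≠ 0 := by
      intro t h
      refine minors_ne_zero (y t) (funext fun p => e.injective ?_)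
      exact (congrArg (fun x : MinorSpace 𝕜 => x p) h).trans (map_zero e).symm
    have h3 := contDiff_iff_contDiffAt.2 fun t =>
      (contDiffAt_homog (((-(5 * w.mult) : ℝ) : ℂ) * s) Ψ (h0 t) N).comp t h1.contDiffAt
    convert h3 using 1
    funext t
    refine Eq.trans ?_ (homog_eq _ Ψ (h0 t)).symm
    have ez : zVec (archMinors e (minors (y t))) = e (zMin (minors (y t))) := (map_add e _ _).symm
    change archSec e Ψ s (y t) = _
    rw [ez, he, archSec]
    by_cases hz : zMin (minors (y t)) = 0
    · rw [if_pos hz, if_pos (by rw [hz, map_zero])]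
    · rw [if_neg hz, if_neg (by simpa using hz)]
      congr 2
      · ext p
        change e (_ * _) = _ * e _
        rw [map_mul, map_inv₀]
      · push_cast
        ring
  exponential h := by
    by_cases hz : zMin (minors h) = 0
    · exact ⟨0, 0, fun s => by simp [archSec, hz]⟩
    · exact ⟨_, _, fun s => by rw [archSec, if_neg hz]⟩

end ArchSection

/-! ### Fourier transforms at the archimedean places -/

section Fourier

open scoped SchwartzMap ComplexConjugate FourierTransform

theorem exists_exp_of_oneParam {M : ℝ → ℂ} (hM : Continuous M) (h0 : M 0 = 1)
    (hadd : ∀ s t, M (s + t) = M s * M t) :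
    ∃ c : ℂ, HasDerivAt M c 0 ∧ ∀ t : ℝ, M t = Complex.exp (t * c) := by
  obtain ⟨a, Y, h⟩ := exists_hasDerivAt_of_oneParam hM h0 hadd
  have hc := h 0
  set c := (M (0 + a) - M 0) * Y with hcdef
  have hd : ∀ t, HasDerivAt M (M t * c) t := by
    intro t
    have e : (M (t + a) - M t) * Y = M t * c := by
      rw [hcdef, hadd, hadd, h0]; ring
    rw [← e]
    exact h t
  refine ⟨c, hc, fun t => ?_⟩
  have h1 : ∀ t : ℝ, HasDerivAt (fun t : ℝ => M t * Complex.exp (-(t * c))) 0 t := by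
    intro t
    have h2 : HasDerivAt (fun t : ℝ => Complex.exp (-(t * c))) (Complex.exp (-(t * c)) * -c) t := by
      have := ((Complex.ofRealCLM.hasDerivAt (x := t)).mul_const c).neg.cexp
      simpa using this
    have h3 := (hd t).mul h2
    have e0 : M t * c * Complex.exp (-(t * c)) + M t * (Complex.exp (-(t * c)) * -c) = 0 := by ring
    rw [e0] at h3
    exact h3
  have h3 := is_const_of_deriv_eq_zero (fun t => (h1 t).differentiableAt)
    (fun t => (h1 t).deriv) t 0
  simp only [h0, Complex.ofReal_zero, zero_mul, neg_zero, Complex.exp_zero, mul_one] at h3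
  rw [Complex.exp_neg] at h3
  field_simp at h3
  exact h3

variable {𝕜 : Type} [RCLike 𝕜]

theorem exists_inner_of_addChar {χ : AddChar 𝕜 Circle} (hχ : Continuous χ) :
    ∃ t : 𝕜, ∀ x, χ x = 𝐞 (inner ℝ x t) := by
  have hex : ∀ x : 𝕜, ∃ c : ℂ, HasDerivAt (fun s : ℝ => (χ (s • x) : ℂ)) c 0 ∧
      ∀ s : ℝ, (χ (s • x) : ℂ) = Complex.exp (s * c) := by
    intro x
    refine exists_exp_of_oneParam (M := fun s : ℝ => (χ (s • x) : ℂ)) ?_ (by simp) ?_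
    · exact continuous_subtype_val.comp (hχ.comp (continuous_id.smul continuous_const))
    · intro s t
      simp only [add_smul]
      rw [AddChar.map_add_eq_mul, Circle.coe_mul]
  choose c hc hexp using hex
  have hadd : ∀ x y, c (x + y) = c x + c y := by
    intro x y
    refine (hc (x + y)).unique ?_
    have h1 := (hc x).mul (hc y)
    simp only [zero_smul, AddChar.map_zero_eq_one, Circle.coe_one, mul_one, one_mul] at h1
    have e1 : (fun s : ℝ => (χ (s • (x + y)) : ℂ)) =
        (fun s : ℝ => (χ (s • x) : ℂ)) * fun s : ℝ => (χ (s • y) : ℂ) := by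
      funext s
      simp [smul_add, AddChar.map_add_eq_mul]
    rw [e1]
    exact h1
  have hsmul : ∀ (r : ℝ) x, c (r • x) = r * c x := by
    intro r x
    refine (hc (r • x)).unique ?_
    have h1 : HasDerivAt (fun s : ℝ => (χ (s • x) : ℂ)) (c x) (0 * r) := by
      rw [zero_mul]; exact hc x
    have h2 := h1.scomp 0 ((hasDerivAt_id (0 : ℝ)).mul_const r)
    convert h2 using 1
    · funext s
      simp [smul_smul]
    · simp
  have hre : ∀ x, (c x).re = 0 := by
    intro x
    have h1 := congrArg norm (hexp x 1)
    rw [Circle.norm_coe, Complex.norm_exp] at h1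
    simpa using h1.symm
  let ℓ : 𝕜 →ₗ[ℝ] ℝ :=
    { toFun := fun x => (c x).im / (2 * Real.pi)
      map_add' := fun x y => by rw [hadd, Complex.add_im, add_div]
      map_smul' := fun r x => by simp [hsmul, mul_div_assoc] }
  refine ⟨(InnerProductSpace.toDual ℝ 𝕜).symm (LinearMap.toContinuousLinearMap ℓ), fun x => ?_⟩
  rw [real_inner_comm, InnerProductSpace.toDual_symm_apply]
  refine Circle.ext ?_
  have h1 := hexp x 1
  rw [one_smul] at h1
  rw [h1, Real.fourierChar_apply]
  congr 1
  change _ = ((2 * Real.pi * ((c x).im / (2 * Real.pi)) : ℝ) : ℂ) * Complex.I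
  rw [mul_div_cancel₀ _ (by positivity)]
  apply Complex.ext <;> simp [hre]

theorem isAddHaarMeasure_map_mul {k : Type*} [NormedField k] [MeasurableSpace k] [BorelSpace k]
    (μ : Measure k) [μ.IsAddHaarMeasure] {b : k} (hb : b ≠ 0) :
    (μ.map (b * ·)).IsAddHaarMeasure := by
  let E : k ≃+ k := { Equiv.mulLeft₀ b hb with map_add' := fun x y => mul_add b x y }
  exact AddEquiv.isAddHaarMeasure_map μ E (continuous_const_mul b) (continuous_const_mul b⁻¹)

theorem integrable_comp_mul {k : Type*} [NormedField k] [LocallyCompactSpace k]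
    [SecondCountableTopology k] [MeasurableSpace k] [BorelSpace k]
    {μ : Measure k} [μ.IsAddHaarMeasure] {b : k} (hb : b ≠ 0) {f : k → ℂ} (hf : Integrable f μ) :
    Integrable (fun r => f (b * r)) μ := by
  have h1 := isAddHaarMeasure_map_mul μ hb
  have h2 := Measure.isAddLeftInvariant_eq_smul (μ.map (b * ·)) μ
  have h3 : Integrable f (μ.map (b * ·)) := by
    rw [h2]
    exact hf.smul_measure_nnreal
  exact (integrable_map_equiv (Homeomorph.mulLeft₀ b hb).toMeasurableEquiv f).1 h3

variable {k : Type*} [NormedField k] [MeasurableSpace k] [BorelSpace k]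

/-- An isometric isomorphism as a measurable equivalence. -/
def isomMeasurableEquiv (e : k ≃+* 𝕜) (he : ∀ x, ‖e x‖ = ‖x‖) : k ≃ᵐ 𝕜 :=
  (IsometryEquiv.mk e.toEquiv (AddMonoidHomClass.isometry_of_norm e he)).toHomeomorph.toMeasurableEquiv

theorem exists_map_eq_smul_volume (e : k ≃+* 𝕜) (he : ∀ x, ‖e x‖ = ‖x‖) (μ : Measure k)
    [μ.IsAddHaarMeasure] : ∃ c : NNReal, 0 < c ∧
      μ.map (isomMeasurableEquiv e he) = c • (volume : Measure 𝕜) := by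
  have hi : Isometry e := AddMonoidHomClass.isometry_of_norm e he
  have h : (μ.map (e : k ≃+ 𝕜)).IsAddHaarMeasure :=
    AddEquiv.isAddHaarMeasure_map μ (e : k ≃+ 𝕜) hi.continuous
      (IsometryEquiv.mk e.toEquiv hi).symm.continuous
  refine ⟨Measure.addHaarScalarFactor (μ.map (e : k ≃+ 𝕜)) volume,
    Measure.addHaarScalarFactor_pos_of_isAddHaarMeasure _ _, ?_⟩
  exact Measure.isAddLeftInvariant_eq_smul (μ.map (e : k ≃+ 𝕜)) volume

theorem integrable_schwartz_comp (e : k ≃+* 𝕜) (he : ∀ x, ‖e x‖ = ‖x‖) (μ : Measure k)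
    [μ.IsAddHaarMeasure] (χ : AddChar k Circle) (hχ : Continuous χ) (φ : 𝓢(𝕜, ℂ)) {b : k}
    (hb : b ≠ 0) (c : k) : Integrable (fun r => φ (e (b * r - c)) * (χ r : ℂ)) μ := by
  obtain ⟨a, ha, hmap⟩ := exists_map_eq_smul_volume e he μ
  have h1 : Integrable (fun x => φ (e b * x - e c)) (μ.map (isomMeasurableEquiv e he)) := by
    rw [hmap]
    refine Integrable.smul_measure_nnreal ?_
    exact integrable_comp_mul (f := fun x => φ (x - e c)) (by simpa using hb)
      (φ.integrable.comp_sub_right (e c))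
  have h2 := (integrable_map_equiv (isomMeasurableEquiv e he) _).1 h1
  have h3 : Integrable (fun r => φ (e (b * r - c))) μ := by
    refine h2.congr (Filter.Eventually.of_forall fun r => ?_)
    change φ (e b * e r - e c) = φ (e (b * r - c))
    rw [map_sub e, map_mul e]
  refine h3.mul_bdd (c := 1) ?_ ?_
  · exact (continuous_subtype_val.comp hχ).aestronglyMeasurable
  · exact Filter.Eventually.of_forall fun r => (Circle.norm_coe _).le

theorem exists_schwartz_integral (e : k ≃+* 𝕜) (he : ∀ x, ‖e x‖ = ‖x‖) (μ : Measure k)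
    [μ.IsAddHaarMeasure] {χ : AddChar k Circle} (hχ : Continuous χ) (hχ1 : χ ≠ 1) {b₀ : k}
    (hb₀ : b₀ ≠ 0) {U : Set k} (hU : U ∈ 𝓝 b₀) :
    ∃ (φ : 𝓢(𝕜, ℂ)) (H : k → ℝ), ContinuousOn H {0}ᶜ ∧ 0 < H b₀ ∧ (∀ b ≠ 0, 0 ≤ H b) ∧
      (∀ b ≠ 0, H b ≠ 0 → b ∈ U) ∧
      ∀ b ≠ 0, ∫ r, φ (e (b * r)) * (χ r : ℂ) ∂μ = H b := by
  obtain ⟨c, hc, hmap⟩ := exists_map_eq_smul_volume e he μ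
  have hi : Isometry e := AddMonoidHomClass.isometry_of_norm e he
  have hsc : Continuous e.symm := (IsometryEquiv.mk e.toEquiv hi).symm.continuous
  let χ' : AddChar 𝕜 Circle := χ.compAddMonoidHom (e.symm : 𝕜 →+ k)
  obtain ⟨t, ht⟩ := exists_inner_of_addChar (χ := χ') (hχ.comp hsc)
  have ht0 : t ≠ 0 := by
    rintro rfl
    refine hχ1 (DFunLike.ext _ _ fun x => ?_)
    have := ht (e x)
    simpa [χ'] using this
  have hct : conj t ≠ 0 := by simpa using ht0
  let q : k → 𝕜 := fun b => conj (e b)⁻¹ * t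
  have hb₀e : e b₀ ≠ 0 := by simpa using hb₀
  -- neighbourhoods
  obtain ⟨δ, hδ, hδU⟩ : ∃ δ > 0, ∀ b ≠ 0, dist (q b) (q b₀) < δ → b ∈ U := by
    have h1 : ContinuousAt (fun x : 𝕜 => e.symm (conj (x / t))⁻¹) (q b₀) := by
      refine hsc.continuousAt.comp (ContinuousAt.inv₀ ?_ ?_)
      · exact (RCLike.continuous_conj.comp (continuous_id.div_const t)).continuousAt
      · simpa [q, ht0] using hb₀
    have h2 : ∀ b ≠ 0, e.symm (conj (q b / t))⁻¹ = b := by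
      intro b _
      simp [q, ht0]
    have h3 := h1.preimage_mem_nhds (t := U) (by rw [h2 b₀ hb₀]; exact hU)
    obtain ⟨δ, hδ, h4⟩ := Metric.mem_nhds_iff.1 h3
    refine ⟨δ, hδ, fun b hb h => ?_⟩
    rw [← h2 b hb]
    exact h4 h
  let ρ : ContDiffBump (q b₀) := ⟨δ / 2, δ, by positivity, by linarith⟩
  have hρ : HasCompactSupport (fun x => (ρ x : ℂ)) := by
    refine ρ.hasCompactSupport.comp_left (g := ((↑) : ℝ → ℂ)) Complex.ofReal_zero
  have hρ2 : ContDiff ℝ (⊤ : ℕ∞) (fun x => (ρ x : ℂ)) := Complex.ofRealCLM.contDiff.comp ρ.contDiff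
  let g : 𝓢(𝕜, ℂ) := hρ.toSchwartzMap hρ2
  let J : k → ℝ := fun b => |((ContinuousLinearMap.mul ℝ 𝕜 (e b)).det)⁻¹|
  have hdet : ∀ b ≠ 0, (ContinuousLinearMap.mul ℝ 𝕜 (e b)).det ≠ 0 := by
    intro b hb h
    have hbe : e b ≠ 0 := by simpa using hb
    have h1 : ContinuousLinearMap.mul ℝ 𝕜 (e b) ∘L ContinuousLinearMap.mul ℝ 𝕜 (e b)⁻¹ =
        ContinuousLinearMap.id ℝ 𝕜 := by
      ext x; simp [hbe]
    have h2 := congrArg ContinuousLinearMap.det h1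
    have h3 : (ContinuousLinearMap.mul ℝ 𝕜 (e b) ∘L ContinuousLinearMap.mul ℝ 𝕜 (e b)⁻¹).det =
      (ContinuousLinearMap.mul ℝ 𝕜 (e b)).det * (ContinuousLinearMap.mul ℝ 𝕜 (e b)⁻¹).det :=
      LinearMap.det_comp _ _
    rw [h3, h, zero_mul] at h2
    exact zero_ne_one (h2.trans LinearMap.det_id)
  refine ⟨𝓕 g, fun b => c * J b * ρ (q b), ?_, ?_, ?_, ?_, ?_⟩
  · refine ContinuousOn.mul (ContinuousOn.mul continuousOn_const ?_) ?_
    · refine (ContinuousOn.inv₀ ?_ fun b hb => hdet b hb).abs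
      exact (ContinuousLinearMap.continuous_det.comp
        ((ContinuousLinearMap.mul ℝ 𝕜).continuous.comp hi.continuous)).continuousOn
    · refine ρ.continuous.comp_continuousOn (ContinuousOn.mul ?_ continuousOn_const)
      exact RCLike.continuous_conj.comp_continuousOn
        (hi.continuous.continuousOn.inv₀ fun b hb => by simpa using hb)
  · have : 0 < J b₀ := abs_pos.2 (inv_ne_zero (hdet b₀ hb₀))
    have h2 : ρ (q b₀) = 1 := ρ.one_of_mem_closedBall (Metric.mem_closedBall_self ρ.rIn_pos.le)
    change 0 < (c : ℝ) * J b₀ * ρ (q b₀)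
    rw [h2, mul_one]
    positivity
  · intro b _
    have := ρ.nonneg (x := q b)
    positivity
  · intro b hb h
    refine hδU b hb ?_
    have h2 : ρ (q b) ≠ 0 := right_ne_zero_of_mul h
    have h3 : q b ∈ Function.support ρ := h2
    rw [ρ.support_eq] at h3
    exact h3
  · intro b hb
    have hbe : e b ≠ 0 := by simpa using hb
    have h1 : ∫ r, 𝓕 g (e (b * r)) * (χ r : ℂ) ∂μ =
        c * ∫ x, 𝓕 g (e b * x) * (χ' x : ℂ) := by
      have := integral_map_equiv (μ := μ) (isomMeasurableEquiv e he)
        (fun x => 𝓕 g (e b * x) * (χ' x : ℂ))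
      rw [hmap, integral_smul_nnreal_measure] at this
      refine Eq.trans ?_ (this.symm.trans rfl)
      refine integral_congr_ae (Filter.Eventually.of_forall fun r => ?_)
      change 𝓕 g (e (b * r)) * (χ r : ℂ) = 𝓕 g (e b * e r) * (χ (e.symm (e r)) : ℂ)
      rw [map_mul e, e.symm_apply_apply]
    have h2 : ∫ x, 𝓕 g (e b * x) * (χ' x : ℂ) = J b * ∫ y, 𝓕 g y * (𝐞 (inner ℝ y (q b)) : ℂ) := by
      have hm := Measure.map_linearMap_addHaar_eq_smul_addHaar (μ := (volume : Measure 𝕜))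
        (f := (ContinuousLinearMap.mul ℝ 𝕜 (e b) : 𝕜 →ₗ[ℝ] 𝕜)) (hdet b hb)
      have h5 := integral_map_equiv (μ := (volume : Measure 𝕜)) (MeasurableEquiv.mulLeft₀ (e b) hbe)
        (fun y => 𝓕 g y * (𝐞 (inner ℝ y (q b)) : ℂ))
      have hm' : Measure.map (MeasurableEquiv.mulLeft₀ (e b) hbe) (volume : Measure 𝕜) =
        ENNReal.ofReal (J b) • volume := hm
      rw [hm', integral_smul_measure, ENNReal.toReal_ofReal (abs_nonneg _)] at h5
      refine Eq.trans ?_ (h5.symm.trans (Complex.real_smul))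
      refine integral_congr_ae (Filter.Eventually.of_forall fun x => ?_)
      change 𝓕 g (e b * x) * (χ' x : ℂ) = 𝓕 g (e b * x) * (𝐞 (inner ℝ (e b * x) (q b)) : ℂ)
      rw [ht]
      congr 3
      change RCLike.re _ = RCLike.re _
      congr 1
      rw [RCLike.inner_apply, RCLike.inner_apply]
      simp only [q, map_mul, map_inv₀]
      have : conj (e b) ≠ 0 := by simpa using hbe
      field_simp
    have h3 : ∫ y, 𝓕 g y * (𝐞 (inner ℝ y (q b)) : ℂ) = ρ (q b) := by
      have h4 : 𝓕⁻ (𝓕 g) (q b) = g (q b) := by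
        rw [FourierTransform.fourierInv_fourier_eq]
      rw [SchwartzMap.fourierInv_coe, Real.fourierInv_eq] at h4
      refine Eq.trans ?_ h4
      refine integral_congr_ae (Filter.Eventually.of_forall fun x => ?_)
      simp [Circle.smul_def, mul_comm]
    rw [h1, h2, h3]
    push_cast
    ring

end Fourier

/-! ### The archimedean section supported near the open orbit -/

section Ratio

variable {k : Type*} [NormedField k]

/-- The third row and the middle part of the fourth row, normalised by `A₃ = 1`. -/
def rowRatio (g : G2 k) : (Fin 8 → k) × (Fin 8 → k) :=
  ((g.1.1 3 3)⁻¹ • g.1.1 3, (g.1.1 3 3)⁻¹ • midPart (g.1.1 4))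

theorem rowRatio_unip_mul {u : G2 k} (hu : u ∈ unipU k) (g : G2 k) :
    rowRatio (u * g) = rowRatio g := by
  rw [rowRatio, uElt_mul_row_three hu, uElt_mul_row_four hu]; rfl

theorem rowRatio_torusF {a : k} (ha : a ≠ 0) :
    rowRatio (torusF a 1 : G2 k) = (Pi.single 3 1, Pi.single 4 1) := by
  have h := torusF_mul_row ha (1 : G2 k)
  rw [mul_one] at h
  rw [rowRatio, h, h, G2.val_one]
  refine Prod.ext (funext fun j => ?_) (funext fun j => ?_)
  · fin_cases j <;> simp [ha]
  · fin_cases j <;> simp [ha, midPart]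

theorem exists_torusF_mul_of_rowRatio_near {N : Set (G2 k)} (hN : N ∈ 𝓝 (1 : G2 k)) :
    ∃ ε > 0, ∀ g : G2 k, g.1.1 3 3 ≠ 0 →
      dist (rowRatio g) (Pi.single 3 1, Pi.single 4 1) ≤ ε →
      ∃ u ∈ unipU k, ∃ n ∈ N, g = torusF (g.1.1 3 3)⁻¹ 1 * u * n := by
  set c : (Fin 8 → k) × (Fin 8 → k) := (Pi.single 3 1, Pi.single 4 1) with hc
  have ht : Filter.Tendsto (rowRatio : G2 k → _)
      (Filter.comap rowRatio (𝓝 c) ⊓ Filter.principal {g | g.1.1 3 3 ≠ 0})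
      (𝓝 c) := Filter.tendsto_comap.mono_left inf_le_left
  have key := eventually_exists_torusF_mul
    (l := Filter.comap rowRatio (𝓝 c) ⊓ Filter.principal {g | g.1.1 3 3 ≠ 0})
    (g := fun g : G2 k => g)
    (Filter.mem_inf_of_right (Filter.mem_principal_self _))
    (fun j => (tendsto_pi_nhds.1 ((continuous_fst.tendsto c).comp ht)) j)
    (fun j => (tendsto_pi_nhds.1 ((continuous_snd.tendsto c).comp ht)) j) hN
  rw [((Metric.nhds_basis_closedBall.comap _).inf_principal _).eventually_iff] at key
  obtain ⟨ε, hε, h⟩ := key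
  exact ⟨ε, hε, fun g hg hd => h ⟨hd, hg⟩⟩

open scoped Classical in
theorem continuous_rowCutoff {ρ : (Fin 8 → k) × (Fin 8 → k) → ℝ} (hρ : Continuous ρ) {ε : ℝ}
    (hs : ∀ x, ρ x ≠ 0 → dist x (Pi.single 3 1, Pi.single 4 1) < ε) :
    Continuous fun g : G2 k => if g.1.1 3 3 = 0 then 0 else ρ (rowRatio g) := by
  rw [continuous_iff_continuousAt]
  intro g₀
  by_cases h0 : g₀.1.1 3 3 = 0
  · obtain ⟨j, hj⟩ : ∃ j, g₀.1.1 3 j ≠ 0 := by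
      by_contra! h
      have h1 : (g₀ * g₀⁻¹).1.1 3 3 = ∑ j, g₀.1.1 3 j * (g₀⁻¹).1.1 j 3 := by
        rw [G2.val_mul, Matrix.mul_apply]
      rw [mul_inv_cancel, G2.val_one, Matrix.one_apply_eq] at h1
      simp [h] at h1
    have h1 : ∀ᶠ g in 𝓝 g₀, (1 + ε) * ‖g.1.1 3 3‖ < ‖g.1.1 3 j‖ := by
      refine (continuous_const.mul (G2.continuous_entry 3 3).norm).continuousAt.eventually_lt
        (G2.continuous_entry 3 j).norm.continuousAt ?_
      change (1 + ε) * ‖g₀.1.1 3 3‖ < _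
      rw [h0, norm_zero, mul_zero]
      exact norm_pos_iff.2 hj
    refine (continuousAt_const (y := (0 : ℝ))).congr ?_
    filter_upwards [h1] with g hg
    split_ifs with h3
    · rfl
    by_contra hθ
    have h4 := hs _ (Ne.symm hθ)
    have h5 : dist ((rowRatio g).1 j) ((Pi.single 3 1 : Fin 8 → k) j) < ε :=
      lt_of_le_of_lt ((dist_le_pi_dist _ _ j).trans (le_max_left _ _)) h4
    have h6 : ‖(Pi.single 3 1 : Fin 8 → k) j‖ ≤ 1 := by
      rw [Pi.single_apply]; split_ifs <;> simp
    have h7 : ‖(rowRatio g).1 j‖ < 1 + ε := by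
      rw [dist_eq_norm] at h5
      calc ‖(rowRatio g).1 j‖ = ‖((rowRatio g).1 j - (Pi.single 3 1 : Fin 8 → k) j) +
            (Pi.single 3 1 : Fin 8 → k) j‖ := by rw [sub_add_cancel]
        _ ≤ _ := norm_add_le _ _
        _ < _ := by linarith
    have h8 : ‖(rowRatio g).1 j‖ = ‖g.1.1 3 3‖⁻¹ * ‖g.1.1 3 j‖ := by
      rw [← norm_inv, ← norm_mul]; rfl
    rw [h8, inv_mul_lt_iff₀ (norm_pos_iff.2 h3)] at h7
    linarith
  · have h1 : ∀ᶠ g in 𝓝 g₀, g.1.1 3 3 ≠ 0 :=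
      (G2.continuous_entry 3 3).continuousAt.eventually_ne h0
    have h2 : ContinuousAt (fun g => ρ (rowRatio g)) g₀ := by
      refine hρ.continuousAt.comp ?_
      have hi : ContinuousAt (fun g : G2 k => (g.1.1 3 3)⁻¹) g₀ :=
        (G2.continuous_entry 3 3).continuousAt.inv₀ h0
      refine ContinuousAt.prodMk (continuousAt_pi.2 fun j => ?_) (continuousAt_pi.2 fun j => ?_)
      · exact hi.mul (G2.continuous_entry 3 j).continuousAt
      · refine hi.mul ?_
        have := G2.continuous_entry (R := k)
        have hm : Continuous fun g : G2 k => midPart (g.1.1 4) j := by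
          fin_cases j <;> simp [midPart] <;> first | exact continuous_const | exact this _ _
        exact hm.continuousAt
    exact h2.congr (h1.mono fun g hg => (if_neg hg).symm)

theorem muRatio_torusF_mul {a : k} (ha : a ≠ 0) (g : G2 k) :
    muRatio (torusF a 1 * g) = muRatio g := by
  have h := torusF_mul_row ha g
  funext p
  simp only [muRatio, minors, Pi.smul_apply, smul_eq_mul]
  rw [rowA_muH_mul, rowB_muH_mul, rowA_muH_mul, rowB_muH_mul, h, h, h]
  simp [pm]
  field_simp

theorem muRatio_unip_mul_apply {u : G2 k} (hu : u ∈ unipU k) (n : G2 k) (p : Fin 8 × Fin 8) :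
    muRatio (u * n) p = (n.1.1 3 3)⁻¹ * (pm (n.1.1 3) (n.1.1 0 + n.1.1 2) p.1 p.2 -
      psiArg u * pm (n.1.1 3) (n.1.1 4) p.1 p.2) := by
  obtain ⟨t, ht⟩ := exists_uElt_mul_row hu n
  simp only [muRatio, minors, Pi.smul_apply, smul_eq_mul]
  rw [rowA_muH_mul, rowB_muH_mul, ht, uElt_mul_row_three hu]
  simp only [pm, Pi.add_apply, Pi.sub_apply, Pi.smul_apply, smul_eq_mul]
  ring

/-- The neighbourhood of `1` on which the estimates hold. -/
def tameSet (k : Type*) [NormedField k] : Set (G2 k) :=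
  {n | (∀ i j, ‖n.1.1 i j‖ ≤ 2) ∧ 1 / 2 ≤ ‖n.1.1 3 3‖ ∧ 1 / 2 ≤ ‖detD n‖}

theorem continuous_detD : Continuous (detD : G2 k → k) := by
  have := G2.continuous_entry (R := k)
  unfold detD; fun_prop

theorem continuous_kap : Continuous (kap : G2 k → k) := by
  have := G2.continuous_entry (R := k)
  unfold kap pm; simp only [Pi.add_apply]; fun_prop

theorem detD_one : detD (1 : G2 k) = 1 := by simp [detD]

theorem tameSet_mem_nhds : tameSet k ∈ 𝓝 (1 : G2 k) := by
  have h1 : ∀ i j, ∀ᶠ n : G2 k in 𝓝 1, ‖n.1.1 i j‖ ≤ 2 := by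
    intro i j
    have h := (G2.continuous_entry (R := k) i j).norm.tendsto 1
    refine h.eventually (ge_mem_nhds ?_)
    rw [G2.val_one, Matrix.one_apply]
    split_ifs <;> simp
  have h2 : ∀ᶠ n : G2 k in 𝓝 1, 1 / 2 ≤ ‖n.1.1 3 3‖ := by
    have h := (G2.continuous_entry (R := k) 3 3).norm.tendsto 1
    refine h.eventually (le_mem_nhds ?_)
    rw [G2.val_one, Matrix.one_apply_eq, norm_one]; norm_num
  have h3 : ∀ᶠ n : G2 k in 𝓝 1, 1 / 2 ≤ ‖detD n‖ := by
    have h := (continuous_detD (k := k)).norm.tendsto 1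
    refine h.eventually (le_mem_nhds ?_)
    rw [detD_one, norm_one]; norm_num
  filter_upwards [Filter.eventually_all.2 fun i => Filter.eventually_all.2 (h1 i), h2, h3] with n a b c
  exact ⟨a, b, c⟩

theorem norm_pm_le {A B : Fin 8 → k} {a b : ℝ} (hA : ∀ i, ‖A i‖ ≤ a) (hB : ∀ i, ‖B i‖ ≤ b)
    (i j : Fin 8) : ‖pm A B i j‖ ≤ 2 * (a * b) := by
  have h : ∀ i j, ‖A i * B j‖ ≤ a * b := fun i j => by
    rw [norm_mul]
    exact mul_le_mul (hA i) (hB j) (norm_nonneg _) ((norm_nonneg _).trans (hA i))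
  calc ‖pm A B i j‖ ≤ ‖A i * B j‖ + ‖A j * B i‖ := norm_sub_le _ _
    _ ≤ _ := by linarith [h i j, h j i]

theorem norm_muRatio_le {a : k} (ha : a ≠ 0) {u n : G2 k} (hu : u ∈ unipU k) (hn : n ∈ tameSet k)
    (p : Fin 8 × Fin 8) : ‖muRatio (torusF a 1 * u * n) p‖ ≤
      2000 * (1 + ‖muRatio (torusF a 1 * u * n) (3, 4)‖) := by
  obtain ⟨h1, h2, h3⟩ := hn
  rw [mul_assoc, muRatio_torusF_mul ha]
  have hb : ∀ i, ‖(n.1.1 0 + n.1.1 2) i‖ ≤ 4 := fun i => by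
    refine (norm_add_le _ _).trans ?_
    linarith [h1 0 i, h1 2 i]
  have hpos : 0 < ‖n.1.1 3 3‖ := by linarith
  have e34 := muRatio_unip_mul_apply hu n (3, 4)
  have hk := norm_pm_le (h1 3) hb 3 4
  have h33 : n.1.1 3 3 ≠ 0 := norm_pos_iff.1 hpos
  have e1 : psiArg u * detD n = pm (n.1.1 3) (n.1.1 0 + n.1.1 2) 3 4 -
      n.1.1 3 3 * muRatio (u * n) (3, 4) := by
    rw [e34, mul_inv_cancel_left₀ h33]
    simp [detD, pm]
  set x := ‖muRatio (u * n) (3, 4)‖ with hx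
  have hx0 : 0 ≤ x := norm_nonneg _
  have e2 : ‖psiArg u‖ * ‖detD n‖ ≤ 16 + 2 * x := by
    rw [← norm_mul, e1]
    refine (norm_sub_le _ _).trans ?_
    rw [norm_mul]
    have := mul_le_mul_of_nonneg_right (h1 3 3) hx0
    linarith
  have e3 : ‖psiArg u‖ ≤ 32 + 4 * x := by
    have : ‖psiArg u‖ * (1 / 2) ≤ ‖psiArg u‖ * ‖detD n‖ :=
      mul_le_mul_of_nonneg_left h3 (norm_nonneg _)
    linarith
  rw [muRatio_unip_mul_apply hu n p, norm_mul, norm_inv]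
  have e4 : ‖n.1.1 3 3‖⁻¹ ≤ 2 := by
    rw [inv_le_comm₀ hpos two_pos]; linarith
  have e5 : ‖pm (n.1.1 3) (n.1.1 0 + n.1.1 2) p.1 p.2 - psiArg u * pm (n.1.1 3) (n.1.1 4) p.1 p.2‖
      ≤ 16 + (32 + 4 * x) * 8 := by
    refine (norm_sub_le _ _).trans ?_
    rw [norm_mul]
    have e6 := norm_pm_le (h1 3) hb p.1 p.2
    have e7 := norm_pm_le (h1 3) (h1 4) p.1 p.2
    have e8 : ‖psiArg u‖ * ‖pm (n.1.1 3) (n.1.1 4) p.1 p.2‖ ≤ (32 + 4 * x) * 8 :=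
      mul_le_mul e3 (by linarith) (norm_nonneg _) (by linarith)
    linarith
  calc _ ≤ 2 * (16 + (32 + 4 * x) * 8) := mul_le_mul e4 e5 (norm_nonneg _) two_pos.le
    _ ≤ _ := by linarith

end Ratio

section ArchSection

open scoped SchwartzMap

variable {K : Type*} [Field K] [NumberField K] {w : InfinitePlace K} {𝕜 : Type} [RCLike 𝕜]

/-- The coordinates of a vector of minors which give the normalised rows. -/
def rowCoord (𝕜 : Type) [RCLike 𝕜] : MinorSpace 𝕜 →L[ℝ] (Fin 8 → 𝕜) × (Fin 8 → 𝕜) :=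
  LinearMap.toContinuousLinearMap
    { toFun := fun x => (fun j => x (j, 0) + x (j, 7), pcMin x)
      map_add' := fun x y => by
        refine Prod.ext (funext fun j => ?_) (funext fun j => ?_)
        · simp; ring
        · fin_cases j <;> simp [pcMin] <;> ring
      map_smul' := fun c x => by
        refine Prod.ext (funext fun j => ?_) (funext fun j => ?_)
        · simp
        · fin_cases j <;> simp [pcMin] }

theorem rowCoord_archMinors (e : w.Completion →+* 𝕜) (g : G2 w.Completion) :
    rowCoord 𝕜 (archMinors e (muRatio g)) =
      (fun j => e ((rowRatio g).1 j), fun j => e ((rowRatio g).2 j)) := by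
  refine Prod.ext (funext fun j => ?_) (funext fun j => ?_)
  · change e (muRatio g (j, 0)) + e (muRatio g (j, 7)) = _
    rw [← map_add, paMin_muRatio]; rfl
  · have h : ∀ m : Fin 8 × Fin 8 → w.Completion,
        pcMin (fun p => e (m p)) j = e (pcMin m j) := by
      intro m
      fin_cases j <;> simp [pcMin]
    exact (h _).trans (congrArg e (pcMin_muRatio g j))

/-- The cutoff at distance `ε` from the open orbit. -/
def orbitBump (𝕜 : Type) [RCLike 𝕜] (ε : ℝ) (hε : 0 < ε) :
    ContDiffBump ((Pi.single 3 1, Pi.single 4 1) : (Fin 8 → 𝕜) × (Fin 8 → 𝕜)) :=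
  ⟨ε / 2, ε, by positivity, by linarith⟩

/-- The cutoff as a function on the space of minors. -/
def minorCutoff (𝕜 : Type) [RCLike 𝕜] (ε : ℝ) (hε : 0 < ε) (x : MinorSpace 𝕜) : ℂ :=
  ((orbitBump 𝕜 ε hε (rowCoord 𝕜 x) *
    Real.smoothTransition (128 * 2000 ^ 2 * (1 + ‖x (3, 4)‖ ^ 2) + 1 - ‖x‖ ^ 2) : ℝ) : ℂ)

/-- The coordinate `-x₃₄`. -/
def negCoord (𝕜 : Type) [RCLike 𝕜] : MinorSpace 𝕜 →L[ℝ] 𝕜 :=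
  -(PiLp.proj (𝕜 := ℝ) 2 (fun _ : Fin 8 × Fin 8 => 𝕜) (3, 4))

theorem negCoord_apply (x : MinorSpace 𝕜) : negCoord 𝕜 x = -x (3, 4) := rfl

theorem hasTemperateGrowth_minorCutoff (ε : ℝ) (hε : 0 < ε) :
    (minorCutoff 𝕜 ε hε).HasTemperateGrowth := by
  refine Function.Complex.hasTemperateGrowth_ofReal.comp (Function.HasTemperateGrowth.mul ?_ ?_)
  · have h : Function.HasTemperateGrowth (orbitBump 𝕜 ε hε) :=
      ((orbitBump 𝕜 ε hε).hasCompactSupport.toSchwartzMap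
        (orbitBump 𝕜 ε hε).contDiff).hasTemperateGrowth
    exact h.comp (rowCoord 𝕜).hasTemperateGrowth
  · refine hasTemperateGrowth_smoothTransition.comp ?_
    refine Function.HasTemperateGrowth.sub (Function.HasTemperateGrowth.add
      (Function.HasTemperateGrowth.mul (Function.HasTemperateGrowth.const _)
        (Function.HasTemperateGrowth.add (Function.HasTemperateGrowth.const _) ?_))
      (Function.HasTemperateGrowth.const _)) (Function.hasTemperateGrowth_norm_sq _)
    have h := (Function.hasTemperateGrowth_norm_sq 𝕜).comp (negCoord 𝕜).hasTemperateGrowth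
    have e : (fun x : MinorSpace 𝕜 => ‖x (3, 4)‖ ^ 2) = (fun y : 𝕜 => ‖y‖ ^ 2) ∘ negCoord 𝕜 := by
      funext x
      change _ = ‖-x (3, 4)‖ ^ 2
      rw [norm_neg]
    rw [e]
    exact h

theorem norm_le_of_minorCutoff_ne_zero {ε : ℝ} {hε : 0 < ε} {x : MinorSpace 𝕜}
    (hx : minorCutoff 𝕜 ε hε x ≠ 0) : ‖x‖ ≤ (128 * 2000 ^ 2 + 1) * (1 + ‖negCoord 𝕜 x‖) := by
  have h1 : Real.smoothTransition (128 * 2000 ^ 2 * (1 + ‖x (3, 4)‖ ^ 2) + 1 - ‖x‖ ^ 2) ≠ 0 := by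
    intro h
    exact hx (by rw [minorCutoff, h, mul_zero, Complex.ofReal_zero])
  have h2 : 0 < 128 * 2000 ^ 2 * (1 + ‖x (3, 4)‖ ^ 2) + 1 - ‖x‖ ^ 2 := by
    by_contra h
    exact h1 (Real.smoothTransition.zero_of_nonpos (not_lt.1 h))
  rw [negCoord_apply, norm_neg]
  set t := ‖x (3, 4)‖
  have ht : 0 ≤ t := norm_nonneg _
  refine (sq_le_sq₀ (norm_nonneg _) (by positivity)).1 ?_
  nlinarith

theorem dist_comp_pair (e : w.Completion →+* 𝕜) (he : ∀ x, ‖e x‖ = ‖x‖)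
    (x y : (Fin 8 → w.Completion) × (Fin 8 → w.Completion)) :
    dist ((fun j => e (x.1 j), fun j => e (x.2 j)) : (Fin 8 → 𝕜) × (Fin 8 → 𝕜))
      (fun j => e (y.1 j), fun j => e (y.2 j)) = dist x y := by
  have h : ∀ a b : Fin 8 → w.Completion, dist (fun j => e (a j)) (fun j => e (b j)) = dist a b := by
    intro a b
    rw [dist_eq_norm, dist_eq_norm, Pi.norm_def, Pi.norm_def]
    congr 2
    funext j
    refine NNReal.eq ?_
    change ‖e (a j) - e (b j)‖ = ‖a j - b j‖
    rw [← map_sub, he]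
  rw [Prod.dist_eq, Prod.dist_eq, h, h]

theorem exists_inf_section (e : w.Completion →+* 𝕜) (he : ∀ x, ‖e x‖ = ‖x‖)
    {N : Set (G2 w.Completion)} (hN : N ∈ 𝓝 (1 : G2 w.Completion)) :
    ∃ θ : G2 w.Completion → ℝ, Continuous θ ∧ (∀ g, 0 ≤ θ g) ∧
      (∀ u ∈ unipU w.Completion, ∀ g, θ (u * g) = θ g) ∧ (∀ a ≠ 0, θ (torusF a 1) = 1) ∧
      (∀ g, θ g ≠ 0 → g.1.1 3 3 ≠ 0 ∧
        ∃ u ∈ unipU w.Completion, ∃ n ∈ N, g = torusF (g.1.1 3 3)⁻¹ 1 * u * n) ∧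
      ∀ φ : 𝓢(𝕜, ℂ), ∃ Ψ : 𝓢(MinorSpace 𝕜, ℂ), ∀ s g,
        archSec e Ψ s (muH _ * G2.toSpin8 g) = θ g * φ (e (-((g.1.1 3 3)⁻¹ * kap g))) *
          Complex.exp ((-(5 * w.mult * Real.log ‖g.1.1 3 3‖) : ℝ) * s) := by
  classical
  obtain ⟨ε, hε, hnear⟩ := exists_torusF_mul_of_rowRatio_near
    (Filter.inter_mem hN (tameSet_mem_nhds (k := w.Completion)))
  set ρ := orbitBump 𝕜 ε hε with hρ
  let q : G2 w.Completion → (Fin 8 → 𝕜) × (Fin 8 → 𝕜) := fun g =>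
    (fun j => e ((rowRatio g).1 j), fun j => e ((rowRatio g).2 j))
  have hec : Continuous e := (AddMonoidHomClass.isometry_of_norm e he).continuous
  have hq0 : ∀ g, dist (q g) (Pi.single 3 1, Pi.single 4 1) =
      dist (rowRatio g) (Pi.single 3 1, Pi.single 4 1) := by
    intro g
    rw [← dist_comp_pair e he]
    congr 2 <;> · funext j; fin_cases j <;> simp
  let θ : G2 w.Completion → ℝ := fun g => if g.1.1 3 3 = 0 then 0 else ρ (q g)
  have hsupp : ∀ g, θ g ≠ 0 → g.1.1 3 3 ≠ 0 ∧
      dist (rowRatio g) (Pi.single 3 1, Pi.single 4 1) < ε := by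
    intro g hg
    have h0 : g.1.1 3 3 ≠ 0 := fun h => hg (if_pos h)
    refine ⟨h0, ?_⟩
    have h1 : ρ (q g) ≠ 0 := by
      have : θ g = ρ (q g) := if_neg h0
      rwa [← this]
    have h2 : q g ∈ Function.support ρ := h1
    rw [ρ.support_eq] at h2
    rw [← hq0]
    exact h2
  have hunip : ∀ u ∈ unipU w.Completion, ∀ g, θ (u * g) = θ g := by
    intro u hu g
    simp only [θ, q]
    rw [rowRatio_unip_mul hu, uElt_mul_row_three hu]
  refine ⟨θ, ?_, ?_, hunip, ?_, ?_, ?_⟩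
  · refine continuous_rowCutoff (ρ := fun x => ρ (fun j => e (x.1 j), fun j => e (x.2 j)))
      (ρ.continuous.comp (by fun_prop)) (ε := ε) fun x hx => ?_
    have h2 : (fun j => e (x.1 j), fun j => e (x.2 j)) ∈ Function.support ρ := hx
    rw [ρ.support_eq] at h2
    rw [← dist_comp_pair e he]
    convert Metric.mem_ball.1 h2 using 2
    · exact Prod.ext (funext fun j => by fin_cases j <;> simp)
        (funext fun j => by fin_cases j <;> simp)
    · rfl
  · intro g
    simp only [θ]
    split_ifs
    · exact le_rfl
    · exact ρ.nonneg
  · intro a ha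
    have h := torusF_mul_row ha (1 : G2 w.Completion) 3
    rw [mul_one] at h
    have h3 : (torusF a 1 : G2 w.Completion).1.1 3 3 ≠ 0 := by
      rw [h, G2.val_one]; simpa using ha
    simp only [θ]
    rw [if_neg h3]
    refine ρ.one_of_mem_closedBall ?_
    rw [Metric.mem_closedBall, hq0, rowRatio_torusF ha, dist_self]
    exact ρ.rIn_pos.le
  · intro g hg
    obtain ⟨h0, h1⟩ := hsupp g hg
    obtain ⟨u, hu, n, hn, h⟩ := hnear g h0 h1.le
    exact ⟨h0, u, hu, n, hn.1, h⟩
  · intro φ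
    obtain ⟨Ψ, hΨ⟩ := exists_schwartz_mul (hasTemperateGrowth_minorCutoff (𝕜 := 𝕜) ε hε) φ
      (negCoord 𝕜) (fun x hx => norm_le_of_minorCutoff_ne_zero hx)
    refine ⟨Ψ, fun s g => ?_⟩
    rw [archSec, zMin_minors_mu]
    by_cases h0 : g.1.1 3 3 = 0
    · have : θ g = 0 := if_pos h0
      rw [if_pos h0, this]; simp
    rw [if_neg h0]
    congr 1
    change Ψ (archMinors e (muRatio g)) = _
    rw [hΨ, minorCutoff, rowCoord_archMinors, negCoord_apply]
    have e1 : θ g = ρ (q g) := if_neg h0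
    have e2 : (archMinors e (muRatio g) : MinorSpace 𝕜) (3, 4) = e (muRatio g (3, 4)) := rfl
    rw [e2, he, muRatio_three_four, ← map_neg, e1]
    congr 2
    by_cases h1 : ρ (q g) = 0
    · change ρ (q g) * _ = _
      rw [h1, zero_mul]
    · obtain ⟨_, hd⟩ := hsupp g (by rwa [e1])
      obtain ⟨u, hu, n, hn, hg⟩ := hnear g h0 hd.le
      change ρ (q g) * _ = _
      rw [Real.smoothTransition.one_of_one_le, mul_one]
      have hb : ∀ p, ‖muRatio g p‖ ≤ 2000 * (1 + ‖muRatio g (3, 4)‖) := by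
        intro p
        have := norm_muRatio_le (inv_ne_zero h0) hu hn.2 p
        rwa [← hg] at this
      rw [← muRatio_three_four]
      set t := ‖muRatio g (3, 4)‖
      have hn2 : ‖archMinors e (muRatio g)‖ ^ 2 ≤ 64 * (2000 * (1 + t)) ^ 2 := by
        rw [EuclideanSpace.norm_sq_eq]
        refine (Finset.sum_le_card_nsmul _ _ ((2000 * (1 + t)) ^ 2) fun p _ => ?_).trans ?_
        · change ‖e (muRatio g p)‖ ^ 2 ≤ _
          rw [he]
          exact pow_le_pow_left₀ (norm_nonneg _) (hb p) 2
        · simp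
      nlinarith [sq_nonneg (1 - t)]

end ArchSection

/-! ### Orders of vanishing of exponential integrals -/

section ExpIntegral

variable {Ω : Type*} [MeasurableSpace Ω] {μ : Measure Ω}

theorem integrable_mul_pow_exp {f : Ω → ℂ} (hf : Integrable f μ) {b : Ω → ℝ} (hb : Measurable b)
    {R : ℝ} (hR : ∀ x, f x ≠ 0 → |b x| ≤ R) (j : ℕ) (s : ℂ) :
    Integrable (fun x => f x * ((b x : ℂ) ^ j * Complex.exp (b x * s))) μ := by
  have hm : Measurable fun x => (b x : ℂ) ^ j * Complex.exp (b x * s) := by fun_prop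
  refine (hf.norm.mul_const (R ^ j * Real.exp (R * ‖s‖))).mono
    (hf.aestronglyMeasurable.mul hm.aestronglyMeasurable) (ae_of_all _ fun x => ?_)
  by_cases h : f x = 0
  · simp [h]
  have h1 := hR x h
  have hR0 : 0 ≤ R := (abs_nonneg _).trans h1
  rw [norm_mul, norm_mul, norm_pow, Complex.norm_real, Real.norm_eq_abs (b x), Complex.norm_exp,
    Real.norm_of_nonneg (by positivity : (0 : ℝ) ≤ ‖f x‖ * (R ^ j * Real.exp (R * ‖s‖)))]
  refine mul_le_mul_of_nonneg_left (mul_le_mul (pow_le_pow_left₀ (abs_nonneg _) h1 j) ?_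
    (Real.exp_pos _).le (by positivity)) (norm_nonneg _)
  rw [Real.exp_le_exp, Complex.re_ofReal_mul]
  calc b x * s.re ≤ |b x * s.re| := le_abs_self _
    _ = |b x| * |s.re| := abs_mul _ _
    _ ≤ R * ‖s‖ := mul_le_mul h1 (Complex.abs_re_le_norm s) (abs_nonneg _) hR0

theorem hasDerivAt_expIntegral {f : Ω → ℂ} (hf : Integrable f μ) {b : Ω → ℝ} (hb : Measurable b)
    {R : ℝ} (hR : ∀ x, f x ≠ 0 → |b x| ≤ R) (j : ℕ) (s₀ : ℂ) :
    HasDerivAt (fun s => ∫ x, f x * ((b x : ℂ) ^ j * Complex.exp (b x * s)) ∂μ)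
      (∫ x, f x * ((b x : ℂ) ^ (j + 1) * Complex.exp (b x * s₀)) ∂μ) s₀ := by
  have hint := integrable_mul_pow_exp hf hb hR
  refine (hasDerivAt_integral_of_dominated_loc_of_deriv_le
    (F := fun s x => f x * ((b x : ℂ) ^ j * Complex.exp (b x * s)))
    (F' := fun s x => f x * ((b x : ℂ) ^ (j + 1) * Complex.exp (b x * s)))
    (bound := fun x => ‖f x‖ * (R ^ (j + 1) * Real.exp (R * (‖s₀‖ + 1))))
    (Metric.ball_mem_nhds s₀ one_pos)
    (Filter.Eventually.of_forall fun s => (hint j s).aestronglyMeasurable) (hint j s₀)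
    (hint (j + 1) s₀).aestronglyMeasurable ?_ (hf.norm.mul_const _) ?_).2
  · refine ae_of_all _ fun x s hs => ?_
    by_cases h : f x = 0
    · simp [h]
    have h1 := hR x h
    have hR0 : 0 ≤ R := (abs_nonneg _).trans h1
    rw [norm_mul, norm_mul, norm_pow, Complex.norm_real, Real.norm_eq_abs, Complex.norm_exp]
    refine mul_le_mul_of_nonneg_left (mul_le_mul (pow_le_pow_left₀ (abs_nonneg _) h1 _) ?_
      (Real.exp_pos _).le (by positivity)) (norm_nonneg _)
    rw [Real.exp_le_exp, Complex.re_ofReal_mul]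
    have h2 : ‖s‖ ≤ ‖s₀‖ + 1 := by
      have := norm_sub_norm_le s s₀
      rw [Metric.mem_ball, dist_eq_norm] at hs
      linarith
    calc b x * s.re ≤ |b x * s.re| := le_abs_self _
      _ = |b x| * |s.re| := abs_mul _ _
      _ ≤ R * (‖s₀‖ + 1) := mul_le_mul h1 ((Complex.abs_re_le_norm s).trans h2) (abs_nonneg _) hR0
  · refine ae_of_all _ fun x s _ => ?_
    have h1 : HasDerivAt (fun s : ℂ => Complex.exp (b x * s)) (Complex.exp (b x * s) * b x) s := by
      simpa using ((hasDerivAt_id s).const_mul (b x : ℂ)).cexp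
    have h2 := (h1.const_mul ((b x : ℂ) ^ j)).const_mul (f x)
    exact h2.congr_deriv (by ring)

theorem analyticOrderAt_expIntegral {f : Ω → ℂ} (hf : Integrable f μ) {b : Ω → ℝ}
    (hb : Measurable b) {R : ℝ} (hR : ∀ x, f x ≠ 0 → |b x| ≤ R) {m : ℕ} {s₀ : ℂ}
    (h0 : ∀ j < m, ∫ x, f x * ((b x : ℂ) ^ j * Complex.exp (b x * s₀)) ∂μ = 0)
    (h1 : ∫ x, f x * ((b x : ℂ) ^ m * Complex.exp (b x * s₀)) ∂μ ≠ 0) :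
    AnalyticAt ℂ (fun s => ∫ x, f x * Complex.exp (b x * s) ∂μ) s₀ ∧
      analyticOrderAt (fun s => ∫ x, f x * Complex.exp (b x * s) ∂μ) s₀ = m := by
  have hd := hasDerivAt_expIntegral hf hb hR
  have e : ∀ j, iteratedDeriv j (fun s => ∫ x, f x * Complex.exp (b x * s) ∂μ) =
      fun s => ∫ x, f x * ((b x : ℂ) ^ j * Complex.exp (b x * s)) ∂μ := by
    intro j
    induction j with
    | zero => simp
    | succ j ih =>
      rw [iteratedDeriv_succ, ih]
      funext s
      exact (hd j s).deriv
  have han : AnalyticAt ℂ (fun s => ∫ x, f x * Complex.exp (b x * s) ∂μ) s₀ := by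
    have hdiff : Differentiable ℂ (fun s => ∫ x, f x * Complex.exp (b x * s) ∂μ) := fun s => by
      have := (hd 0 s).differentiableAt
      simpa using this
    exact hdiff.analyticAt s₀
  refine ⟨han, (analyticOrderAt_eq_nat_iff_iteratedDeriv_eq_zero han).2 ⟨fun j hj => ?_, ?_⟩⟩
  · rw [e]; exact h0 j hj
  · rw [e]; exact h1

end ExpIntegral

section Core

variable {X : Type*} [Group X] [TopologicalSpace X] [IsTopologicalGroup X] {Y : Subgroup X}
  {ν : Measure (Coset Y)}

theorem exists_coefficients {m : ℕ} (A β : Fin (m + 1) → ℂ) (hA : ∀ i, A i ≠ 0)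
    (hβ : Function.Injective β) :
    ∃ ε > 0, ∀ M : Matrix (Fin (m + 1)) (Fin (m + 1)) ℂ,
      (∀ i j, ‖M i j - A i * β i ^ (j : ℕ)‖ ≤ ε) →
      ∃ x : Fin (m + 1) → ℂ, x ᵥ* M = Pi.single (Fin.last m) 1 := by
  let M₀ : Matrix (Fin (m + 1)) (Fin (m + 1)) ℂ := Matrix.diagonal A * Matrix.vandermonde β
  have hM₀ : M₀.det ≠ 0 := by
    rw [Matrix.det_mul, Matrix.det_diagonal]
    exact mul_ne_zero (Finset.prod_ne_zero_iff.2 fun i _ => hA i)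
      (Matrix.det_vandermonde_ne_zero_iff.2 hβ)
  have hc : Continuous fun M : Fin (m + 1) → Fin (m + 1) → ℂ => (Matrix.of M).det :=
    Continuous.matrix_det (continuous_id (X := Matrix (Fin (m + 1)) (Fin (m + 1)) ℂ))
  have hev : ∀ᶠ M in 𝓝 (fun i j => M₀ i j : Fin (m + 1) → Fin (m + 1) → ℂ), (Matrix.of M).det ≠ 0 :=
    hc.continuousAt.eventually_ne hM₀
  obtain ⟨ε, hε, h⟩ := Metric.nhds_basis_closedBall.eventually_iff.1 hev
  refine ⟨ε, hε, fun M hM => ?_⟩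
  have hdet : M.det ≠ 0 := by
    refine h (x := fun i j => M i j) ?_
    rw [Metric.mem_closedBall, dist_pi_le_iff hε.le]
    intro i
    rw [dist_pi_le_iff hε.le]
    intro j
    rw [dist_eq_norm]
    have e : M₀ i j = A i * β i ^ (j : ℕ) := by
      simp [M₀, Matrix.diagonal_mul, Matrix.vandermonde_apply]
    rw [e]
    exact hM i j
  refine ⟨Pi.single (Fin.last m) 1 ᵥ* M⁻¹, ?_⟩
  rw [Matrix.vecMul_vecMul, Matrix.nonsing_inv_mul _ (isUnit_iff_ne_zero.2 hdet), Matrix.vecMul_one]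

theorem exists_order_of_vanishing (hν : IsInvariantMeasure ν) {m : ℕ} {A : X → ℂ}
    (hA : ∀ y ∈ Y, ∀ x, A (y * x) = A x) {B : X → ℝ} (hB : ∀ y ∈ Y, ∀ x, B (y * x) = B x)
    (hBc : Continuous B) {g : Fin (m + 1) → X} (hAc : ∀ i, ContinuousAt A (g i))
    (hA0 : ∀ i, A (g i) ≠ 0) (hinj : Function.Injective (B ∘ g))
    (hK : ∀ i, ∃ K ∈ 𝓝 (g i), IsCompact K) {S : (Fin (m + 1) → X → ℝ) → Prop}
    (hS : ∀ N : Fin (m + 1) → Set X, (∀ i, N i ∈ 𝓝 (g i)) → ∃ P, S P ∧ ∀ i,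
      (∀ y ∈ Y, ∀ x, P i (y * x) = P i x) ∧ Continuous (P i) ∧
      Continuous (fun x => A x * P i x) ∧ (∀ x, 0 ≤ P i x) ∧ 0 < P i (g i) ∧
      ∀ x, P i x ≠ 0 → ∃ y ∈ Y, y * x ∈ N i) (s₀ : ℂ) :
    ∃ P, S P ∧ ∃ a : Fin (m + 1) → ℂ,
      (∀ s, CosetIntegrable ν fun h => A h * (∑ i, a i * P i h) * Complex.exp (B h * s)) ∧
      AnalyticAt ℂ (fun s => cosetIntegral ν fun h =>
        A h * (∑ i, a i * P i h) * Complex.exp (B h * s)) s₀ ∧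
      analyticOrderAt (fun s => cosetIntegral ν fun h =>
        A h * (∑ i, a i * P i h) * Complex.exp (B h * s)) s₀ = m := by
  choose K hK hKc using hK
  let Q : ℕ → X → ℂ := fun j h => A h * ((B h : ℂ) ^ j * Complex.exp (B h * s₀))
  have hQY : ∀ j, ∀ y ∈ Y, ∀ x, Q j (y * x) = Q j x := fun j y hy x => by
    simp only [Q, hA y hy, hB y hy]
  have hQc : ∀ i j, ContinuousAt (Q j) (g i) := fun i j => by
    refine (hAc i).mul (Continuous.continuousAt ?_)
    fun_prop
  obtain ⟨ε, hε, hx⟩ := exists_coefficients (m := m)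
    (fun i => A (g i) * Complex.exp (B (g i) * s₀)) (fun i => (B (g i) : ℂ))
    (fun i => mul_ne_zero (hA0 i) (Complex.exp_ne_zero _))
    (fun i j h => hinj (Complex.ofReal_injective h))
  obtain ⟨P, hSP, hP⟩ := hS (fun i => K i ∩ {h | ∀ j : Fin (m + 1), ‖Q j h - Q j (g i)‖ ≤ ε})
    (fun i => Filter.inter_mem (hK i) (Filter.eventually_all.2 fun j => by
      have h : ContinuousAt (fun h => ‖Q j h - Q j (g i)‖) (g i) :=
        ((hQc i j).sub continuousAt_const).norm
      refine h.eventually (ge_mem_nhds ?_)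
      simpa using hε))
  choose hPY hPc hAPc hP0 hPg hPN using hP
  -- functions on the coset space
  have hPYc : ∀ i, ∀ y ∈ Y, ∀ x, (P i (y * x) : ℂ) = P i x := fun i y hy x => by rw [hPY i y hy]
  have hAPY : ∀ i, ∀ y ∈ Y, ∀ x, A (y * x) * P i (y * x) = A x * P i x := fun i y hy x => by
    rw [hPY i y hy, hA y hy]
  have hBY : ∀ y ∈ Y, ∀ x, (B (y * x) : ℂ) = B x := fun y hy x => by rw [hB y hy]
  let p : Fin (m + 1) → Coset Y → ℂ := fun i => onCoset Y fun h => (P i h : ℂ)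
  let f : Fin (m + 1) → Coset Y → ℂ := fun i => onCoset Y fun h => A h * P i h
  let b : Coset Y → ℝ := fun q => (onCoset Y (fun h => (B h : ℂ)) q).re
  have hp : ∀ i x, p i (toCoset Y x) = P i x := fun i x => onCoset_toCoset (hPYc i) x
  have hf : ∀ i x, f i (toCoset Y x) = A x * P i x := fun i x => onCoset_toCoset (hAPY i) x
  have hb : ∀ x, b (toCoset Y x) = B x := fun x => by
    simp only [b]; rw [onCoset_toCoset hBY, Complex.ofReal_re]
  have hbm : Measurable b :=
    (Complex.continuous_re.comp (continuous_onCoset hBY (by fun_prop))).measurable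
  have hpint : ∀ i, Integrable (p i) ν := fun i =>
    cosetIntegrable_of_support hν (hPYc i) (by have := hPc i; fun_prop) (hKc i) (fun x hx => by
      obtain ⟨y, hy, hyx⟩ := hPN i x (by simpa using hx)
      exact ⟨y, hy, hyx.1⟩)
  have hfint : ∀ i, Integrable (f i) ν := fun i =>
    cosetIntegrable_of_support hν (hAPY i) (hAPc i) (hKc i) (fun x hx => by
      obtain ⟨y, hy, hyx⟩ := hPN i x (by simpa using right_ne_zero_of_mul hx)
      exact ⟨y, hy, hyx.1⟩)
  obtain ⟨R, hR⟩ : ∃ R, ∀ i, ∀ x ∈ K i, |B x| ≤ R := by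
    obtain ⟨R, hR⟩ := ((isCompact_iUnion hKc).image hBc).isBounded.exists_norm_le
    exact ⟨R, fun i x hx => hR _ ⟨x, Set.mem_iUnion.2 ⟨i, hx⟩, rfl⟩⟩
  have hbR : ∀ i q, f i q ≠ 0 → |b q| ≤ R := by
    intro i q hq
    obtain ⟨x, rfl⟩ := toCoset_surjective q
    rw [hf] at hq
    obtain ⟨y, hy, hyx⟩ := hPN i x (by simpa using right_ne_zero_of_mul hq)
    rw [hb, ← hB y hy]
    exact hR i _ hyx.1
  let V : Fin (m + 1) → ℝ := fun i => ∫ q, ‖p i q‖ ∂ν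
  have hV : ∀ i, 0 < V i := by
    intro i
    refine (integral_pos_iff_support_of_nonneg (fun q => norm_nonneg _) (hpint i).norm).2 ?_
    have hpc : Continuous (p i) := continuous_onCoset (hPYc i) (by have := hPc i; fun_prop)
    refine hν.measure_pos (hpc.norm.isOpen_support) ⟨toCoset Y (g i), ?_⟩
    rw [Function.mem_support, hp, norm_ne_zero_iff]
    exact_mod_cast (hPg i).ne'
  have hpV : ∀ i, ∫ q, p i q ∂ν = V i := by
    intro i
    rw [← integral_complex_ofReal]
    refine integral_congr_ae (ae_of_all _ fun q => ?_)
    obtain ⟨x, rfl⟩ := toCoset_surjective q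
    change p i _ = ((‖p i _‖ : ℝ) : ℂ)
    rw [hp, Complex.norm_real, Real.norm_of_nonneg (hP0 i x)]
  let M : Matrix (Fin (m + 1)) (Fin (m + 1)) ℂ := fun i j =>
    (V i : ℂ)⁻¹ * ∫ q, f i q * ((b q : ℂ) ^ (j : ℕ) * Complex.exp (b q * s₀)) ∂ν
  have hint := fun i => integrable_mul_pow_exp (hfint i) hbm (hbR i)
  obtain ⟨y, hy⟩ := hx M (fun i j => by
    have hVc : (V i : ℂ) ≠ 0 := by exact_mod_cast (hV i).ne'
    have e1 : M i j - A (g i) * Complex.exp (B (g i) * s₀) * (B (g i) : ℂ) ^ (j : ℕ) =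
        (V i : ℂ)⁻¹ * ∫ q, (f i q * ((b q : ℂ) ^ (j : ℕ) * Complex.exp (b q * s₀)) -
          p i q * Q j (g i)) ∂ν := by
      rw [integral_sub (hint i j s₀) ((hpint i).mul_const _), integral_mul_const, hpV, mul_sub,
        inv_mul_cancel_left₀ hVc]
      simp only [M, Q]
      ring
    rw [e1, norm_mul, norm_inv, Complex.norm_real, Real.norm_of_nonneg (hV i).le,
      inv_mul_le_iff₀ (hV i), mul_comm (V i), ← integral_const_mul]
    refine norm_integral_le_of_norm_le ((hpint i).norm.const_mul ε) (ae_of_all _ fun q => ?_)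
    obtain ⟨x, rfl⟩ := toCoset_surjective q
    rw [hf, hp, hb]
    have e2 : A x * (P i x : ℂ) * ((B x : ℂ) ^ (j : ℕ) * Complex.exp (B x * s₀)) -
        P i x * Q j (g i) = (Q j x - Q j (g i)) * P i x := by simp only [Q]; ring
    rw [e2, norm_mul]
    by_cases hx0 : P i x = 0
    · simp [hx0]
    · obtain ⟨y, hy, hyx⟩ := hPN i x hx0
      have := hyx.2 j
      rw [hQY j y hy] at this
      gcongr)
  refine ⟨P, hSP, fun i => y i * (V i : ℂ)⁻¹, ?_⟩
  set F : Coset Y → ℂ := fun q => ∑ i, y i * (V i : ℂ)⁻¹ * f i q with hF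
  have hFint : Integrable F ν := integrable_finsetSum _ fun i _ => (hfint i).const_mul _
  have hFR : ∀ q, F q ≠ 0 → |b q| ≤ R := by
    intro q hq
    obtain ⟨i, -, hi⟩ := Finset.exists_ne_zero_of_sum_ne_zero hq
    exact hbR i q (right_ne_zero_of_mul hi)
  have hmom : ∀ j : Fin (m + 1), ∫ q, F q * ((b q : ℂ) ^ (j : ℕ) * Complex.exp (b q * s₀)) ∂ν =
      (Pi.single (Fin.last m) 1 : Fin (m + 1) → ℂ) j := by
    intro j
    rw [← hy]
    simp only [hF, Finset.sum_mul]
    rw [integral_finsetSum _ fun i _ => by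
      simpa only [mul_assoc] using (hint i j s₀).const_mul (y i * (V i : ℂ)⁻¹)]
    refine Finset.sum_congr rfl fun i _ => ?_
    simp only [mul_assoc]
    rw [integral_const_mul, integral_const_mul]
  have hon : ∀ s, (onCoset Y fun h => A h * (∑ i, y i * (V i : ℂ)⁻¹ * P i h) *
      Complex.exp (B h * s)) = fun q => F q * Complex.exp (b q * s) := by
    intro s
    funext q
    obtain ⟨x, rfl⟩ := toCoset_surjective q
    rw [onCoset_toCoset (fun y hy x => by simp only [hA y hy, hB y hy, hPY _ y hy])]
    simp only [hF, hf, hb, Finset.mul_sum]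
    congr 1
    exact Finset.sum_congr rfl fun i _ => by ring
  have key := analyticOrderAt_expIntegral hFint hbm hFR (m := m) (s₀ := s₀) (fun j hj => by
      have := hmom ⟨j, by omega⟩
      rw [Pi.single_eq_of_ne (fun h => by
        have := congrArg Fin.val h
        simp at this; omega)] at this
      exact this)
    (by
      have := hmom (Fin.last m)
      rw [Pi.single_eq_same, Fin.val_last] at this
      rw [this]; exact one_ne_zero)
  refine ⟨fun s => ?_, ?_⟩
  · rw [CosetIntegrable, hon]
    simpa using integrable_mul_pow_exp hFint hbm hFR 0 s
  · simp only [cosetIntegral, hon]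
    exact key

end Core

/-! ### The unfolded local integrals -/

section Phase

variable {k : Type*} [NormedField k] {χ : AddChar k Circle}

open scoped Classical in
/-- The character of `κ / D`, extended by `0` to the zeros of `D`. -/
def phase (χ : AddChar k Circle) (g : G2 k) : ℂ :=
  if detD g = 0 then 0 else (χ (kap g / detD g) : ℂ)

theorem phase_of_ne_zero {g : G2 k} (h : detD g ≠ 0) : phase χ g = χ (kap g / detD g) := if_neg h

theorem phase_unip_mul {u : G2 k} (hu : u ∈ unipU k) (g : G2 k) :
    (χ (psiArg u) : ℂ) * phase χ (u * g) = phase χ g := by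
  rw [phase, phase, detD_unip_mul hu, kap_unip_mul hu]
  split_ifs with h
  · rw [mul_zero]
  · rw [← Circle.coe_mul, ← AddChar.map_add_eq_mul]
    congr 2
    field_simp
    ring

theorem norm_phase_le (g : G2 k) : ‖phase χ g‖ ≤ 1 := by
  rw [phase]
  split_ifs
  · simp
  · exact (Circle.norm_coe _).le

theorem continuousAt_phase (hχ : Continuous χ) {g : G2 k} (h : detD g ≠ 0) :
    ContinuousAt (phase χ) g := by
  have h1 : ∀ᶠ x in 𝓝 g, detD x ≠ 0 := continuous_detD.continuousAt.eventually_ne h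
  have h2 : ContinuousAt (fun x : G2 k => ((χ (kap x / detD x) : Circle) : ℂ)) g :=
    (continuous_subtype_val.comp hχ).continuousAt.comp
      (continuous_kap.continuousAt.div continuous_detD.continuousAt h)
  exact h2.congr (h1.mono fun x hx => (phase_of_ne_zero hx).symm)

theorem continuous_phase_mul (hχ : Continuous χ) {P : G2 k → ℝ} (hP : Continuous P)
    (h : ∀ g, P g ≠ 0 → detD g ≠ 0) : Continuous fun g => phase χ g * P g := by
  refine continuous_iff_continuousAt.2 fun g => ?_
  by_cases hg : P g = 0
  · have h1 : Filter.Tendsto (fun x => ‖P x‖) (𝓝 g) (𝓝 0) := by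
      have := hP.norm.tendsto g
      rwa [hg, norm_zero] at this
    rw [ContinuousAt, hg, Complex.ofReal_zero, mul_zero]
    refine squeeze_zero_norm (fun x => ?_) h1
    rw [norm_mul, Complex.norm_real]
    exact mul_le_of_le_one_left (norm_nonneg _) (norm_phase_le x)
  · exact (continuousAt_phase hχ (h g hg)).mul
      (Complex.continuous_ofReal.comp hP).continuousAt

/-- A nonnegative bump function on `U \ G`, supported near `g₀`, which can be multiplied with the
phase. -/
structure IsBumpNear (χ : AddChar k Circle) (g₀ : G2 k) (N : Set (G2 k)) (P : G2 k → ℝ) :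
    Prop where
  unip_mul : ∀ u ∈ unipU k, ∀ g, P (u * g) = P g
  continuous : Continuous P
  continuous_phase : Continuous fun g => phase χ g * P g
  nonneg : ∀ g, 0 ≤ P g
  pos : 0 < P g₀
  mem : ∀ g, P g ≠ 0 → ∃ u ∈ unipU k, u * g ∈ N

theorem torusF_row_three {a : k} (ha : a ≠ 0) : (torusF a⁻¹ 1 : G2 k).1.1 3 3 = a := by
  have h := torusF_mul_row (inv_ne_zero ha) (1 : G2 k) 3
  rw [mul_one] at h
  rw [h, G2.val_one]
  simp

theorem detD_torusF {a : k} (ha : a ≠ 0) : detD (torusF a⁻¹ 1 : G2 k) = a ^ 2 := by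
  have h := detD_torusF_mul (inv_ne_zero ha) (1 : G2 k)
  rw [mul_one, detD_one, mul_one, inv_inv] at h
  exact h

theorem phase_torusF_ne_zero {a : k} (ha : a ≠ 0) : phase χ (torusF a⁻¹ 1 : G2 k) ≠ 0 := by
  rw [phase_of_ne_zero (by rw [detD_torusF ha]; exact pow_ne_zero 2 ha)]
  exact Circle.coe_ne_zero _

theorem inv_mul_detD_of_eq {a : k} (ha : a ≠ 0) {u g n : G2 k} (hu : u ∈ unipU k)
    (e : g = torusF a⁻¹ 1 * u * n) : a⁻¹ * detD g = a * detD n := by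
  rw [e, mul_assoc, detD_torusF_mul (inv_ne_zero ha), detD_unip_mul hu, inv_inv, sq, mul_assoc,
    inv_mul_cancel_left₀ ha]

/-- Elements of `G` near the torus element with parameter `t`, modulo `U`, in terms of
`D / A₃`. -/
theorem exists_nhds_torusF {t : k} (ht : t ≠ 0) {c : ℝ} (hc : c < ‖t‖) {N : Set (G2 k)}
    (hN : N ∈ 𝓝 (torusF t⁻¹ 1 : G2 k)) :
    ∃ M ∈ 𝓝 (1 : G2 k), ∃ V ∈ 𝓝 t, ∀ g : G2 k, g.1.1 3 3 ≠ 0 → detD g ≠ 0 → ∀ u ∈ unipU k,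
      ∀ n ∈ M, g = torusF (g.1.1 3 3)⁻¹ 1 * u * n → (g.1.1 3 3)⁻¹ * detD g ∈ V →
      c ≤ ‖g.1.1 3 3‖ ∧ ∃ u' ∈ unipU k, u' * g ∈ N := by
  have h1 : Filter.Tendsto (fun p : G2 k × k => p.2 / detD p.1) (𝓝 (1, t)) (𝓝 t) := by
    have := (continuous_snd.tendsto ((1 : G2 k), t)).div
      ((continuous_detD.comp continuous_fst).tendsto ((1 : G2 k), t))
      (by simp [detD_one])
    rw [Function.comp_apply, detD_one, div_one] at this
    exact this
  have h2 : ∀ᶠ p : G2 k × k in 𝓝 (1, t), c ≤ ‖p.2 / detD p.1‖ :=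
    h1.norm.eventually (le_mem_nhds hc)
  have h3 : ∀ᶠ p : G2 k × k in 𝓝 (1, t), torusF (p.2 / detD p.1)⁻¹ 1 * p.1 ∈ N := by
    have h4 : Filter.Tendsto (fun p : G2 k × k => torusF (p.2 / detD p.1)⁻¹ 1 * p.1) (𝓝 (1, t))
        (𝓝 (torusF t⁻¹ 1 * 1)) :=
      (tendsto_torusF (inv_ne_zero ht) one_ne_zero (h1.inv₀ ht) tendsto_const_nhds).mul
        (continuous_fst.tendsto ((1 : G2 k), t))
    rw [mul_one] at h4
    exact h4 hN
  have h5 := h2.and h3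
  rw [nhds_prod_eq] at h5
  obtain ⟨M, hM, V, hV, h⟩ := Filter.eventually_prod_iff.1 h5
  refine ⟨{n | M n}, hM, {b | V b}, hV, fun g h0 hd u hu n hn e hb => ?_⟩
  have e1 : (g.1.1 3 3)⁻¹ * detD g = g.1.1 3 3 * detD n :=
    inv_mul_detD_of_eq h0 hu e
  have hn0 : detD n ≠ 0 := by
    rintro h'
    rw [h', mul_zero] at e1
    exact mul_ne_zero (inv_ne_zero h0) hd e1
  have e2 : (g.1.1 3 3)⁻¹ * detD g / detD n = g.1.1 3 3 := by
    rw [e1, mul_div_cancel_right₀ _ hn0]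
  have h6 := h hn hb
  simp only [e2] at h6
  refine ⟨h6.1, _, torusF_conj_mem (inv_ne_zero h0) (inv_mem hu), ?_⟩
  convert h6.2 using 1
  generalize (g.1.1 3 3)⁻¹ = a at e
  rw [e]
  group

end Phase

section Bump

variable {k : Type*} [NormedField k] {χ : AddChar k Circle}

/-- The bump function `θ(g) H(D(g) / A₃(g))`. -/
theorem isBumpNear_of (hχ : Continuous χ) {θ : G2 k → ℝ} (hθc : Continuous θ)
    (hθ0 : ∀ g, 0 ≤ θ g) (hθu : ∀ u ∈ unipU k, ∀ g, θ (u * g) = θ g)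
    (hθs : ∀ g, θ g ≠ 0 → g.1.1 3 3 ≠ 0 ∧ detD g ≠ 0) {H : k → ℝ} (hHc : ContinuousOn H {0}ᶜ)
    {C : ℝ} (hC : ∀ b ≠ 0, H b ≤ C) (hH0 : ∀ b ≠ 0, 0 ≤ H b) {t : k} (ht : t ≠ 0)
    (hθt : θ (torusF t⁻¹ 1) ≠ 0) (hHt : 0 < H t) {N : Set (G2 k)}
    (hN : ∀ g, θ g ≠ 0 → H ((g.1.1 3 3)⁻¹ * detD g) ≠ 0 → ∃ u ∈ unipU k, u * g ∈ N) :
    IsBumpNear χ (torusF t⁻¹ 1) N fun g => θ g * H ((g.1.1 3 3)⁻¹ * detD g) := by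
  have hrat : ∀ g, θ g ≠ 0 → (g.1.1 3 3)⁻¹ * detD g ≠ 0 := fun g hg =>
    mul_ne_zero (inv_ne_zero (hθs g hg).1) (hθs g hg).2
  have hPc : Continuous fun g => θ g * H ((g.1.1 3 3)⁻¹ * detD g) := by
    refine continuous_iff_continuousAt.2 fun g => ?_
    by_cases hg : θ g = 0
    · have h1 : Filter.Tendsto (fun x => θ x * C) (𝓝 g) (𝓝 0) := by
        have := (hθc.tendsto g).mul_const C
        rwa [hg, zero_mul] at this
      rw [ContinuousAt, hg, zero_mul]
      refine squeeze_zero_norm (fun x => ?_) h1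
      by_cases hx : θ x = 0
      · simp [hx]
      · rw [norm_mul, Real.norm_of_nonneg (hθ0 x), Real.norm_of_nonneg (hH0 _ (hrat x hx))]
        exact mul_le_mul_of_nonneg_left (hC _ (hrat x hx)) (hθ0 x)
    · refine hθc.continuousAt.mul
        (ContinuousAt.comp (f := fun g : G2 k => (g.1.1 3 3)⁻¹ * detD g) (g := H) ?_ ?_)
      · exact hHc.continuousAt (isOpen_compl_singleton.mem_nhds (hrat g hg))
      · exact ((G2.continuous_entry 3 3).continuousAt.inv₀ (hθs g hg).1).mul
          continuous_detD.continuousAt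
  refine ⟨fun u hu g => ?_, hPc, ?_, fun g => ?_, ?_, fun g hg =>
    hN g (left_ne_zero_of_mul hg) (right_ne_zero_of_mul hg)⟩
  · rw [hθu u hu, detD_unip_mul hu, uElt_mul_row_three hu]
  · exact continuous_phase_mul hχ hPc fun g hg => (hθs g (left_ne_zero_of_mul hg)).2
  · by_cases hg : θ g = 0
    · simp [hg]
    · exact mul_nonneg (hθ0 g) (hH0 _ (hrat g hg))
  · rw [torusF_row_three ht, detD_torusF ht, sq, inv_mul_cancel_left₀ ht]
    exact mul_pos (lt_of_le_of_ne (hθ0 _) (Ne.symm hθt)) hHt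

end Bump

section ArchDatum

open scoped SchwartzMap

variable {K : Type*} [Field K] [NumberField K] {w : InfinitePlace K} {𝕜 : Type} [RCLike 𝕜]
  [MeasurableSpace w.Completion] [BorelSpace w.Completion]

theorem exists_inf_datum (e : w.Completion ≃+* 𝕜) (he : ∀ x, ‖e x‖ = ‖x‖)
    (μ : Measure w.Completion) [μ.IsAddHaarMeasure] {χ : AddChar w.Completion Circle}
    (hχ : Continuous χ) (hχ1 : χ ≠ 1) {ι : Type*} [Fintype ι] {t : ι → w.Completion}
    (ht : ∀ i, 1 ≤ ‖t i‖) {N : ι → Set (G2 w.Completion)}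
    (hN : ∀ i, N i ∈ 𝓝 (torusF (t i)⁻¹ 1)) :
    ∃ P : ι → G2 w.Completion → ℝ, (∀ i, IsBumpNear χ (torusF (t i)⁻¹ 1) (N i) (P i)) ∧
      ∀ a : ι → ℂ, ∃ f, IsInfSection w f ∧
        (∀ s g, Integrable (fun r => f s (muH _ * G2.toSpin8 (xAB r * g)) * (χ r : ℂ)) μ) ∧
        ∀ s g, ∫ r, f s (muH _ * G2.toSpin8 (xAB r * g)) * (χ r : ℂ) ∂μ =
          phase χ g * (∑ i, a i * P i g) *
            Complex.exp ((-(5 * w.mult * Real.log (max ‖g.1.1 3 3‖ (1 / 2))) : ℝ) * s) := by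
  have ht0 : ∀ i, t i ≠ 0 := fun i h => by
    have := ht i
    rw [h, norm_zero] at this
    linarith
  choose M hM V hV hMV using fun i => exists_nhds_torusF (ht0 i) (c := 1 / 2)
    (by linarith [ht i]) (hN i)
  choose φ H hHc hHt hH0 hHU hφ using fun i => exists_schwartz_integral e he μ hχ hχ1 (ht0 i)
    (Filter.inter_mem (hV i) (Metric.closedBall_mem_nhds (t i) (ε := 1 / 2) (by norm_num)))
  obtain ⟨θ, hθc, hθ0, hθu, hθ1, hθs, hθΨ⟩ := exists_inf_section (e : w.Completion →+* 𝕜) he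
    (N := (⋂ i, M i) ∩ tameSet w.Completion)
    (Filter.inter_mem (Filter.iInter_mem.2 hM) tameSet_mem_nhds)
  have hdet : ∀ g, θ g ≠ 0 → detD g ≠ 0 := by
    intro g hg
    obtain ⟨h0, u, hu, n, hn, e1⟩ := hθs g hg
    have e2 := inv_mul_detD_of_eq h0 hu e1
    have h3 : detD n ≠ 0 := norm_pos_iff.1 (by linarith [hn.2.2.2])
    intro h
    rw [h, mul_zero] at e2
    exact mul_ne_zero h0 h3 e2.symm
  have hrat : ∀ g, θ g ≠ 0 → (g.1.1 3 3)⁻¹ * detD g ≠ 0 := fun g hg =>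
    mul_ne_zero (inv_ne_zero (hθs g hg).1) (hdet g hg)
  let P : ι → G2 w.Completion → ℝ := fun i g => θ g * H i ((g.1.1 3 3)⁻¹ * detD g)
  have hPs : ∀ i g, P i g ≠ 0 → 1 / 2 ≤ ‖g.1.1 3 3‖ ∧ ∃ u ∈ unipU _, u * g ∈ N i := by
    intro i g hg
    have h1 := left_ne_zero_of_mul hg
    obtain ⟨h0, u, hu, n, hn, e1⟩ := hθs g h1
    exact hMV i g h0 (hdet g h1) u hu n (Set.mem_iInter.1 hn.1 i) e1
      (hHU i _ (hrat g h1) (right_ne_zero_of_mul hg)).1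
  have hbound : ∀ i, ∃ C, ∀ b ≠ 0, H i b ≤ C := by
    intro i
    have hs : Metric.closedBall (t i) (1 / 2) ⊆ {0}ᶜ := by
      intro b hb h
      rw [Set.mem_singleton_iff.1 h, Metric.mem_closedBall, dist_zero_left] at hb
      linarith [ht i]
    obtain ⟨C, hC⟩ := ((isCompact_closedBall (t i) (1 / 2)).image_of_continuousOn
      ((hHc i).mono hs)).isBounded.exists_norm_le
    refine ⟨max C 0, fun b hb => ?_⟩
    by_cases h : H i b = 0
    · rw [h]; exact le_max_right _ _
    · exact (le_abs_self _).trans ((hC _ ⟨b, (hHU i b hb h).2, rfl⟩).trans (le_max_left _ _))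
  choose C hC using hbound
  refine ⟨P, fun i => isBumpNear_of hχ hθc hθ0 hθu (fun g hg => ⟨(hθs g hg).1, hdet g hg⟩) (hHc i)
    (hC i) (hH0 i) (ht0 i) ?_ (hHt i) fun g hg hH => (hPs i g (mul_ne_zero hg hH)).2, fun a => ?_⟩
  · rw [hθ1 _ (inv_ne_zero (ht0 i))]; exact one_ne_zero
  obtain ⟨Ψ, hΨ⟩ := hθΨ (∑ i, a i • φ i)
  have hval : ∀ s g r, archSec (e : w.Completion →+* 𝕜) Ψ s (muH _ * G2.toSpin8 (xAB r * g)) =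
      θ g * (∑ i, a i * φ i (e ((g.1.1 3 3)⁻¹ * detD g * r - (g.1.1 3 3)⁻¹ * kap g))) *
        Complex.exp ((-(5 * w.mult * Real.log ‖g.1.1 3 3‖) : ℝ) * s) := by
    intro s g r
    have hu := xAB_mem_unipU r
    rw [hΨ, hθu _ hu, uElt_mul_row_three hu, kap_unip_mul hu, psiArg_xAB]
    congr 2
    have e1 : -((g.1.1 3 3)⁻¹ * (kap g - r * detD g)) =
        (g.1.1 3 3)⁻¹ * detD g * r - (g.1.1 3 3)⁻¹ * kap g := by ring
    rw [e1]
    simp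
  have hint : ∀ i g, θ g ≠ 0 → Integrable (fun r =>
      φ i (e ((g.1.1 3 3)⁻¹ * detD g * r - (g.1.1 3 3)⁻¹ * kap g)) * (χ r : ℂ)) μ :=
    fun i g hg => integrable_schwartz_comp e he μ χ hχ (φ i) (hrat g hg) _
  have hform : ∀ s g r, archSec (e : w.Completion →+* 𝕜) Ψ s (muH _ * G2.toSpin8 (xAB r * g)) *
      (χ r : ℂ) = θ g * Complex.exp ((-(5 * w.mult * Real.log ‖g.1.1 3 3‖) : ℝ) * s) *
        ∑ i, a i * (φ i (e ((g.1.1 3 3)⁻¹ * detD g * r - (g.1.1 3 3)⁻¹ * kap g)) * (χ r : ℂ)) := by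
    intro s g r
    rw [hval, Finset.sum_congr rfl fun i _ => (mul_assoc (a i) _ (χ r : ℂ)).symm, ← Finset.sum_mul]
    ring
  refine ⟨archSec (e : w.Completion →+* 𝕜) Ψ, isInfSection_archSec _ he Ψ, fun s g => ?_,
    fun s g => ?_⟩
  · simp only [hform]
    by_cases hg : θ g = 0
    · simp [hg]
    · exact (integrable_finsetSum _ fun i _ => (hint i g hg).const_mul _).const_mul _
  · simp only [hform]
    by_cases hg : θ g = 0
    · simp [P, hg]
    rw [integral_const_mul, integral_finsetSum _ fun i _ => (hint i g hg).const_mul _,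
      Finset.mul_sum, Finset.mul_sum, Finset.sum_mul]
    refine Finset.sum_congr rfl fun i _ => ?_
    have e1 : ∫ r, φ i (e ((g.1.1 3 3)⁻¹ * detD g * r - (g.1.1 3 3)⁻¹ * kap g)) * (χ r : ℂ) ∂μ =
        phase χ g * H i ((g.1.1 3 3)⁻¹ * detD g) := by
      rw [← integral_add_right_eq_self _ (kap g / detD g), ← hφ i _ (hrat g hg),
        ← integral_const_mul, phase_of_ne_zero (hdet g hg)]
      refine integral_congr_ae (ae_of_all _ fun r => ?_)
      have h0 := hdet g hg
      have e2 : (g.1.1 3 3)⁻¹ * detD g * (r + kap g / detD g) - (g.1.1 3 3)⁻¹ * kap g =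
        (g.1.1 3 3)⁻¹ * detD g * r := by field_simp; ring
      simp only [e2, AddChar.map_add_eq_mul, Circle.coe_mul]
      ring
    rw [integral_const_mul, e1]
    simp only [P]
    by_cases hP : P i g = 0
    · have hH : H i ((g.1.1 3 3)⁻¹ * detD g) = 0 := (mul_eq_zero.1 hP).resolve_left hg
      rw [hH]; simp
    · rw [max_eq_left (hPs i g hP).1]
      push_cast
      ring

end ArchDatum

/-! ### The unfolded local integral at a finite place -/

section Ball

variable {k : Type*} [NormedField k] [IsUltrametricDist k] [ProperSpace k] [MeasurableSpace k]
  [BorelSpace k] {χ : AddChar k Circle}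

open scoped Classical in
theorem integral_addChar_closedBall (μ : Measure k) [μ.IsAddHaarMeasure] (χ : AddChar k Circle)
    (ρ : ℝ) : ∫ r, (if ‖r‖ ≤ ρ then (χ r : ℂ) else 0) ∂μ =
      if ∀ r, ‖r‖ ≤ ρ → χ r = 1 then (μ.real (Metric.closedBall 0 ρ) : ℂ) else 0 := by
  split_ifs with h
  · have e : (fun r => if ‖r‖ ≤ ρ then (χ r : ℂ) else 0) =
        (Metric.closedBall (0 : k) ρ).indicator fun _ => (1 : ℂ) := by
      funext r
      rw [Set.indicator_apply]
      simp only [mem_closedBall_zero_iff]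
      split_ifs with hr
      · rw [h r hr, Circle.coe_one]
      · rfl
    rw [e, integral_indicator_const _ Metric.isClosed_closedBall.measurableSet, Complex.real_smul,
      mul_one]
  · push Not at h
    obtain ⟨r₁, hr₁, h1⟩ := h
    set I := ∫ r, (if ‖r‖ ≤ ρ then (χ r : ℂ) else 0) ∂μ with hI
    have e : I = χ r₁ * I := by
      conv_lhs => rw [hI, ← integral_add_right_eq_self _ r₁]
      rw [hI, ← integral_const_mul]
      refine integral_congr_ae (ae_of_all _ fun r => ?_)
      have h2 : ‖r + r₁‖ ≤ ρ ↔ ‖r‖ ≤ ρ := by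
        refine ⟨fun h => ?_, fun h => (IsUltrametricDist.norm_add_le_max _ _).trans (max_le h hr₁)⟩
        have := IsUltrametricDist.norm_add_le_max (r + r₁) (-r₁)
        rw [add_neg_cancel_right, norm_neg] at this
        exact this.trans (max_le h hr₁)
      simp only [h2]
      split_ifs
      · rw [AddChar.map_add_eq_mul, Circle.coe_mul, mul_comm]
      · rw [mul_zero]
    have h2 : (1 - (χ r₁ : ℂ)) * I = 0 := by rw [sub_mul, one_mul, ← e, sub_self]
    refine (mul_eq_zero.1 h2).resolve_left fun h3 => h1 ?_
    exact Circle.ext (by rw [Circle.coe_one]; exact (sub_eq_zero.1 h3).symm)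

open scoped Classical in
/-- The integral of `χ((1 - b) r)` over the ball `‖b r‖ ≤ R`. -/
def ballIntegral (μ : Measure k) (χ : AddChar k Circle) (R : ℝ) (b : k) : ℝ :=
  if ∀ r, ‖r‖ ≤ R / ‖b‖ → χ ((1 - b) * r) = 1 then μ.real (Metric.closedBall 0 (R / ‖b‖)) else 0

open scoped Classical in
theorem integral_eq_ballIntegral (μ : Measure k) [μ.IsAddHaarMeasure] (R : ℝ) {b : k}
    (hb : b ≠ 0) : ∫ r, (if ‖b * r‖ ≤ R then (χ (-(b * r)) : ℂ) else 0) * (χ r : ℂ) ∂μ =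
      ballIntegral μ χ R b := by
  have h := integral_addChar_closedBall μ (χ.compAddMonoidHom (AddMonoidHom.mulLeft (1 - b)))
    (R / ‖b‖)
  simp only [AddChar.compAddMonoidHom_apply, AddMonoidHom.coe_mulLeft] at h
  rw [ballIntegral, apply_ite Complex.ofReal, Complex.ofReal_zero]
  refine Eq.trans (integral_congr_ae (ae_of_all _ fun r => ?_)) h
  have h2 : ‖b * r‖ ≤ R ↔ ‖r‖ ≤ R / ‖b‖ := by
    rw [norm_mul, le_div_iff₀ (norm_pos_iff.2 hb), mul_comm]
  simp only [h2]
  split_ifs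
  · rw [← Circle.coe_mul, ← AddChar.map_add_eq_mul]
    congr 2; ring
  · rw [zero_mul]

theorem ballIntegral_nonneg (μ : Measure k) (R : ℝ) (b : k) : 0 ≤ ballIntegral μ χ R b := by
  rw [ballIntegral]
  split_ifs
  · exact measureReal_nonneg
  · exact le_rfl

theorem ballIntegral_one_pos (μ : Measure k) [μ.IsAddHaarMeasure] {R : ℝ} (hR : 0 < R) :
    0 < ballIntegral μ χ R 1 := by
  rw [ballIntegral, if_pos fun r _ => by rw [sub_self, zero_mul, AddChar.map_zero_eq_one]]
  refine ENNReal.toReal_pos (Metric.measure_closedBall_pos _ _ (by simpa using hR)).ne'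
    (isCompact_closedBall _ _).measure_lt_top.ne

theorem near_one_of_ballIntegral_ne_zero (μ : Measure k) {x₁ : k} (hx₁ : χ x₁ ≠ 1) {δ R : ℝ}
    (hδ : 0 < δ) (hδ1 : δ ≤ 1) (hR : ‖x₁‖ / δ ≤ R) {b : k} (hb : b ≠ 0)
    (h : ballIntegral μ χ R b ≠ 0) : ‖b‖ = 1 ∧ ‖b - 1‖ < δ := by
  have h1 : ∀ r, ‖r‖ ≤ R / ‖b‖ → χ ((1 - b) * r) = 1 := by
    by_contra h'
    exact h (if_neg h')
  have hb0 := norm_pos_iff.2 hb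
  have h2 : ‖1 - b‖ < δ * ‖b‖ := by
    by_contra! h2
    have h3 : 0 < ‖1 - b‖ := lt_of_lt_of_le (by positivity) h2
    have h4 := h1 ((1 - b)⁻¹ * x₁) (by
      rw [le_div_iff₀ hb0, norm_mul, norm_inv]
      refine le_trans ?_ hR
      rw [le_div_iff₀ hδ, mul_assoc, mul_assoc, inv_mul_le_iff₀ h3]
      nlinarith [norm_nonneg x₁])
    rw [mul_inv_cancel_left₀ (norm_pos_iff.1 h3)] at h4
    exact hx₁ h4
  have h5 : ‖(1 : k)‖ = ‖b‖ := norm_eq_of_near (h2.trans_le (mul_le_of_le_one_left hb0.le hδ1))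
  rw [norm_one] at h5
  rw [← h5, mul_one, norm_sub_rev] at h2
  exact ⟨h5.symm, h2⟩

theorem continuousOn_ballIntegral (hχ : Continuous χ) (μ : Measure k) (R : ℝ) :
    ContinuousOn (ballIntegral μ χ R) {0}ᶜ := by
  intro b₀ hb₀
  have hb₀' : 0 < ‖b₀‖ := norm_pos_iff.2 hb₀
  obtain ⟨η, hη, h1⟩ := exists_addChar_eq_one hχ
  refine ContinuousAt.continuousWithinAt ?_
  refine (continuousAt_const (y := ballIntegral μ χ R b₀)).congr ?_
  have hn : Filter.Tendsto (fun b => ‖b - b₀‖) (𝓝 b₀) (𝓝 0) := by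
    have : Continuous fun b : k => ‖b - b₀‖ := by fun_prop
    simpa using this.tendsto b₀
  have hn2 : Filter.Tendsto (fun b => ‖b - b₀‖ * (|R| / ‖b₀‖)) (𝓝 b₀) (𝓝 0) := by
    simpa using hn.mul_const (|R| / ‖b₀‖)
  filter_upwards [hn.eventually (gt_mem_nhds hb₀'), hn2.eventually (gt_mem_nhds hη)] with b h2 h3
  have h4 : ‖b‖ = ‖b₀‖ := norm_eq_of_near h2
  rw [ballIntegral, ballIntegral, h4]
  have h5 : ∀ r, ‖r‖ ≤ R / ‖b₀‖ → χ ((1 - b) * r) = χ ((1 - b₀) * r) := by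
    intro r hr
    have e : (1 - b) * r = (1 - b₀) * r + -((b - b₀) * r) := by ring
    rw [e, AddChar.map_add_eq_mul, h1 (-((b - b₀) * r)), mul_one]
    rw [norm_neg, norm_mul]
    refine le_trans (mul_le_mul_of_nonneg_left (hr.trans ?_) (norm_nonneg _)) h3.le
    gcongr
    exact le_abs_self R
  have h6 : (∀ r, ‖r‖ ≤ R / ‖b₀‖ → χ ((1 - b) * r) = 1) ↔
      ∀ r, ‖r‖ ≤ R / ‖b₀‖ → χ ((1 - b₀) * r) = 1 :=
    forall_congr' fun r => imp_congr_right fun hr => by rw [h5 r hr]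
  classical exact if_congr h6.symm rfl rfl

open scoped Classical in
theorem integrable_ball_addChar (hχ : Continuous χ) (μ : Measure k) [μ.IsAddHaarMeasure] (R : ℝ)
    {b : k} (hb : b ≠ 0) (c : k) :
    Integrable (fun r => (if ‖b * r - c‖ ≤ R then (χ (-(b * r - c)) : ℂ) else 0) * (χ r : ℂ)) μ := by
  have hcont : Continuous fun r => b * r - c := by fun_prop
  have hS : IsClosed {r | ‖b * r - c‖ ≤ R} := isClosed_le hcont.norm continuous_const
  have hSc : IsCompact {r | ‖b * r - c‖ ≤ R} := by
    refine (isCompact_closedBall (b⁻¹ * c) (R / ‖b‖)).of_isClosed_subset hS fun r hr => ?_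
    have e : (r - b⁻¹ * c) * b = b * r - c := by field_simp
    rw [mem_closedBall_iff_norm, le_div_iff₀ (norm_pos_iff.2 hb), ← norm_mul, e]
    exact hr
  have h1 : Continuous fun r => (χ (-(b * r - c)) : ℂ) * (χ r : ℂ) :=
    (continuous_subtype_val.comp (hχ.comp hcont.neg)).mul (continuous_subtype_val.comp hχ)
  refine ((h1.continuousOn.integrableOn_compact hSc).integrable_indicator
    hS.measurableSet).congr (ae_of_all _ fun r => ?_)
  rw [Set.indicator_apply]
  simp only [Set.mem_ofPred_eq]
  split_ifs
  · rfl
  · rw [zero_mul]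

end Ball

section Ridge

variable {k : Type*} [NormedField k]

/-- The normalised minors of `μ x_{α+β}(-x)`, whose entry with index `(3, 4)` is `x`. -/
def ridge (x : k) : Fin 8 × Fin 8 → k := muRatio (xAB (-x))

theorem muRatio_xAB_mul_apply (r : k) (n : G2 k) (p : Fin 8 × Fin 8) :
    muRatio (xAB r * n) p = (n.1.1 3 3)⁻¹ * (pm (n.1.1 3) (n.1.1 0 + n.1.1 2) p.1 p.2 -
      r * pm (n.1.1 3) (n.1.1 4) p.1 p.2) := by
  rw [muRatio_unip_mul_apply (xAB_mem_unipU r), psiArg_xAB]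

theorem muRatio_unip_mul_eq {u : G2 k} (hu : u ∈ unipU k) (n : G2 k) :
    muRatio (u * n) = muRatio (xAB (psiArg u) * n) :=
  funext fun p => by rw [muRatio_unip_mul_apply hu, muRatio_xAB_mul_apply]

theorem ridge_apply (x : k) (p : Fin 8 × Fin 8) :
    ridge x p = pm (Pi.single 3 1) (Pi.single 0 1 + Pi.single 2 1) p.1 p.2 +
      x * pm (Pi.single 3 1) (Pi.single 4 1) p.1 p.2 := by
  have h := muRatio_xAB_mul_apply (-x) 1 p
  have e : ∀ i, (1 : G2 k).1.1 i = Pi.single i 1 := fun i => by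
    rw [G2.val_one]; exact funext fun j => by simp [Matrix.one_apply, Pi.single_apply, eq_comm]
  rw [mul_one, e, e, e, e] at h
  rw [ridge, h]
  simp

theorem eventually_muRatio_near_ridge [ProperSpace k] (R : ℝ) {η : ℝ} (hη : 0 < η) :
    ∀ᶠ n in 𝓝 (1 : G2 k), ∀ r ∈ Metric.closedBall (0 : k) R,
      ‖muRatio (xAB r * n) - ridge (muRatio (xAB r * n) (3, 4))‖ ≤ η := by
  refine (isCompact_closedBall (0 : k) R).eventually_forall_of_forall_eventually fun r _ => ?_
  have h1 : ∀ p, ContinuousAt (fun z : G2 k × k => muRatio (xAB z.2 * z.1) p) (1, r) := by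
    intro p
    simp only [muRatio_xAB_mul_apply, pm, Pi.add_apply]
    have hc : ∀ i j, Continuous fun z : G2 k × k => z.1.1.1 i j := fun i j =>
      (G2.continuous_entry i j).comp continuous_fst
    refine ContinuousAt.mul (ContinuousAt.inv₀ (hc 3 3).continuousAt (by simp)) ?_
    exact Continuous.continuousAt (by fun_prop)
  have h2 : ContinuousAt (fun z : G2 k × k =>
      ‖muRatio (xAB z.2 * z.1) - ridge (muRatio (xAB z.2 * z.1) (3, 4))‖) (1, r) := by
    refine ContinuousAt.norm (continuousAt_pi.2 fun p => ?_)
    simp only [Pi.sub_apply, ridge_apply]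
    exact (h1 p).sub (continuousAt_const.add ((h1 (3, 4)).mul continuousAt_const))
  refine (h2.eventually_lt (continuousAt_const (y := η)) ?_).mono fun _ => le_of_lt
  have h3 : muRatio (xAB r * (1 : G2 k)) (3, 4) = -r := by
    rw [muRatio_xAB_mul_apply]
    simp [pm]
  simp only [h3]
  rw [ridge, neg_neg, mul_one, sub_self, norm_zero]
  exact hη

end Ridge

section Ultra

variable {k : Type*} [NormedField k] [IsUltrametricDist k]

theorem norm_pm_single_le (i : Fin 8) (p : Fin 8 × Fin 8) :
    ‖pm (Pi.single 3 1 : Fin 8 → k) (Pi.single i 1) p.1 p.2‖ ≤ 1 := by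
  have h : ∀ i j, ‖(Pi.single i 1 : Fin 8 → k) j‖ ≤ 1 := by
    intro i j; rw [Pi.single_apply]; split_ifs <;> simp
  rw [pm, sub_eq_add_neg]
  refine (IsUltrametricDist.norm_add_le_max _ _).trans (max_le ?_ ?_)
  · rw [norm_mul]; exact mul_le_one₀ (h _ _) (norm_nonneg _) (h _ _)
  · rw [norm_neg, norm_mul]; exact mul_le_one₀ (h _ _) (norm_nonneg _) (h _ _)

theorem norm_ridge_sub_le (x y : k) : ‖ridge x - ridge y‖ ≤ ‖x - y‖ := by
  refine (pi_norm_le_iff_of_nonneg (norm_nonneg _)).2 fun p => ?_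
  rw [Pi.sub_apply, ridge_apply, ridge_apply, add_sub_add_left_eq_sub, ← sub_mul, norm_mul]
  exact mul_le_of_le_one_right (norm_nonneg _) (norm_pm_single_le 4 p)

theorem norm_ridge_le (x : k) : ‖ridge x‖ ≤ max 1 ‖x‖ := by
  refine (pi_norm_le_iff_of_nonneg (zero_le_one.trans (le_max_left _ _))).2 fun p => ?_
  rw [ridge_apply]
  refine (IsUltrametricDist.norm_add_le_max _ _).trans (max_le_max ?_ ?_)
  · have e : pm (Pi.single 3 1 : Fin 8 → k) (Pi.single 0 1 + Pi.single 2 1) p.1 p.2 =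
        pm (Pi.single 3 1) (Pi.single 0 1) p.1 p.2 + pm (Pi.single 3 1) (Pi.single 2 1) p.1 p.2 := by
      simp only [pm, Pi.add_apply]; ring
    rw [e]
    exact (IsUltrametricDist.norm_add_le_max _ _).trans
      (max_le (norm_pm_single_le 0 p) (norm_pm_single_le 2 p))
  · rw [norm_mul]
    exact mul_le_of_le_one_right (norm_nonneg _) (norm_pm_single_le 4 p)

theorem norm_ridge_of_one_le {x : k} (hx : 1 ≤ ‖x‖) : ‖ridge x‖ = ‖x‖ := by
  refine le_antisymm ((norm_ridge_le x).trans (max_le hx le_rfl)) ?_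
  have := norm_le_pi_norm (ridge x) (3, 4)
  rw [ridge_apply] at this
  simpa [pm] using this

/-- The size of the minors after right translation by `x_{α+β}(r₀)`, for large `r₀`. -/
theorem norm_minors_mul_xAB {r₀ : k} (hr₀ : 1 ≤ ‖r₀‖) {η : ℝ} (hη : η * ‖r₀‖ ^ 3 < 1) {g : G2 k}
    (hg : g.1.1 3 3 ≠ 0) (hx : ‖muRatio g (3, 4)‖ < ‖r₀‖)
    (hnear : ‖muRatio g - ridge (muRatio g (3, 4))‖ ≤ η) :
    ‖minors (muH k * G2.toSpin8 (g * xAB r₀))‖ = ‖g.1.1 3 3‖ * ‖r₀‖ := by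
  set x := muRatio g (3, 4) with hxdef
  let Λ : (Fin 8 × Fin 8 → k) → Fin 8 × Fin 8 → k := fun m p =>
    ∑ a, ∑ b, m (a, b) * (xABMat r₀ a p.1 * xABMat r₀ b p.2)
  have hent : ∀ i j, ‖xABMat r₀ i j‖ ≤ ‖r₀‖ ^ 2 := by
    have h1 : (1 : ℝ) ≤ ‖r₀‖ ^ 2 := one_le_pow₀ hr₀
    have h2 : ‖r₀‖ ≤ ‖r₀‖ ^ 2 := le_self_pow₀ hr₀ two_ne_zero
    intro i j
    fin_cases i <;> fin_cases j <;> simp [xABMat, h1, h2]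
  have hΛ : ∀ m, ‖Λ m‖ ≤ ‖m‖ * ‖r₀‖ ^ 4 := by
    intro m
    refine (pi_norm_le_iff_of_nonneg (by positivity)).2 fun p => ?_
    refine IsUltrametricDist.norm_sum_le_of_forall_le_of_nonneg (by positivity) fun a _ => ?_
    refine IsUltrametricDist.norm_sum_le_of_forall_le_of_nonneg (by positivity) fun b _ => ?_
    rw [norm_mul, norm_mul]
    calc _ ≤ ‖m‖ * (‖r₀‖ ^ 2 * ‖r₀‖ ^ 2) := by
          gcongr
          · exact norm_le_pi_norm m (a, b)
          · exact hent _ _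
          · exact hent _ _
      _ = _ := by ring
  have hΛsub : ∀ m m', Λ (m - m') = Λ m - Λ m' := by
    intro m m'
    funext p
    simp only [Λ, Pi.sub_apply, sub_mul, Finset.sum_sub_distrib]
  have hΛsmul : ∀ (c : k) m, Λ (c • m) = c • Λ m := by
    intro c m
    funext p
    simp only [Λ, Pi.smul_apply, smul_eq_mul, Finset.mul_sum, mul_assoc]
  have hΛmul : ∀ g : G2 k, minors (muH k * G2.toSpin8 (g * xAB r₀)) =
      Λ (minors (muH k * G2.toSpin8 g)) := by
    intro g
    funext p
    rw [map_mul, ← mul_assoc, minors_mul]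
    rfl
  have hone : ∀ r : k, (xAB r : G2 k).1.1 3 3 = 1 := fun r => by
    have h : (xAB r : G2 k).1.1 3 3 = xABMat r 3 3 := rfl
    rw [h]; simp [xABMat]
  have hmr : ∀ r : k, muRatio (xAB r) = minors (muH k * G2.toSpin8 (xAB r)) := fun r => by
    rw [muRatio, hone, inv_one, one_smul]
  have e1 : Λ (ridge x) = ridge (x - r₀) := by
    rw [ridge, hmr, ← hΛmul, ← xAB_add, ridge, hmr]
    congr 4
    ring
  have h0 : ‖r₀‖ = ‖x - r₀‖ := by
    have := IsUltrametricDist.norm_add_eq_max_of_norm_ne_norm (x := x) (y := -r₀)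
      (by rw [norm_neg]; exact hx.ne)
    rw [norm_neg, max_eq_right hx.le, ← sub_eq_add_neg] at this
    exact this.symm
  have e2 : ‖Λ (ridge x)‖ = ‖r₀‖ := by
    rw [e1, norm_ridge_of_one_le (h0 ▸ hr₀), ← h0]
  have hr0 : 0 < ‖r₀‖ := zero_lt_one.trans_le hr₀
  have e3 : ‖Λ (muRatio g)‖ = ‖r₀‖ := by
    rw [← e2]
    refine norm_eq_of_near ?_
    rw [← hΛsub, e2]
    calc _ ≤ ‖muRatio g - ridge x‖ * ‖r₀‖ ^ 4 := hΛ _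
      _ ≤ η * ‖r₀‖ ^ 4 := by gcongr
      _ = η * ‖r₀‖ ^ 3 * ‖r₀‖ := by ring
      _ < 1 * ‖r₀‖ := by gcongr
      _ = ‖r₀‖ := one_mul _
  have e4 : minors (muH k * G2.toSpin8 g) = g.1.1 3 3 • muRatio g := by
    rw [muRatio, smul_smul, mul_inv_cancel₀ hg, one_smul]
  rw [hΛmul, e4, hΛsmul, norm_smul, e3]

theorem exists_rowRatio_near_ridge [ProperSpace k] {N : Set (G2 k)} (hN : N ∈ 𝓝 (1 : G2 k)) {R : ℝ}
    (hR : 0 < R) {η : ℝ} (hη : 0 < η) :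
    ∃ ε > 0, ∀ g : G2 k, g.1.1 3 3 ≠ 0 →
      dist (rowRatio g) (Pi.single 3 1, Pi.single 4 1) ≤ ε →
      (∃ u ∈ unipU k, ∃ n ∈ N, ‖detD n‖ = 1 ∧ g = torusF (g.1.1 3 3)⁻¹ 1 * u * n) ∧
      (‖muRatio g (3, 4)‖ ≤ R → ‖muRatio g - ridge (muRatio g (3, 4))‖ ≤ η) := by
  have hone : (1 : G2 k).1.1 3 3 = 1 := by rw [G2.val_one, Matrix.one_apply_eq]
  have hkN : ∀ᶠ n in 𝓝 (1 : G2 k), ‖kap n‖ < R := by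
    have := continuous_kap.norm.tendsto (1 : G2 k)
    have h0 : kap (1 : G2 k) = 0 := by simp [kap, pm]
    rw [h0, norm_zero] at this
    exact this.eventually (gt_mem_nhds hR)
  have hdN : ∀ᶠ n in 𝓝 (1 : G2 k), ‖detD n - 1‖ < 1 := by
    have hc : Continuous fun n : G2 k => ‖detD n - 1‖ := (continuous_detD.sub continuous_const).norm
    have := hc.tendsto 1
    rw [detD_one, sub_self, norm_zero] at this
    exact this.eventually (gt_mem_nhds one_pos)
  have haN : ∀ᶠ n in 𝓝 (1 : G2 k), ‖n.1.1 3 3 - 1‖ < 1 := by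
    have hc : Continuous fun n : G2 k => ‖n.1.1 3 3 - 1‖ :=
      ((G2.continuous_entry 3 3).sub continuous_const).norm
    have := hc.tendsto 1
    rw [hone, sub_self, norm_zero] at this
    exact this.eventually (gt_mem_nhds one_pos)
  obtain ⟨ε, hε, h⟩ := exists_torusF_mul_of_rowRatio_near
    ((((show ∀ᶠ n in 𝓝 (1 : G2 k), n ∈ N from hN).and hkN).and (hdN.and haN)).and (eventually_muRatio_near_ridge R hη))
  refine ⟨ε, hε, fun g hg hd => ?_⟩
  obtain ⟨u, hu, n, ⟨⟨⟨hn, hn1⟩, hn2, hn3⟩, hn4⟩, e⟩ := h g hg hd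
  have hd1 : ‖detD n‖ = 1 := by
    rw [← norm_one (α := k)]; exact norm_eq_of_near (by rwa [norm_one])
  have ha1 : ‖n.1.1 3 3‖ = 1 := by
    rw [← norm_one (α := k)]; exact norm_eq_of_near (by rwa [norm_one])
  refine ⟨⟨u, hu, n, hn, hd1, e⟩, fun hx => ?_⟩
  have e1 : muRatio g = muRatio (xAB (psiArg u) * n) := by
    rw [← muRatio_unip_mul_eq hu]
    conv_lhs => rw [e]
    rw [mul_assoc, muRatio_torusF_mul (inv_ne_zero hg)]
  rw [e1] at hx ⊢
  refine hn4 _ ?_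
  rw [mem_closedBall_zero_iff]
  have e2 : psiArg u * detD n =
      kap n - n.1.1 3 3 * muRatio (xAB (psiArg u) * n) (3, 4) := by
    have h0 : n.1.1 3 3 ≠ 0 := norm_pos_iff.1 (by rw [ha1]; exact one_pos)
    rw [muRatio_xAB_mul_apply, mul_inv_cancel_left₀ h0]
    simp only [kap, detD, pm]
    ring
  calc ‖psiArg u‖ = ‖psiArg u * detD n‖ := by rw [norm_mul, hd1, mul_one]
    _ ≤ max ‖kap n‖ ‖n.1.1 3 3 * muRatio (xAB (psiArg u) * n) (3, 4)‖ := by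
      rw [e2, sub_eq_add_neg, ← norm_neg (n.1.1 3 3 * _)]
      exact IsUltrametricDist.norm_add_le_max _ _
    _ ≤ R := max_le (le_of_lt hn1) (by rw [norm_mul, ha1, one_mul]; exact hx)

end Ultra

section FinDatum

variable {k : Type*} [NormedField k] [IsUltrametricDist k]

/-- The rows recorded by `rowRatio`, as functions of the minors. -/
def rowMin (m : Fin 8 × Fin 8 → k) : (Fin 8 → k) × (Fin 8 → k) :=
  (fun j => m (j, 0) + m (j, 7), pcMin m)

theorem rowMin_muRatio (g : G2 k) : rowMin (muRatio g) = rowRatio g :=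
  Prod.ext (funext fun j => paMin_muRatio g j) (funext fun j => pcMin_muRatio g j)

theorem dist_rowMin_le (m m' : Fin 8 × Fin 8 → k) : dist (rowMin m) (rowMin m') ≤ ‖m - m'‖ := by
  have h : ∀ p, ‖m p - m' p‖ ≤ ‖m - m'‖ := fun p => norm_le_pi_norm (m - m') p
  have h2 : ∀ p q, dist (m p + m q) (m' p + m' q) ≤ ‖m - m'‖ := by
    intro p q
    rw [dist_eq_norm, add_sub_add_comm]
    exact (IsUltrametricDist.norm_add_le_max _ _).trans (max_le (h p) (h q))
  refine max_le ((dist_pi_le_iff (norm_nonneg _)).2 fun j => h2 _ _)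
    ((dist_pi_le_iff (norm_nonneg _)).2 fun j => ?_)
  fin_cases j <;> simp [rowMin, pcMin, h2]

theorem dist_rowMin_lt {m m' : Fin 8 × Fin 8 → k} {c : (Fin 8 → k) × (Fin 8 → k)} {ε : ℝ}
    (h : ‖m - m'‖ < ε) (hm : dist (rowMin m) c < ε) : dist (rowMin m') c < ε := by
  have h1 := (dist_rowMin_le m m').trans_lt h
  rw [Prod.dist_eq, max_lt_iff] at h1 hm ⊢
  exact ⟨(dist_triangle_max _ _ _).trans_lt (max_lt (by rw [dist_comm]; exact h1.1) hm.1),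
    (dist_triangle_max _ _ _).trans_lt (max_lt (by rw [dist_comm]; exact h1.2) hm.2)⟩

open scoped Classical in
/-- The function of the minors defining the test section: the character of the entry `(3, 4)`, cut
off near the minors of `μ x_{α+β}(r)`, `‖r‖ ≤ R`. -/
def ridgeFun (χ : AddChar k Circle) (R ε η : ℝ) (m : Fin 8 × Fin 8 → k) : ℂ :=
  if ‖m (3, 4)‖ ≤ R ∧ dist (rowMin m) (Pi.single 3 1, Pi.single 4 1) < ε ∧
    ‖m - ridge (m (3, 4))‖ ≤ η then χ (m (3, 4)) else 0

theorem norm_le_of_ridgeFun_ne_zero {χ : AddChar k Circle} {R ε η : ℝ} {m : Fin 8 × Fin 8 → k}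
    (h : ridgeFun χ R ε η m ≠ 0) : ‖m‖ ≤ max η (max 1 R) := by
  have h1 := (ite_ne_right_iff.1 h).1
  calc ‖m‖ = ‖(m - ridge (m (3, 4))) + ridge (m (3, 4))‖ := by rw [sub_add_cancel]
    _ ≤ max ‖m - ridge (m (3, 4))‖ ‖ridge (m (3, 4))‖ := IsUltrametricDist.norm_add_le_max _ _
    _ ≤ _ := max_le_max h1.2.2 ((norm_ridge_le _).trans (max_le_max le_rfl h1.1))

theorem ridgeFun_stable {χ : AddChar k Circle} (hχ : Continuous χ) {R ε η : ℝ} (hR : 0 < R)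
    (hε : 0 < ε) (hη : 0 < η) :
    ∃ δ > 0, ∀ x y, ‖x - y‖ ≤ δ → ridgeFun χ R ε η x = ridgeFun χ R ε η y := by
  obtain ⟨η₀, hη₀, h1⟩ := exists_addChar_eq_one hχ
  have himp : ∀ x y : Fin 8 × Fin 8 → k, ‖x - y‖ ≤ min (min R η) (min (ε / 2) η₀) →
      (‖x (3, 4)‖ ≤ R ∧ dist (rowMin x) (Pi.single 3 1, Pi.single 4 1) < ε ∧
        ‖x - ridge (x (3, 4))‖ ≤ η) →
      (‖y (3, 4)‖ ≤ R ∧ dist (rowMin y) (Pi.single 3 1, Pi.single 4 1) < ε ∧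
        ‖y - ridge (y (3, 4))‖ ≤ η) := by
    rintro x y hxy ⟨hx1, hx2, hx3⟩
    rw [le_min_iff, le_min_iff, le_min_iff] at hxy
    have h34 : ‖x (3, 4) - y (3, 4)‖ ≤ ‖x - y‖ := norm_le_pi_norm (x - y) (3, 4)
    refine ⟨?_, dist_rowMin_lt (by linarith [hxy.2.1]) hx2, ?_⟩
    · calc ‖y (3, 4)‖ = ‖x (3, 4) + -(x (3, 4) - y (3, 4))‖ := by congr 1; ring
        _ ≤ max ‖x (3, 4)‖ ‖-(x (3, 4) - y (3, 4))‖ := IsUltrametricDist.norm_add_le_max _ _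
        _ ≤ R := max_le hx1 (by rw [norm_neg]; exact h34.trans hxy.1.1)
    · calc ‖y - ridge (y (3, 4))‖ = ‖((x - ridge (x (3, 4))) + -(x - y)) +
            (ridge (x (3, 4)) - ridge (y (3, 4)))‖ := by congr 1; abel
        _ ≤ max ‖(x - ridge (x (3, 4))) + -(x - y)‖ ‖ridge (x (3, 4)) - ridge (y (3, 4))‖ :=
          IsUltrametricDist.norm_add_le_max _ _
        _ ≤ η := max_le ((IsUltrametricDist.norm_add_le_max _ _).trans
            (max_le hx3 (by rw [norm_neg]; exact hxy.1.2)))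
            ((norm_ridge_sub_le _ _).trans (h34.trans hxy.1.2))
  refine ⟨min (min R η) (min (ε / 2) η₀), by positivity, fun x y hxy => ?_⟩
  have hχxy : χ (x (3, 4)) = χ (y (3, 4)) := by
    have h34 : ‖x (3, 4) - y (3, 4)‖ ≤ ‖x - y‖ := norm_le_pi_norm (x - y) (3, 4)
    have := h1 _ (h34.trans (hxy.trans ((min_le_right _ _).trans (min_le_right _ _))))
    rw [← sub_add_cancel (x (3, 4)) (y (3, 4)), AddChar.map_add_eq_mul, this, one_mul]
  rw [ridgeFun, ridgeFun, hχxy]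
  exact if_congr ⟨himp x y hxy, himp y x (by rwa [norm_sub_rev])⟩ rfl rfl

open scoped Classical in
theorem continuous_rowBall (ε : ℝ) (c : (Fin 8 → k) × (Fin 8 → k)) :
    Continuous fun x : (Fin 8 → k) × (Fin 8 → k) => if dist x c < ε then (1 : ℝ) else 0 := by
  have h : IsClopen (Metric.ball c ε) := by
    have := (IsUltrametricDist.isClopen_ball c.1 ε).prod (IsUltrametricDist.isClopen_ball c.2 ε)
    rwa [ball_prod_same] at this
  exact (IsClopen.continuous_indicator h continuous_const (f := fun _ => (1 : ℝ))).congr fun x => by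
    rw [Set.indicator_apply]; rfl

end FinDatum

section FinDatum

variable {K : Type*} [Field K] [NumberField K] {v : HeightOneSpectrum (𝓞 K)}

theorem exists_lt_norm_adicCompletion (R : ℝ) : ∃ x : v.adicCompletion K, R < ‖x‖ := by
  obtain ⟨a, ha, ha0⟩ := Submodule.exists_mem_ne_zero_of_ne_bot v.ne_bot
  set x := FinitePlace.embedding v (algebraMap (𝓞 K) K a)
  have hx1 : ‖x‖ < 1 := (FinitePlace.norm_lt_one_iff_mem K v a).2 ha
  have hx0 : 0 < ‖x‖ := norm_pos_iff.2 (by simpa [x] using ha0)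
  obtain ⟨n, hn⟩ := pow_unbounded_of_one_lt R ((one_lt_inv₀ hx0).2 hx1)
  exact ⟨x⁻¹ ^ n, by rwa [norm_pow, norm_inv]⟩

variable [MeasurableSpace (v.adicCompletion K)] [BorelSpace (v.adicCompletion K)]

theorem exists_fin_datum (μ : Measure (v.adicCompletion K)) [μ.IsAddHaarMeasure]
    {χ : AddChar (v.adicCompletion K) Circle} (hχ : Continuous χ) (hχ1 : χ ≠ 1)
    {N : Set (G2 (v.adicCompletion K))} (hN : N ∈ 𝓝 1) :
    ∃ (y : G2 (v.adicCompletion K)) (P : G2 (v.adicCompletion K) → ℝ) (B : ℝ)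
      (f : ℂ → Spin8 (v.adicCompletion K) → ℂ), IsBumpNear χ 1 N P ∧ IsFinSection v f ∧
        (∀ s g, Integrable (fun r => f s (muH _ * G2.toSpin8 (xAB r * g)) * (χ r : ℂ)) μ) ∧
        ∀ s g, ∫ r, f s (muH _ * G2.toSpin8 (xAB r * (g * y))) * (χ r : ℂ) ∂μ =
          phase χ g * P g * Complex.exp (B * s) := by
  classical
  obtain ⟨x₁, hx₁⟩ : ∃ x₁, χ x₁ ≠ 1 := by
    by_contra! h
    exact hχ1 (DFunLike.ext _ _ h)
  have hT1 : (torusF (1 : v.adicCompletion K)⁻¹ 1 : G2 _) = 1 := by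
    rw [inv_one, torusF, dif_pos ⟨one_ne_zero, one_ne_zero⟩, Units.mk0_one, torus_one]
  obtain ⟨M, hM, V, hV, hMV⟩ := exists_nhds_torusF (t := (1 : v.adicCompletion K)) one_ne_zero
    (c := 1 / 2) (by rw [norm_one]; norm_num) (N := N) (by rwa [hT1])
  obtain ⟨δ', hδ', hδV⟩ := Metric.mem_nhds_iff.1 hV
  set δ := min δ' 1 with hδdef
  have hδ : 0 < δ := lt_min hδ' one_pos
  set R := max (‖x₁‖ / δ) 1 with hRdef
  have hR : 0 < R := lt_max_of_lt_right one_pos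
  obtain ⟨r₀, hr₀⟩ := exists_lt_norm_adicCompletion (v := v) R
  have hr1 : 1 ≤ ‖r₀‖ := (le_max_right _ _).trans hr₀.le
  have hr0 : 0 < ‖r₀‖ := one_pos.trans_le hr1
  obtain ⟨η, hη, hηr⟩ : ∃ η > 0, η * ‖r₀‖ ^ 3 < 1 :=
    ⟨(2 * ‖r₀‖ ^ 3)⁻¹, by positivity, by field_simp; norm_num⟩
  obtain ⟨ε, hε, hnear⟩ := exists_rowRatio_near_ridge hM hR hη
  let c : (Fin 8 → v.adicCompletion K) × (Fin 8 → v.adicCompletion K) :=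
    (Pi.single 3 1, Pi.single 4 1)
  let θ : G2 (v.adicCompletion K) → ℝ := fun g =>
    if g.1.1 3 3 = 0 then 0 else if dist (rowRatio g) c < ε then 1 else 0
  have hθc : Continuous θ := continuous_rowCutoff (continuous_rowBall ε c) fun x hx =>
    (ite_ne_right_iff.1 hx).1
  have hθs : ∀ g, θ g ≠ 0 → g.1.1 3 3 ≠ 0 ∧ dist (rowRatio g) c < ε := fun g hg => by
    by_contra h
    rw [not_and_or, not_not] at h
    refine hg ?_
    simp only [θ]
    rcases h with h | h
    · rw [if_pos h]
    · rw [if_neg h, ite_self]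
  have hθ01 : ∀ g, g.1.1 3 3 ≠ 0 → dist (rowRatio g) c < ε → θ g = 1 := fun g h0 h => by
    simp only [θ]; rw [if_neg h0, if_pos h]
  have hθu : ∀ u ∈ unipU (v.adicCompletion K), ∀ g, θ (u * g) = θ g := fun u hu g => by
    simp only [θ]
    rw [rowRatio_unip_mul hu, uElt_mul_row_three hu]
  have hnorm : ∀ g, θ g ≠ 0 → ‖detD g‖ = ‖g.1.1 3 3‖ ^ 2 ∧ detD g ≠ 0 := by
    intro g hg
    obtain ⟨h0, h1⟩ := hθs g hg
    obtain ⟨⟨u, hu, n, hn, hd, e⟩, -⟩ := hnear g h0 h1.le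
    have e2 := congrArg norm (inv_mul_detD_of_eq h0 hu e)
    rw [norm_mul, norm_mul, hd, mul_one, norm_inv, inv_mul_eq_iff_eq_mul₀ (norm_ne_zero_iff.2 h0),
      ← sq] at e2
    exact ⟨e2, norm_ne_zero_iff.1 (by rw [e2]; exact pow_ne_zero 2 (norm_ne_zero_iff.2 h0))⟩
  have hH : ∀ g, θ g ≠ 0 → ballIntegral μ χ R ((g.1.1 3 3)⁻¹ * detD g) ≠ 0 →
      ‖g.1.1 3 3‖ = 1 ∧ (g.1.1 3 3)⁻¹ * detD g ∈ V := by
    intro g hg hb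
    obtain ⟨h0, -⟩ := hθs g hg
    obtain ⟨h1, h2⟩ := hnorm g hg
    obtain ⟨h3, h4⟩ := near_one_of_ballIntegral_ne_zero μ hx₁ hδ (min_le_right _ _)
      (le_max_left _ _) (mul_ne_zero (inv_ne_zero h0) h2) hb
    refine ⟨?_, hδV (mem_ball_iff_norm.2 (h4.trans_le (min_le_left _ _)))⟩
    rwa [norm_mul, h1, norm_inv, sq, inv_mul_cancel_left₀ (norm_ne_zero_iff.2 h0)] at h3
  let P : G2 (v.adicCompletion K) → ℝ := fun g =>
    θ g * ballIntegral μ χ R ((g.1.1 3 3)⁻¹ * detD g)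
  have hbump : IsBumpNear χ (torusF (1 : v.adicCompletion K)⁻¹ 1) N P := by
    refine isBumpNear_of hχ hθc (fun g => ?_) hθu (fun g hg => ⟨(hθs g hg).1, (hnorm g hg).2⟩)
      (continuousOn_ballIntegral hχ μ R) (C := μ.real (Metric.closedBall 0 R)) (fun b hb => ?_)
      (fun b _ => ballIntegral_nonneg μ R b) one_ne_zero ?_ (ballIntegral_one_pos μ hR)
      fun g hg hb => ?_
    · simp only [θ]; split_ifs <;> norm_num
    · by_cases h : ballIntegral μ χ R b = 0
      · rw [h]; exact measureReal_nonneg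
      · have h1 := (near_one_of_ballIntegral_ne_zero μ hx₁ hδ (min_le_right _ _)
          (le_max_left _ _) hb h).1
        rw [ballIntegral, h1, div_one]
        split_ifs
        · exact le_rfl
        · exact measureReal_nonneg
    · rw [hθ01 _ (by rw [torusF_row_three one_ne_zero]; exact one_ne_zero)
        (by rw [rowRatio_torusF (inv_ne_zero one_ne_zero), dist_self]; exact hε)]
      exact one_ne_zero
    · obtain ⟨h0, h1⟩ := hθs g hg
      obtain ⟨⟨u, hu, n, hn, hd, e⟩, -⟩ := hnear g h0 h1.le
      exact (hMV g h0 (hnorm g hg).2 u hu n hn e (hH g hg hb).2).2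
  let Y : G2 (v.adicCompletion K) := xAB r₀
  obtain ⟨ε', hε', hst⟩ := ridgeFun_stable hχ hR hε hη
  have hval : ∀ s g r, finSec (ridgeFun χ R ε η) (G2.toSpin8 Y) s
      (muH _ * G2.toSpin8 (xAB r * (g * Y))) =
      θ g * (((‖g.1.1 3 3‖ * ‖r₀‖) ^ 5 : ℝ) : ℂ) ^ (-s) *
        (if ‖(g.1.1 3 3)⁻¹ * detD g * r - (g.1.1 3 3)⁻¹ * kap g‖ ≤ R then
          (χ (-((g.1.1 3 3)⁻¹ * detD g * r - (g.1.1 3 3)⁻¹ * kap g)) : ℂ) else 0) := by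
    intro s g r
    have hu := xAB_mem_unipU r
    have e0 : muH _ * G2.toSpin8 (xAB r * (g * Y)) * (G2.toSpin8 Y)⁻¹ =
        muH _ * G2.toSpin8 (xAB r * g) := by
      rw [← mul_assoc (xAB r), map_mul G2.toSpin8 (xAB r * g) Y, ← mul_assoc, mul_inv_cancel_right]
    have e33 : (xAB r * g).1.1 3 3 = g.1.1 3 3 := by rw [uElt_mul_row_three hu]
    rw [finSec, e0, homogExt, zMin_minors_mu, e33]
    by_cases h0 : g.1.1 3 3 = 0
    · have : θ g = 0 := if_pos h0
      rw [if_pos h0, this]; simp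
    rw [if_neg h0]
    have e1 : (g.1.1 3 3)⁻¹ • minors (muH _ * G2.toSpin8 (xAB r * g)) = muRatio (xAB r * g) := by
      rw [muRatio, e33]
    have e34 : muRatio (xAB r * g) (3, 4) =
        -((g.1.1 3 3)⁻¹ * detD g * r - (g.1.1 3 3)⁻¹ * kap g) := by
      rw [muRatio_three_four, e33, kap_unip_mul hu, psiArg_xAB]; ring
    rw [e1, ridgeFun, rowMin_muRatio, rowRatio_unip_mul hu]
    by_cases hd : dist (rowRatio g) c < ε
    · have hn := (hnear (xAB r * g) (by rwa [e33]) (by rw [rowRatio_unip_mul hu]; exact hd.le)).2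
      rw [hθ01 g h0 hd, Complex.ofReal_one, one_mul,
        ← norm_neg ((g.1.1 3 3)⁻¹ * detD g * r - (g.1.1 3 3)⁻¹ * kap g), ← e34]
      by_cases hx : ‖muRatio (xAB r * g) (3, 4)‖ ≤ R
      · rw [if_pos ⟨hx, hd, hn hx⟩, if_pos hx, ← mul_assoc (xAB r), norm_minors_mul_xAB hr1 hηr
          (by rwa [e33]) (hx.trans_lt hr₀) (hn hx), e33, mul_comm]
      · rw [if_neg (fun h => hx h.1), if_neg hx, zero_mul, mul_zero]
    · have : θ g = 0 := by
        by_contra h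
        exact hd (hθs g h).2
      rw [if_neg (fun h => hd h.2.1), this]; simp
  have hform : ∀ s g r, finSec (ridgeFun χ R ε η) (G2.toSpin8 Y) s
      (muH _ * G2.toSpin8 (xAB r * (g * Y))) * (χ r : ℂ) =
      θ g * (((‖g.1.1 3 3‖ * ‖r₀‖) ^ 5 : ℝ) : ℂ) ^ (-s) *
        ((if ‖(g.1.1 3 3)⁻¹ * detD g * r - (g.1.1 3 3)⁻¹ * kap g‖ ≤ R then
          (χ (-((g.1.1 3 3)⁻¹ * detD g * r - (g.1.1 3 3)⁻¹ * kap g)) : ℂ) else 0) * (χ r : ℂ)) := by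
    intro s g r
    rw [hval, mul_assoc]
  refine ⟨Y, P, -(5 * Real.log ‖r₀‖), finSec (ridgeFun χ R ε η) (G2.toSpin8 Y), by rwa [hT1] at hbump,
    isFinSection_finSec hε' (fun x hx => norm_le_of_ridgeFun_ne_zero hx) hst _, fun s g => ?_,
    fun s g => ?_⟩
  · obtain ⟨g, rfl⟩ : ∃ g', g = g' * Y := ⟨g * Y⁻¹, by rw [inv_mul_cancel_right]⟩
    simp only [hform]
    by_cases hg : θ g = 0
    · simp [hg]
    · exact (integrable_ball_addChar hχ μ R
        (mul_ne_zero (inv_ne_zero (hθs g hg).1) (hnorm g hg).2) _).const_mul _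
  · simp only [hform]
    by_cases hg : θ g = 0
    · simp [P, hg]
    have hd := (hnorm g hg).2
    have hb := mul_ne_zero (inv_ne_zero (hθs g hg).1) hd
    rw [integral_const_mul]
    have e1 : ∫ r, (if ‖(g.1.1 3 3)⁻¹ * detD g * r - (g.1.1 3 3)⁻¹ * kap g‖ ≤ R then
        (χ (-((g.1.1 3 3)⁻¹ * detD g * r - (g.1.1 3 3)⁻¹ * kap g)) : ℂ) else 0) * (χ r : ℂ) ∂μ =
        phase χ g * ballIntegral μ χ R ((g.1.1 3 3)⁻¹ * detD g) := by
      rw [← integral_add_right_eq_self _ (kap g / detD g), ← integral_eq_ballIntegral μ R hb,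
        ← integral_const_mul, phase_of_ne_zero hd]
      refine integral_congr_ae (ae_of_all _ fun r => ?_)
      have e2 : (g.1.1 3 3)⁻¹ * detD g * (r + kap g / detD g) - (g.1.1 3 3)⁻¹ * kap g =
        (g.1.1 3 3)⁻¹ * detD g * r := by field_simp; ring
      simp only [e2, AddChar.map_add_eq_mul, Circle.coe_mul]
      ring
    rw [e1]
    simp only [P]
    by_cases hP : ballIntegral μ χ R ((g.1.1 3 3)⁻¹ * detD g) = 0
    · rw [hP]; simp
    · rw [(hH g hg hP).1, one_mul, Complex.cpow_def_of_ne_zero (by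
        exact_mod_cast (pow_pos hr0 5).ne'), ← Complex.ofReal_log (by positivity), Real.log_pow]
      push_cast
      ring_nf

end FinDatum

/-! ### The normalising factor `j_S` -/

section JFactor

variable {K : Type*} [Field K] [NumberField K]

theorem inv_jFactor (ζ : ℂ → ℂ) (s : ℂ) : (jFactor ζ s)⁻¹ =
    (ζ (5 * s))⁻¹ * (ζ (5 * s - 1))⁻¹ ^ 2 * (ζ (10 * s - 4))⁻¹ := by
  rw [jFactor, mul_inv, mul_inv, inv_pow]

theorem differentiable_inv_jFactor {ζ : ℂ → ℂ} (h : Differentiable ℂ fun s => (ζ s)⁻¹) :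
    Differentiable ℂ fun s => (jFactor ζ s)⁻¹ := by
  simp only [inv_jFactor]
  exact ((h.comp (f := fun s => 5 * s) (by fun_prop)).mul
    ((h.comp (f := fun s => 5 * s - 1) (by fun_prop)).pow 2)).mul
    (h.comp (f := fun s => 10 * s - 4) (by fun_prop))

theorem jFactor_one_ne_zero {ζ : ℂ → ℂ} (h : ∀ s : ℂ, 0 < s.re → ζ s ≠ 0) : jFactor ζ 1 ≠ 0 :=
  mul_ne_zero (mul_ne_zero (h _ (by norm_num)) (pow_ne_zero 2 (h _ (by norm_num))))
    (h _ (by norm_num))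

theorem differentiable_inv_zetaInf (w : InfinitePlace K) :
    Differentiable ℂ fun s => (zetaInf w s)⁻¹ := by
  unfold zetaInf
  split_ifs
  · exact Complex.differentiable_Gammaℝ_inv
  · exact Complex.differentiable_Gammaℂ_inv

theorem zetaInf_ne_zero (w : InfinitePlace K) {s : ℂ} (hs : 0 < s.re) : zetaInf w s ≠ 0 := by
  rw [zetaInf]
  split_ifs
  · exact Complex.Gammaℝ_ne_zero_of_re_pos hs
  · rw [← Complex.Gammaℝ_mul_Gammaℝ_add_one]
    exact mul_ne_zero (Complex.Gammaℝ_ne_zero_of_re_pos hs)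
      (Complex.Gammaℝ_ne_zero_of_re_pos (by simp; linarith))

theorem one_lt_absNorm (v : HeightOneSpectrum (𝓞 K)) : 1 < Ideal.absNorm v.asIdeal := by
  exact_mod_cast HeightOneSpectrum.one_lt_absNorm_nnreal v

theorem differentiable_inv_zetaFin (v : HeightOneSpectrum (𝓞 K)) :
    Differentiable ℂ fun s => (zetaFin v s)⁻¹ := by
  unfold zetaFin
  simp only [inv_inv]
  have h : (Ideal.absNorm v.asIdeal : ℂ) ≠ 0 := by
    exact_mod_cast (zero_lt_one.trans (one_lt_absNorm v)).ne'
  exact (differentiable_const _).sub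
    ((differentiable_neg).const_cpow (Or.inl h))

theorem zetaFin_ne_zero (v : HeightOneSpectrum (𝓞 K)) {s : ℂ} (hs : 0 < s.re) :
    zetaFin v s ≠ 0 := by
  rw [zetaFin]
  refine inv_ne_zero (sub_ne_zero.2 fun h => ?_)
  have h1 := congrArg norm h
  have h2 : (1 : ℝ) < Ideal.absNorm v.asIdeal := by exact_mod_cast one_lt_absNorm v
  rw [norm_one, Complex.norm_natCast_cpow_of_pos (zero_lt_one.trans (one_lt_absNorm v)),
    Complex.neg_re] at h1
  have h3 := Real.rpow_lt_one_of_one_lt_of_neg h2 (neg_lt_zero.2 hs)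
  linarith

theorem differentiable_inv_jS (S : Finset (HeightOneSpectrum (𝓞 K))) :
    Differentiable ℂ fun s => (jS S s)⁻¹ := by
  have e : (fun s => (jS S s)⁻¹) = fun s => (∏ w : InfinitePlace K, (jFactor (zetaInf w) s)⁻¹) *
      ∏ v ∈ S, (jFactor (zetaFin v) s)⁻¹ := by
    funext s
    rw [jS, mul_inv, Finset.prod_inv_distrib, Finset.prod_inv_distrib]
  rw [e]
  exact (Differentiable.fun_finsetProd fun w _ =>
    differentiable_inv_jFactor (differentiable_inv_zetaInf w)).mul
    (Differentiable.fun_finsetProd fun v _ =>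
      differentiable_inv_jFactor (differentiable_inv_zetaFin v))

theorem exists_analyticOrderAt_inv_jS (S : Finset (HeightOneSpectrum (𝓞 K))) (s₀ : ℂ) :
    ∃ m : ℕ, analyticOrderAt (fun s => (jS S s)⁻¹) s₀ = m := by
  have hd := differentiable_inv_jS S
  have ha : AnalyticOnNhd ℂ (fun s => (jS S s)⁻¹) Set.univ := fun s _ => hd.analyticAt s
  have h1 : (jS S 1)⁻¹ ≠ 0 := by
    refine inv_ne_zero (mul_ne_zero ?_ ?_)
    · exact Finset.prod_ne_zero_iff.2 fun w _ => jFactor_one_ne_zero fun s => zetaInf_ne_zero w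
    · exact Finset.prod_ne_zero_iff.2 fun v _ => jFactor_one_ne_zero fun s => zetaFin_ne_zero v
  refine ⟨_, (ENat.natCast_toNat fun htop => h1 ?_).symm⟩
  exact ha.eqOn_zero_of_preconnected_of_eventuallyEq_zero isPreconnected_univ (Set.mem_univ s₀)
    (analyticOrderAt_eq_top.1 htop) (Set.mem_univ 1)

/-- The quotient of two functions which vanish to the same order. -/
theorem exists_analyticAt_div {E I : ℂ → ℂ} {s₀ : ℂ} {m : ℕ} (hE : AnalyticAt ℂ E s₀)
    (hEm : analyticOrderAt E s₀ = m) (hI : AnalyticAt ℂ I s₀) (hIm : analyticOrderAt I s₀ = m) :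
    ∃ D : ℂ → ℂ, AnalyticAt ℂ D s₀ ∧ D s₀ ≠ 0 ∧ ∀ᶠ s in 𝓝[≠] s₀, (E s)⁻¹ * I s = D s := by
  obtain ⟨a, ha, ha0, hEa⟩ := hE.analyticOrderAt_eq_natCast.1 hEm
  obtain ⟨b, hb, hb0, hIb⟩ := hI.analyticOrderAt_eq_natCast.1 hIm
  refine ⟨fun s => b s / a s, hb.div ha ha0, div_ne_zero hb0 ha0, ?_⟩
  filter_upwards [eventually_nhdsWithin_of_eventually_nhds hEa,
    eventually_nhdsWithin_of_eventually_nhds hIb,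
    eventually_nhdsWithin_of_eventually_nhds (ha.continuousAt.eventually_ne ha0),
    self_mem_nhdsWithin] with s h1 h2 h3 h4
  have h5 : s - s₀ ≠ 0 := sub_ne_zero.2 h4
  rw [h1, h2, smul_eq_mul, smul_eq_mul]
  field_simp

end JFactor

/-! ### Haar measures on `K_S` -/

section SMeasure

variable {K : Type*} [Field K] [NumberField K] {S : Finset (HeightOneSpectrum (𝓞 K))}

instance (w : InfinitePlace K) : MeasurableSpace w.Completion := borel _

instance (w : InfinitePlace K) : BorelSpace w.Completion := ⟨rfl⟩

instance (v : HeightOneSpectrum (𝓞 K)) : MeasurableSpace (v.adicCompletion K) := borel _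

instance (v : HeightOneSpectrum (𝓞 K)) : BorelSpace (v.adicCompletion K) := ⟨rfl⟩

instance : IsTopologicalAddGroup (SRing K S) := inferInstanceAs (IsTopologicalAddGroup
  ((∀ w : InfinitePlace K, w.Completion) × (∀ v : S, v.1.adicCompletion K)))

instance : LocallyCompactSpace (SRing K S) := inferInstanceAs (LocallyCompactSpace
  ((∀ w : InfinitePlace K, w.Completion) × (∀ v : S, v.1.adicCompletion K)))

instance : SecondCountableTopology (SRing K S) := inferInstanceAs (SecondCountableTopology
  ((∀ w : InfinitePlace K, w.Completion) × (∀ v : S, v.1.adicCompletion K)))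

/-- The identity as a map from the product of the local fields to `K_S`. -/
def toSRing : ((∀ w : InfinitePlace K, w.Completion) × (∀ v : S, v.1.adicCompletion K)) ≃+
    SRing K S := AddEquiv.refl _

theorem continuous_toSRing : Continuous (toSRing : _ ≃+ SRing K S) := continuous_id

theorem continuous_toSRing_symm : Continuous (toSRing : _ ≃+ SRing K S).symm := continuous_id

theorem integral_SRing (νr : Measure (SRing K S)) [νr.IsAddHaarMeasure]
    (μI : ∀ w : InfinitePlace K, Measure w.Completion) [∀ w, (μI w).IsAddHaarMeasure]
    (μF : ∀ v : S, Measure (v.1.adicCompletion K)) [∀ v, (μF v).IsAddHaarMeasure] :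
    ∃ c : ℂ, c ≠ 0 ∧ ∀ (F : ∀ w : InfinitePlace K, w.Completion → ℂ)
      (G : ∀ v : S, v.1.adicCompletion K → ℂ), (∀ w, Integrable (F w) (μI w)) →
      (∀ v, Integrable (G v) (μF v)) →
      Integrable (fun r : SRing K S => (∏ w, F w (r.1 w)) * ∏ v, G v (r.2 v)) νr ∧
      ∫ r : SRing K S, (∏ w, F w (r.1 w)) * ∏ v, G v (r.2 v) ∂νr =
        c * ((∏ w, ∫ x, F w x ∂μI w) * ∏ v, ∫ x, G v x ∂μF v) := by
  set μ := (Measure.pi μI).prod (Measure.pi μF) with hμdef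
  have hμ' : μ.IsAddHaarMeasure := by
    have h1 := Measure.pi.isAddHaarMeasure μI
    have h2 := Measure.pi.isAddHaarMeasure μF
    exact Measure.prod.instIsAddHaarMeasure _ _
  have hμ : (μ.map (toSRing : _ ≃+ SRing K S)).IsAddHaarMeasure :=
    AddEquiv.isAddHaarMeasure_map μ _ continuous_toSRing continuous_toSRing_symm
  let c := Measure.addHaarScalarFactor νr (μ.map (toSRing : _ ≃+ SRing K S))
  have hc : 0 < c := Measure.addHaarScalarFactor_pos_of_isAddHaarMeasure _ _
  have hν : νr = c • μ.map (toSRing : _ ≃+ SRing K S) := Measure.isAddLeftInvariant_eq_smul _ _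
  let e : ((∀ w : InfinitePlace K, w.Completion) × (∀ v : S, v.1.adicCompletion K)) ≃ₜ SRing K S :=
    Homeomorph.refl _
  have he : MeasurableEmbedding (toSRing : _ ≃+ SRing K S) := e.measurableEmbedding
  refine ⟨c, by exact_mod_cast hc.ne', fun F G hF hG => ?_⟩
  have h1 : Integrable (fun x : (∀ w : InfinitePlace K, w.Completion) ×
      (∀ v : S, v.1.adicCompletion K) => (∏ w, F w (x.1 w)) * ∏ v, G v (x.2 v)) μ :=
    (Integrable.fintype_prod_dep hF).mul_prod (Integrable.fintype_prod_dep hG)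
  rw [hν]
  constructor
  · refine Integrable.smul_measure_nnreal ?_
    rw [he.integrable_map_iff]
    exact h1
  · rw [integral_smul_nnreal_measure, he.integral_map]
    change c • ∫ x, (∏ w, F w (x.1 w)) * ∏ v, G v (x.2 v) ∂μ = _
    rw [hμdef, integral_prod_mul (fun x : ∀ w : InfinitePlace K, w.Completion => ∏ w, F w (x w))
      (fun x : ∀ v : S, v.1.adicCompletion K => ∏ v, G v (x v)), integral_fintype_prod_eq_prod,
      integral_fintype_prod_eq_prod]
    rfl

end SMeasure

section SChar

variable {K : Type*} [Field K] [NumberField K] {S : Finset (HeightOneSpectrum (𝓞 K))}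
  {ψ : AddChar (Adele K) Circle}

open scoped Classical in
/-- The embedding of `K_w` in the adeles as a homomorphism. -/
def adeleAtInfHom (w : InfinitePlace K) : w.Completion →+ Adele K :=
  (AddMonoidHom.inl _ _).comp
    (AddMonoidHom.single (fun w : InfinitePlace K => w.Completion) w)

theorem continuous_adeleAtInfHom (w : InfinitePlace K) :
    Continuous (adeleAtInfHom w : w.Completion → Adele K) := by
  classical
  exact (continuous_single (A := fun w : InfinitePlace K => w.Completion) w).prodMk
    continuous_const

/-- The local component of `ψ` at the archimedean place `w`. -/
def infChar (ψ : AddChar (Adele K) Circle) (w : InfinitePlace K) : AddChar w.Completion Circle :=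
  ψ.compAddMonoidHom (adeleAtInfHom w)

theorem addChar_sum (ψ : AddChar (Adele K) Circle) {ι : Type*} (s : Finset ι) (f : ι → Adele K) :
    ψ (∑ i ∈ s, f i) = ∏ i ∈ s, ψ (f i) :=
  map_prod ψ.toMonoidHom (fun i => Multiplicative.ofAdd (f i)) s

theorem addChar_override (ψ : AddChar (Adele K) Circle)
    (r : (∀ w : InfinitePlace K, w.Completion) × (∀ v : S, v.1.adicCompletion K)) :
    ψ (override S r 0) = (∏ w, infChar ψ w (r.1 w)) * ∏ v : S, localChar ψ v.1 (r.2 v) := by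
  classical
  have h0 : override S 0 (0 : Adele K) = 0 := by
    refine adele_ext (fun w => rfl) fun v => ?_
    change (if h : v ∈ S then (0 : v.adicCompletion K) else 0) = 0
    rw [dite_eq_ite, ite_self]
  have h1 : adeleInf r.1 = ∑ w, adeleAtInfHom w (r.1 w) := by
    refine adele_ext (fun u => ?_) fun v => ?_
    · rw [map_sum, Finset.sum_eq_single u]
      · exact (Pi.single_eq_same (M := fun w : InfinitePlace K => w.Completion) u (r.1 u)).symm
      · intro w _ hw
        exact Pi.single_eq_of_ne (M := fun w : InfinitePlace K => w.Completion) hw.symm (r.1 w)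
      · exact fun h => absurd (Finset.mem_univ u) h
    · rw [map_sum]
      exact (Finset.sum_eq_zero fun w _ => rfl).symm
  rw [override_eq, h0, add_zero, h1, AddChar.map_add_eq_mul]
  congr 1
  · exact addChar_sum ψ _ _
  · exact addChar_sum ψ _ _

end SChar

section Coset

variable {X : Type*} [Group X] [TopologicalSpace X] [IsTopologicalGroup X] {Y : Subgroup X}
  {ν : Measure (Coset Y)}

theorem cosetIntegrable_mul_right (hν : IsInvariantMeasure ν) {Φ : X → ℂ}
    (hΦ : ∀ y ∈ Y, ∀ x, Φ (y * x) = Φ x) (h : CosetIntegrable ν Φ) (u : X) :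
    CosetIntegrable ν fun x => Φ (x * u) := by
  have := hν.smulInvariant
  have h1 : (onCoset Y fun x => Φ (x * u)) = fun q => onCoset Y Φ (u⁻¹ • q) := by
    funext q
    obtain ⟨x, rfl⟩ := toCoset_surjective q
    rw [onCoset_toCoset (fun y hy x => by rw [mul_assoc, hΦ y hy]), smul_toCoset,
      onCoset_toCoset hΦ, inv_inv]
  rw [CosetIntegrable, h1]
  exact (measurePreserving_smul u⁻¹ ν).integrable_comp_of_integrable h

end Coset

section LocallyCompact

variable {k : Type*} [NormedField k] [ProperSpace k]

instance : WeaklyLocallyCompactSpace (G2 k) where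
  exists_compact_mem_nhds g := by
    let C : ℝ := ∑ i, ∑ j, (‖g.1.1 i j‖ + 1)
    refine ⟨_, isCompact_bounded C, ?_⟩
    have h : ∀ i j, ∀ᶠ x : G2 k in 𝓝 g, ‖x.1.1 i j‖ ≤ C := by
      intro i j
      refine ((G2.continuous_entry i j).norm.continuousAt.eventually_lt
        (continuousAt_const (y := ‖g.1.1 i j‖ + 1)) (lt_add_one _)).mono fun x hx => hx.le.trans ?_
      calc ‖g.1.1 i j‖ + 1 ≤ ∑ j, (‖g.1.1 i j‖ + 1) :=
            Finset.single_le_sum (f := fun j => ‖g.1.1 i j‖ + 1) (fun j _ => by positivity)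
              (Finset.mem_univ j)
        _ ≤ C := Finset.single_le_sum (f := fun i => ∑ j, (‖g.1.1 i j‖ + 1))
              (fun i _ => by positivity) (Finset.mem_univ i)
    exact Filter.eventually_all.2 fun i => Filter.eventually_all.2 fun j => h i j

end LocallyCompact

section SGroup

variable {K : Type*} [Field K] [NumberField K] {S : Finset (HeightOneSpectrum (𝓞 K))}
  {ψ : AddChar (Adele K) Circle}

theorem SGroup.toAdele_mem_unipU {u : SGroup K S} (hu : u ∈ SUnip K S) :
    SGroup.toAdele u ∈ unipU (Adele K) := by
  have hI : ∀ w, u.1 w ∈ unipU w.Completion := fun w => hu.1 w (Set.mem_univ w)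
  have hF : ∀ v : S, u.2 v ∈ unipU (v.1.adicCompletion K) := fun v => hu.2 v (Set.mem_univ v)
  have key : ∀ i : Fin 8, (∀ w, (u.1 w).1.1 i = Pi.single i 1) →
      (∀ v : S, (u.2 v).1.1 i = Pi.single i 1) → (SGroup.toAdele u).1.1 i = Pi.single i 1 := by
    intro i h1 h2
    have e : (Pi.single i 1 : Fin 8 → Adele K) = (1 : Matrix (Fin 8) (Fin 8) (Adele K)) i :=
      funext fun j => by simp [Matrix.one_apply, Pi.single_apply, eq_comm]
    rw [e]
    funext j
    refine adele_ext (fun w => ?_) fun v => ?_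
    · refine (congrFun (h1 w) j).trans ?_
      rw [Matrix.one_apply, apply_ite (prInf w), map_one, map_zero, Pi.single_apply]
      simp only [eq_comm]
    · rw [Matrix.one_apply, apply_ite (prFin v), map_one, map_zero]
      by_cases hv : v ∈ S
      · refine (congrFun (congrFun (SGroup.mat_fin u ⟨v, hv⟩) i) j).trans ?_
        rw [h2 ⟨v, hv⟩, Pi.single_apply]
        simp only [eq_comm]
      · refine (congrFun (congrFun (SGroup.mat_fin_out u v hv) i) j).trans ?_
        rw [Matrix.one_apply]
  rw [mem_unipU_iff]
  exact ⟨key 3 (fun w => (mem_unipU_iff.1 (hI w)).1) fun v => (mem_unipU_iff.1 (hF v)).1,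
    key 4 (fun w => (mem_unipU_iff.1 (hI w)).2) fun v => (mem_unipU_iff.1 (hF v)).2⟩

theorem SGroup.psiArg_toAdele (u : SGroup K S) : psiArg (SGroup.toAdele u) =
    override S (fun w => psiArg (u.1 w), fun v => psiArg (u.2 v)) 0 := by
  refine adele_ext (fun w => rfl) fun v => ?_
  rw [psiArg, map_add]
  by_cases hv : v ∈ S
  · refine (congrArg₂ (· + ·) (congrFun (congrFun (SGroup.mat_fin u ⟨v, hv⟩) 1) 0)
      (congrFun (congrFun (SGroup.mat_fin u ⟨v, hv⟩) 6) 7)).trans ?_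
    have h : prFin v (override S (fun w => psiArg (u.1 w), fun v => psiArg (u.2 v)) 0) =
        psiArg (u.2 ⟨v, hv⟩) := dif_pos hv
    exact h.symm
  · refine (congrArg₂ (· + ·) (congrFun (congrFun (SGroup.mat_fin_out u v hv) 1) 0)
      (congrFun (congrFun (SGroup.mat_fin_out u v hv) 6) 7)).trans ?_
    rw [Matrix.one_apply_ne (by decide), Matrix.one_apply_ne (by decide), add_zero]
    have h : prFin v (override S (fun w => psiArg (u.1 w), fun v => psiArg (u.2 v)) 0) =
        (0 : Adele K).2 v := dif_neg hv
    exact h.symm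

/-- Elements of `G_S` commute with adelic points that are trivial at the places in `S`. -/
theorem SGroup.toAdele_comm (t : SGroup K S) {k : G2 (Adele K)} (hk : InfTrivial k)
    (hkS : ∀ v ∈ S, ∀ i j, (k.1.1 i j).2 v = (1 : Matrix (Fin 8) (Fin 8) _) i j) :
    k * SGroup.toAdele t = SGroup.toAdele t * k := by
  refine G2.adele_ext (fun w => ?_) fun v => ?_
  · have h : k.1.1.map (prInf w) = 1 := Matrix.ext fun i j => hk i j w
    rw [G2.val_mul, G2.val_mul, Matrix.map_mul, Matrix.map_mul, h, one_mul, mul_one]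
  · rw [G2.val_mul, G2.val_mul, Matrix.map_mul, Matrix.map_mul]
    by_cases hv : v ∈ S
    · have h : k.1.1.map (prFin v) = 1 := Matrix.ext fun i j => hkS v hv i j
      rw [h, one_mul, mul_one]
    · rw [SGroup.toAdele_val, SGroup.mat_fin_out t v hv, one_mul, mul_one]

theorem IsSphericalOutside.translate {φ : G2 (Adele K) → ℂ} (h : IsSphericalOutside S φ)
    (t : SGroup K S) : IsSphericalOutside S fun x => φ (x * SGroup.toAdele t) := by
  intro k hk hkS hkO x
  change φ (x * k * SGroup.toAdele t) = φ (x * SGroup.toAdele t)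
  rw [mul_assoc, SGroup.toAdele_comm t hk hkS, ← mul_assoc]
  exact h k hk hkS hkO _

theorem localAct_single (t : SGroup K S) (φ : G2 (Adele K) → ℂ) :
    localAct (S := S) (fun w => Finsupp.single (t.1 w) 1) (fun v => Finsupp.single (t.2 v) 1) φ =
      fun x => φ (x * SGroup.toAdele t) := by
  classical
  funext x
  have h1 : Fintype.piFinset (fun w : InfinitePlace K =>
      (Finsupp.single (t.1 w) (1 : ℂ)).support) = {t.1} := by
    simp only [Finsupp.support_single _ (one_ne_zero (α := ℂ))]
    exact Fintype.piFinset_singleton t.1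
  have h2 : Fintype.piFinset (fun v : S =>
      (Finsupp.single (t.2 v) (1 : ℂ)).support) = {t.2} := by
    simp only [Finsupp.support_single _ (one_ne_zero (α := ℂ))]
    exact Fintype.piFinset_singleton t.2
  rw [localAct]
  rw [Finset.sum_congr (by convert h1) fun _ _ => Finset.sum_congr (by convert h2) fun _ _ => rfl]
  rw [Finset.sum_singleton, Finset.sum_singleton]
  simp

/-- The product of the local phases. -/
def phaseS (ψ : AddChar (Adele K) Circle) (g : SGroup K S) : ℂ :=
  (∏ w, phase (infChar ψ w) (g.1 w)) * ∏ v : S, phase (localChar ψ v.1) (g.2 v)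

theorem phaseS_unip_mul {u : SGroup K S} (hu : u ∈ SUnip K S) (g : SGroup K S) :
    (ψ (psiArg (SGroup.toAdele u)) : ℂ) * phaseS ψ (u * g) = phaseS ψ g := by
  have e : ((ψ (psiArg (SGroup.toAdele u)) : Circle) : ℂ) =
      (∏ w, (infChar ψ w (psiArg (u.1 w)) : ℂ)) *
        ∏ v : S, (localChar ψ v.1 (psiArg (u.2 v)) : ℂ) := by
    rw [SGroup.psiArg_toAdele, addChar_override, Circle.coe_mul]
    congr 1
    · exact map_prod Circle.coeHom _ _
    · exact map_prod Circle.coeHom _ _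
  rw [e, phaseS, mul_mul_mul_comm, ← Finset.prod_mul_distrib, ← Finset.prod_mul_distrib, phaseS]
  congr 1
  · exact Finset.prod_congr rfl fun w _ => phase_unip_mul (hu.1 w (Set.mem_univ w)) _
  · exact Finset.prod_congr rfl fun v _ => phase_unip_mul (hu.2 v (Set.mem_univ v)) _

theorem continuous_infChar (hψ : Continuous ψ) (w : InfinitePlace K) :
    Continuous (infChar ψ w) := hψ.comp (continuous_adeleAtInfHom w)

theorem continuous_localChar (hψ : Continuous ψ) (v : HeightOneSpectrum (𝓞 K)) :
    Continuous (localChar ψ v) := hψ.comp (continuous_adeleAt v)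

theorem continuousAt_phaseS (hψ : Continuous ψ) {g : SGroup K S} (hI : ∀ w, detD (g.1 w) ≠ 0)
    (hF : ∀ v : S, detD (g.2 v) ≠ 0) : ContinuousAt (phaseS ψ) g := by
  refine ContinuousAt.mul (tendsto_finsetProd _ fun w _ => ?_) (tendsto_finsetProd _ fun v _ => ?_)
  · exact (continuousAt_phase (continuous_infChar hψ w) (hI w)).tendsto.comp
      (((continuous_apply w).comp continuous_fst).tendsto g)
  · exact (continuousAt_phase (continuous_localChar hψ v.1) (hF v)).tendsto.comp
      (((continuous_apply v).comp continuous_snd).tendsto g)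

theorem exists_pi_nhds {ι : Type*} {X : ι → Type*} [∀ i, TopologicalSpace (X i)] {x : ∀ i, X i}
    {s : Set (∀ i, X i)} (hs : s ∈ 𝓝 x) :
    ∃ t : ∀ i, Set (X i), (∀ i, t i ∈ 𝓝 (x i)) ∧ ∀ y, (∀ i, y i ∈ t i) → y ∈ s := by
  rw [nhds_pi, Filter.mem_pi] at hs
  obtain ⟨I, -, t, ht, hts⟩ := hs
  exact ⟨t, ht, fun y hy => hts fun i _ => hy i⟩

end SGroup

section Infinite

variable {K : Type*} [Field K] [NumberField K] {w : InfinitePlace K}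

theorem exists_inf_datum_completion
    (μ : Measure w.Completion) [μ.IsAddHaarMeasure] {χ : AddChar w.Completion Circle}
    (hχ : Continuous χ) (hχ1 : χ ≠ 1) {ι : Type*} [Fintype ι] {t : ι → w.Completion}
    (ht : ∀ i, 1 ≤ ‖t i‖) {N : ι → Set (G2 w.Completion)}
    (hN : ∀ i, N i ∈ 𝓝 (torusF (t i)⁻¹ 1)) :
    ∃ P : ι → G2 w.Completion → ℝ, (∀ i, IsBumpNear χ (torusF (t i)⁻¹ 1) (N i) (P i)) ∧
      ∀ a : ι → ℂ, ∃ f, IsInfSection w f ∧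
        (∀ s g, Integrable (fun r => f s (muH _ * G2.toSpin8 (xAB r * g)) * (χ r : ℂ)) μ) ∧
        ∀ s g, ∫ r, f s (muH _ * G2.toSpin8 (xAB r * g)) * (χ r : ℂ) ∂μ =
          phase χ g * (∑ i, a i * P i g) *
            Complex.exp ((-(5 * w.mult * Real.log (max ‖g.1.1 3 3‖ (1 / 2))) : ℝ) * s) := by
  rcases w.isReal_or_isComplex with hw | hw
  · refine exists_inf_datum (InfinitePlace.Completion.ringEquivRealOfIsReal hw) (fun x => ?_)
      μ hχ hχ1 ht hN
    exact (InfinitePlace.Completion.isometry_extensionEmbeddingOfIsReal hw).norm_map_of_map_zero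
      (map_zero _) x
  · refine exists_inf_datum (InfinitePlace.Completion.ringEquivComplexOfIsComplex hw) (fun x => ?_)
      μ hχ hχ1 ht hN
    exact (InfinitePlace.Completion.isometry_extensionEmbedding w).norm_map_of_map_zero
      (map_zero _) x

end Infinite

section SGroup

variable {K : Type*} [Field K] [NumberField K] {S : Finset (HeightOneSpectrum (𝓞 K))}
  {ψ : AddChar (Adele K) Circle}

theorem infChar_ne_one (hψ : Continuous ψ) (hψK : ∀ x : K, ψ (algebraMap K (Adele K) x) = 1)
    (hψ1 : ψ ≠ 1) (w : InfinitePlace K) : infChar ψ w ≠ 1 := by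
  obtain ⟨x, hx⟩ := exists_adeleAtInf_ne_one hψ hψK hψ1 w
  exact fun h => hx (DFunLike.congr_fun h x)

theorem localChar_ne_one (hψ : Continuous ψ) (hψK : ∀ x : K, ψ (algebraMap K (Adele K) x) = 1)
    (hψ1 : ψ ≠ 1) (v : HeightOneSpectrum (𝓞 K)) : localChar ψ v ≠ 1 := by
  obtain ⟨x, hx⟩ := exists_adeleAt_ne_one hψ hψK hψ1 v
  exact fun h => hx (DFunLike.congr_fun h x)

/-- A nonnegative function on `U_S \ G_S`, positive at `g₀`, supported in `U_S N`, and vanishing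
near the discontinuities of the phase. -/
structure IsBumpNearS (ψ : AddChar (Adele K) Circle) (g₀ : SGroup K S) (N : Set (SGroup K S))
    (P : SGroup K S → ℝ) : Prop where
  unip_mul : ∀ u ∈ SUnip K S, ∀ g, P (u * g) = P g
  continuous : Continuous P
  continuous_phase : Continuous fun g => phaseS ψ g * P g
  nonneg : ∀ g, 0 ≤ P g
  pos : 0 < P g₀
  mem : ∀ g, P g ≠ 0 → ∃ u ∈ SUnip K S, u * g ∈ N

theorem isBumpNearS_prod {g₀ : SGroup K S} {N : Set (SGroup K S)}
    {NI : ∀ w : InfinitePlace K, Set (G2 w.Completion)}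
    {NF : ∀ v : S, Set (G2 (v.1.adicCompletion K))}
    (hN : ∀ g : SGroup K S, (∀ w, g.1 w ∈ NI w) → (∀ v, g.2 v ∈ NF v) → g ∈ N)
    {PI : ∀ w : InfinitePlace K, G2 w.Completion → ℝ}
    (hI : ∀ w, IsBumpNear (infChar ψ w) (g₀.1 w) (NI w) (PI w))
    {PF : ∀ v : S, G2 (v.1.adicCompletion K) → ℝ}
    (hF : ∀ v : S, IsBumpNear (localChar ψ v.1) (g₀.2 v) (NF v) (PF v)) :
    IsBumpNearS ψ g₀ N fun g => (∏ w, PI w (g.1 w)) * ∏ v, PF v (g.2 v) where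
  unip_mul u hu g := by
    congr 1
    · exact Finset.prod_congr rfl fun w _ => (hI w).unip_mul _ (hu.1 w (Set.mem_univ w)) _
    · exact Finset.prod_congr rfl fun v _ => (hF v).unip_mul _ (hu.2 v (Set.mem_univ v)) _
  continuous := by
    refine Continuous.mul (continuous_finsetProd _ fun w _ => ?_)
      (continuous_finsetProd _ fun v _ => ?_)
    · exact (hI w).continuous.comp ((continuous_apply w).comp continuous_fst)
    · exact (hF v).continuous.comp ((continuous_apply v).comp continuous_snd)
  continuous_phase := by
    have e : (fun g : SGroup K S => phaseS ψ g *
        (((∏ w, PI w (g.1 w)) * ∏ v, PF v (g.2 v) : ℝ) : ℂ)) = fun g =>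
        (∏ w, phase (infChar ψ w) (g.1 w) * (PI w (g.1 w) : ℂ)) *
          ∏ v : S, phase (localChar ψ v.1) (g.2 v) * (PF v (g.2 v) : ℂ) := by
      funext g
      push_cast
      rw [Finset.prod_mul_distrib, Finset.prod_mul_distrib, phaseS, mul_mul_mul_comm]
    rw [e]
    refine Continuous.mul (continuous_finsetProd _ fun w _ => ?_)
      (continuous_finsetProd _ fun v _ => ?_)
    · exact (hI w).continuous_phase.comp ((continuous_apply w).comp continuous_fst)
    · exact (hF v).continuous_phase.comp ((continuous_apply v).comp continuous_snd)
  nonneg g := mul_nonneg (Finset.prod_nonneg fun w _ => (hI w).nonneg _)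
    (Finset.prod_nonneg fun v _ => (hF v).nonneg _)
  pos := mul_pos (Finset.prod_pos fun w _ => (hI w).pos) (Finset.prod_pos fun v _ => (hF v).pos)
  mem g hg := by
    have h1 : ∀ w, PI w (g.1 w) ≠ 0 := fun w =>
      Finset.prod_ne_zero_iff.1 (left_ne_zero_of_mul hg) w (Finset.mem_univ w)
    have h2 : ∀ v, PF v (g.2 v) ≠ 0 := fun v =>
      Finset.prod_ne_zero_iff.1 (right_ne_zero_of_mul hg) v (Finset.mem_univ v)
    choose uI huI hgI using fun w => (hI w).mem _ (h1 w)
    choose uF huF hgF using fun v => (hF v).mem _ (h2 v)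
    exact ⟨(uI, uF), ⟨fun w _ => huI w, fun v _ => huF v⟩, hN _ hgI hgF⟩

open scoped Classical in
/-- The torus element of `G_S` with parameter `t` at the place `w₀`. -/
def torusAt (S : Finset (HeightOneSpectrum (𝓞 K))) (w₀ : InfinitePlace K) (t : w₀.Completion) :
    SGroup K S :=
  (fun w => torusF ((Function.update 1 w₀ t : ∀ w : InfinitePlace K, w.Completion) w)⁻¹ 1, 1)

theorem torusF_one {k : Type*} [Field k] : (torusF (1 : k) 1) = 1 := by
  rw [torusF, dif_pos ⟨one_ne_zero, one_ne_zero⟩, Units.mk0_one, torus_one]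

theorem torusAt_one (w₀ : InfinitePlace K) : torusAt S w₀ 1 = 1 := by
  classical
  have h : (Function.update 1 w₀ 1 : ∀ w : InfinitePlace K, w.Completion) = 1 :=
    Function.update_eq_self w₀ _
  refine Prod.ext (funext fun w => ?_) rfl
  change torusF ((Function.update 1 w₀ 1 : ∀ w : InfinitePlace K, w.Completion) w)⁻¹ 1 = 1
  rw [h, Pi.one_apply, inv_one, torusF_one]

theorem tendsto_torusAt (w₀ : InfinitePlace K) :
    Filter.Tendsto (torusAt S w₀) (𝓝 1) (𝓝 1) := by
  classical
  suffices h : Filter.Tendsto (torusAt S w₀) (𝓝 1) (𝓝 (torusAt S w₀ 1)) by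
    rwa [torusAt_one] at h
  refine Filter.Tendsto.prodMk_nhds (tendsto_pi_nhds.2 fun w => ?_) tendsto_const_nhds
  have h1 : (Function.update 1 w₀ 1 : ∀ w : InfinitePlace K, w.Completion) w ≠ 0 := by
    have h : (Function.update 1 w₀ 1 : ∀ w : InfinitePlace K, w.Completion) = 1 :=
      Function.update_eq_self w₀ _
    rw [h]; exact one_ne_zero
  refine tendsto_torusF (inv_ne_zero h1) one_ne_zero (Filter.Tendsto.inv₀ ?_ h1) tendsto_const_nhds
  exact ((continuous_apply w).comp (continuous_const.update w₀ continuous_id)).tendsto 1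

/-- The exponent of the archimedean part of the inner integral of `F*`. -/
def expS (g : SGroup K S) : ℝ :=
  ∑ w : InfinitePlace K, -(5 * w.mult * Real.log (max ‖(g.1 w).1.1 3 3‖ (1 / 2)))

theorem expS_unip_mul {u : SGroup K S} (hu : u ∈ SUnip K S) (g : SGroup K S) :
    expS (u * g) = expS g := by
  refine Finset.sum_congr rfl fun w _ => ?_
  have h : ((u * g).1 w).1.1 3 = (g.1 w).1.1 3 :=
    uElt_mul_row_three (hu.1 w (Set.mem_univ w)) (g.1 w)
  rw [h]

theorem continuous_expS : Continuous (expS : SGroup K S → ℝ) := by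
  refine continuous_finsetSum _ fun w _ => (continuous_const.mul (Continuous.log ?_ ?_)).neg
  · exact ((((G2.continuous_entry 3 3).comp
      ((continuous_apply w).comp continuous_fst)).norm).max continuous_const)
  · exact fun g => (lt_max_of_lt_right (by norm_num)).ne'

theorem expS_torusAt (w₀ : InfinitePlace K) {t : w₀.Completion} (ht : 1 ≤ ‖t‖) :
    expS (torusAt S w₀ t) = -(5 * w₀.mult * Real.log ‖t‖) := by
  classical
  have ht0 : t ≠ 0 := norm_pos_iff.1 (by linarith)
  rw [expS, Finset.sum_eq_single w₀]
  · have h : ((torusAt S w₀ t).1 w₀) = torusF t⁻¹ 1 := by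
      change torusF ((Function.update 1 w₀ t : ∀ w : InfinitePlace K, w.Completion) w₀)⁻¹ 1 = _
      rw [Function.update_self]
    rw [h, torusF_row_three ht0, max_eq_left (by linarith)]
  · intro w _ hw
    have h : ((torusAt S w₀ t).1 w) = 1 := by
      change torusF ((Function.update 1 w₀ t : ∀ w : InfinitePlace K, w.Completion) w)⁻¹ 1 = _
      rw [Function.update_of_ne hw, Pi.one_apply, inv_one, torusF_one]
    rw [h]
    norm_num
  · exact fun h => absurd (Finset.mem_univ _) h

theorem continuousAt_phaseS_torusAt (hψ : Continuous ψ) (w₀ : InfinitePlace K) {t : w₀.Completion}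
    (ht : t ≠ 0) :
    ContinuousAt (phaseS ψ) (torusAt S w₀ t) ∧ phaseS ψ (torusAt S w₀ t) ≠ 0 := by
  classical
  have h : ∀ w, (Function.update 1 w₀ t : ∀ w : InfinitePlace K, w.Completion) w ≠ 0 := by
    intro w
    rcases eq_or_ne w w₀ with rfl | hw
    · rwa [Function.update_self]
    · rw [Function.update_of_ne hw]; exact one_ne_zero
  have h1 : ∀ v : S, (torusAt S w₀ t).2 v = torusF (1 : v.1.adicCompletion K)⁻¹ 1 := fun v => by
    rw [inv_one, torusF_one]; rfl
  refine ⟨continuousAt_phaseS hψ (fun w => ?_) fun v => ?_, ?_⟩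
  · exact (detD_torusF (h w)).trans_ne (pow_ne_zero 2 (h w))
  · rw [h1, detD_torusF one_ne_zero]; exact pow_ne_zero 2 one_ne_zero
  · refine mul_ne_zero (Finset.prod_ne_zero_iff.2 fun w _ => phase_torusF_ne_zero (h w))
      (Finset.prod_ne_zero_iff.2 fun v _ => ?_)
    rw [h1]
    exact phase_torusF_ne_zero one_ne_zero

end SGroup

variable {K : Type*} [Field K] [NumberField K] {S : Finset (HeightOneSpectrum (𝓞 K))}
  {ψ : AddChar (Adele K) Circle}

theorem fStarIntegrand_eq_prod (fI : ∀ w : InfinitePlace K, ℂ → Spin8 w.Completion → ℂ)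
    (fF : ∀ v : S, ℂ → Spin8 (v.1.adicCompletion K) → ℂ) (s : ℂ) (g : SGroup K S)
    (r : SRing K S) : fStarIntegrand ψ fI fF s g r =
      (∏ w, fI w s (muH _ * G2.toSpin8 (xAB (r.1 w) * g.1 w)) * (infChar ψ w (r.1 w) : ℂ)) *
        ∏ v : S, fF v s (muH _ * G2.toSpin8 (xAB (r.2 v) * g.2 v)) *
          (localChar ψ v.1 (r.2 v) : ℂ) := by
  have e : ∀ r : (∀ w : InfinitePlace K, w.Completion) × (∀ v : S, v.1.adicCompletion K),
      ((ψ (override S r 0) : Circle) : ℂ) = (∏ w, (infChar ψ w (r.1 w) : ℂ)) *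
        ∏ v : S, (localChar ψ v.1 (r.2 v) : ℂ) := fun r => by
    rw [addChar_override, Circle.coe_mul]
    congr 1
    · exact map_prod Circle.coeHom _ _
    · exact map_prod Circle.coeHom _ _
  rw [Finset.prod_mul_distrib, Finset.prod_mul_distrib, mul_mul_mul_comm]
  exact congrArg (sectionProd fI fF s (xABS r * g) * ·) (e r)

/-- The inner integral of `F*` factors over the places in `S`. -/
theorem exists_integral_fStarIntegrand (ψ : AddChar (Adele K) Circle) (νr : Measure (SRing K S))
    [νr.IsAddHaarMeasure] : ∃ c : ℂ, c ≠ 0 ∧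
      ∀ (fI : ∀ w : InfinitePlace K, ℂ → Spin8 w.Completion → ℂ)
        (fF : ∀ v : S, ℂ → Spin8 (v.1.adicCompletion K) → ℂ) (s : ℂ) (g : SGroup K S),
        (∀ w, Integrable (fun r => fI w s (muH _ * G2.toSpin8 (xAB r * g.1 w)) *
          (infChar ψ w r : ℂ)) Measure.addHaar) →
        (∀ v : S, Integrable (fun r => fF v s (muH _ * G2.toSpin8 (xAB r * g.2 v)) *
          (localChar ψ v.1 r : ℂ)) Measure.addHaar) →
        Integrable (fStarIntegrand ψ fI fF s g) νr ∧ ∫ r, fStarIntegrand ψ fI fF s g r ∂νr =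
          c * ((∏ w, ∫ r, fI w s (muH _ * G2.toSpin8 (xAB r * g.1 w)) *
            (infChar ψ w r : ℂ) ∂Measure.addHaar) *
          ∏ v : S, ∫ r, fF v s (muH _ * G2.toSpin8 (xAB r * g.2 v)) *
            (localChar ψ v.1 r : ℂ) ∂Measure.addHaar) := by
  obtain ⟨c, hc, h⟩ := integral_SRing νr (fun w => Measure.addHaar) (fun v => Measure.addHaar)
  refine ⟨c, hc, fun fI fF s g hI hF => ?_⟩
  have h1 := h (fun w r => fI w s (muH _ * G2.toSpin8 (xAB r * g.1 w)) * (infChar ψ w r : ℂ))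
    (fun v r => fF v s (muH _ * G2.toSpin8 (xAB r * g.2 v)) * (localChar ψ v.1 r : ℂ)) hI hF
  refine ⟨h1.1.congr (Filter.Eventually.of_forall fun r => ?_),
    (integral_congr_ae (Filter.Eventually.of_forall fun r => ?_)).trans h1.2⟩
  · exact (fStarIntegrand_eq_prod fI fF s g r).symm
  · exact fStarIntegrand_eq_prod fI fF s g r

theorem exists_S_datum (hψ : Continuous ψ) (hψK : ∀ x : K, ψ (algebraMap K (Adele K) x) = 1)
    (hψ1 : ψ ≠ 1) (νr : Measure (SRing K S)) [νr.IsAddHaarMeasure] (w₀ : InfinitePlace K) {m : ℕ}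
    {t : Fin (m + 1) → w₀.Completion} (ht : ∀ i, 1 ≤ ‖t i‖) {N : Fin (m + 1) → Set (SGroup K S)}
    (hN : ∀ i, N i ∈ 𝓝 (torusAt S w₀ (t i))) :
    ∃ P : Fin (m + 1) → SGroup K S → ℝ,
      (∃ (y : SGroup K S) (c : ℂ) (B : ℝ), c ≠ 0 ∧ ∀ a : Fin (m + 1) → ℂ, ∃ fI fF,
        (∀ w, IsInfSection w (fI w)) ∧ (∀ v : S, IsFinSection v.1 (fF v)) ∧
        (∀ s g, Integrable (fStarIntegrand ψ fI fF s g) νr) ∧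
        ∀ s g, ∫ r, fStarIntegrand ψ fI fF s (g * y) r ∂νr = c * Complex.exp (B * s) *
          (phaseS ψ g * (∑ i, a i * P i g) * Complex.exp (expS g * s))) ∧
      ∀ i, IsBumpNearS ψ (torusAt S w₀ (t i)) (N i) (P i) := by
  classical
  let T : Fin (m + 1) → ∀ w : InfinitePlace K, w.Completion := fun i => Function.update 1 w₀ (t i)
  have hT : ∀ w i, 1 ≤ ‖T i w‖ := by
    intro w i
    rcases eq_or_ne w w₀ with rfl | hw
    · simpa only [T, Function.update_self] using ht i
    · simp only [T, Function.update_of_ne hw, Pi.one_apply, norm_one, le_refl]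
  let idx : Fin (m + 1) → InfinitePlace K → Fin (m + 1) := fun i w => if w = w₀ then i else 0
  have hidx : ∀ i w, T (idx i w) w = T i w := by
    intro i w
    rcases eq_or_ne w w₀ with rfl | hw
    · simp only [idx, if_true]
    · simp only [T, Function.update_of_ne hw]
  have hNI : ∀ i, ∃ (NI : ∀ w : InfinitePlace K, Set (G2 w.Completion))
      (NF : ∀ v : S, Set (G2 (v.1.adicCompletion K))), (∀ w, NI w ∈ 𝓝 (torusF (T i w)⁻¹ 1)) ∧
      (∀ v, NF v ∈ 𝓝 1) ∧
      ∀ g : SGroup K S, (∀ w, g.1 w ∈ NI w) → (∀ v, g.2 v ∈ NF v) → g ∈ N i := by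
    intro i
    obtain ⟨A, hA, B, hB, hAB⟩ := mem_nhds_prod_iff.1 (hN i)
    obtain ⟨NI, hNI, hNI'⟩ := exists_pi_nhds hA
    obtain ⟨NF, hNF, hNF'⟩ := exists_pi_nhds hB
    exact ⟨NI, NF, hNI, hNF, fun g h1 h2 => hAB ⟨hNI' _ h1, hNF' _ h2⟩⟩
  choose NI NF hNI hNF hNN using hNI
  have hI : ∀ w, ∀ j, {g | ∀ i, idx i w = j → g ∈ NI i w} ∈ 𝓝 (torusF (T j w)⁻¹ 1) := by
    intro w j
    refine Filter.eventually_all.2 fun i => ?_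
    by_cases hi : idx i w = j
    · have := hNI i w
      rw [← hidx, hi] at this
      filter_upwards [this] with g hg _ using hg
    · exact Filter.Eventually.of_forall fun g h => absurd h hi
  choose PI hPI fI hfI hfIi hfIe using fun w => exists_inf_datum_completion
    (Measure.addHaar : Measure w.Completion) (continuous_infChar hψ w)
    (infChar_ne_one hψ hψK hψ1 w) (fun i => hT w i) (hI w)
  have hF : ∀ v : S, (⋂ i, NF i v) ∈ 𝓝 (1 : G2 (v.1.adicCompletion K)) := fun v =>
    Filter.iInter_mem.2 fun i => hNF i v
  choose yF PF BF fF hPF hfF hfFi hfFe using fun v : S => exists_fin_datum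
    (Measure.addHaar : Measure (v.1.adicCompletion K)) (continuous_localChar hψ v.1)
    (localChar_ne_one hψ hψK hψ1 v.1) (hF v)
  obtain ⟨c, hc, hcint⟩ := exists_integral_fStarIntegrand ψ νr
  refine ⟨fun i g => (∏ w, PI w (idx i w) (g.1 w)) * ∏ v, PF v (g.2 v),
    ⟨(1, yF), c, ∑ v, BF v, hc, fun a => ?_⟩, fun i => ?_⟩
  · let a' : InfinitePlace K → Fin (m + 1) → ℂ := fun w => if w = w₀ then a else Pi.single 0 1
    refine ⟨fun w => fI w (a' w), fF, fun w => hfI w _, hfF, fun s g =>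
      (hcint _ _ s g (fun w => hfIi w _ s _) fun v => hfFi v s _).1, fun s g => ?_⟩
    refine ((hcint _ _ s (g * (1, yF)) (fun w => hfIi w _ s _) fun v => hfFi v s _).2).trans ?_
    have e1 : (∏ w, ∫ r, fI w (a' w) s (muH _ * G2.toSpin8 (xAB r * (g * (1, yF)).1 w)) *
        (infChar ψ w r : ℂ) ∂Measure.addHaar) = (∏ w, phase (infChar ψ w) (g.1 w)) *
        (∑ i, a i * ∏ w, (PI w (idx i w) (g.1 w) : ℂ)) * Complex.exp (expS g * s) := by
      have e2 : ∀ w, (∫ r, fI w (a' w) s (muH _ * G2.toSpin8 (xAB r * (g * (1, yF)).1 w)) *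
          (infChar ψ w r : ℂ) ∂Measure.addHaar) = phase (infChar ψ w) (g.1 w) *
          (∑ i, a' w i * PI w i (g.1 w)) * Complex.exp
            ((-(5 * w.mult * Real.log (max ‖(g.1 w).1.1 3 3‖ (1 / 2))) : ℝ) * s) := by
        intro w
        have e3 : (g * (1, yF)).1 w = g.1 w := mul_one (g.1 w)
        rw [e3]
        exact hfIe w (a' w) s (g.1 w)
      rw [Finset.prod_congr rfl fun w _ => e2 w, Finset.prod_mul_distrib, Finset.prod_mul_distrib,
        ← Complex.exp_sum, ← Finset.sum_mul, expS, Complex.ofReal_sum]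
      congr 2
      rw [← Finset.mul_prod_erase _ _ (Finset.mem_univ w₀), Finset.sum_mul]
      refine Finset.sum_congr rfl fun i _ => ?_
      rw [← Finset.mul_prod_erase _ _ (Finset.mem_univ w₀)]
      simp only [a', idx, if_true, mul_assoc]
      congr 2
      refine Finset.prod_congr rfl fun w hw => ?_
      rw [if_neg (Finset.ne_of_mem_erase hw), if_neg (Finset.ne_of_mem_erase hw),
        Finset.sum_eq_single 0 (fun j _ hj => by rw [Pi.single_eq_of_ne hj, zero_mul])
          (fun h => absurd (Finset.mem_univ _) h), Pi.single_eq_same, one_mul]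
    have e4 : (∏ v : S, ∫ r, fF v s (muH _ * G2.toSpin8 (xAB r * (g * (1, yF)).2 v)) *
        (localChar ψ v.1 r : ℂ) ∂Measure.addHaar) = (∏ v : S, phase (localChar ψ v.1) (g.2 v)) *
        (∏ v : S, (PF v (g.2 v) : ℂ)) * Complex.exp ((∑ v, BF v : ℝ) * s) := by
      have e6 : ∀ v : S, (∫ r, fF v s (muH _ * G2.toSpin8 (xAB r * (g * (1, yF)).2 v)) *
          (localChar ψ v.1 r : ℂ) ∂Measure.addHaar) = phase (localChar ψ v.1) (g.2 v) *
          PF v (g.2 v) * Complex.exp (BF v * s) := fun v => hfFe v s (g.2 v)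
      rw [Finset.prod_congr rfl fun v _ => e6 v, Finset.prod_mul_distrib, Finset.prod_mul_distrib, ← Complex.exp_sum, ← Finset.sum_mul, Complex.ofReal_sum]
    rw [e1, e4, phaseS]
    have e5 : ∑ i, a i * ((((∏ w, PI w (idx i w) (g.1 w)) * ∏ v, PF v (g.2 v) : ℝ)) : ℂ) =
        (∑ i, a i * ∏ w, (PI w (idx i w) (g.1 w) : ℂ)) * ∏ v : S, (PF v (g.2 v) : ℂ) := by
      rw [Finset.sum_mul]
      refine Finset.sum_congr rfl fun i _ => ?_
      push_cast
      ring
    rw [e5]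
    ring
  · refine isBumpNearS_prod (NI := fun w => {g | ∀ i', idx i' w = idx i w → g ∈ NI i' w})
      (NF := fun v => ⋂ i, NF i v) (fun g h1 h2 => hNN i g (fun w => h1 w i rfl)
        fun v => Set.mem_iInter.1 (h2 v) i) (fun w => ?_) hPF
    have := hPI w (idx i w)
    rw [hidx] at this
    exact this

variable {K : Type*} [Field K] [NumberField K] {S : Finset (HeightOneSpectrum (𝓞 K))}
  {ψ : AddChar (Adele K) Circle}

/-- Elements of a completion close to `1` with distinct absolute values `≥ 1`. -/
theorem exists_norm_injective (w : InfinitePlace K) {N : Set w.Completion} (hN : N ∈ 𝓝 1) (m : ℕ) :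
    ∃ t : Fin (m + 1) → w.Completion, (∀ i, 1 ≤ ‖t i‖) ∧ (∀ i, t i ∈ N) ∧
      Function.Injective fun i => ‖t i‖ := by
  have h : Filter.Tendsto (fun δ : ℝ => algebraMap ℝ w.Completion (1 + δ)) (𝓝 0) (𝓝 1) := by
    have h1 : Continuous fun δ : ℝ => algebraMap ℝ w.Completion (1 + δ) :=
      (algebraMapCLM ℝ w.Completion).continuous.comp (by fun_prop)
    have h2 := h1.tendsto 0
    rwa [add_zero, map_one] at h2
  obtain ⟨ε, hε, hεN⟩ := Metric.mem_nhds_iff.1 (h hN)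
  have hn : ∀ i : Fin (m + 1), ‖algebraMap ℝ w.Completion (1 + ε * (i / (m + 1)))‖ =
      1 + ε * (i / (m + 1)) := fun i => by
    rw [norm_algebraMap', Real.norm_of_nonneg (by positivity)]
  refine ⟨fun i => algebraMap ℝ w.Completion (1 + ε * (i / (m + 1))), fun i => ?_, fun i => ?_,
    fun i j hij => ?_⟩
  · rw [hn]
    exact le_add_of_nonneg_right (by positivity)
  · refine hεN (a := ε * (i / (m + 1))) ?_
    rw [mem_ball_zero_iff, Real.norm_of_nonneg (by positivity)]
    have hi : (i : ℝ) / (m + 1) < 1 := by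
      rw [div_lt_one (by positivity)]
      exact_mod_cast i.2
    nlinarith
  · simp only [hn] at hij
    have h1 := mul_left_cancel₀ hε.ne' (add_left_cancel hij)
    have h2 := (div_left_inj' (by positivity : (m : ℝ) + 1 ≠ 0)).1 h1
    exact Fin.ext (by exact_mod_cast h2)

variable {νU : Measure (Coset ((ratG K).subgroupOf (unipU (Adele K))))}
  {νG : Measure (Coset (ratG K))} {V : Submodule ℂ (G2 (Adele K) → ℂ)}

/-- Local data at the places in `S` for which `d_S` is holomorphic and nonvanishing at `s₀`. -/
theorem exists_dS_ne_zero (hψ : Continuous ψ) (hψK : ∀ x : K, ψ (algebraMap K (Adele K) x) = 1)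
    (hψ1 : ψ ≠ 1) (hνU : IsInvariantMeasure νU) (hV : IsCuspSubrep K νG V)
    {φ₀ : G2 (Adele K) → ℂ} (hφ₀ : φ₀ ∈ V) (hsph : IsSphericalOutside S φ₀)
    (hL : ∃ g : SGroup K S, fourierCoeff ψ νU φ₀ g.toAdele ≠ 0)
    (νr : Measure (SRing K S)) [νr.IsAddHaarMeasure]
    {νS : Measure (Coset (SUnip K S))} (hνS : IsInvariantMeasure νS) (s₀ : ℂ) :
    ∃ (aI : ∀ w : InfinitePlace K, G2 w.Completion →₀ ℂ)
      (aF : ∀ v : S, G2 (v.1.adicCompletion K) →₀ ℂ)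
      (fI : ∀ w : InfinitePlace K, ℂ → Spin8 w.Completion → ℂ)
      (fF : ∀ v : S, ℂ → Spin8 (v.1.adicCompletion K) → ℂ),
      localAct aI aF φ₀ ∈ V ∧ IsSphericalOutside S (localAct aI aF φ₀) ∧
      (∀ w, IsInfSection w (fI w)) ∧ (∀ v : S, IsFinSection v.1 (fF v)) ∧
      (∀ s g, Integrable (fStarIntegrand ψ fI fF s g) νr) ∧
      (∀ s, CosetIntegrable νS (dSIntegrand ψ νU νr (localAct aI aF φ₀) fI fF s)) ∧
      ∃ D : ℂ → ℂ, AnalyticAt ℂ D s₀ ∧ D s₀ ≠ 0 ∧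
        ∀ᶠ s in 𝓝[≠] s₀, dS ψ νU νr νS (localAct aI aF φ₀) fI fF s = D s := by
  obtain ⟨g₁, hg₁⟩ := hL
  obtain ⟨w₀⟩ : Nonempty (InfinitePlace K) := inferInstance
  obtain ⟨m, hm⟩ := exists_analyticOrderAt_inv_jS S s₀
  have hc₀ := hV.cuspForm φ₀ hφ₀
  let Λ : SGroup K S → ℂ := fun g => fourierCoeff ψ νU φ₀ (SGroup.toAdele (g * g₁))
  have hΛc : Continuous Λ := (continuous_fourierCoeff hψ hψK hνU hc₀).comp
    (continuous_toAdele.comp (continuous_id.mul continuous_const))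
  have hΛu : ∀ u ∈ SUnip K S, ∀ g, Λ (u * g) = ψ (psiArg (SGroup.toAdele u)) * Λ g := by
    intro u hu g
    change fourierCoeff ψ νU φ₀ (SGroup.toAdele (u * g * g₁)) = _
    rw [mul_assoc, SGroup.toAdele_mul]
    exact fourierCoeff_unip_mul hψK hνU hc₀.left_invariant (SGroup.toAdele_mem_unipU hu) _
  have hΛ1 : Λ 1 ≠ 0 := by
    change fourierCoeff ψ νU φ₀ (SGroup.toAdele (1 * g₁)) ≠ 0
    rwa [one_mul]
  obtain ⟨t, ht1, htN, htinj⟩ := exists_norm_injective w₀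
    ((tendsto_torusAt (S := S) w₀) (hΛc.continuousAt.eventually_ne hΛ1)) m
  have ht0 : ∀ i, t i ≠ 0 := fun i => norm_pos_iff.1 (by linarith [ht1 i])
  have hA : ∀ u ∈ SUnip K S, ∀ g, Λ (u * g) * phaseS ψ (u * g) = Λ g * phaseS ψ g := by
    intro u hu g
    rw [hΛu u hu, ← phaseS_unip_mul hu g]
    ring
  have hinj : Function.Injective (expS ∘ fun i => torusAt S w₀ (t i)) := by
    intro i j hij
    simp only [Function.comp_apply, expS_torusAt w₀ (ht1 _), neg_inj] at hij
    have h5 : (5 * w₀.mult : ℝ) ≠ 0 := by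
      have := w₀.mult_pos
      positivity
    exact htinj (Real.log_injOn_pos (lt_of_lt_of_le one_pos (ht1 i))
      (lt_of_lt_of_le one_pos (ht1 j)) (mul_left_cancel₀ h5 hij))
  obtain ⟨P, ⟨hPu, y, c, B, hc, hP⟩, a, hint, han, hord⟩ := exists_order_of_vanishing hνS (m := m)
    (A := fun g => Λ g * phaseS ψ g) hA (B := expS) (fun u hu g => expS_unip_mul hu g)
    continuous_expS (g := fun i => torusAt S w₀ (t i))
    (fun i => hΛc.continuousAt.mul (continuousAt_phaseS_torusAt hψ w₀ (ht0 i)).1)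
    (fun i => mul_ne_zero (htN i) (continuousAt_phaseS_torusAt hψ w₀ (ht0 i)).2) hinj
    (fun i => by
      obtain ⟨C, hC, hCn⟩ := exists_compact_mem_nhds (torusAt S w₀ (t i))
      exact ⟨C, hCn, hC⟩)
    (S := fun P => (∀ i, ∀ u ∈ SUnip K S, ∀ g, P i (u * g) = P i g) ∧
      ∃ (y : SGroup K S) (c : ℂ) (B : ℝ), c ≠ 0 ∧ ∀ a : Fin (m + 1) → ℂ, ∃ fI fF,
        (∀ w, IsInfSection w (fI w)) ∧ (∀ v : S, IsFinSection v.1 (fF v)) ∧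
        (∀ s g, Integrable (fStarIntegrand ψ fI fF s g) νr) ∧
        ∀ s g, ∫ r, fStarIntegrand ψ fI fF s (g * y) r ∂νr = c * Complex.exp (B * s) *
          (phaseS ψ g * (∑ i, a i * P i g) * Complex.exp (expS g * s)))
    (fun N hN => by
      obtain ⟨P, hP, hb⟩ := exists_S_datum hψ hψK hψ1 νr w₀ ht1 hN
      refine ⟨P, ⟨fun i => (hb i).unip_mul, hP⟩, fun i => ⟨(hb i).unip_mul, (hb i).continuous, ?_, (hb i).nonneg, (hb i).pos,
        (hb i).mem⟩⟩
      simp only [mul_assoc]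
      exact hΛc.mul (hb i).continuous_phase) s₀
  obtain ⟨fI, fF, hfI, hfF, hfi, hfe⟩ := hP a
  have hloc := localAct_single (y⁻¹ * g₁) φ₀
  let I : ℂ → SGroup K S → ℂ := fun s h =>
    Λ h * phaseS ψ h * (∑ i, a i * P i h) * Complex.exp (expS h * s)
  have hIu : ∀ s, ∀ u ∈ SUnip K S, ∀ h, I s (u * h) = I s h := by
    intro s u hu h
    have h1 : ∀ i, P i (u * h) = P i h := fun i => hPu i u hu h
    simp only [I, hA u hu h, expS_unip_mul hu h, h1]
  have hd : ∀ s, dSIntegrand ψ νU νr (fun x => φ₀ (x * SGroup.toAdele (y⁻¹ * g₁))) fI fF s =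
      fun g => jS S s * (c * Complex.exp (B * s)) * I s (g * y⁻¹) := by
    intro s
    funext g
    have h1 : fourierCoeff ψ νU (fun x => φ₀ (x * SGroup.toAdele (y⁻¹ * g₁))) g.toAdele =
        Λ (g * y⁻¹) := by
      rw [fourierCoeff_translate, ← SGroup.toAdele_mul, ← mul_assoc]
    have h2 := hfe s (g * y⁻¹)
    rw [inv_mul_cancel_right] at h2
    rw [dSIntegrand, fStar, h1, h2]
    simp only [I]
    ring
  refine ⟨fun w => Finsupp.single ((y⁻¹ * g₁).1 w) 1, fun v => Finsupp.single ((y⁻¹ * g₁).2 v) 1,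
    fI, fF, ?_⟩
  rw [hloc]
  refine ⟨hV.translate φ₀ hφ₀ _, hsph.translate _, hfI, hfF, hfi, fun s => ?_, ?_⟩
  · rw [hd]
    exact (cosetIntegrable_mul_right hνS (hIu s) (hint s) y⁻¹).const_mul _
  · have hcB : AnalyticAt ℂ (fun s : ℂ => c * Complex.exp (B * s)) s₀ := by fun_prop
    have hcB0 : c * Complex.exp (B * s₀) ≠ 0 := mul_ne_zero hc (Complex.exp_ne_zero _)
    obtain ⟨D, hD, hD0, hDe⟩ := exists_analyticAt_div
      ((differentiable_inv_jS S).analyticAt s₀) hm (hcB.mul han) (by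
        rw [analyticOrderAt_mul hcB han, hord, hcB.analyticOrderAt_eq_zero.2 hcB0, zero_add])
    refine ⟨D, hD, hD0, hDe.mono fun s hs => ?_⟩
    rw [← hs, dS, hd, inv_inv]
    refine (integral_const_mul _ _).trans ?_
    have h1 := cosetIntegral_mul_right hνS (hIu s) y⁻¹
    exact (congrArg (jS S s * (c * Complex.exp (B * s)) * ·) h1).trans (mul_assoc _ _ _)

end G2Zeta

end

open G2Zeta NumberField IsDedekindDomain MeasureTheory Topology in
theorem mainTheorem6 (K : Type*) [Field K] [NumberField K]
    (ψ : AddChar (Adele K) Circle) (hψ_cont : Continuous ψ) (hψ_ne : ψ ≠ 1)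
    (hψ_rat : ∀ x : K, ψ (algebraMap K (Adele K) x) = 1)
    (νG : Measure (Coset (ratG K))) (hνG : IsInvariantMeasure νG)
    (νU : Measure (Coset ((ratG K).subgroupOf (unipU (Adele K))))) (hνU : IsInvariantMeasure νU)
    (π : Submodule ℂ (G2 (Adele K) → ℂ)) (hπ : IsIrredCuspRep K νG π)
    (hsplit : ∃ φ ∈ π, ∃ g, fourierCoeff ψ νU φ g ≠ 0) :
    (∃ S₀ : Finset (HeightOneSpectrum (𝓞 K)), ∀ S : Finset (HeightOneSpectrum (𝓞 K)), S₀ ⊆ S →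
      ∃ φ ∈ π, IsSphericalOutside S φ ∧
        ∃ g : SGroup K S, fourierCoeff ψ νU φ g.toAdele ≠ 0) ∧
    (∀ (S : Finset (HeightOneSpectrum (𝓞 K))) (φ₀ : G2 (Adele K) → ℂ), φ₀ ∈ π →
      IsSphericalOutside S φ₀ → (∃ g : SGroup K S, fourierCoeff ψ νU φ₀ g.toAdele ≠ 0) →
      ∀ (νr : Measure (SRing K S)) [νr.IsAddHaarMeasure]
        (νS : Measure (Coset (SUnip K S))), IsInvariantMeasure νS →
      ∀ s₀ : ℂ,
      ∃ (aI : ∀ w : InfinitePlace K, G2 w.Completion →₀ ℂ)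
        (aF : ∀ v : S, G2 (v.1.adicCompletion K) →₀ ℂ)
        (fI : ∀ w : InfinitePlace K, ℂ → Spin8 w.Completion → ℂ)
        (fF : ∀ v : S, ℂ → Spin8 (v.1.adicCompletion K) → ℂ),
        localAct aI aF φ₀ ∈ π ∧ IsSphericalOutside S (localAct aI aF φ₀) ∧
        (∀ w, IsInfSection w (fI w)) ∧ (∀ v : S, IsFinSection v.1 (fF v)) ∧
        (∀ s g, Integrable (fStarIntegrand ψ fI fF s g) νr) ∧
        (∀ s, CosetIntegrable νS (dSIntegrand ψ νU νr (localAct aI aF φ₀) fI fF s)) ∧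
        ∃ D : ℂ → ℂ, AnalyticAt ℂ D s₀ ∧ D s₀ ≠ 0 ∧
          ∀ᶠ s in 𝓝[≠] s₀, dS ψ νU νr νS (localAct aI aF φ₀) fI fF s = D s) ∧
    (∀ (v : HeightOneSpectrum (𝓞 K)) (E : Type*) [AddCommGroup E] [Module ℂ E]
      (ρ : Representation ℂ (G2 (v.adicCompletion K)) E), IsSmoothRep ρ →
      ∀ (ν : Measure (Coset (unipUmu (v.adicCompletion K)))), IsInvariantMeasure ν →
      ∀ x₀ : E, ∃ (x : E) (f : ℂ → Spin8 (v.adicCompletion K) → ℂ), IsFinSection v f ∧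
        ∀ l : E →ₗ[ℂ] ℂ, IsSplitFunctional ψ ρ l → l x = l x₀ ∧ ∀ s : ℂ,
          CosetIntegrable ν (fun g => l (ρ g x) * f s (muH _ * G2.toSpin8 g)) ∧
          cosetIntegral ν (fun g => l (ρ g x) * f s (muH _ * G2.toSpin8 g)) = l x) := by
  exact ⟨exists_spherical hπ.toIsCuspSubrep hsplit,
    fun _ _ hφ₀ hsph hL νr _ _ hνS s₀ =>
      exists_dS_ne_zero hψ_cont hψ_rat hψ_ne hνU hπ.toIsCuspSubrep hφ₀ hsph hL νr hνS s₀,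
    fun _ _ _ _ ρ hρ _ hν x₀ => exists_local_integral hψ_cont hψ_rat hψ_ne ρ hρ hν x₀⟩
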